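/- Conventions. Let $m_k(x)=\sqrt{2/\pi}\,\sin(kx)$, let $P^D(t,x,y)=\sum_{k\ge1}e^{-k^2t}m_k(x)m_k(y)$ be the Dirichlet heat kernel on $(0,\pi)$, and let $e^{t\Delta}f(x)=\int_0^\pi P^D(t,x,y)f(y)\,dy$ for $t>0$. For $1\le p<\infty$ and $0<s<2$, $H^s_p=H^s_p(0,\pi)$ is the space of all $f\in L_p(0,\pi)$ for which $$(-\Delta)^{s/2}f=\frac1{\Gamma(-s/2)}\int_0^\infty (e^{t\Delta}f-f)\,\frac{dt}{t^{1+s/2}}$$ exists in $L_p(0,\pi)$ (as the $L_p$-limit of $\int_\delta^\infty$ as $\delta\to0^+$), with norm $\|f\|_{H^s_p}=\|(-\Delta)^{s/2}f\|_{L_p(0,\pi)}$. The norm of $C^\gamma(0,\pi)$ is $\sup_x|f(x)|+\sup_{x\ne y}|f(x)-f(y)|/|x-y|^\gamma$. Theorem. Let $0<\beta<\gamma<1/2$, $1\le p<\infty$, $T>0$, $u_0\in H^\beta_p(0,\pi)$ and $W\in C^\gamma(0,\pi)$ (for instance a path of Brownian motion, almost surely). For $\varepsilon>0$ let $W^\varepsilon\in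 C^\infty([0,\pi])$, with $\|W^\varepsilon-W\|_{C^\gamma(0,\pi)}\to0$ as $\varepsilon\to0^+$. Let $u^\varepsilon$ be the classical solution of $$u^\varepsilon_t=u^\varepsilon_{xx}+u^\varepsilon\,\partial_xW^\varepsilon\ \text{ on }(0,T)\times(0,\pi),\qquad u^\varepsilon(t,0)=u^\varepsilon(t,\pi)=0,\qquad u^\varepsilon(0,\cdot)=u_0,$$ that is, $u^\varepsilon$ is $C^1$ in $t$ and $C^2$ in $x$ on $(0,T)\times(0,\pi)$, continuous on $(0,T)\times[0,\pi]$, satisfies the equation and the boundary condition, and $\|u^\varepsilon(t,\cdot)-u_0\|_{L_p(0,\pi)}\to0$ as $t\to0^+$. Let $u$ be the mild solution of $u_t=u_{xx}+u\,\partial_xW$ with the same boundary and initial conditions, that is, $u\in L_1(0,T;H^{1+\beta}_p(0,\pi))$; for $0<t<T$ and $0<x<\pi$, $u$ is continuous in $t$, continuously differentiable in $x$ and satisfies $$u(t,x)=e^{t\Delta}u_0(x)-\int_0^t\!\!\int_0^\pi P^D_y(t-s,x,y)\,u(s,y)W(y)\,dy\,ds-\int_0^t\!\!\int_0^\pi P^D(t-s,x,y)\,u_y(s,y)W(y)\,dy\,ds$$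 with absolutely convergent integrals; $u(t,0)=u(t,\pi)=0$ for $0\le t\le T$; and $\lim_{t\to0^+}u(t,x)=u_0(x)$ for almost every $x\in(0,\pi)$. Then $$\|u^\varepsilon-u\|_{L_\infty(0,T;H^{1+\beta}_p(0,\pi))}\longrightarrow0\quad\text{as }\varepsilon\to0^+ .$$ -/

import Mathlib

open MeasureTheory Filter Topology Set
open scoped ENNReal ContDiff

noncomputable section

/-- Lebesgue measure on the interval `(0, π)`. -/
def muI : Measure ℝ := volume.restrict (Ioo 0 Real.pi)

/-- The norm `‖f‖_{C^γ(0,π)} = sup |f| + [f]_γ`, with value `∞` when it is not finite. -/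
def holderNorm (γ : ℝ) (f : ℝ → ℝ) : ℝ≥0∞ :=
  (⨆ x ∈ Ioo 0 Real.pi, ENNReal.ofReal |f x|) +
    ⨆ x ∈ Ioo 0 Real.pi, ⨆ y ∈ Ioo 0 Real.pi, ⨆ _ : x ≠ y,
      ENNReal.ofReal (|f x - f y| / |x - y| ^ γ)

/-- The Dirichlet eigenfunctions `m_k(x) = √(2/π) sin(kx)`. -/
def sineMode (k : ℕ) (x : ℝ) : ℝ := Real.sqrt (2 / Real.pi) * Real.sin (k * x)

/-- The Dirichlet heat kernel `P^D(t,x,y) = ∑_{k ≥ 1} e^{-k²t} m_k(x) m_k(y)` on `(0,π)`. -/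
def dirichletKernel (t x y : ℝ) : ℝ :=
  ∑' j : ℕ, Real.exp (-((j + 1 : ℕ) : ℝ) ^ 2 * t) * sineMode (j + 1) x * sineMode (j + 1) y

/-- The derivative `P^D_y` of the Dirichlet heat kernel in its last variable. -/
def dirichletKernelDy (t x y : ℝ) : ℝ := deriv (fun z => dirichletKernel t x z) y

/-- The heat semigroup `(e^{tΔ} f)(x)`, `t > 0`, with zero boundary conditions on `(0,π)`. -/
def heatSemigroup (t : ℝ) (f : ℝ → ℝ) (x : ℝ) : ℝ :=
  ∫ y in (0 : ℝ)..Real.pi, dirichletKernel t x y * f y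

/-- The truncation `Γ(-s/2)⁻¹ ∫_δ^∞ (e^{tΔ} f - f)(x) t^{-1-s/2} dt` of the integral that
defines `(-Δ)^{s/2} f`. -/
def fracLapTrunc (s δ : ℝ) (f : ℝ → ℝ) (x : ℝ) : ℝ :=
  (Real.Gamma (-s / 2))⁻¹ *
    ∫ t in Ioi δ, (heatSemigroup t f x - f x) / t ^ (1 + s / 2)

/-- `g = (-Δ)^{s/2} f` in `L_p(0,π)`, for `0 < s < 2`: both functions are in `L_p(0,π)` and
`Γ(-s/2)⁻¹ ∫_0^∞ (e^{tΔ} f - f) t^{-1-s/2} dt`, which is singular at `t = 0`, converges to `g`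
there as an improper integral. -/
structure HasFracLap (p : ℝ≥0∞) (s : ℝ) (f g : ℝ → ℝ) : Prop where
  memLp_left : MemLp f p muI
  memLp_right : MemLp g p muI
  tendsto : Tendsto (fun δ : ℝ => eLpNorm (fun x => fracLapTrunc s δ f x - g x) p muI)
    (𝓝[>] 0) (𝓝 0)

/-- Membership in the fractional Sobolev space `H^s_p(0,π)`. -/
def MemSobolev (p : ℝ≥0∞) (s : ℝ) (f : ℝ → ℝ) : Prop := ∃ g, HasFracLap p s f g

/-- The norm `‖(-Δ)^{s/2} f‖_{L_p(0,π)}` of `H^s_p(0,π)`; it is `∞` when `f` is not in the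
space (the function `g` is unique up to null sets when it exists). -/
def sobolevNorm (p : ℝ≥0∞) (s : ℝ) (f : ℝ → ℝ) : ℝ≥0∞ :=
  ⨅ (g : ℝ → ℝ) (_ : HasFracLap p s f g), eLpNorm g p muI

/-- The norm of `L_∞(0,T; H^s_p(0,π))`. -/
def linftySobolevNorm (T : ℝ) (p : ℝ≥0∞) (s : ℝ) (v : ℝ → ℝ → ℝ) : ℝ≥0∞ :=
  essSup (fun t => sobolevNorm p s (v t)) (volume.restrict (Ioo 0 T))

/-- Classical solution on `(0,T) × (0,π)` of `u_t = u_xx + u V'`, `u(t,0) = u(t,π) = 0`,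
`u(0,·) = u₀`, with `V` smooth: `u` is of class `C^{1,2}` inside, continuous up to the lateral
boundary, and takes the initial value `u₀ ∈ L_p(0,π)` in `L_p(0,π)`. -/
structure IsClassicalSolution (T : ℝ) (p : ℝ≥0∞) (V u₀ : ℝ → ℝ) (u : ℝ → ℝ → ℝ) : Prop where
  diff_time : ∀ x ∈ Ioo 0 Real.pi, DifferentiableOn ℝ (fun t => u t x) (Ioo 0 T)
  diff_space : ∀ t ∈ Ioo 0 T, ContDiffOn ℝ 2 (u t) (Ioo 0 Real.pi)
  cont : ContinuousOn (fun z : ℝ × ℝ => u z.1 z.2) (Ioo 0 T ×ˢ Icc 0 Real.pi)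
  cont_dt : ContinuousOn (fun z : ℝ × ℝ => deriv (fun t => u t z.2) z.1)
    (Ioo 0 T ×ˢ Ioo 0 Real.pi)
  cont_dx : ContinuousOn (fun z : ℝ × ℝ => deriv (u z.1) z.2) (Ioo 0 T ×ˢ Ioo 0 Real.pi)
  cont_dxx : ContinuousOn (fun z : ℝ × ℝ => deriv (deriv (u z.1)) z.2)
    (Ioo 0 T ×ˢ Ioo 0 Real.pi)
  equation : ∀ t ∈ Ioo 0 T, ∀ x ∈ Ioo 0 Real.pi,
    deriv (fun r => u r x) t = deriv (deriv (u t)) x + u t x * deriv V x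
  boundary : ∀ t ∈ Ioo 0 T, u t 0 = 0 ∧ u t Real.pi = 0
  initial : Tendsto (fun t => eLpNorm (fun x => u t x - u₀ x) p muI) (𝓝[>] 0) (𝓝 0)

/-- Mild solution on `(0,T)`, with state space `H^s_p(0,π)`, of `u_t = u_xx + u W'`,
`u(t,0) = u(t,π) = 0`, `u(0,·) = u₀`, where `W'` is a generalized function.
The double integrals are required to converge absolutely. The last two fields say
`u ∈ L_1(0,T; H^s_p(0,π))`. -/
structure IsMildSolution (T : ℝ) (p : ℝ≥0∞) (s : ℝ) (W u₀ : ℝ → ℝ) (u : ℝ → ℝ → ℝ) : Prop where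
  cont_time : ∀ x ∈ Ioo 0 Real.pi, ContinuousOn (fun t => u t x) (Ioo 0 T)
  diff_space : ∀ t ∈ Ioo 0 T, ContDiffOn ℝ 1 (u t) (Ioo 0 Real.pi)
  integrable_left : ∀ t ∈ Ioo 0 T, ∀ x ∈ Ioo 0 Real.pi,
    IntegrableOn (fun z : ℝ × ℝ => dirichletKernelDy (t - z.1) x z.2 * u z.1 z.2 * W z.2)
      (Ioo 0 t ×ˢ Ioo 0 Real.pi)
  integrable_right : ∀ t ∈ Ioo 0 T, ∀ x ∈ Ioo 0 Real.pi,
    IntegrableOn (fun z : ℝ × ℝ => dirichletKernel (t - z.1) x z.2 * deriv (u z.1) z.2 * W z.2)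
      (Ioo 0 t ×ˢ Ioo 0 Real.pi)
  equation : ∀ t ∈ Ioo 0 T, ∀ x ∈ Ioo 0 Real.pi,
    u t x = heatSemigroup t u₀ x
      - (∫ r in (0 : ℝ)..t, ∫ y in (0 : ℝ)..Real.pi,
          dirichletKernelDy (t - r) x y * u r y * W y)
      - ∫ r in (0 : ℝ)..t, ∫ y in (0 : ℝ)..Real.pi,
          dirichletKernel (t - r) x y * deriv (u r) y * W y
  boundary : ∀ t ∈ Icc 0 T, u t 0 = 0 ∧ u t Real.pi = 0
  initial : ∀ᵐ x ∂muI, Tendsto (fun t => u t x) (𝓝[>] 0) (𝓝 (u₀ x))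
  aemeasurable_norm :
    AEMeasurable (fun t => sobolevNorm p s (u t)) (volume.restrict (Ioo 0 T))
  integrable_norm : ∫⁻ t in Ioo 0 T, sobolevNorm p s (u t) < ⊤

end

/-! The convergence is a consequence of a Lipschitz estimate (`exists_linftySobolevNorm_le`). If `V`
is smooth with `‖V - W‖ ≤ 1` in `C^γ`, the classical solution `v` with coefficient `V` satisfies `‖v
- u‖ ≤ D ‖V - W‖`, where the left norm is that of `L_∞(0,T; H^{1+β}_p)` and `D` depends on `W` and
on the mild solution `u`, but not on `V`.

The heart of the matter is the operator `f ↦ e^{τΔ}(f V')`, read as `-∫ ∂_y(P^D f) V dy`. As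
`P^D(τ,x,·)` vanishes at both endpoints, `∫ ∂_y(P^D f) dy = 0`, so `V(y)` may be replaced by `V(y) -
V(x)`. The resulting factor `|x-y|^γ` is worth `τ^{γ/2}` against a Gaussian. Thus `e^{τΔ}(f V')`
costs `τ^{(γ-1)/2}` on `f` and `τ^{γ/2}` on `f'`, and its space derivative half a power more
(`eLpNorm_divForm_le`, `eLpNorm_divSemigroup_le`). Each of these powers is integrable at `τ = 0`,
because `γ > 0`. All kernels are dominated by the Neumann heat kernel, which is positive, symmetric
and of mass one and is therefore a contraction of every `L_p`; no exponent `1 ≤ p < ∞` needs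
separate treatment.

Both equations are used after applying `e^{ηΔ}`, `η > 0`: `e^{ηΔ}u(t) = e^{(t+η)Δ}u₀ + ∫_0^t
e^{(t-s+η)Δ}(u(s)V') ds`. There the singularity at `s = t` is gone, while the estimates are uniform
in small `η`, and Fatou's lemma transfers them to `u`, `u_x` and `e^{rΔ}u - u`
(`eLpNorm_le_of_regularization`, `eLpNorm_heatSemigroup_sub_le`). For the mild solution the identity
follows from Fubini and the semigroup law (`IsMildSolution.regularized`). For the classical solution
it is proved for each sine coefficient, working on slightly smaller intervals because nothing is
known about `u_x` at the boundary (`IsClassicalSolution.sine_moment_eq`,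
`IsClassicalSolution.regularized`).

The embedding of `H^{1+β}_p` in `W^1_p` makes `‖u‖ + ‖u_x‖` integrable in time, and a singular
Gronwall inequality improves this to `‖u‖ ≤ K` and `‖u_x‖ ≤ K t^{-1/2}`
(`IsMildSolution.exists_eLpNorm_bound`). Of the classical solution only finiteness of norms is
needed, not a uniform bound. The difference `w = v - u` starts from zero and has source `w V' + u (V
- W)'`, and Gronwall's inequality gives `‖w‖ + ‖w_x‖ ≤ C ‖V - W‖`. Finally, `H^{1+β}_p` is
controlled by `∫ r^{-1-(1+β)/2} ‖e^{rΔ}w - w‖ dr` (`sobolevNorm_le`); carrying out the `r`-integral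
in the Duhamel formula leaves kernels no worse than `(t-s)^{(γ-β)/2-1}`, integrable because `β < γ`
(`exists_duhamel_sobolev_bound`). -/

noncomputable section

/-! ### The Gaussian kernel and its derivatives -/

/-- The heat kernel on the line. -/
def gk (t z : ℝ) : ℝ := (Real.sqrt (4 * Real.pi * t))⁻¹ * Real.exp (-z ^ 2 / (4 * t))

/-- First space derivative of `gk`. -/
def gk1 (t z : ℝ) : ℝ := -(z / (2 * t)) * gk t z

/-- Second space derivative of `gk`. -/
def gk2 (t z : ℝ) : ℝ := (z ^ 2 / (4 * t ^ 2) - 1 / (2 * t)) * gk t z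

/-- Third space derivative of `gk`. -/
def gk3 (t z : ℝ) : ℝ := (-(z ^ 3 / (8 * t ^ 3)) + 3 * z / (4 * t ^ 2)) * gk t z

lemma gk_nonneg (t z : ℝ) : 0 ≤ gk t z := by unfold gk; positivity

lemma hasDerivAt_gk {t : ℝ} (ht : 0 < t) (z : ℝ) : HasDerivAt (gk t) (gk1 t z) z := by
  have h : HasDerivAt (fun z : ℝ => -z ^ 2 / (4 * t)) (-(z / (2 * t))) z := by
    have := ((hasDerivAt_pow 2 z).neg).div_const (4 * t)
    refine this.congr_deriv ?_
    field_simp; norm_num; ring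
  have := (h.exp).const_mul (Real.sqrt (4 * Real.pi * t))⁻¹
  refine this.congr_deriv ?_
  simp only [gk1, gk]; ring

lemma hasDerivAt_gk1 {t : ℝ} (ht : 0 < t) (z : ℝ) : HasDerivAt (gk1 t) (gk2 t z) z := by
  have h : HasDerivAt (fun z : ℝ => -(z / (2 * t))) (-(1 / (2 * t))) z :=
    ((hasDerivAt_id z).div_const (2 * t)).neg
  refine (h.mul (hasDerivAt_gk ht z)).congr_deriv ?_
  simp only [gk2, gk1]; field_simp; ring

/-- The heat equation for the Gaussian. Through it the bounds on second and third space derivatives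
control increments in time of `gk` and `gk1`. -/
lemma hasDerivAt_gk_time {t : ℝ} (ht : 0 < t) (z : ℝ) :
    HasDerivAt (fun t => gk t z) (gk2 t z) t := by
  have h1 : HasDerivAt (fun t : ℝ => Real.sqrt (4 * Real.pi * t))
      (4 * Real.pi / (2 * Real.sqrt (4 * Real.pi * t))) t := by
    have : HasDerivAt (fun t : ℝ => 4 * Real.pi * t) (4 * Real.pi) t := by
      simpa using (hasDerivAt_id t).const_mul (4 * Real.pi)
    exact this.sqrt (by positivity)
  have hs : 0 < Real.sqrt (4 * Real.pi * t) := by positivity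
  have hs2 : Real.sqrt (4 * Real.pi * t) ^ 2 = 4 * Real.pi * t := Real.sq_sqrt (by positivity)
  have h2 : HasDerivAt (fun t : ℝ => -z ^ 2 / (4 * t)) (z ^ 2 / (4 * t ^ 2)) t := by
    have h3 : HasDerivAt (fun t : ℝ => 4 * t) 4 t := by
      simpa using (hasDerivAt_id t).const_mul (4 : ℝ)
    have := (hasDerivAt_const t (-z ^ 2)).div h3 (by positivity)
    refine this.congr_deriv ?_
    field_simp; ring
  have h3 := (h1.inv hs.ne').mul h2.exp
  refine h3.congr_deriv ?_
  simp only [gk2, gk]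
  have : -(4 * Real.pi / (2 * √(4 * Real.pi * t))) / √(4 * Real.pi * t) ^ 2
      = -(1 / (2 * t)) * (√(4 * Real.pi * t))⁻¹ := by
    rw [hs2]
    field_simp
  rw [this]; simp only [Pi.inv_apply]; ring

lemma hasDerivAt_gk1_time {t : ℝ} (ht : 0 < t) (z : ℝ) :
    HasDerivAt (fun t => gk1 t z) (gk3 t z) t := by
  have h : HasDerivAt (fun t : ℝ => -(z / (2 * t))) (z / (2 * t ^ 2)) t := by
    have h3 : HasDerivAt (fun t : ℝ => 2 * t) 2 t := by
      simpa using (hasDerivAt_id t).const_mul (2 : ℝ)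
    refine ((hasDerivAt_const t z).div h3 (by positivity)).neg.congr_deriv ?_
    field_simp; ring
  refine (h.mul (hasDerivAt_gk_time ht z)).congr_deriv ?_
  simp only [gk2, gk3]; field_simp; ring

/-- Half of the exponent is split off. That half absorbs polynomial factors, and a Gaussian at the
doubled time remains. -/
lemma gk_scale {t : ℝ} (ht : 0 < t) (z : ℝ) :
    gk t z = Real.sqrt 2 * Real.exp (-z ^ 2 / (8 * t)) * gk (2 * t) z := by
  have h1 : Real.sqrt (4 * Real.pi * (2 * t)) = Real.sqrt 2 * Real.sqrt (4 * Real.pi * t) := by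
    rw [← Real.sqrt_mul (by norm_num)]; ring_nf
  have h2 : -z ^ 2 / (4 * t) = -z ^ 2 / (8 * t) + -z ^ 2 / (4 * (2 * t)) := by
    field_simp; ring
  have hs : 0 < Real.sqrt (4 * Real.pi * t) := by positivity
  simp only [gk]
  rw [h1, h2, Real.exp_add]
  field_simp

/-- For `n ≥ b` one has `v^b ≤ 1 + v^(2n)`, and `v^(2n)` is bounded by the `n`-th term of the series
of `exp (v²/8)`; this is the source of `8^n n!`. -/
lemma rpow_mul_exp_neg_bound (b : ℝ) (hb : 0 ≤ b) :
    ∃ C : ℝ, 0 ≤ C ∧ ∀ v : ℝ, 0 ≤ v → v ^ b * Real.exp (-v ^ 2 / 8) ≤ C := by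
  obtain ⟨n, hn⟩ := exists_nat_ge b
  refine ⟨1 + 8 ^ n * n.factorial, by positivity, fun v hv => ?_⟩
  have h1 : v ^ b ≤ 1 + v ^ (2 * n) := by
    rcases le_total v 1 with h | h
    · have := Real.rpow_le_one hv h hb
      have : 0 ≤ v ^ (2 * n) := by positivity
      linarith
    · have : v ^ b ≤ v ^ (((2 * n : ℕ) : ℝ)) :=
        Real.rpow_le_rpow_of_exponent_le h (by push_cast; nlinarith)
      rw [Real.rpow_natCast] at this
      linarith
  have h2 : v ^ (2 * n) ≤ 8 ^ n * n.factorial * Real.exp (v ^ 2 / 8) := by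
    have := Real.pow_div_factorial_le_exp (v ^ 2 / 8) (by positivity) n
    rw [div_pow, div_div, div_le_iff₀ (by positivity)] at this
    rw [pow_mul]; linarith
  have he : Real.exp (-v ^ 2 / 8) ≤ 1 := Real.exp_le_one_iff.2 (by
    have : 0 ≤ v ^ 2 := by positivity
    linarith)
  calc v ^ b * Real.exp (-v ^ 2 / 8) ≤ (1 + v ^ (2 * n)) * Real.exp (-v ^ 2 / 8) := by gcongr
    _ = Real.exp (-v ^ 2 / 8) + v ^ (2 * n) * Real.exp (-v ^ 2 / 8) := by ring
    _ ≤ 1 + 8 ^ n * n.factorial * Real.exp (v ^ 2 / 8) * Real.exp (-v ^ 2 / 8) := by gcongr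
    _ = 1 + 8 ^ n * n.factorial := by
      rw [mul_assoc _ (Real.exp _), ← Real.exp_add]
      simp [neg_div]

/-- In the similarity variable `|z|/√t` any power costs only a constant and a doubling of the time.
-/
lemma gk_moment (b : ℝ) (hb : 0 ≤ b) : ∃ C : ℝ, 0 ≤ C ∧ ∀ t z : ℝ, 0 < t →
    (|z| / Real.sqrt t) ^ b * gk t z ≤ C * gk (2 * t) z := by
  obtain ⟨C, hC, h⟩ := rpow_mul_exp_neg_bound b hb
  refine ⟨C * Real.sqrt 2, by positivity, fun t z ht => ?_⟩
  have h1 := h (|z| / Real.sqrt t) (by positivity)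
  rw [div_pow, Real.sq_sqrt ht.le, sq_abs] at h1
  have h2 : -(z ^ 2 / t) / 8 = -z ^ 2 / (8 * t) := by field_simp
  rw [h2] at h1
  rw [gk_scale ht z]
  have := gk_nonneg (2 * t) z
  calc _ = ((|z| / √t) ^ b * Real.exp (-z ^ 2 / (8 * t))) * (√2 * gk (2 * t) z) := by ring
    _ ≤ C * (√2 * gk (2 * t) z) := by gcongr
    _ = _ := by ring

lemma abs_rpow_eq {t : ℝ} (ht : 0 < t) (z α : ℝ) :
    |z| ^ α = t ^ (α / 2) * (|z| / Real.sqrt t) ^ α := by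
  rw [Real.div_rpow (abs_nonneg z) (Real.sqrt_nonneg t), Real.sqrt_eq_rpow, ← Real.rpow_mul ht.le]
  have : 0 < t ^ (α / 2) := by positivity
  rw [show 1 / 2 * α = α / 2 by ring]
  field_simp

/-- The weight `|z|^α` stands for the Hölder modulus of the coefficient and gains `t^(α/2)`. In the
three bounds that follow, each space derivative loses `t^(-1/2)`. -/
lemma gk_bound (α : ℝ) (hα : 0 ≤ α) : ∃ C : ℝ, 0 ≤ C ∧ ∀ t z : ℝ, 0 < t →
    |z| ^ α * |gk t z| ≤ C * t ^ (α / 2) * gk (2 * t) z := by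
  obtain ⟨C, hC, h⟩ := gk_moment α hα
  refine ⟨C, hC, fun t z ht => ?_⟩
  rw [abs_of_nonneg (gk_nonneg t z), abs_rpow_eq ht]
  have := h t z ht
  calc _ = t ^ (α / 2) * ((|z| / Real.sqrt t) ^ α * gk t z) := by ring
    _ ≤ t ^ (α / 2) * (C * gk (2 * t) z) := by gcongr
    _ = _ := by ring

lemma rpow_split {t : ℝ} (ht : 0 < t) (α : ℝ) (j : ℕ) :
    t ^ ((α - j) / 2) = t ^ (α / 2) * (Real.sqrt t ^ j)⁻¹ := by
  rw [Real.sqrt_eq_rpow, ← Real.rpow_natCast, ← Real.rpow_mul ht.le, ← Real.rpow_neg ht.le,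
    ← Real.rpow_add ht]
  ring_nf

lemma gk1_bound (α : ℝ) (hα : 0 ≤ α) : ∃ C : ℝ, 0 ≤ C ∧ ∀ t z : ℝ, 0 < t →
    |z| ^ α * |gk1 t z| ≤ C * t ^ ((α - 1) / 2) * gk (2 * t) z := by
  obtain ⟨C, hC, h⟩ := gk_moment (α + 1) (by linarith)
  refine ⟨C, hC, fun t z ht => ?_⟩
  have h1 := h t z ht
  have h0 := gk_nonneg t z
  have hs : 0 < Real.sqrt t := by positivity
  have hs2 : Real.sqrt t ^ 2 = t := Real.sq_sqrt ht.le
  have hv : |gk1 t z| = (Real.sqrt t)⁻¹ * ((|z| / Real.sqrt t) / 2 * gk t z) := by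
    rw [gk1, abs_mul, abs_of_nonneg h0, abs_neg, abs_div, abs_of_pos (by positivity : 0 < 2 * t)]
    rw [show |z| / (2 * t) = |z| / (2 * Real.sqrt t ^ 2) by rw [hs2]]
    field_simp
  have hsp := rpow_split ht α 1
  simp only [Nat.cast_one, pow_one] at hsp
  rw [hv, abs_rpow_eq ht, hsp]
  rw [Real.rpow_add_one' (by positivity) (by linarith)] at h1
  have hnn : 0 ≤ (|z| / √t) ^ α * (|z| / √t) * gk t z := by positivity
  calc _ = t ^ (α / 2) * (√t)⁻¹ * (((|z| / √t) ^ α * (|z| / √t) * gk t z) / 2) := by ring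
    _ ≤ t ^ (α / 2) * (√t)⁻¹ * (C * gk (2 * t) z) := by gcongr; linarith
    _ = _ := by ring

lemma gk2_bound (α : ℝ) (hα : 0 ≤ α) : ∃ C : ℝ, 0 ≤ C ∧ ∀ t z : ℝ, 0 < t →
    |z| ^ α * |gk2 t z| ≤ C * t ^ ((α - 2) / 2) * gk (2 * t) z := by
  obtain ⟨C, hC, h⟩ := gk_moment (α + 2) (by linarith)
  obtain ⟨C', hC', h'⟩ := gk_moment α hα
  refine ⟨C + C', by positivity, fun t z ht => ?_⟩
  have h1 := h t z ht
  have h2 := h' t z ht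
  have h0 := gk_nonneg t z
  have hs : 0 < Real.sqrt t := by positivity
  have hs2 : Real.sqrt t ^ 2 = t := Real.sq_sqrt ht.le
  have hv : |gk2 t z| ≤ (Real.sqrt t ^ 2)⁻¹ * (((|z| / Real.sqrt t) ^ 2 + 1) * gk t z) := by
    rw [gk2, abs_mul, abs_of_nonneg h0, ← mul_assoc]
    refine mul_le_mul_of_nonneg_right ?_ h0
    refine (abs_sub _ _).trans ?_
    rw [abs_of_nonneg (by positivity), abs_of_nonneg (by positivity), div_pow, hs2, sq_abs]
    have : 0 ≤ z ^ 2 / t ^ 2 := by positivity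
    have : 0 ≤ 1 / t := by positivity
    rw [show t⁻¹ * (z ^ 2 / t + 1) = z ^ 2 / t ^ 2 + 1 / t by field_simp]
    rw [show z ^ 2 / (4 * t ^ 2) = (z ^ 2 / t ^ 2) / 4 by field_simp,
      show 1 / (2 * t) = (1 / t) / 2 by field_simp]
    linarith
  have hsp := rpow_split ht α 2
  simp only [Nat.cast_ofNat] at hsp
  rw [abs_rpow_eq ht, hsp]
  rw [Real.rpow_add' (by positivity) (by linarith), Real.rpow_two] at h1
  calc _ ≤ t ^ (α / 2) * (|z| / √t) ^ α *
        ((Real.sqrt t ^ 2)⁻¹ * (((|z| / Real.sqrt t) ^ 2 + 1) * gk t z)) := by gcongr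
    _ = t ^ (α / 2) * (√t ^ 2)⁻¹ * (((|z| / √t) ^ α * (|z| / √t) ^ 2 * gk t z) +
        (|z| / √t) ^ α * gk t z) := by ring
    _ ≤ t ^ (α / 2) * (√t ^ 2)⁻¹ * (C * gk (2 * t) z + C' * gk (2 * t) z) := by gcongr
    _ = _ := by ring

lemma gk3_bound (α : ℝ) (hα : 0 ≤ α) : ∃ C : ℝ, 0 ≤ C ∧ ∀ t z : ℝ, 0 < t →
    |z| ^ α * |gk3 t z| ≤ C * t ^ ((α - 3) / 2) * gk (2 * t) z := by
  obtain ⟨C, hC, h⟩ := gk_moment (α + 3) (by linarith)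
  obtain ⟨C', hC', h'⟩ := gk_moment (α + 1) (by linarith)
  refine ⟨C + C', by positivity, fun t z ht => ?_⟩
  have h1 := h t z ht
  have h2 := h' t z ht
  have h0 := gk_nonneg t z
  have hs : 0 < Real.sqrt t := by positivity
  have hs2 : Real.sqrt t ^ 2 = t := Real.sq_sqrt ht.le
  have hv : |gk3 t z| ≤
      (Real.sqrt t ^ 3)⁻¹ * (((|z| / Real.sqrt t) ^ 3 + (|z| / Real.sqrt t)) * gk t z) := by
    rw [gk3, abs_mul, abs_of_nonneg h0, ← mul_assoc]
    refine mul_le_mul_of_nonneg_right ?_ h0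
    refine (abs_add_le _ _).trans ?_
    rw [abs_neg, abs_div, abs_div, abs_of_pos (by positivity : 0 < 8 * t ^ 3),
      abs_of_pos (by positivity : 0 < 4 * t ^ 2), abs_pow, abs_mul,
      abs_of_pos (by norm_num : (0 : ℝ) < 3)]
    rw [show |z| ^ 3 / (8 * t ^ 3) = |z| ^ 3 / (8 * (Real.sqrt t ^ 2) ^ 3) by rw [hs2],
      show 3 * |z| / (4 * t ^ 2) = 3 * |z| / (4 * (Real.sqrt t ^ 2) ^ 2) by rw [hs2]]
    rw [show |z| ^ 3 / (8 * (√t ^ 2) ^ 3) = (|z| / √t) ^ 3 * (√t ^ 3)⁻¹ / 8 by field_simp,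
      show 3 * |z| / (4 * (√t ^ 2) ^ 2) = (|z| / √t) * (√t ^ 3)⁻¹ * (3 / 4) by field_simp]
    have : 0 ≤ (|z| / √t) ^ 3 * (√t ^ 3)⁻¹ := by positivity
    have : 0 ≤ (|z| / √t) * (√t ^ 3)⁻¹ := by positivity
    linarith
  have hsp := rpow_split ht α 3
  simp only [Nat.cast_ofNat] at hsp
  rw [abs_rpow_eq ht, hsp]
  rw [Real.rpow_add' (by positivity) (by linarith),
    show ((3 : ℝ)) = ((3 : ℕ) : ℝ) by norm_num, Real.rpow_natCast] at h1
  rw [Real.rpow_add_one' (by positivity) (by linarith)] at h2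
  calc _ ≤ t ^ (α / 2) * (|z| / √t) ^ α *
        ((√t ^ 3)⁻¹ * (((|z| / √t) ^ 3 + (|z| / √t)) * gk t z)) := by gcongr
    _ = t ^ (α / 2) * (√t ^ 3)⁻¹ * (((|z| / √t) ^ α * (|z| / √t) ^ 3 * gk t z) +
        (|z| / √t) ^ α * (|z| / √t) * gk t z) := by ring
    _ ≤ t ^ (α / 2) * (√t ^ 3)⁻¹ * (C * gk (2 * t) z + C' * gk (2 * t) z) := by gcongr
    _ = _ := by ring

/-- One Gaussian dominates all those with times in `[τ, 2τ]`. Hence increments in time of length `r`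
are estimated by the mean value theorem only for `r ≤ τ`. -/
lemma gk_le_of_le_two_mul {τ s : ℝ} (hτ : 0 < τ) (h1 : τ ≤ s) (h2 : s ≤ 2 * τ) (z : ℝ) :
    gk (2 * s) z ≤ Real.sqrt 2 * gk (4 * τ) z := by
  have hs : 0 < s := hτ.trans_le h1
  have e : Real.sqrt (4 * Real.pi * (4 * τ)) = Real.sqrt 2 * Real.sqrt (4 * Real.pi * (2 * τ)) := by
    rw [← Real.sqrt_mul (by norm_num)]; ring_nf
  simp only [gk]
  rw [e]
  have hs' : 0 < Real.sqrt (4 * Real.pi * (2 * τ)) := by positivity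
  have : √2 * ((√2 * √(4 * Real.pi * (2 * τ)))⁻¹ * Real.exp (-z ^ 2 / (4 * (4 * τ)))) =
      (√(4 * Real.pi * (2 * τ)))⁻¹ * Real.exp (-z ^ 2 / (4 * (4 * τ))) := by field_simp
  rw [this]
  refine mul_le_mul (by gcongr) (Real.exp_le_exp.2 ?_) (Real.exp_nonneg _) (by positivity)
  rw [neg_div, neg_div]
  exact neg_le_neg (div_le_div_of_nonneg_left (by positivity) (by positivity) (by linarith))

/-- Mean value bound in time for a family with a Gaussian bound on its time derivative. -/
lemma time_diff_bound {g g' : ℝ → ℝ → ℝ} {α e C : ℝ} (he : e ≤ 0) (hC : 0 ≤ C)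
    (hg : ∀ t z : ℝ, 0 < t → HasDerivAt (fun t => g t z) (g' t z) t)
    (hb : ∀ t z : ℝ, 0 < t → |z| ^ α * |g' t z| ≤ C * t ^ e * gk (2 * t) z)
    {τ r : ℝ} (hτ : 0 < τ) (hr : 0 ≤ r) (hrτ : r ≤ τ) (z : ℝ) :
    |z| ^ α * |g (τ + r) z - g τ z| ≤ C * Real.sqrt 2 * r * τ ^ e * gk (4 * τ) z := by
  have key := (convex_Icc τ (τ + r)).norm_image_sub_le_of_norm_hasDerivWithin_le
    (f := fun t => |z| ^ α * g t z) (f' := fun t => |z| ^ α * g' t z)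
    (C := C * Real.sqrt 2 * τ ^ e * gk (4 * τ) z) (x := τ) (y := τ + r)
    (fun t ht => ((hg t z (hτ.trans_le ht.1)).const_mul _).hasDerivWithinAt) (fun t ht => by
      have ht0 := hτ.trans_le ht.1
      rw [Real.norm_eq_abs, abs_mul, abs_of_nonneg (by positivity : 0 ≤ |z| ^ α)]
      refine (hb t z ht0).trans ?_
      have h1 : t ^ e ≤ τ ^ e := Real.rpow_le_rpow_of_nonpos hτ ht.1 he
      have h2 := gk_le_of_le_two_mul hτ ht.1 (by linarith [ht.2]) z
      have := gk_nonneg (2 * t) z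
      calc C * t ^ e * gk (2 * t) z ≤ C * τ ^ e * (Real.sqrt 2 * gk (4 * τ) z) := by gcongr
        _ = _ := by ring) ⟨le_rfl, by linarith⟩ ⟨by linarith, le_rfl⟩
  simp only [← mul_sub, Real.norm_eq_abs, abs_mul, add_sub_cancel_left, abs_of_nonneg hr] at key
  rw [abs_of_nonneg (by positivity : 0 ≤ |z| ^ α)] at key
  linarith

/-! ### Periodization -/

lemma hasSum_of_eq {ι : Type*} {f g : ι → ℝ} {a b : ℝ} (h : HasSum f a) (hf : ∀ n, g n = f n)
    (hb : b = a) : HasSum g b := by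
  rw [hb, funext hf]; exact h

/-- The `2π`-periodization of a function. -/
def per (g : ℝ → ℝ) (z : ℝ) : ℝ := ∑' n : ℤ, g (z + 2 * Real.pi * n)

/-- Poisson summation, in the form of the functional equation of the theta kernels. It provides
summability over the images and, at the same time, the passage to Fourier series. -/
lemma hasSum_gk {s : ℝ} (hs : 0 < s) (z : ℝ) :
    HasSum (fun n : ℤ => gk s (z + 2 * Real.pi * n))
      ((2 * Real.pi)⁻¹ * HurwitzZeta.cosKernel ((z / (2 * Real.pi) : ℝ) : UnitAddCircle)
        (s / Real.pi)) := by
  have hpi := Real.pi_pos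
  have h := (HurwitzZeta.hasSum_int_evenKernel (z / (2 * Real.pi))
    (t := Real.pi / s) (by positivity)).mul_left (Real.sqrt (4 * Real.pi * s))⁻¹
  rw [HurwitzZeta.evenKernel_functional_equation] at h
  have e : (Real.sqrt (4 * Real.pi * s))⁻¹ * (1 / (Real.pi / s) ^ (1 / 2 : ℝ)) =
      (2 * Real.pi)⁻¹ := by
    rw [← Real.sqrt_eq_rpow, one_div, ← mul_inv, ← Real.sqrt_mul (by positivity)]
    rw [show 4 * Real.pi * s * (Real.pi / s) = (2 * Real.pi) ^ 2 by field_simp; ring,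
      Real.sqrt_sq (by positivity)]
  rw [← mul_assoc, e, one_div_div] at h
  refine hasSum_of_eq h (fun n => ?_) rfl
  rw [gk]
  congr 2
  field_simp
  ring

lemma summable_gk {s : ℝ} (hs : 0 < s) (z : ℝ) :
    Summable (fun n : ℤ => gk s (z + 2 * Real.pi * n)) := (hasSum_gk hs z).summable

lemma per_gk_nonneg (s z : ℝ) : 0 ≤ per (gk s) z := tsum_nonneg fun _ => gk_nonneg _ _

lemma summable_of_gk_bound {s c : ℝ} (hs : 0 < s) {g : ℝ → ℝ} (hg : ∀ z, |g z| ≤ c * gk s z)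
    (z : ℝ) : Summable (fun n : ℤ => g (z + 2 * Real.pi * n)) :=
  .of_norm_bounded ((summable_gk hs z).mul_left c) fun _ => hg _

lemma per_sub {s c : ℝ} (hs : 0 < s) {g h : ℝ → ℝ} (hg : ∀ z, |g z| ≤ c * gk s z)
    {s' c' : ℝ} (hs' : 0 < s') (hh : ∀ z, |h z| ≤ c' * gk s' z) (z : ℝ) :
    per (fun z => g z - h z) z = per g z - per h z :=
  (summable_of_gk_bound hs hg z).tsum_sub (summable_of_gk_bound hs' hh z)

/-- Since `(z + m)² ≥ m²/2 - z²`, the translates have a majorant that is uniform for bounded `z` and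
summable over `m ∈ 2πℤ`. This is what termwise differentiation of the periodization needs. -/
lemma gk_shift_le {s R : ℝ} (hs : 0 < s) {z : ℝ} (hz : |z| ≤ R) (m : ℝ) :
    gk s (z + m) ≤ Real.sqrt 2 * Real.exp (R ^ 2 / (4 * s)) * gk (2 * s) m := by
  have e : Real.sqrt (4 * Real.pi * (2 * s)) = Real.sqrt 2 * Real.sqrt (4 * Real.pi * s) := by
    rw [← Real.sqrt_mul (by norm_num)]; ring_nf
  have hR : z ^ 2 ≤ R ^ 2 := by
    rw [← sq_abs]; gcongr
  have h1 : -(z + m) ^ 2 / (4 * s) ≤ R ^ 2 / (4 * s) + -m ^ 2 / (4 * (2 * s)) := by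
    rw [show R ^ 2 / (4 * s) + -m ^ 2 / (4 * (2 * s)) = (R ^ 2 - m ^ 2 / 2) / (4 * s) by
      field_simp; ring]
    gcongr
    nlinarith [sq_nonneg (2 * z + m)]
  have hsq : 0 < Real.sqrt (4 * Real.pi * s) := by positivity
  simp only [gk, e]
  calc _ ≤ (√(4 * Real.pi * s))⁻¹ * Real.exp (R ^ 2 / (4 * s) + -m ^ 2 / (4 * (2 * s))) := by
        gcongr
    _ = _ := by rw [Real.exp_add]; field_simp

lemma hasDerivAt_per {s c : ℝ} (hs : 0 < s) (hc : 0 ≤ c) {g g' : ℝ → ℝ}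
    (hd : ∀ z, HasDerivAt g (g' z) z) (hg : ∀ z, |g z| ≤ c * gk s z)
    (hg' : ∀ z, |g' z| ≤ c * gk s z) (z : ℝ) : HasDerivAt (per g) (per g' z) z := by
  set R := |z| + 1
  have hu : Summable fun n : ℤ => c * (Real.sqrt 2 * Real.exp (R ^ 2 / (4 * s)) *
      gk (2 * s) (2 * Real.pi * n)) := by
    have := ((summable_gk (by positivity : 0 < 2 * s) 0).mul_left
      (Real.sqrt 2 * Real.exp (R ^ 2 / (4 * s)))).mul_left c
    simpa using this
  refine hasDerivAt_tsum_of_isPreconnected (g := fun (n : ℤ) w => g (w + 2 * Real.pi * n))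
    (g' := fun (n : ℤ) w => g' (w + 2 * Real.pi * n)) hu (t := Metric.ball 0 R) Metric.isOpen_ball
    (convex_ball _ _).isPreconnected (fun n y _ => ?_) (fun n y hy => ?_)
    (y₀ := z) ?_ (summable_of_gk_bound hs hg z) ?_
  · simpa [Function.comp_def] using (hd (y + 2 * Real.pi * n)).comp y ((hasDerivAt_id y).add_const _)
  · have hy' : |y| ≤ R := by simpa using (Metric.mem_ball.1 hy).le
    exact (hg' _).trans (mul_le_mul_of_nonneg_left (gk_shift_le hs hy' _) hc)
  all_goals simp [R]

lemma measurable_per {g : ℝ → ℝ → ℝ} (hg : Measurable (Function.uncurry g)) :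
    Measurable (fun q : ℝ × ℝ => per (g q.1) q.2) := by
  refine Measurable.tsum fun n => ?_
  exact hg.comp (measurable_fst.prodMk (measurable_snd.add_const _))

/-! ### The Neumann kernel as a majorant -/

/-- The Neumann heat kernel on `(0,π)`, as a sum over images. -/
def neumannKernel (t x y : ℝ) : ℝ := per (gk t) (x - y) + per (gk t) (x + y)

lemma neumannKernel_nonneg (t x y : ℝ) : 0 ≤ neumannKernel t x y :=
  add_nonneg (per_gk_nonneg _ _) (per_gk_nonneg _ _)

/-- Among all images of `y`, the point itself is nearest to `x`. The weight `|x - y|^α` can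
therefore be moved inside the sum over images. -/
lemma abs_sub_le_image {x y : ℝ} (hx : x ∈ Ioo 0 Real.pi) (hy : y ∈ Ioo 0 Real.pi) (n : ℤ) :
    |x - y| ≤ |x - y + 2 * Real.pi * n| ∧ |x - y| ≤ |x + y + 2 * Real.pi * n| := by
  have hpi := Real.pi_pos
  obtain ⟨hx0, hx1⟩ := hx
  obtain ⟨hy0, hy1⟩ := hy
  rcases lt_trichotomy n 0 with hn | rfl | hn
  · have h1 : (n : ℝ) ≤ -1 := by exact_mod_cast Int.le_sub_one_of_lt hn
    have h2 : 2 * Real.pi * n ≤ 2 * Real.pi * (-1) := by gcongr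
    constructor <;> rw [abs_le] <;> constructor <;>
      nlinarith [neg_le_abs (x - y + 2 * Real.pi * n), neg_le_abs (x + y + 2 * Real.pi * n)]
  · constructor
    · simp
    · rw [abs_le]
      simp only [Int.cast_zero, mul_zero, add_zero]
      constructor <;> linarith [le_abs_self (x + y)]
  · have h1 : (1 : ℝ) ≤ n := by exact_mod_cast hn
    have h2 : 2 * Real.pi * 1 ≤ 2 * Real.pi * n := by gcongr
    constructor <;> rw [abs_le] <;> constructor <;>
      nlinarith [le_abs_self (x - y + 2 * Real.pi * n), le_abs_self (x + y + 2 * Real.pi * n)]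

/-- Two Gaussian bounds enter: `hg₀` serves only to make the series converge, with constants that
are then forgotten, and `hg` gives the estimate. -/
lemma abs_per_le {s c d α : ℝ} (hs : 0 < s) (hα : 0 ≤ α) (hd : 0 ≤ d) {g : ℝ → ℝ} {c₀ s₀ : ℝ}
    (hs₀ : 0 < s₀) (hg₀ : ∀ z, |g z| ≤ c₀ * gk s₀ z)
    (hg : ∀ z, |z| ^ α * |g z| ≤ c * gk s z) {z : ℝ} (hz : ∀ n : ℤ, d ≤ |z + 2 * Real.pi * n|) :
    d ^ α * |per g z| ≤ c * per (gk s) z := by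
  have hsum := summable_of_gk_bound hs₀ hg₀ z
  calc d ^ α * |per g z| ≤ d ^ α * ∑' n : ℤ, |g (z + 2 * Real.pi * n)| := by
        gcongr
        exact norm_tsum_le_tsum_norm hsum.norm
    _ = ∑' n : ℤ, d ^ α * |g (z + 2 * Real.pi * n)| := tsum_mul_left.symm
    _ ≤ ∑' n : ℤ, c * gk s (z + 2 * Real.pi * n) := by
        refine Summable.tsum_le_tsum (fun n => ?_) (hsum.norm.mul_left _)
          ((summable_gk hs z).mul_left c)
        refine le_trans ?_ (hg _)
        gcongr
        exact hz n
    _ = c * per (gk s) z := tsum_mul_left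

/-- The coefficients `a`, `b` are the signs of the direct and reflected images: `(1,-1)` for `P^D`
and `∂_x P^D`, `(-1,-1)` for `∂_y P^D` and `∂_x∂_y P^D`, `(1,1)` for the Neumann kernel. -/
lemma image_kernel_bound {s c α a b : ℝ} (hs : 0 < s) (hα : 0 ≤ α) {g : ℝ → ℝ} {c₀ s₀ : ℝ}
    (hs₀ : 0 < s₀) (hg₀ : ∀ z, |g z| ≤ c₀ * gk s₀ z)
    (hg : ∀ z, |z| ^ α * |g z| ≤ c * gk s z) (ha : |a| ≤ 1) (hb : |b| ≤ 1)
    {x y : ℝ} (hx : x ∈ Ioo 0 Real.pi) (hy : y ∈ Ioo 0 Real.pi) :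
    |x - y| ^ α * |a * per g (x - y) + b * per g (x + y)| ≤ c * neumannKernel s x y := by
  have h1 := abs_per_le hs hα (abs_nonneg (x - y)) hs₀ hg₀ hg
    (fun n => (abs_sub_le_image hx hy n).1)
  have h2 := abs_per_le hs hα (abs_nonneg (x - y)) hs₀ hg₀ hg
    (fun n => (abs_sub_le_image hx hy n).2)
  have h3 : |a * per g (x - y) + b * per g (x + y)| ≤ |per g (x - y)| + |per g (x + y)| := by
    refine (abs_add_le _ _).trans ?_
    rw [abs_mul, abs_mul]
    have := abs_nonneg (per g (x - y))
    have := abs_nonneg (per g (x + y))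
    nlinarith
  rw [neumannKernel, mul_add]
  have : 0 ≤ |x - y| ^ α := by positivity
  nlinarith

/-! ### Fourier series -/

/-- The decay factors `e^{-(j+1)^2 t}`. -/
def decay (j : ℕ) (t : ℝ) : ℝ := Real.exp (-((j + 1 : ℕ) : ℝ) ^ 2 * t)

lemma decay_pos (j : ℕ) (t : ℝ) : 0 < decay j t := Real.exp_pos _

lemma decay_le_one (j : ℕ) {t : ℝ} (ht : 0 ≤ t) : decay j t ≤ 1 := by
  apply Real.exp_le_one_iff.2
  nlinarith [sq_nonneg (((j + 1 : ℕ) : ℝ))]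

lemma decay_add (j : ℕ) (s t : ℝ) : decay j (s + t) = decay j s * decay j t := by
  rw [decay, decay, decay, ← Real.exp_add]; ring_nf

lemma summable_decay (m : ℕ) {t : ℝ} (ht : 0 < t) :
    Summable (fun j : ℕ => ((j + 1 : ℕ) : ℝ) ^ m * decay j t) := by
  have h := (summable_nat_add_iff 1).2 (Real.summable_pow_mul_exp_neg_nat_mul m ht)
  refine .of_nonneg_of_le (fun j => by have := decay_pos j t; positivity) (fun j => ?_) h
  have h1 : (1 : ℝ) ≤ ((j + 1 : ℕ) : ℝ) := by exact_mod_cast Nat.le_add_left 1 j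
  unfold decay
  refine mul_le_mul_of_nonneg_left (Real.exp_le_exp.2 ?_) (by positivity)
  have : (0 : ℝ) ≤ ((j + 1 : ℕ) : ℝ) * t := by positivity
  nlinarith

lemma summable_decay_zero {t : ℝ} (ht : 0 < t) : Summable (fun j : ℕ => decay j t) := by
  simpa using summable_decay 0 ht

lemma per_gk_hasSum {t : ℝ} (ht : 0 < t) (z : ℝ) :
    HasSum (fun j : ℕ => (2 * Real.pi)⁻¹ * (2 * Real.cos (z * ((j + 1 : ℕ) : ℝ)) * decay j t))
      (per (gk t) z - (2 * Real.pi)⁻¹) := by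
  have hpi := Real.pi_pos
  have h := (HurwitzZeta.hasSum_nat_cosKernel₀ (z / (2 * Real.pi))
    (t := t / Real.pi) (by positivity)).mul_left (2 * Real.pi)⁻¹
  rw [per, (hasSum_gk ht z).tsum_eq]
  refine hasSum_of_eq h (fun j => ?_) (by ring)
  rw [decay]
  congr 3
  · congr 1; push_cast; field_simp
  · push_cast; field_simp

lemma abs_sineMode_le (k : ℕ) (x : ℝ) : |sineMode k x| ≤ Real.sqrt (2 / Real.pi) := by
  rw [sineMode, abs_mul, abs_of_nonneg (Real.sqrt_nonneg _)]
  exact mul_le_of_le_one_right (Real.sqrt_nonneg _) (Real.abs_sin_le_one _)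

lemma sineMode_mul (k : ℕ) (x y : ℝ) : sineMode k x * sineMode k y =
    (Real.pi)⁻¹ * (Real.cos ((x - y) * k) - Real.cos ((x + y) * k)) := by
  have hpi := Real.pi_pos
  have h : Real.sqrt (2 / Real.pi) * Real.sqrt (2 / Real.pi) = 2 / Real.pi :=
    Real.mul_self_sqrt (by positivity)
  rw [sineMode, sineMode, show (x - y) * k = k * x - k * y by ring,
    show (x + y) * k = k * x + k * y by ring, Real.cos_sub, Real.cos_add]
  calc _ = (Real.sqrt (2 / Real.pi) * Real.sqrt (2 / Real.pi)) *
        (Real.sin (k * x) * Real.sin (k * y)) := by ring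
    _ = _ := by rw [h]; ring

/-- The product formula for sines turns the sine series into a difference of two cosine series,
hence into the method of images. -/
lemma dirichletKernel_hasSum {t : ℝ} (ht : 0 < t) (x y : ℝ) :
    HasSum (fun j : ℕ => decay j t * sineMode (j + 1) x * sineMode (j + 1) y)
      (per (gk t) (x - y) - per (gk t) (x + y)) := by
  refine hasSum_of_eq ((per_gk_hasSum ht (x - y)).sub (per_gk_hasSum ht (x + y)))
    (fun j => ?_) (by ring)
  rw [mul_assoc, sineMode_mul]
  field_simp

lemma dirichletKernel_eq {t : ℝ} (ht : 0 < t) (x y : ℝ) :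
    dirichletKernel t x y = per (gk t) (x - y) - per (gk t) (x + y) :=
  (dirichletKernel_hasSum ht x y).tsum_eq

lemma neumannKernel_hasSum {t : ℝ} (ht : 0 < t) (x y : ℝ) :
    HasSum (fun j : ℕ => 2 / Real.pi * decay j t * Real.cos (((j + 1 : ℕ) : ℝ) * x) *
      Real.cos (((j + 1 : ℕ) : ℝ) * y)) (neumannKernel t x y - Real.pi⁻¹) := by
  have hpi := Real.pi_pos
  refine hasSum_of_eq ((per_gk_hasSum ht (x - y)).add (per_gk_hasSum ht (x + y)))
    (fun j => ?_) ?_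
  · rw [show (x - y) * ((j + 1 : ℕ) : ℝ) = ((j + 1 : ℕ) : ℝ) * x - ((j + 1 : ℕ) : ℝ) * y by ring,
      show (x + y) * ((j + 1 : ℕ) : ℝ) = ((j + 1 : ℕ) : ℝ) * x + ((j + 1 : ℕ) : ℝ) * y by ring,
      Real.cos_sub, Real.cos_add]
    field_simp
    ring
  · rw [neumannKernel]; field_simp; ring

lemma neumannKernel_comm {t : ℝ} (ht : 0 < t) (x y : ℝ) :
    neumannKernel t x y = neumannKernel t y x := by
  have h1 := neumannKernel_hasSum ht x y
  have h2 := neumannKernel_hasSum ht y x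
  have := h1.unique (hasSum_of_eq h2 (fun _ => by ring) rfl)
  linarith

lemma measurable_gk : Measurable (Function.uncurry gk) := by
  unfold gk Function.uncurry; fun_prop

lemma measurable_gk1 : Measurable (Function.uncurry gk1) := by
  unfold gk1 gk Function.uncurry; fun_prop

lemma measurable_gk2 : Measurable (Function.uncurry gk2) := by
  unfold gk2 gk Function.uncurry; fun_prop

lemma continuous_per_gk {t : ℝ} (ht : 0 < t) : Continuous (per (gk t)) := by
  obtain ⟨C, hC, h⟩ := gk1_bound 0 le_rfl
  obtain ⟨C', hC', h'⟩ := gk_bound 0 le_rfl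
  have hd := fun z => hasDerivAt_per (by positivity : 0 < 2 * t)
    (c := C * t ^ (((0 : ℝ) - 1) / 2) + C' * t ^ ((0 : ℝ) / 2)) (by positivity) (hasDerivAt_gk ht)
    (fun z => by
      have := h' t z ht
      rw [Real.rpow_zero, one_mul] at this
      refine this.trans (mul_le_mul_of_nonneg_right ?_ (gk_nonneg _ _))
      exact le_add_of_nonneg_left (by positivity))
    (fun z => by
      have := h t z ht
      rw [Real.rpow_zero, one_mul] at this
      refine this.trans (mul_le_mul_of_nonneg_right ?_ (gk_nonneg _ _))
      exact le_add_of_nonneg_right (by positivity)) z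
  exact continuous_iff_continuousAt.2 fun z => (hd z).continuousAt

/-- Every cosine mode has mean zero on `(0,π)`, so only the constant mode `π⁻¹` contributes. -/
lemma integral_neumannKernel {t : ℝ} (ht : 0 < t) (x : ℝ) :
    ∫ y in (0 : ℝ)..Real.pi, neumannKernel t x y = 1 := by
  have hpi := Real.pi_pos
  have hcos (j : ℕ) : ∫ y in (0 : ℝ)..Real.pi, Real.cos (((j + 1 : ℕ) : ℝ) * y) = 0 := by
    have h0 : ((j + 1 : ℕ) : ℝ) ≠ 0 := by positivity
    rw [intervalIntegral.integral_comp_mul_left (fun y => Real.cos y) h0]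
    simp only [integral_cos, Real.sin_nat_mul_pi]
    simp
  have hF := intervalIntegral.hasSum_integral_of_dominated_convergence
    (μ := volume) (a := 0) (b := Real.pi)
    (F := fun (j : ℕ) y => 2 / Real.pi * decay j t * Real.cos (((j + 1 : ℕ) : ℝ) * x) *
      Real.cos (((j + 1 : ℕ) : ℝ) * y)) (f := fun y => neumannKernel t x y - Real.pi⁻¹)
    (fun j _ => 2 / Real.pi * decay j t)
    (fun j => (by fun_prop : Continuous _).aestronglyMeasurable)
    (fun j => ae_of_all _ fun y _ => by
      have h0 := decay_pos j t
      rw [Real.norm_eq_abs, abs_mul, abs_mul, abs_of_nonneg (by positivity)]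
      have h1 := Real.abs_cos_le_one (((j + 1 : ℕ) : ℝ) * x)
      have h2 := Real.abs_cos_le_one (((j + 1 : ℕ) : ℝ) * y)
      calc _ ≤ 2 / Real.pi * decay j t * 1 * 1 := by gcongr
        _ = _ := by ring)
    (ae_of_all _ fun _ _ => (summable_decay_zero ht).mul_left _)
    (by simp)
    (ae_of_all _ fun y _ => neumannKernel_hasSum ht x y)
  simp only [intervalIntegral.integral_const_mul, hcos, mul_zero] at hF
  have h0 := hF.unique hasSum_zero
  have hc : Continuous fun y => neumannKernel t x y := by
    have := continuous_per_gk ht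
    unfold neumannKernel; fun_prop
  rw [intervalIntegral.integral_sub (hc.intervalIntegrable _ _) (by simp)] at h0
  simp at h0
  linarith

instance isFiniteMeasure_muI : IsFiniteMeasure muI := by
  unfold muI; infer_instance

lemma muI_univ : muI univ = ENNReal.ofReal Real.pi := by simp [muI]

lemma intervalIntegral_eq_muI (f : ℝ → ℝ) :
    ∫ y in (0 : ℝ)..Real.pi, f y = ∫ y, f y ∂muI := by
  rw [intervalIntegral.integral_of_le Real.pi_pos.le, integral_Ioc_eq_integral_Ioo, muI]

lemma continuous_neumannKernel {t : ℝ} (ht : 0 < t) (x : ℝ) : Continuous (neumannKernel t x) := by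
  have := continuous_per_gk ht
  unfold neumannKernel; fun_prop

lemma lintegral_neumannKernel {t : ℝ} (ht : 0 < t) (x : ℝ) :
    ∫⁻ y, ENNReal.ofReal (neumannKernel t x y) ∂muI = 1 := by
  have hi : Integrable (neumannKernel t x) muI := by
    have := ((continuous_neumannKernel ht x).intervalIntegrable (μ := volume) 0 Real.pi)
    rw [intervalIntegrable_iff_integrableOn_Ioo_of_le Real.pi_pos.le] at this
    exact this
  rw [← ofReal_integral_eq_lintegral_ofReal hi (ae_of_all _ fun y => neumannKernel_nonneg _ _ _),
    ← intervalIntegral_eq_muI, integral_neumannKernel ht]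
  simp

lemma measurable_neumannKernel :
    Measurable fun q : ℝ × ℝ × ℝ => neumannKernel q.1 q.2.1 q.2.2 := by
  have h := measurable_per measurable_gk
  unfold neumannKernel
  exact (h.comp (f := fun q : ℝ × ℝ × ℝ => (q.1, q.2.1 - q.2.2)) (by fun_prop)).add
    (h.comp (f := fun q : ℝ × ℝ × ℝ => (q.1, q.2.1 + q.2.2)) (by fun_prop))

/-! ### Derivatives of the Dirichlet kernel -/

/-- `∂_x P^D`. -/
def kDx (t x y : ℝ) : ℝ := per (gk1 t) (x - y) - per (gk1 t) (x + y)

/-- `∂_y P^D`. -/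
def kDy (t x y : ℝ) : ℝ := -per (gk1 t) (x - y) - per (gk1 t) (x + y)

/-- `∂_x ∂_y P^D`. -/
def kDxy (t x y : ℝ) : ℝ := -per (gk2 t) (x - y) - per (gk2 t) (x + y)

/-- A qualitative bound at a fixed time, by one constant for the Gaussian and two derivatives; it
justifies summation over images and termwise differentiation. -/
lemma gk_bound_simple (t : ℝ) (ht : 0 < t) : ∃ c : ℝ, 0 ≤ c ∧ (∀ z, |gk t z| ≤ c * gk (2 * t) z) ∧
    (∀ z, |gk1 t z| ≤ c * gk (2 * t) z) ∧ (∀ z, |gk2 t z| ≤ c * gk (2 * t) z) := by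
  obtain ⟨C0, hC0, h0⟩ := gk_bound 0 le_rfl
  obtain ⟨C1, hC1, h1⟩ := gk1_bound 0 le_rfl
  obtain ⟨C2, hC2, h2⟩ := gk2_bound 0 le_rfl
  set a := C0 * t ^ ((0 : ℝ) / 2)
  set b := C1 * t ^ (((0 : ℝ) - 1) / 2)
  set d := C2 * t ^ (((0 : ℝ) - 2) / 2)
  have ha : 0 ≤ a := by positivity
  have hb : 0 ≤ b := by positivity
  have hd : 0 ≤ d := by positivity
  refine ⟨a + b + d, by positivity, fun z => ?_, fun z => ?_, fun z => ?_⟩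
  · have := h0 t z ht
    rw [Real.rpow_zero, one_mul] at this
    exact this.trans (mul_le_mul_of_nonneg_right (by change a ≤ a + b + d; linarith)
      (gk_nonneg _ _))
  · have := h1 t z ht
    rw [Real.rpow_zero, one_mul] at this
    exact this.trans (mul_le_mul_of_nonneg_right (by change b ≤ a + b + d; linarith)
      (gk_nonneg _ _))
  · have := h2 t z ht
    rw [Real.rpow_zero, one_mul] at this
    exact this.trans (mul_le_mul_of_nonneg_right (by change d ≤ a + b + d; linarith)
      (gk_nonneg _ _))

lemma hasDerivAt_per_gk {t : ℝ} (ht : 0 < t) (z : ℝ) :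
    HasDerivAt (per (gk t)) (per (gk1 t) z) z := by
  obtain ⟨c, hc, h0, h1, -⟩ := gk_bound_simple t ht
  exact hasDerivAt_per (by positivity) hc (hasDerivAt_gk ht) h0 h1 z

lemma hasDerivAt_per_gk1 {t : ℝ} (ht : 0 < t) (z : ℝ) :
    HasDerivAt (per (gk1 t)) (per (gk2 t) z) z := by
  obtain ⟨c, hc, -, h1, h2⟩ := gk_bound_simple t ht
  exact hasDerivAt_per (by positivity) hc (hasDerivAt_gk1 ht) h1 h2 z

lemma hasDerivAt_comp_sub_const {f : ℝ → ℝ} {f' x y : ℝ} (h : HasDerivAt f f' (x - y)) :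
    HasDerivAt (fun x => f (x - y)) f' x := by
  simpa [Function.comp_def] using h.comp x ((hasDerivAt_id x).sub_const y)

lemma hasDerivAt_comp_const_sub {f : ℝ → ℝ} {f' x y : ℝ} (h : HasDerivAt f f' (x - y)) :
    HasDerivAt (fun y => f (x - y)) (-f') y := by
  simpa [Function.comp_def] using h.comp y ((hasDerivAt_id y).const_sub x)

lemma hasDerivAt_comp_add_const {f : ℝ → ℝ} {f' x y : ℝ} (h : HasDerivAt f f' (x + y)) :
    HasDerivAt (fun x => f (x + y)) f' x := by
  simpa [Function.comp_def] using h.comp x ((hasDerivAt_id x).add_const y)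

lemma hasDerivAt_comp_const_add {f : ℝ → ℝ} {f' x y : ℝ} (h : HasDerivAt f f' (x + y)) :
    HasDerivAt (fun y => f (x + y)) f' y := by
  simpa [Function.comp_def] using h.comp y ((hasDerivAt_id y).const_add x)

lemma hasDerivAt_dirichletKernel_left {t : ℝ} (ht : 0 < t) (x y : ℝ) :
    HasDerivAt (fun x => dirichletKernel t x y) (kDx t x y) x := by
  simp only [dirichletKernel_eq ht]
  exact (hasDerivAt_comp_sub_const (hasDerivAt_per_gk ht _)).sub
    (hasDerivAt_comp_add_const (hasDerivAt_per_gk ht _))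

lemma hasDerivAt_dirichletKernel_right {t : ℝ} (ht : 0 < t) (x y : ℝ) :
    HasDerivAt (fun y => dirichletKernel t x y) (kDy t x y) y := by
  simp only [dirichletKernel_eq ht]
  exact (hasDerivAt_comp_const_sub (hasDerivAt_per_gk ht _)).sub
    (hasDerivAt_comp_const_add (hasDerivAt_per_gk ht _))

lemma dirichletKernelDy_eq {t : ℝ} (ht : 0 < t) (x y : ℝ) : dirichletKernelDy t x y = kDy t x y :=
  (hasDerivAt_dirichletKernel_right ht x y).deriv

lemma hasDerivAt_kDy_left {t : ℝ} (ht : 0 < t) (x y : ℝ) :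
    HasDerivAt (fun x => kDy t x y) (kDxy t x y) x :=
  (hasDerivAt_comp_sub_const (hasDerivAt_per_gk1 ht _)).neg.sub
    (hasDerivAt_comp_add_const (hasDerivAt_per_gk1 ht _))

lemma hasDerivAt_kDx_right {t : ℝ} (ht : 0 < t) (x y : ℝ) :
    HasDerivAt (fun y => kDx t x y) (kDxy t x y) y :=
  (hasDerivAt_comp_const_sub (hasDerivAt_per_gk1 ht _)).sub
    (hasDerivAt_comp_const_add (hasDerivAt_per_gk1 ht _))

lemma dirichletKernel_comm (t x y : ℝ) : dirichletKernel t x y = dirichletKernel t y x := by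
  unfold dirichletKernel
  exact tsum_congr fun j => by ring

lemma kDx_eq_kDy {t : ℝ} (ht : 0 < t) (x y : ℝ) : kDx t x y = kDy t y x := by
  have h1 := hasDerivAt_dirichletKernel_left ht x y
  simp only [dirichletKernel_comm t _ y] at h1
  exact h1.unique (hasDerivAt_dirichletKernel_right ht y x)

lemma sineMode_zero_right (k : ℕ) : sineMode k 0 = 0 := by simp [sineMode]
lemma sineMode_pi (k : ℕ) : sineMode k Real.pi = 0 := by simp [sineMode, Real.sin_nat_mul_pi]

lemma dirichletKernel_zero (t x : ℝ) : dirichletKernel t x 0 = 0 := by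
  simp [dirichletKernel, sineMode_zero_right]

lemma dirichletKernel_pi (t x : ℝ) : dirichletKernel t x Real.pi = 0 := by
  simp [dirichletKernel, sineMode_pi]

/-- The kernel vanishes at the endpoint for every `x`, so differentiation in `x` preserves the
boundary value. Thus `∂_x P^D` also qualifies for integration by parts in `y` without boundary
terms. -/
lemma kDx_zero {t : ℝ} (ht : 0 < t) (x : ℝ) : kDx t x 0 = 0 := by
  have h1 := hasDerivAt_dirichletKernel_left ht x 0
  simp only [dirichletKernel_zero] at h1
  exact h1.unique (hasDerivAt_const _ _)

lemma kDx_pi {t : ℝ} (ht : 0 < t) (x : ℝ) : kDx t x Real.pi = 0 := by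
  have h1 := hasDerivAt_dirichletKernel_left ht x Real.pi
  simp only [dirichletKernel_pi] at h1
  exact h1.unique (hasDerivAt_const _ _)

/-! ### Measurability -/

lemma measurable_sineMode (k : ℕ) : Measurable (sineMode k) := by unfold sineMode; fun_prop

lemma measurable_dirichletKernel :
    Measurable fun q : ℝ × ℝ × ℝ => dirichletKernel q.1 q.2.1 q.2.2 := by
  unfold dirichletKernel
  refine Measurable.tsum fun j => ?_
  have := measurable_sineMode (j + 1)
  fun_prop

lemma measurable_kDx : Measurable fun q : ℝ × ℝ × ℝ => kDx q.1 q.2.1 q.2.2 := by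
  have h := measurable_per measurable_gk1
  exact (h.comp (f := fun q : ℝ × ℝ × ℝ => (q.1, q.2.1 - q.2.2)) (by fun_prop)).sub
    (h.comp (f := fun q : ℝ × ℝ × ℝ => (q.1, q.2.1 + q.2.2)) (by fun_prop))

lemma measurable_kDy : Measurable fun q : ℝ × ℝ × ℝ => kDy q.1 q.2.1 q.2.2 := by
  have h := measurable_per measurable_gk1
  exact (h.comp (f := fun q : ℝ × ℝ × ℝ => (q.1, q.2.1 - q.2.2)) (by fun_prop)).neg.sub
    (h.comp (f := fun q : ℝ × ℝ × ℝ => (q.1, q.2.1 + q.2.2)) (by fun_prop))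

lemma measurable_kDxy : Measurable fun q : ℝ × ℝ × ℝ => kDxy q.1 q.2.1 q.2.2 := by
  have h := measurable_per measurable_gk2
  exact (h.comp (f := fun q : ℝ × ℝ × ℝ => (q.1, q.2.1 - q.2.2)) (by fun_prop)).neg.sub
    (h.comp (f := fun q : ℝ × ℝ × ℝ => (q.1, q.2.1 + q.2.2)) (by fun_prop))

/-! ### Pointwise bounds by the Neumann kernel -/

lemma dirichletKernel_weight_bound (α : ℝ) (hα : 0 ≤ α) : ∃ C : ℝ, 0 ≤ C ∧ ∀ t, 0 < t →
    ∀ x ∈ Ioo 0 Real.pi, ∀ y ∈ Ioo 0 Real.pi,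
      |x - y| ^ α * |dirichletKernel t x y| ≤ C * t ^ (α / 2) * neumannKernel (2 * t) x y := by
  obtain ⟨C, hC, h⟩ := gk_bound α hα
  refine ⟨C, hC, fun t ht x hx y hy => ?_⟩
  obtain ⟨c, hc, h0, -, -⟩ := gk_bound_simple t ht
  have := image_kernel_bound (by positivity) hα (by positivity) h0 (fun z => h t z ht)
    (a := 1) (b := -1) (by simp) (by simp) hx hy
  rw [dirichletKernel_eq ht]
  convert this using 3
  ring

lemma kDx_weight_bound (α : ℝ) (hα : 0 ≤ α) : ∃ C : ℝ, 0 ≤ C ∧ ∀ t, 0 < t →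
    ∀ x ∈ Ioo 0 Real.pi, ∀ y ∈ Ioo 0 Real.pi,
      |x - y| ^ α * |kDx t x y| ≤ C * t ^ ((α - 1) / 2) * neumannKernel (2 * t) x y := by
  obtain ⟨C, hC, h⟩ := gk1_bound α hα
  refine ⟨C, hC, fun t ht x hx y hy => ?_⟩
  obtain ⟨c, hc, -, h0, -⟩ := gk_bound_simple t ht
  have := image_kernel_bound (by positivity) hα (by positivity) h0 (fun z => h t z ht)
    (a := 1) (b := -1) (by simp) (by simp) hx hy
  rw [kDx]
  convert this using 3
  ring

lemma kDy_weight_bound (α : ℝ) (hα : 0 ≤ α) : ∃ C : ℝ, 0 ≤ C ∧ ∀ t, 0 < t →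
    ∀ x ∈ Ioo 0 Real.pi, ∀ y ∈ Ioo 0 Real.pi,
      |x - y| ^ α * |kDy t x y| ≤ C * t ^ ((α - 1) / 2) * neumannKernel (2 * t) x y := by
  obtain ⟨C, hC, h⟩ := kDx_weight_bound α hα
  refine ⟨C, hC, fun t ht x hx y hy => ?_⟩
  rw [← kDx_eq_kDy ht, abs_sub_comm, neumannKernel_comm (by positivity)]
  exact h t ht y hy x hx

lemma kDxy_weight_bound (α : ℝ) (hα : 0 ≤ α) : ∃ C : ℝ, 0 ≤ C ∧ ∀ t, 0 < t →
    ∀ x ∈ Ioo 0 Real.pi, ∀ y ∈ Ioo 0 Real.pi,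
      |x - y| ^ α * |kDxy t x y| ≤ C * t ^ ((α - 2) / 2) * neumannKernel (2 * t) x y := by
  obtain ⟨C, hC, h⟩ := gk2_bound α hα
  refine ⟨C, hC, fun t ht x hx y hy => ?_⟩
  obtain ⟨c, hc, -, -, h0⟩ := gk_bound_simple t ht
  have := image_kernel_bound (by positivity) hα (by positivity) h0 (fun z => h t z ht)
    (a := -1) (b := -1) (by simp) (by simp) hx hy
  rw [kDxy]
  convert this using 3
  ring

lemma dirichletKernel_time_diff (α : ℝ) (hα : 0 ≤ α) (hα2 : α ≤ 2) : ∃ C : ℝ, 0 ≤ C ∧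
    ∀ t, 0 < t → ∀ r, 0 ≤ r → r ≤ t → ∀ x ∈ Ioo 0 Real.pi, ∀ y ∈ Ioo 0 Real.pi,
      |x - y| ^ α * |dirichletKernel (t + r) x y - dirichletKernel t x y| ≤
        C * r * t ^ ((α - 2) / 2) * neumannKernel (4 * t) x y := by
  obtain ⟨C, hC, h⟩ := gk2_bound α hα
  obtain ⟨C', hC', h'⟩ := gk2_bound 0 le_rfl
  refine ⟨C * Real.sqrt 2, by positivity, fun t ht r hr hrt x hx y hy => ?_⟩
  have htr : 0 < t + r := by linarith
  obtain ⟨c, hc, h0, -, -⟩ := gk_bound_simple t ht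
  obtain ⟨c1, hc1, h1, -, -⟩ := gk_bound_simple (t + r) htr
  have key := fun z => time_diff_bound (g := gk) (by linarith) hC
    (fun t z ht => hasDerivAt_gk_time ht z) h ht hr hrt z
  -- The unweighted bound is needed only for summability over the images.
  have key0 := fun z => time_diff_bound (g := gk) (by linarith) hC'
    (fun t z ht => hasDerivAt_gk_time ht z) h' ht hr hrt z
  simp only [Real.rpow_zero, one_mul] at key0
  have := image_kernel_bound (by positivity) hα (by positivity) key0 key
    (a := 1) (b := -1) (by simp) (by simp) hx hy
  rw [dirichletKernel_eq ht, dirichletKernel_eq htr]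
  rw [per_sub (by positivity) h1 (by positivity) h0,
    per_sub (by positivity) h1 (by positivity) h0] at this
  convert this using 3
  ring

lemma kDy_time_diff (α : ℝ) (hα : 0 ≤ α) (hα3 : α ≤ 3) : ∃ C : ℝ, 0 ≤ C ∧
    ∀ t, 0 < t → ∀ r, 0 ≤ r → r ≤ t → ∀ x ∈ Ioo 0 Real.pi, ∀ y ∈ Ioo 0 Real.pi,
      |x - y| ^ α * |kDy (t + r) x y - kDy t x y| ≤
        C * r * t ^ ((α - 3) / 2) * neumannKernel (4 * t) x y := by
  obtain ⟨C, hC, h⟩ := gk3_bound α hα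
  obtain ⟨C', hC', h'⟩ := gk3_bound 0 le_rfl
  refine ⟨C * Real.sqrt 2, by positivity, fun t ht r hr hrt x hx y hy => ?_⟩
  have htr : 0 < t + r := by linarith
  obtain ⟨c, hc, -, h0, -⟩ := gk_bound_simple t ht
  obtain ⟨c1, hc1, -, h1, -⟩ := gk_bound_simple (t + r) htr
  have key := fun z => time_diff_bound (g := gk1) (by linarith) hC
    (fun t z ht => hasDerivAt_gk1_time ht z) h ht hr hrt z
  have key0 := fun z => time_diff_bound (g := gk1) (by linarith) hC'
    (fun t z ht => hasDerivAt_gk1_time ht z) h' ht hr hrt z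
  simp only [Real.rpow_zero, one_mul] at key0
  have := image_kernel_bound (by positivity) hα (by positivity) key0 key
    (a := -1) (b := -1) (by simp) (by simp) hx hy
  rw [kDy, kDy]
  rw [per_sub (by positivity) h1 (by positivity) h0,
    per_sub (by positivity) h1 (by positivity) h0] at this
  convert this using 3
  ring

/-! ### Uniform bounds -/

lemma decay_le_inv (j : ℕ) {t : ℝ} (ht : 0 < t) :
    decay j t ≤ 1 / ((j + 1 : ℕ) : ℝ) ^ 2 * t⁻¹ := by
  have h0 : (0 : ℝ) < ((j + 1 : ℕ) : ℝ) := by positivity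
  have h : 0 < ((j + 1 : ℕ) : ℝ) ^ 2 * t := by positivity
  have h1 : ((j + 1 : ℕ) : ℝ) ^ 2 * t ≤ Real.exp (((j + 1 : ℕ) : ℝ) ^ 2 * t) := by
    have := Real.add_one_le_exp (((j + 1 : ℕ) : ℝ) ^ 2 * t); linarith
  rw [decay, neg_mul, Real.exp_neg]
  rw [show 1 / ((j + 1 : ℕ) : ℝ) ^ 2 * t⁻¹ = (((j + 1 : ℕ) : ℝ) ^ 2 * t)⁻¹ by field_simp]
  gcongr

lemma decay_le_inv_sq (j : ℕ) {t : ℝ} (ht : 0 < t) :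
    decay j t ≤ 2 / ((j + 1 : ℕ) : ℝ) ^ 4 * (t ^ 2)⁻¹ := by
  have h0 : (0 : ℝ) < ((j + 1 : ℕ) : ℝ) := by positivity
  have h : 0 < ((j + 1 : ℕ) : ℝ) ^ 2 * t := by positivity
  have h1 : (((j + 1 : ℕ) : ℝ) ^ 2 * t) ^ 2 / 2 ≤ Real.exp (((j + 1 : ℕ) : ℝ) ^ 2 * t) := by
    have := Real.pow_div_factorial_le_exp (((j + 1 : ℕ) : ℝ) ^ 2 * t) h.le 2
    simpa using this
  rw [decay, neg_mul, Real.exp_neg]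
  rw [show 2 / ((j + 1 : ℕ) : ℝ) ^ 4 * (t ^ 2)⁻¹ = ((((j + 1 : ℕ) : ℝ) ^ 2 * t) ^ 2 / 2)⁻¹ by
    field_simp]
  gcongr

lemma summable_inv_pow {m : ℕ} (hm : 1 < m) :
    Summable fun j : ℕ => 1 / ((j + 1 : ℕ) : ℝ) ^ m :=
  (summable_nat_add_iff 1).2 (Real.summable_one_div_nat_pow.2 hm)

/-- Termwise `e^{-k²t} ≤ 1/(k²t)`. The rate `t⁻¹` is not sharp, but it is used only at times bounded
below or against a factor `t²`. -/
lemma neumannKernel_le : ∃ C : ℝ, 0 ≤ C ∧ ∀ t, 0 < t → ∀ x y,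
    neumannKernel t x y ≤ C * (1 + t⁻¹) := by
  have hpi := Real.pi_pos
  set S := ∑' j : ℕ, 1 / ((j + 1 : ℕ) : ℝ) ^ 2
  have hS : 0 ≤ S := tsum_nonneg fun j => by positivity
  refine ⟨Real.pi⁻¹ + 2 / Real.pi * S, by positivity, fun t ht x y => ?_⟩
  have h := neumannKernel_hasSum ht x y
  have h2 : HasSum (fun j : ℕ => 2 / Real.pi * (1 / ((j + 1 : ℕ) : ℝ) ^ 2 * t⁻¹))
      (2 / Real.pi * (S * t⁻¹)) :=
    ((summable_inv_pow one_lt_two).hasSum.mul_right _).mul_left _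
  have h3 := hasSum_le (fun j => ?_) h h2
  · have : 0 < t⁻¹ := by positivity
    have h4 : 0 ≤ Real.pi⁻¹ * t⁻¹ := by positivity
    have h5 : 0 ≤ 2 / Real.pi * S := by positivity
    nlinarith
  · have h0 := decay_pos j t
    have h1 := decay_le_inv j ht
    refine (le_abs_self _).trans ?_
    rw [abs_mul, abs_mul, abs_of_nonneg (by positivity)]
    calc _ ≤ 2 / Real.pi * decay j t * 1 * 1 := by
          gcongr <;> exact Real.abs_cos_le_one _
      _ = 2 / Real.pi * decay j t := by ring
      _ ≤ _ := by gcongr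

/-- Away from `t = 0` everything is bounded. This serves integrability, Fubini and differentiation
under the integral; the quantitative estimates come from the weighted bounds. -/
lemma exists_kernel_bound {t₀ : ℝ} (ht₀ : 0 < t₀) : ∃ C : ℝ, 0 ≤ C ∧ ∀ t, t₀ ≤ t →
    ∀ x ∈ Ioo 0 Real.pi, ∀ y ∈ Ioo 0 Real.pi, |dirichletKernel t x y| ≤ C ∧ |kDx t x y| ≤ C ∧
      |kDy t x y| ≤ C ∧ |kDxy t x y| ≤ C := by
  obtain ⟨C, hC, h⟩ := neumannKernel_le
  obtain ⟨C0, hC0, h0⟩ := dirichletKernel_weight_bound 0 le_rfl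
  obtain ⟨C1, hC1, h1⟩ := kDx_weight_bound 0 le_rfl
  obtain ⟨C1', hC1', h1'⟩ := kDy_weight_bound 0 le_rfl
  obtain ⟨C2, hC2, h2⟩ := kDxy_weight_bound 0 le_rfl
  set D := C * (1 + (2 * t₀)⁻¹)
  have hD : 0 ≤ D := by positivity
  have hD' : ∀ t, t₀ ≤ t → ∀ x y, neumannKernel (2 * t) x y ≤ D := fun t ht x y =>
    (h (2 * t) (by linarith) x y).trans (by
      have : (2 * t)⁻¹ ≤ (2 * t₀)⁻¹ := by gcongr
      exact mul_le_mul_of_nonneg_left (by linarith) hC)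
  set e1 := t₀ ^ (((0 : ℝ) - 1) / 2)
  set e2 := t₀ ^ (((0 : ℝ) - 2) / 2)
  have he1 : 0 < e1 := by positivity
  have he2 : 0 < e2 := by positivity
  refine ⟨C0 * D + C1 * e1 * D + C1' * e1 * D + C2 * e2 * D, by positivity,
    fun t ht x hx y hy => ?_⟩
  have htp : 0 < t := ht₀.trans_le ht
  have a0 := h0 t htp x hx y hy
  have a1 := h1 t htp x hx y hy
  have a1' := h1' t htp x hx y hy
  have a2 := h2 t htp x hx y hy
  have b1 : t ^ (((0 : ℝ) - 1) / 2) ≤ e1 :=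
    Real.rpow_le_rpow_of_nonpos ht₀ ht (by norm_num)
  have b2 : t ^ (((0 : ℝ) - 2) / 2) ≤ e2 :=
    Real.rpow_le_rpow_of_nonpos ht₀ ht (by norm_num)
  have hn := hD' t ht x y
  have hnn := neumannKernel_nonneg (2 * t) x y
  simp only [Real.rpow_zero, one_mul, zero_div, mul_one] at a0 a1 a1' a2
  have p0 : C0 * neumannKernel (2 * t) x y ≤ C0 * D := by gcongr
  have p1 : C1 * t ^ (((0 : ℝ) - 1) / 2) * neumannKernel (2 * t) x y ≤ C1 * e1 * D := by gcongr
  have p1' : C1' * t ^ (((0 : ℝ) - 1) / 2) * neumannKernel (2 * t) x y ≤ C1' * e1 * D := by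
    gcongr
  have p2 : C2 * t ^ (((0 : ℝ) - 2) / 2) * neumannKernel (2 * t) x y ≤ C2 * e2 * D := by gcongr
  have q0 : 0 ≤ C0 * D := by positivity
  have q1 : 0 ≤ C1 * e1 * D := by positivity
  have q1' : 0 ≤ C1' * e1 * D := by positivity
  have q2 : 0 ≤ C2 * e2 * D := by positivity
  refine ⟨?_, ?_, ?_, ?_⟩ <;> linarith

/-- The derivative of `sineMode`. -/
def cosMode (k : ℕ) (x : ℝ) : ℝ := Real.sqrt (2 / Real.pi) * (k * Real.cos (k * x))

lemma hasDerivAt_sineMode (k : ℕ) (x : ℝ) : HasDerivAt (sineMode k) (cosMode k x) x := by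
  have h : HasDerivAt (fun x : ℝ => (k : ℝ) * x) k x := by
    simpa using (hasDerivAt_id x).const_mul (k : ℝ)
  have := (h.sin).const_mul (Real.sqrt (2 / Real.pi))
  refine this.congr_deriv ?_
  rw [cosMode]; ring

lemma abs_cosMode_le (k : ℕ) (x : ℝ) : |cosMode k x| ≤ Real.sqrt (2 / Real.pi) * k := by
  rw [cosMode, abs_mul, abs_of_nonneg (Real.sqrt_nonneg _), abs_mul, abs_of_nonneg (by positivity)]
  gcongr
  exact mul_le_of_le_one_right (by positivity) (Real.abs_cos_le_one _)

lemma abs_mode_mul_le {a b A B d : ℝ} (hd : 0 ≤ d) (ha : |a| ≤ A) (hb : |b| ≤ B) :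
    |d * a * b| ≤ d * A * B := by
  have := (abs_nonneg a).trans ha
  rw [abs_mul, abs_mul, abs_of_nonneg hd]
  gcongr

lemma summable_dirichlet {t : ℝ} (ht : 0 < t) (x y : ℝ) :
    Summable fun j : ℕ => decay j t * sineMode (j + 1) x * sineMode (j + 1) y :=
  (dirichletKernel_hasSum ht x y).summable

lemma kDy_hasSum {t : ℝ} (ht : 0 < t) (x y : ℝ) :
    HasSum (fun j : ℕ => decay j t * sineMode (j + 1) x * cosMode (j + 1) y) (kDy t x y) := by
  set c := Real.sqrt (2 / Real.pi)
  have hu : Summable fun j : ℕ => decay j t * c * (c * ((j + 1 : ℕ) : ℝ)) := by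
    refine ((summable_decay 1 ht).mul_left (c * c)).congr fun j => ?_
    rw [pow_one]; ring
  have hb : ∀ (j : ℕ) (y : ℝ), ‖decay j t * sineMode (j + 1) x * cosMode (j + 1) y‖ ≤
      decay j t * c * (c * ((j + 1 : ℕ) : ℝ)) := fun j y =>
    abs_mode_mul_le (decay_pos j t).le (abs_sineMode_le _ _) (abs_cosMode_le _ _)
  have h := hasDerivAt_tsum hu
    (g := fun (j : ℕ) y => decay j t * sineMode (j + 1) x * sineMode (j + 1) y)
    (fun j y => (hasDerivAt_sineMode (j + 1) y).const_mul _) hb (summable_dirichlet ht x y) y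
  have h2 := h.unique (hasDerivAt_dirichletKernel_right ht x y)
  rw [← h2]
  exact (Summable.of_norm_bounded hu (fun j => hb j y)).hasSum

/-- Exponential decay is weakened to `t⁻²`: with `e^{-k²t} ≤ 2/(k⁴t²)` the series still converges
after a derivative has produced a factor `k`, and the rate makes `r^(σ/2-1)` integrable at infinity
for `σ < 2`. -/
lemma kernel_large_time : ∃ C : ℝ, 0 ≤ C ∧ ∀ t, 0 < t → ∀ x y,
    |dirichletKernel t x y| ≤ C * (t ^ 2)⁻¹ ∧ |kDx t x y| ≤ C * (t ^ 2)⁻¹ := by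
  set c := Real.sqrt (2 / Real.pi)
  have hc : 0 ≤ c := Real.sqrt_nonneg _
  set S := ∑' j : ℕ, 1 / ((j + 1 : ℕ) : ℝ) ^ 3
  have hS : 0 ≤ S := tsum_nonneg fun j => by positivity
  refine ⟨c * c * 2 * S, by positivity, fun t ht x y => ?_⟩
  have h2 : HasSum (fun j : ℕ => c * c * 2 * (1 / ((j + 1 : ℕ) : ℝ) ^ 3) * (t ^ 2)⁻¹)
      (c * c * 2 * S * (t ^ 2)⁻¹) :=
    ((summable_inv_pow (by norm_num)).hasSum.mul_left _).mul_right _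
  have hb : ∀ j : ℕ, decay j t * c * (c * ((j + 1 : ℕ) : ℝ)) ≤
      c * c * 2 * (1 / ((j + 1 : ℕ) : ℝ) ^ 3) * (t ^ 2)⁻¹ := fun j => by
    have h1 := decay_le_inv_sq j ht
    have h0 : (0 : ℝ) < ((j + 1 : ℕ) : ℝ) := by positivity
    calc _ ≤ 2 / ((j + 1 : ℕ) : ℝ) ^ 4 * (t ^ 2)⁻¹ * c * (c * ((j + 1 : ℕ) : ℝ)) := by gcongr
      _ = _ := by field_simp
  constructor
  · rw [dirichletKernel_eq ht, ← (dirichletKernel_hasSum ht x y).tsum_eq, ← Real.norm_eq_abs]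
    refine tsum_of_norm_bounded h2 fun j => ?_
    refine (abs_mode_mul_le (decay_pos j t).le (abs_sineMode_le _ _) (abs_sineMode_le _ _)).trans
      (le_trans ?_ (hb j))
    have := decay_pos j t
    have h1 : (1 : ℝ) ≤ ((j + 1 : ℕ) : ℝ) := by exact_mod_cast Nat.le_add_left 1 j
    gcongr
    exact le_mul_of_one_le_right hc h1
  · rw [kDx_eq_kDy ht, ← (kDy_hasSum ht y x).tsum_eq, ← Real.norm_eq_abs]
    refine tsum_of_norm_bounded h2 fun j => ?_
    exact (abs_mode_mul_le (decay_pos j t).le (abs_sineMode_le _ _) (abs_cosMode_le _ _)).trans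
      (hb j)

/-! ### Inequalities in `L_p` -/

lemma eLpNorm_ennreal_eq {α : Type*} [MeasurableSpace α] {μ : Measure α} {p : ℝ≥0∞}
    (hp : 1 ≤ p) (hp' : p ≠ ⊤) (f : α → ℝ≥0∞) :
    eLpNorm f p μ = (∫⁻ x, f x ^ p.toReal ∂μ) ^ (1 / p.toReal) := by
  have hp0 : p ≠ 0 := (zero_lt_one.trans_le hp).ne'
  rw [eLpNorm_eq_lintegral_rpow_enorm_toReal hp0 hp']
  simp only [enorm_eq_self]

lemma one_le_toReal {p : ℝ≥0∞} (hp : 1 ≤ p) (hp' : p ≠ ⊤) : 1 ≤ p.toReal := by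
  have := ENNReal.toReal_mono hp' hp
  simpa using this

/-- **Minkowski's integral inequality**. -/
theorem eLpNorm_lintegral_le {α β : Type*} [MeasurableSpace α] [MeasurableSpace β]
    {ν : Measure α} [SFinite ν] {μ : Measure β} [IsFiniteMeasure μ] {p : ℝ≥0∞}
    (hp : 1 ≤ p) (hp' : p ≠ ⊤) {F : α → β → ℝ≥0∞} (hF : Measurable (Function.uncurry F)) :
    eLpNorm (fun x => ∫⁻ s, F s x ∂ν) p μ ≤ ∫⁻ s, eLpNorm (F s) p μ ∂ν := by
  set Φ : β → ℝ≥0∞ := fun x => ∫⁻ s, F s x ∂ν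
  have hΦ : Measurable Φ := hF.lintegral_prod_left'
  have hq := one_le_toReal hp hp'
  simp only [eLpNorm_ennreal_eq hp hp']
  set q := p.toReal
  have hq0 : 0 < q := by linarith
  have hFs : ∀ s, Measurable (F s) := fun s => hF.comp measurable_prodMk_left
  rcases hq.eq_or_lt with h1 | h1
  · simp only [← h1, ENNReal.rpow_one, div_one]
    rw [lintegral_lintegral_swap hF.aemeasurable]
  set Λ := ∫⁻ s, (∫⁻ x, F s x ^ q ∂μ) ^ (1 / q) ∂ν
  have hconj : q.HolderConjugate (q / (q - 1)) := Real.HolderConjugate.conjExponent h1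
  have hm : ∀ n : ℕ, Measurable fun x => min (Φ x) n := fun n => hΦ.min measurable_const
  -- One factor `Φ` is written as an integral over `s` and Hölder's inequality is applied for each
  -- `s`. The truncation at `n` makes `I` finite, so that a power of it can be divided out.
  have key : ∀ n : ℕ, ∫⁻ x, (min (Φ x) n) ^ q ∂μ ≤ Λ ^ q := by
    intro n
    set I := ∫⁻ x, (min (Φ x) n) ^ q ∂μ
    have hI : I ≠ ⊤ := by
      refine ne_top_of_le_ne_top (b := ∫⁻ _, (n : ℝ≥0∞) ^ q ∂μ) ?_ ?_
      · rw [lintegral_const]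
        exact ENNReal.mul_ne_top (by simp [hq0.le]) (measure_ne_top _ _)
      · exact lintegral_mono fun x => ENNReal.rpow_le_rpow (min_le_right _ _) hq0.le
    have step : I ≤ Λ * I ^ ((q - 1) / q) := by
      calc I = ∫⁻ x, min (Φ x) n * (min (Φ x) n) ^ (q - 1) ∂μ := by
            refine lintegral_congr fun x => ?_
            have := ENNReal.rpow_add_of_nonneg (x := min (Φ x) n) 1 (q - 1) (by norm_num)
              (by linarith)
            rw [ENNReal.rpow_one] at this
            rw [← this]; ring_nf
        _ ≤ ∫⁻ x, Φ x * (min (Φ x) n) ^ (q - 1) ∂μ :=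
            lintegral_mono fun x => mul_le_mul_left (min_le_left _ _) _
        _ = ∫⁻ x, ∫⁻ s, F s x * (min (Φ x) n) ^ (q - 1) ∂ν ∂μ := by
            refine lintegral_congr fun x => ?_
            exact (lintegral_mul_const (f := fun s => F s x) _
              (hF.comp measurable_prodMk_right)).symm
        _ = ∫⁻ s, ∫⁻ x, F s x * (min (Φ x) n) ^ (q - 1) ∂μ ∂ν := by
            refine (lintegral_lintegral_swap ?_).symm
            exact (hF.mul (((hm n).pow_const _).comp measurable_snd)).aemeasurable
        _ ≤ ∫⁻ s, (∫⁻ x, F s x ^ q ∂μ) ^ (1 / q) * I ^ ((q - 1) / q) ∂ν := by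
            refine lintegral_mono fun s => ?_
            refine (ENNReal.lintegral_mul_le_Lp_mul_Lq μ hconj (hFs s).aemeasurable
              ((hm n).pow_const _).aemeasurable).trans ?_
            refine mul_le_mul_right (le_of_eq ?_) _
            rw [one_div_div]
            congr 1
            refine lintegral_congr fun x => ?_
            rw [← ENNReal.rpow_mul, mul_div_cancel₀ _ (by linarith : q - 1 ≠ 0)]
        _ = Λ * I ^ ((q - 1) / q) := lintegral_mul_const' _ _
              (ENNReal.rpow_ne_top_of_nonneg (div_nonneg (by linarith) hq0.le) hI)
    rcases eq_or_ne I 0 with h0 | h0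
    · rw [h0]; exact zero_le
    have h2 : I ^ (1 / q) ≤ Λ := by
      have e : I = I ^ (1 / q) * I ^ ((q - 1) / q) := by
        rw [← ENNReal.rpow_add _ _ h0 hI, ← add_div]
        rw [show (1 + (q - 1)) / q = 1 by field_simp; ring, ENNReal.rpow_one]
      have hI' : I ^ ((q - 1) / q) ≠ ⊤ :=
        ENNReal.rpow_ne_top_of_nonneg (div_nonneg (by linarith) hq0.le) hI
      have hI0 : I ^ ((q - 1) / q) ≠ 0 := (ENNReal.rpow_pos (pos_iff_ne_zero.2 h0) hI).ne'
      rw [← ENNReal.mul_le_mul_iff_left hI0 hI', ← e]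
      exact step
    calc I = (I ^ (1 / q)) ^ q := by
          rw [← ENNReal.rpow_mul, one_div_mul_cancel hq0.ne', ENNReal.rpow_one]
      _ ≤ _ := ENNReal.rpow_le_rpow h2 hq0.le
  have hlim : ∫⁻ x, Φ x ^ q ∂μ ≤ Λ ^ q := by
    have hmono : ∀ x, Monotone fun n : ℕ => (min (Φ x) n) ^ q := fun x a b hab =>
      ENNReal.rpow_le_rpow (min_le_min_left _ (by exact_mod_cast hab)) hq0.le
    have htend : ∀ x, Tendsto (fun n : ℕ => (min (Φ x) n) ^ q) atTop (𝓝 (Φ x ^ q)) := fun x => by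
      refine (ENNReal.continuous_rpow_const.tendsto _).comp ?_
      have := (tendsto_const_nhds (x := Φ x)).min ENNReal.tendsto_nat_nhds_top
      simpa using this
    refine le_of_tendsto' (lintegral_tendsto_of_tendsto_of_monotone
      (fun n => ((hm n).pow_const _).aemeasurable) (ae_of_all _ hmono) (ae_of_all _ htend)) key
  calc _ ≤ (Λ ^ q) ^ (1 / q) := ENNReal.rpow_le_rpow hlim (by positivity)
    _ = Λ := by rw [← ENNReal.rpow_mul, mul_one_div_cancel hq0.ne', ENNReal.rpow_one]

/-- Jensen's inequality for averages. -/
lemma lintegral_mul_rpow_le {α : Type*} [MeasurableSpace α] {μ : Measure α} {q : ℝ} (hq : 1 ≤ q)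
    {k h : α → ℝ≥0∞} (hk : Measurable k) (hh : AEMeasurable h μ) (hk1 : ∫⁻ y, k y ∂μ ≤ 1) :
    (∫⁻ y, k y * h y ∂μ) ^ q ≤ ∫⁻ y, k y * h y ^ q ∂μ := by
  have hq0 : 0 < q := by linarith
  rcases hq.eq_or_lt with h1 | h1
  · simp [← h1]
  have hconj : q.HolderConjugate (q / (q - 1)) := Real.HolderConjugate.conjExponent h1
  -- Hölder with the weight split as `k = k^{1/q} k^{(q-1)/q}`; the second factor contributes a
  -- power of the mass, at most one.
  have h2 := ENNReal.lintegral_mul_le_Lp_mul_Lq μ hconj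
    (f := fun y => k y ^ (1 / q) * h y) (g := fun y => k y ^ ((q - 1) / q))
    ((hk.pow_const _).aemeasurable.mul hh) (hk.pow_const _).aemeasurable
  have e : ∀ y, k y ^ (1 / q) * h y * k y ^ ((q - 1) / q) = k y * h y := fun y => by
    rw [mul_right_comm, ← ENNReal.rpow_add_of_nonneg _ _ (by positivity)
      (div_nonneg (by linarith) hq0.le), ← add_div, show (1 + (q - 1)) / q = 1 by field_simp; ring,
      ENNReal.rpow_one]
  have e1 : ∀ y, (k y ^ (1 / q) * h y) ^ q = k y * h y ^ q := fun y => by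
    rw [ENNReal.mul_rpow_of_nonneg _ _ hq0.le, ← ENNReal.rpow_mul, one_div_mul_cancel hq0.ne',
      ENNReal.rpow_one]
  have e2 : ∀ y, (k y ^ ((q - 1) / q)) ^ (q / (q - 1)) = k y := fun y => by
    rw [← ENNReal.rpow_mul, div_mul_div_cancel₀ hq0.ne', div_self (by linarith), ENNReal.rpow_one]
  simp only [Pi.mul_apply, e, e1, e2] at h2
  calc _ ≤ ((∫⁻ y, k y * h y ^ q ∂μ) ^ (1 / q)) ^ q := by
        refine ENNReal.rpow_le_rpow (h2.trans ?_) hq0.le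
        refine mul_le_of_le_one_right' (ENNReal.rpow_le_one hk1 ?_)
        rw [one_div_div]; exact div_nonneg (by linarith) hq0.le
    _ = _ := by rw [← ENNReal.rpow_mul, one_div_mul_cancel hq0.ne', ENNReal.rpow_one]

/-- An averaging kernel is a contraction in `L_p`. -/
lemma eLpNorm_averaging_le {α β : Type*} [MeasurableSpace α] [MeasurableSpace β]
    {ν : Measure α} [SFinite ν] {μ : Measure β} [SFinite μ] {p : ℝ≥0∞}
    (hp : 1 ≤ p) (hp' : p ≠ ⊤) {k : β → α → ℝ≥0∞} (hk : Measurable (Function.uncurry k))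
    {h : α → ℝ≥0∞} (hh : AEMeasurable h ν) (h1 : ∀ x, ∫⁻ y, k x y ∂ν ≤ 1)
    (h2 : ∀ y, ∫⁻ x, k x y ∂μ ≤ 1) :
    eLpNorm (fun x => ∫⁻ y, k x y * h y ∂ν) p μ ≤ eLpNorm h p ν := by
  have hq := one_le_toReal hp hp'
  simp only [eLpNorm_ennreal_eq hp hp']
  set q := p.toReal
  have hq0 : 0 < q := by linarith
  refine ENNReal.rpow_le_rpow ?_ (by positivity)
  calc _ ≤ ∫⁻ x, ∫⁻ y, k x y * h y ^ q ∂ν ∂μ := lintegral_mono fun x =>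
        lintegral_mul_rpow_le hq (hk.comp measurable_prodMk_left) hh (h1 x)
    _ = ∫⁻ y, ∫⁻ x, k x y * h y ^ q ∂μ ∂ν :=
        lintegral_lintegral_swap (hk.aemeasurable.mul (hh.pow_const q).comp_snd)
    _ = ∫⁻ y, (∫⁻ x, k x y ∂μ) * h y ^ q ∂ν := lintegral_congr fun y =>
        lintegral_mul_const _ (hk.comp measurable_prodMk_right)
    _ ≤ ∫⁻ y, h y ^ q ∂ν := lintegral_mono fun y => mul_le_of_le_one_left' (h2 y)

/-- Averages with respect to the Neumann kernel. -/
def nAvg (τ : ℝ) (h : ℝ → ℝ≥0∞) (x : ℝ) : ℝ≥0∞ :=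
  ∫⁻ y, ENNReal.ofReal (neumannKernel τ x y) * h y ∂muI

lemma eLpNorm_nAvg_le {p : ℝ≥0∞} (hp : 1 ≤ p) (hp' : p ≠ ⊤) {τ : ℝ} (hτ : 0 < τ)
    {h : ℝ → ℝ≥0∞} (hh : AEMeasurable h muI) :
    eLpNorm (nAvg τ h) p muI ≤ eLpNorm h p muI := by
  refine eLpNorm_averaging_le hp hp' (k := fun x y => ENNReal.ofReal (neumannKernel τ x y))
    ?_ hh (fun x => (lintegral_neumannKernel hτ x).le) (fun y => ?_)
  · exact (measurable_neumannKernel.comp (f := fun q : ℝ × ℝ => (τ, q.1, q.2))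
      (by fun_prop)).ennreal_ofReal
  · simp only [fun x => neumannKernel_comm hτ x y]
    exact (lintegral_neumannKernel hτ y).le

lemma ae_muI_mem : ∀ᵐ x ∂muI, x ∈ Ioo 0 Real.pi := ae_restrict_mem measurableSet_Ioo

/-- Bound of an integral operator whose kernel is dominated by Neumann kernels. -/
lemma eLpNorm_kernel_le {p : ℝ≥0∞} (hp : 1 ≤ p) (hp' : p ≠ ⊤) {τ c : ℝ} (hτ : 0 < τ)
    (hc : 0 ≤ c) {k : ℝ → ℝ → ℝ} {f : ℝ → ℝ} (hf : AEStronglyMeasurable f muI)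
    (hk : ∀ x ∈ Ioo 0 Real.pi, ∀ y ∈ Ioo 0 Real.pi, |k x y| ≤ c * neumannKernel τ x y) :
    eLpNorm (fun x => ∫ y, k x y * f y ∂muI) p muI ≤ ENNReal.ofReal c * eLpNorm f p muI := by
  have h1 : ∀ᵐ x ∂muI, ‖∫ y, k x y * f y ∂muI‖ₑ ≤
      ‖(ENNReal.ofReal c • nAvg τ (fun y => ‖f y‖ₑ)) x‖ₑ := by
    filter_upwards [ae_muI_mem] with x hx
    refine (enorm_integral_le_lintegral_enorm _).trans ?_
    rw [enorm_eq_self, Pi.smul_apply, nAvg, smul_eq_mul,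
      ← lintegral_const_mul' _ _ ENNReal.ofReal_ne_top]
    refine lintegral_mono_ae ?_
    filter_upwards [ae_muI_mem] with y hy
    rw [enorm_mul, ← mul_assoc, ← ENNReal.ofReal_mul hc]
    refine mul_le_mul_left ?_ _
    rw [Real.enorm_eq_ofReal_abs]
    exact ENNReal.ofReal_le_ofReal (hk x hx y hy)
  refine (eLpNorm_mono_enorm_ae h1).trans ?_
  rw [eLpNorm_ennreal_eq hp hp']
  have hq := one_le_toReal hp hp'
  have hq0 : 0 < p.toReal := by linarith
  simp only [Pi.smul_apply, smul_eq_mul, ENNReal.mul_rpow_of_nonneg _ _ hq0.le]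
  rw [lintegral_const_mul' _ _ (ENNReal.rpow_ne_top_of_nonneg hq0.le ENNReal.ofReal_ne_top),
    ENNReal.mul_rpow_of_nonneg _ _ (by positivity), ← ENNReal.rpow_mul,
    mul_one_div_cancel hq0.ne', ENNReal.rpow_one, ← eLpNorm_ennreal_eq hp hp']
  refine mul_le_mul_right ((eLpNorm_nAvg_le hp hp' hτ hf.enorm).trans_eq ?_) _
  exact eLpNorm_enorm _

lemma eLpNorm_le_of_tendsto {p : ℝ≥0∞} {μ : Measure ℝ} {F : ℕ → ℝ → ℝ} {f : ℝ → ℝ} {M : ℝ≥0∞}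
    (hF : ∀ n, AEStronglyMeasurable (F n) μ)
    (hlim : ∀ᵐ x ∂μ, Tendsto (fun n => F n x) atTop (𝓝 (f x))) (hM : ∀ n, eLpNorm (F n) p μ ≤ M) :
    eLpNorm f p μ ≤ M := by
  exact Lp.eLpNorm_le_of_ae_tendsto (Eventually.of_forall hM) hF hlim

/-- Lower semicontinuity of the `L_p` norm of the derivative under pointwise convergence of the
functions. -/
lemma eLpNorm_deriv_le_of_tendsto {p : ℝ≥0∞} (hp : 1 ≤ p) (hp' : p ≠ ⊤) {f f' : ℝ → ℝ}
    {F : ℕ → ℝ → ℝ} {H : ℕ → ℝ → ℝ≥0∞} {M : ℝ≥0∞}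
    (hd : ∀ x ∈ Ioo 0 Real.pi, HasDerivAt f (f' x) x)
    (hF : ∀ n, Measurable (F n))
    (hlim : ∀ x ∈ Ioo 0 Real.pi, Tendsto (fun n => F n x) atTop (𝓝 (f x)))
    (hH : ∀ n, AEMeasurable (H n) muI)
    (hFH : ∀ n, ∀ x₁ ∈ Ioo 0 Real.pi, ∀ x₂ ∈ Ioo 0 Real.pi, x₁ < x₂ →
      ‖F n x₂ - F n x₁‖ₑ ≤ ∫⁻ z in Ioo x₁ x₂, H n z)
    (hM : ∀ n, eLpNorm (H n) p muI ≤ M) : eLpNorm f' p muI ≤ M := by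
  -- Difference quotients, set to zero where `x + h` would leave the interval. The functions `F n`
  -- need not be differentiable; only the majorant `H n` of their increments is used.
  set D : ℝ → (ℝ → ℝ) → ℝ → ℝ := fun h g =>
    (Ioo 0 (Real.pi - h)).indicator fun x => h⁻¹ * (g (x + h) - g x)
  have hDm : ∀ h n, Measurable (D h (F n)) := fun h n =>
    ((((hF n).comp (measurable_id.add_const h)).sub (hF n)).const_mul _).indicator
      measurableSet_Ioo
  have hDlim : ∀ h : ℝ, 0 < h → ∀ x, Tendsto (fun n => D h (F n) x) atTop (𝓝 (D h f x)) := by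
    intro h hh x
    by_cases hx : x ∈ Ioo 0 (Real.pi - h)
    · simp only [D, indicator_of_mem hx]
      exact ((hlim _ ⟨by linarith [hx.1], by linarith [hx.2]⟩).sub
        (hlim _ ⟨hx.1, by linarith [hx.2]⟩)).const_mul _
    · simp only [D, indicator_of_notMem hx]
      exact tendsto_const_nhds
  have hDf : ∀ h : ℝ, 0 < h → Measurable (D h f) := fun h hh =>
    measurable_of_tendsto_metrizable (hDm h) (tendsto_pi_nhds.2 (hDlim h hh))
  have hDn : ∀ h : ℝ, 0 < h → ∀ n, eLpNorm (D h (F n)) p muI ≤ M := by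
    intro h hh n
    set S : Set (ℝ × ℝ) := {q | q.1 < q.2 ∧ q.2 < q.1 + h}
    have hS : MeasurableSet S :=
      (measurableSet_lt measurable_fst measurable_snd).inter
        (measurableSet_lt measurable_snd (measurable_fst.add_const h))
    -- The difference quotient is at most the mean of `H n` over `(x, x + h)`, and this averaging
    -- kernel has both marginals at most one.
    set k : ℝ → ℝ → ℝ≥0∞ := fun x y => S.indicator (fun _ => ENNReal.ofReal h⁻¹) (x, y)
    have hk : Measurable (Function.uncurry k) := measurable_const.indicator hS
    have hone : ENNReal.ofReal h⁻¹ * ENNReal.ofReal h = 1 := by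
      rw [← ENNReal.ofReal_mul (by positivity), inv_mul_cancel₀ hh.ne', ENNReal.ofReal_one]
    have h1 : ∀ x, ∫⁻ y, k x y ∂muI ≤ 1 := fun x => by
      have e : k x = (Ioo x (x + h)).indicator fun _ => ENNReal.ofReal h⁻¹ := rfl
      calc _ ≤ ∫⁻ y, k x y := lintegral_mono' Measure.restrict_le_self le_rfl
        _ = 1 := by
          rw [e, lintegral_indicator measurableSet_Ioo, setLIntegral_const, Real.volume_Ioo]
          simpa using hone
    have h2 : ∀ y, ∫⁻ x, k x y ∂muI ≤ 1 := fun y => by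
      have e : (fun x => k x y) = (Ioo (y - h) y).indicator fun _ => ENNReal.ofReal h⁻¹ := by
        funext x
        by_cases hx : x ∈ Ioo (y - h) y
        · rw [indicator_of_mem hx]
          exact indicator_of_mem (show (x, y) ∈ S from ⟨hx.2, by linarith [hx.1]⟩) _
        · rw [indicator_of_notMem hx]
          exact indicator_of_notMem
            (fun hm : (x, y) ∈ S => hx ⟨by have := hm.2; simp only at this; linarith, hm.1⟩) _
      calc _ ≤ ∫⁻ x, k x y := lintegral_mono' Measure.restrict_le_self le_rfl
        _ = 1 := by
          rw [e, lintegral_indicator measurableSet_Ioo, setLIntegral_const, Real.volume_Ioo]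
          simpa using hone
    refine le_trans ?_ ((eLpNorm_averaging_le hp hp' hk (hH n) h1 h2).trans (hM n))
    refine eLpNorm_mono_enorm fun x => ?_
    rw [enorm_eq_self]
    by_cases hx : x ∈ Ioo 0 (Real.pi - h)
    · simp only [D, indicator_of_mem hx]
      rw [enorm_mul, Real.enorm_of_nonneg (by positivity)]
      refine (mul_le_mul_right (hFH n x ⟨hx.1, by linarith [hx.2]⟩ (x + h)
        ⟨by linarith [hx.1], by linarith [hx.2]⟩ (by linarith)) _).trans (le_of_eq ?_)
      have e : ∀ y, k x y * H n y = (Ioo x (x + h)).indicator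
          (fun y => ENNReal.ofReal h⁻¹ * H n y) y := fun y => by
        by_cases hy : y ∈ Ioo x (x + h)
        · rw [indicator_of_mem hy]
          congr 1
          exact indicator_of_mem (show (x, y) ∈ S from hy) _
        · rw [indicator_of_notMem hy]
          have : k x y = 0 := indicator_of_notMem (show (x, y) ∉ S from hy) _
          rw [this, zero_mul]
      simp only [e]
      rw [muI, lintegral_indicator measurableSet_Ioo, Measure.restrict_restrict measurableSet_Ioo,
        inter_eq_left.2 (Ioo_subset_Ioo hx.1.le (by linarith [hx.2])),
        lintegral_const_mul' _ _ ENNReal.ofReal_ne_top]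
    · simp [D, indicator_of_notMem hx]
  -- Two limits in succession: `n → ∞` at fixed `h`, and then `h → 0` along `1/(m+1)`.
  have hDfM : ∀ h : ℝ, 0 < h → eLpNorm (D h f) p muI ≤ M := fun h hh =>
    eLpNorm_le_of_tendsto (fun n => (hDm h n).aestronglyMeasurable) (ae_of_all _ (hDlim h hh))
      (hDn h hh)
  have hu : Tendsto (fun m : ℕ => 1 / ((m : ℝ) + 1)) atTop (𝓝[>] 0) :=
    tendsto_nhdsWithin_iff.2 ⟨tendsto_one_div_add_atTop_nhds_zero_nat,
      Eventually.of_forall fun m => by simp only [mem_Ioi]; positivity⟩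
  refine eLpNorm_le_of_tendsto (F := fun m : ℕ => D (1 / ((m : ℝ) + 1)) f)
    (fun m => (hDf _ (by positivity)).aestronglyMeasurable) ?_ (fun m => hDfM _ (by positivity))
  filter_upwards [ae_muI_mem] with x hx
  have h1 := (hd x hx).tendsto_slope_zero_right.comp hu
  refine h1.congr' ?_
  have h2 : ∀ᶠ m : ℕ in atTop, 1 / ((m : ℝ) + 1) < Real.pi - x :=
    (tendsto_one_div_add_atTop_nhds_zero_nat (𝕜 := ℝ)).eventually_lt_const (by linarith [hx.2])
  filter_upwards [h2] with m hm
  have : x ∈ Ioo 0 (Real.pi - 1 / ((m : ℝ) + 1)) := ⟨hx.1, by linarith⟩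
  simp only [D, indicator_of_mem this]
  simp

/-! ### Singular Gronwall inequality -/

/-- The convolution kernel `r ↦ r^{θ-1}` on `(0,∞)`. -/
def powKer (θ : ℝ) : ℝ → ℝ≥0∞ := (Ioi 0).indicator fun r => ENNReal.ofReal (r ^ (θ - 1))

@[fun_prop]
lemma measurable_powKer (θ : ℝ) : Measurable (powKer θ) :=
  (by fun_prop : Measurable fun r : ℝ => ENNReal.ofReal (r ^ (θ - 1))).indicator measurableSet_Ioi

lemma powKer_of_pos (θ : ℝ) {r : ℝ} (hr : 0 < r) : powKer θ r = ENNReal.ofReal (r ^ (θ - 1)) :=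
  indicator_of_mem (mem_Ioi.2 hr) _

lemma powKer_of_nonpos (θ : ℝ) {r : ℝ} (hr : r ≤ 0) : powKer θ r = 0 :=
  indicator_of_notMem (by simpa using hr) _

/-- On a bounded interval the more singular power dominates, so that several kernels can be reduced
to a single one. -/
lemma powKer_le {θ η T r : ℝ} (h : η ≤ θ) (hr : r < T) :
    powKer θ r ≤ ENNReal.ofReal (T ^ (θ - η)) * powKer η r := by
  rcases le_or_gt r 0 with h0 | h0
  · simp [powKer_of_nonpos _ h0]
  · rw [powKer_of_pos _ h0, powKer_of_pos _ h0,
      ← ENNReal.ofReal_mul (Real.rpow_nonneg (h0.trans hr).le _)]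
    refine ENNReal.ofReal_le_ofReal ?_
    rw [show θ - 1 = (θ - η) + (η - 1) by ring, Real.rpow_add h0]
    gcongr

lemma lintegral_powKer {θ t : ℝ} (hθ : 0 < θ) (ht : 0 ≤ t) :
    ∫⁻ r in Ioo 0 t, powKer θ r = ENNReal.ofReal (t ^ θ / θ) := by
  have h1 : ∫⁻ r in Ioo 0 t, powKer θ r = ∫⁻ r in Ioo 0 t, ENNReal.ofReal (r ^ (θ - 1)) :=
    setLIntegral_congr_fun measurableSet_Ioo fun r hr => powKer_of_pos _ hr.1
  have hi := intervalIntegral.intervalIntegrable_rpow' (a := 0) (b := t)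
    (by linarith : -1 < θ - 1)
  rw [h1, ← ofReal_integral_eq_lintegral_ofReal]
  · rw [← integral_Ioc_eq_integral_Ioo, ← intervalIntegral.integral_of_le ht,
      integral_rpow (Or.inl (by linarith))]
    congr 1
    rw [sub_add_cancel, Real.zero_rpow hθ.ne', sub_zero]
  · exact (intervalIntegrable_iff_integrableOn_Ioo_of_le ht).1 hi
  · filter_upwards [ae_restrict_mem measurableSet_Ioo] with r hr
    exact Real.rpow_nonneg hr.1.le _

lemma rpow_half_le (a : ℝ) {t r : ℝ} (ht : 0 < t) (h1 : t / 2 ≤ r) (h2 : r ≤ t) :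
    r ^ a ≤ (1 + 2 ^ (-a)) * t ^ a := by
  have hr : 0 < r := by linarith
  have hta : 0 < t ^ a := by positivity
  rcases le_or_gt 0 a with h | h
  · have h3 : r ^ a ≤ t ^ a := by gcongr
    have : (0 : ℝ) < 2 ^ (-a) := by positivity
    nlinarith
  · have h3 : r ^ a ≤ (t / 2) ^ a := Real.rpow_le_rpow_of_nonpos (by positivity) h1 h.le
    rw [div_eq_mul_inv, Real.mul_rpow ht.le (by positivity), Real.inv_rpow (by norm_num),
      ← Real.rpow_neg (by norm_num)] at h3
    linarith

/-- A bound for the Beta integral. -/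
lemma powKer_lconvolution_le {θ η : ℝ} (hθ : 0 < θ) (hη : 0 < η) : ∃ B : ℝ, 0 ≤ B ∧ ∀ t,
    (powKer θ ⋆ₗ[volume] powKer η) t ≤ ENNReal.ofReal B * powKer (θ + η) t := by
  set cη := 1 + (2 : ℝ) ^ (-(η - 1))
  set cθ := 1 + (2 : ℝ) ^ (-(θ - 1))
  have hcη : 0 < cη := by positivity
  have hcθ : 0 < cθ := by positivity
  refine ⟨cη / θ + cθ / η, by positivity, fun t => ?_⟩
  rw [lconvolution_def]
  rcases le_or_gt t 0 with ht | ht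
  · rw [powKer_of_nonpos _ ht, mul_zero, nonpos_iff_eq_zero]
    refine (lintegral_congr fun s => ?_).trans lintegral_zero
    rcases le_or_gt s 0 with hs | hs
    · simp [powKer_of_nonpos _ hs]
    · rw [powKer_of_nonpos η (by linarith), mul_zero]
  -- The integral is split at `t/2`: on each half one of the two factors is comparable to its value
  -- at `t`, and the other one is integrated.
  have hsub : ∀ s, powKer θ s * powKer η (-s + t) ≤ (Ioo 0 t).indicator (fun s =>
      ENNReal.ofReal (cη * t ^ (η - 1)) * powKer θ s +
        ENNReal.ofReal (cθ * t ^ (θ - 1)) * powKer η (t - s)) s := by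
    intro s
    by_cases hs : s ∈ Ioo 0 t
    · rw [indicator_of_mem hs]
      have h1 : 0 < s := hs.1
      have h2 : 0 < t - s := by linarith [hs.2]
      rw [show -s + t = t - s by ring, powKer_of_pos _ h1, powKer_of_pos _ h2,
        ← ENNReal.ofReal_mul (by positivity), ← ENNReal.ofReal_mul (by positivity),
        ← ENNReal.ofReal_mul (by positivity), ← ENNReal.ofReal_add (by positivity) (by positivity)]
      refine ENNReal.ofReal_le_ofReal ?_
      have e1 : 0 < s ^ (θ - 1) := by positivity
      have e2 : 0 < (t - s) ^ (η - 1) := by positivity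
      have e3 : 0 ≤ cη * t ^ (η - 1) * s ^ (θ - 1) := by positivity
      have e4 : 0 ≤ cθ * t ^ (θ - 1) * (t - s) ^ (η - 1) := by positivity
      rcases le_total s (t / 2) with h | h
      · have := rpow_half_le (η - 1) ht (r := t - s) (by linarith) (by linarith)
        calc _ ≤ s ^ (θ - 1) * (cη * t ^ (η - 1)) := by gcongr
          _ ≤ _ := by linarith
      · have := rpow_half_le (θ - 1) ht (r := s) (by linarith) (by linarith [hs.2])
        calc _ ≤ cθ * t ^ (θ - 1) * (t - s) ^ (η - 1) := by gcongr
          _ ≤ _ := by linarith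
    · rw [indicator_of_notMem hs, nonpos_iff_eq_zero]
      rcases le_or_gt s 0 with h | h
      · simp [powKer_of_nonpos _ h]
      · rw [powKer_of_nonpos η (r := -s + t), mul_zero]
        by_contra hc
        exact hs ⟨h, by linarith⟩
  refine (lintegral_mono hsub).trans ?_
  rw [lintegral_indicator measurableSet_Ioo, lintegral_add_left (by fun_prop),
    lintegral_const_mul' _ _ ENNReal.ofReal_ne_top, lintegral_const_mul' _ _ ENNReal.ofReal_ne_top,
    lintegral_powKer hθ ht.le]
  have hrefl : ∫⁻ s in Ioo 0 t, powKer η (t - s) = ∫⁻ s in Ioo 0 t, powKer η s := by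
    rw [← lintegral_indicator measurableSet_Ioo, ← lintegral_indicator measurableSet_Ioo,
      ← lintegral_sub_left_eq_self _ t]
    refine lintegral_congr fun s => ?_
    simp only [indicator_apply, mem_Ioo, sub_pos, sub_lt_self_iff]
    rw [sub_sub_cancel]
    simp only [and_comm]
  rw [hrefl, lintegral_powKer hη ht.le, powKer_of_pos _ ht, ← ENNReal.ofReal_mul (by positivity),
    ← ENNReal.ofReal_mul (by positivity), ← ENNReal.ofReal_mul (by positivity),
    ← ENNReal.ofReal_add (by positivity) (by positivity)]
  refine ENNReal.ofReal_le_ofReal (le_of_eq ?_)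
  rw [show θ + η - 1 = (η - 1) + θ by ring, Real.rpow_add ht]
  rw [mul_assoc cθ, show t ^ (θ - 1) * (t ^ η / η) = t ^ (η - 1) * t ^ θ / η by
      rw [mul_div_assoc', ← Real.rpow_add ht, ← Real.rpow_add ht]; ring_nf]
  ring

/-! ### Convolutions of nonnegative functions on the line. -/

lemma lconvolution_mono_right {f g h : ℝ → ℝ≥0∞} (H : ∀ t, g t ≤ h t) (t : ℝ) :
    (f ⋆ₗ[volume] g) t ≤ (f ⋆ₗ[volume] h) t := by
  simp only [lconvolution_def]
  exact lintegral_mono fun s => mul_le_mul_right (H _) _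

lemma lconvolution_mono_left {f g h : ℝ → ℝ≥0∞} (H : ∀ᵐ t, f t ≤ g t) (t : ℝ) :
    (f ⋆ₗ[volume] h) t ≤ (g ⋆ₗ[volume] h) t := by
  simp only [lconvolution_def]
  exact lintegral_mono_ae (H.mono fun s hs => mul_le_mul_left hs _)

lemma const_mul_lconvolution {f g : ℝ → ℝ≥0∞} (hf : Measurable f) (hg : Measurable g)
    (c : ℝ≥0∞) (t : ℝ) :
    ((fun s => c * f s) ⋆ₗ[volume] g) t = c * (f ⋆ₗ[volume] g) t := by
  simp only [lconvolution_def, mul_assoc]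
  rw [lintegral_const_mul _ (by fun_prop)]

lemma lconvolution_const_mul {f g : ℝ → ℝ≥0∞} (hf : Measurable f) (hg : Measurable g)
    (c : ℝ≥0∞) (t : ℝ) :
    (f ⋆ₗ[volume] (fun s => c * g s)) t = c * (f ⋆ₗ[volume] g) t := by
  simp only [lconvolution_def, mul_left_comm _ c]
  rw [lintegral_const_mul _ (by fun_prop)]

lemma add_lconvolution {f g h : ℝ → ℝ≥0∞} (hf : Measurable f) (hh : Measurable h) (t : ℝ) :
    ((fun s => f s + g s) ⋆ₗ[volume] h) t = (f ⋆ₗ[volume] h) t + (g ⋆ₗ[volume] h) t := by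
  simp only [lconvolution_def, add_mul]
  rw [lintegral_add_left (by fun_prop)]

lemma lintegral_lconvolution_eq {f g : ℝ → ℝ≥0∞} (hf : Measurable f) (hg : Measurable g) :
    ∫⁻ t, (f ⋆ₗ[volume] g) t = (∫⁻ t, f t) * ∫⁻ t, g t := by
  simp only [lconvolution_def]
  rw [lintegral_lintegral_swap (by fun_prop)]
  have : ∀ s, ∫⁻ t, f s * g (-s + t) = f s * ∫⁻ t, g t := fun s => by
    rw [lintegral_const_mul _ (by fun_prop), lintegral_add_left_eq_self]
  simp only [this]
  rw [lintegral_mul_const _ hf]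

lemma lconvolution_powKer_le {f : ℝ → ℝ≥0∞} (hf0 : ∀ t ≤ 0, f t = 0) (hf : Measurable f)
    {θ η T t : ℝ} (h : η ≤ θ) (ht : t ≤ T) :
    (f ⋆ₗ[volume] powKer θ) t ≤
      ENNReal.ofReal (T ^ (θ - η)) * (f ⋆ₗ[volume] powKer η) t := by
  simp only [lconvolution_def]
  rw [← lintegral_const_mul _ (by fun_prop)]
  refine lintegral_mono fun s => ?_
  rcases le_or_gt s 0 with hs | hs
  · simp [hf0 s hs]
  · rw [mul_left_comm]
    exact mul_le_mul_right (powKer_le h (by linarith)) _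

/-- The integral is the Laplace transform `Γ(η) l^(-η)`, which tends to zero as `l → ∞`. -/
lemma exists_exp_lintegral_powKer_le {η : ℝ} (hη : 0 < η) {ε : ℝ} (hε : 0 < ε) :
    ∃ l : ℝ, 0 < l ∧ ∫⁻ r, ENNReal.ofReal (Real.exp (-(l * r))) * powKer η r ≤ ENNReal.ofReal ε := by
  have hΓ := Real.Gamma_pos_of_pos hη
  obtain ⟨l, hl0, hl⟩ : ∃ l : ℝ, 0 < l ∧ l ^ (-η) * Real.Gamma η ≤ ε := by
    have h1 := (tendsto_rpow_neg_atTop hη).mul_const (Real.Gamma η)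
    rw [zero_mul] at h1
    obtain ⟨l, h2, h3⟩ := ((h1.eventually_lt_const hε).and (eventually_gt_atTop 0)).exists
    exact ⟨l, h3, h2.le⟩
  refine ⟨l, hl0, ?_⟩
  have h1 : ∀ r, ENNReal.ofReal (Real.exp (-(l * r))) * powKer η r = (Ioi 0).indicator
      (fun r => ENNReal.ofReal (r ^ (η - 1) * Real.exp (-(l * r)))) r := fun r => by
    rcases le_or_gt r 0 with h | h
    · rw [powKer_of_nonpos _ h, mul_zero, indicator_of_notMem (by simpa using h)]
    · rw [powKer_of_pos _ h, indicator_of_mem (mem_Ioi.2 h), mul_comm,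
        ENNReal.ofReal_mul (by positivity)]
  simp only [h1]
  have hint := Real.integral_rpow_mul_exp_neg_mul_Ioi hη hl0
  have hpos : 0 < (1 / l) ^ η * Real.Gamma η := by positivity
  rw [lintegral_indicator measurableSet_Ioi, ← ofReal_integral_eq_lintegral_ofReal, hint]
  · refine ENNReal.ofReal_le_ofReal (le_trans (le_of_eq ?_) hl)
    rw [one_div, Real.inv_rpow hl0.le, Real.rpow_neg hl0.le]
  -- The Bochner integral has a nonzero value, so the integrand must be integrable.
  · by_contra hc
    have := integral_undef hc
    rw [hint] at this
    exact hpos.ne' this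
  · filter_upwards [ae_restrict_mem measurableSet_Ioi] with r hr
    have : (0 : ℝ) < r := hr
    positivity

/-- `L_1` form of the singular Gronwall inequality. -/
lemma gronwall_lintegral {η C : ℝ} (T : ℝ) (hη : 0 < η) (hC : 0 ≤ C) :
    ∃ C' : ℝ, 0 ≤ C' ∧ ∀ (N a : ℝ → ℝ≥0∞), Measurable N → Measurable a →
      (∀ t ∉ Ioo 0 T, N t = 0) → (∀ t ≤ 0, a t = 0) →
      (∀ᵐ t, N t ≤ a t + ENNReal.ofReal C * (N ⋆ₗ[volume] powKer η) t) → ∫⁻ t, N t ≠ ⊤ →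
      ∫⁻ t, N t ≤ ENNReal.ofReal C' * ∫⁻ t, a t := by
  -- Multiplication by `e^{-lt}` commutes with convolution and gives the kernel mass at most
  -- `1/(2(C+1))`. The convolution term is then at most half of the left side and is absorbed, the
  -- left side being finite.
  obtain ⟨l, hl, hk⟩ := exists_exp_lintegral_powKer_le hη (ε := 1 / (2 * (C + 1))) (by positivity)
  set E : ℝ → ℝ≥0∞ := fun t => ENNReal.ofReal (Real.exp (-(l * t)))
  have hE : Measurable E := by fun_prop
  have hEadd : ∀ s t, E (s + t) = E s * E t := fun s t => by
    simp only [E]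
    rw [← ENNReal.ofReal_mul (by positivity), ← Real.exp_add]; ring_nf
  refine ⟨2 * Real.exp (l * T), by positivity, fun N a hN ha hN0 ha0 hle hfin => ?_⟩
  have hE1 : ∀ t, 0 ≤ t → E t ≤ 1 := fun t ht => by
    rw [← ENNReal.ofReal_one]
    refine ENNReal.ofReal_le_ofReal (Real.exp_le_one_iff.2 ?_)
    have : 0 ≤ l * t := by positivity
    linarith
  set I := ∫⁻ t, E t * N t
  have hI : I ≠ ⊤ := by
    refine ne_top_of_le_ne_top hfin (lintegral_mono fun t => ?_)
    by_cases ht : t ∈ Ioo 0 T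
    · exact mul_le_of_le_one_left' (hE1 t ht.1.le)
    · simp [hN0 t ht]
  have h1 : I ≤ (∫⁻ t, a t) + ENNReal.ofReal C * (I * ENNReal.ofReal (1 / (2 * (C + 1)))) := by
    calc I ≤ ∫⁻ t, (E t * a t + ENNReal.ofReal C * (E t * (N ⋆ₗ[volume] powKer η) t)) := by
          refine lintegral_mono_ae (hle.mono fun t ht => ?_)
          calc _ ≤ E t * (a t + ENNReal.ofReal C * (N ⋆ₗ[volume] powKer η) t) :=
                mul_le_mul_right ht _
            _ = _ := by ring
      _ = (∫⁻ t, E t * a t) + ENNReal.ofReal C * ∫⁻ t, E t * (N ⋆ₗ[volume] powKer η) t := by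
          rw [lintegral_add_left (by fun_prop), lintegral_const_mul _ (by fun_prop)]
      _ = (∫⁻ t, E t * a t) + ENNReal.ofReal C *
            ∫⁻ t, ((fun s => E s * N s) ⋆ₗ[volume] (fun s => E s * powKer η s)) t := by
          congr 2
          refine lintegral_congr fun t => ?_
          simp only [lconvolution_def]
          rw [← lintegral_const_mul _ (by fun_prop)]
          refine lintegral_congr fun s => ?_
          have := hEadd s (-s + t)
          rw [show s + (-s + t) = t by ring] at this
          rw [this]; ring
      _ = (∫⁻ t, E t * a t) + ENNReal.ofReal C * (I * ∫⁻ t, E t * powKer η t) := by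
          rw [lintegral_lconvolution_eq (by fun_prop) (by fun_prop)]
      _ ≤ _ := by
          gcongr with t
          rcases le_or_gt t 0 with h | h
          · simp [ha0 t h]
          · exact mul_le_of_le_one_left' (hE1 t h.le)
  have h2 : ENNReal.ofReal C * (I * ENNReal.ofReal (1 / (2 * (C + 1)))) ≤
      ENNReal.ofReal (1 / 2) * I := by
    rw [mul_left_comm, mul_comm I, ← ENNReal.ofReal_mul hC]
    refine mul_le_mul_left (ENNReal.ofReal_le_ofReal ?_) _
    rw [mul_one_div, div_le_div_iff₀ (by positivity) (by norm_num)]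
    linarith
  have h3 : I ≤ 2 * ∫⁻ t, a t := by
    have h4 := h1.trans (add_le_add_right h2 _)
    rcases eq_or_ne (∫⁻ t, a t) ⊤ with h | h
    · rw [h]; simp
    have hr : I.toReal ≤ (∫⁻ t, a t).toReal + 1 / 2 * I.toReal := by
      have := ENNReal.toReal_mono (by finiteness) h4
      rw [ENNReal.toReal_add h (by finiteness), ENNReal.toReal_mul,
        ENNReal.toReal_ofReal (by norm_num)] at this
      exact this
    rw [← ENNReal.toReal_le_toReal hI (by finiteness), ENNReal.toReal_mul]
    simp only [ENNReal.toReal_ofNat]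
    linarith
  calc ∫⁻ t, N t ≤ ∫⁻ t, ENNReal.ofReal (Real.exp (l * T)) * (E t * N t) := by
        refine lintegral_mono fun t => ?_
        by_cases ht : t ∈ Ioo 0 T
        · rw [← mul_assoc, ← ENNReal.ofReal_mul (by positivity), ← Real.exp_add]
          refine le_mul_of_one_le_left' ?_
          rw [← ENNReal.ofReal_one]
          refine ENNReal.ofReal_le_ofReal (Real.one_le_exp ?_)
          have := mul_le_mul_of_nonneg_left ht.2.le hl.le
          linarith
        · simp [hN0 t ht]
    _ = ENNReal.ofReal (Real.exp (l * T)) * I := lintegral_const_mul _ (by fun_prop)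
    _ ≤ ENNReal.ofReal (Real.exp (l * T)) * (2 * ∫⁻ t, a t) := mul_le_mul_right h3 _
    _ = _ := by
        rw [ENNReal.ofReal_mul (by norm_num)]
        simp only [ENNReal.ofReal_ofNat]
        ring

/-- Pointwise form of the singular Gronwall inequality. -/
lemma gronwall_lconvolution {η C T : ℝ} (hη : 0 < η) (hC : 0 ≤ C) (hT : 0 < T) :
    ∃ C' : ℝ, 0 ≤ C' ∧ ∀ (N a : ℝ → ℝ≥0∞) (A : ℝ≥0∞), Measurable N → Measurable a →
      (∀ t ≤ 0, N t = 0) → (∀ t ≤ 0, a t = 0) →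
      (∀ᵐ t, N t ≤ a t + ENNReal.ofReal C * (N ⋆ₗ[volume] powKer η) t) →
      (∀ t ≤ T, (a ⋆ₗ[volume] powKer η) t ≤ A) →
      ∀ t ≤ T, (N ⋆ₗ[volume] powKer η) t ≤ ENNReal.ofReal C' * (A + ∫⁻ t, N t) := by
  -- Inserting the inequality into itself raises the exponent of the kernel from `θ` to `η + θ`.
  -- Once the exponent reaches one, the kernel is bounded and the total mass of `N` suffices; `j`
  -- counts the iterations that are left.
  suffices h : ∀ (j : ℕ) (θ : ℝ), η ≤ θ → 1 ≤ θ + j * η →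
      ∃ C' : ℝ, 0 ≤ C' ∧ ∀ (N a : ℝ → ℝ≥0∞) (A : ℝ≥0∞), Measurable N → Measurable a →
      (∀ t ≤ 0, N t = 0) → (∀ t ≤ 0, a t = 0) →
      (∀ᵐ t, N t ≤ a t + ENNReal.ofReal C * (N ⋆ₗ[volume] powKer η) t) →
      (∀ t ≤ T, (a ⋆ₗ[volume] powKer η) t ≤ A) →
      ∀ t ≤ T, (N ⋆ₗ[volume] powKer θ) t ≤ ENNReal.ofReal C' * (A + ∫⁻ t, N t) by
    obtain ⟨j, hj⟩ := exists_nat_ge (1 / η)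
    rw [div_le_iff₀ hη] at hj
    exact h j η le_rfl (by linarith)
  intro j
  induction j with
  | zero =>
    intro θ hθ h1
    simp only [Nat.cast_zero, zero_mul, add_zero] at h1
    refine ⟨T ^ (θ - 1), by positivity, fun N a A hN ha hN0 ha0 hle hA t ht => ?_⟩
    refine (lconvolution_powKer_le hN0 hN h1 ht).trans (mul_le_mul_right ?_ _)
    refine le_trans ?_ le_add_self
    rw [lconvolution_def]
    refine lintegral_mono fun s => mul_le_of_le_one_right' ?_
    rcases le_or_gt (-s + t) 0 with h | h
    · simp [powKer_of_nonpos _ h]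
    · simp [powKer_of_pos _ h]
  | succ j ih =>
    intro θ hθ h1
    push_cast at h1
    obtain ⟨C₁, hC₁, h⟩ := ih (η + θ) (by linarith) (by linarith)
    obtain ⟨B, hB, hBle⟩ := powKer_lconvolution_le hη (hη.trans_le hθ)
    refine ⟨T ^ (θ - η) + C * (B * C₁), by positivity,
      fun N a A hN ha hN0 ha0 hle hA t ht => ?_⟩
    have h2 := h N a A hN ha hN0 ha0 hle hA t ht
    calc (N ⋆ₗ[volume] powKer θ) t
        ≤ ((fun s => a s + ENNReal.ofReal C * (N ⋆ₗ[volume] powKer η) s) ⋆ₗ[volume] powKer θ) t :=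
          lconvolution_mono_left hle t
      _ = (a ⋆ₗ[volume] powKer θ) t + ENNReal.ofReal C *
            (N ⋆ₗ[volume] (powKer η ⋆ₗ[volume] powKer θ)) t := by
          rw [add_lconvolution ha (by fun_prop), const_mul_lconvolution (by fun_prop) (by fun_prop),
            lconvolution_assoc hN (by fun_prop) (by fun_prop)]
      _ ≤ ENNReal.ofReal (T ^ (θ - η)) * A + ENNReal.ofReal C *
            (ENNReal.ofReal B * (N ⋆ₗ[volume] powKer (η + θ)) t) := by
          gcongr
          · exact (lconvolution_powKer_le ha0 ha hθ ht).trans (mul_le_mul_right (hA t ht) _)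
          · exact (lconvolution_mono_right hBle t).trans_eq
              (lconvolution_const_mul hN (by fun_prop) _ t)
      _ ≤ ENNReal.ofReal (T ^ (θ - η)) * (A + ∫⁻ t, N t) + ENNReal.ofReal C *
            (ENNReal.ofReal B * (ENNReal.ofReal C₁ * (A + ∫⁻ t, N t))) := by
          gcongr
          exact le_self_add
      _ = _ := by
          rw [ENNReal.ofReal_add (by positivity) (by positivity), ENNReal.ofReal_mul hC,
            ENNReal.ofReal_mul hB]
          ring

/-! ### The heat semigroup -/

lemma heatSemigroup_eq (τ : ℝ) (f : ℝ → ℝ) (x : ℝ) :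
    heatSemigroup τ f x = ∫ y, dirichletKernel τ x y * f y ∂muI :=
  intervalIntegral_eq_muI _

/-- The space derivative of the heat semigroup. -/
def heatSemigroupDx (τ : ℝ) (f : ℝ → ℝ) (x : ℝ) : ℝ := ∫ y, kDx τ x y * f y ∂muI

lemma measurable_dirichletKernel_right (τ x : ℝ) : Measurable (dirichletKernel τ x) :=
  measurable_dirichletKernel.comp (f := fun y => (τ, x, y)) (by fun_prop)

lemma measurable_kDx_right (τ x : ℝ) : Measurable (kDx τ x) :=
  measurable_kDx.comp (f := fun y => (τ, x, y)) (by fun_prop)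

lemma measurable_kDy_right (τ x : ℝ) : Measurable (kDy τ x) :=
  measurable_kDy.comp (f := fun y => (τ, x, y)) (by fun_prop)

lemma measurable_kDxy_right (τ x : ℝ) : Measurable (kDxy τ x) :=
  measurable_kDxy.comp (f := fun y => (τ, x, y)) (by fun_prop)

lemma integrable_bdd_mul {k f : ℝ → ℝ} (hf : Integrable f muI) (hk : AEStronglyMeasurable k muI)
    {C : ℝ} (hb : ∀ y ∈ Ioo 0 Real.pi, |k y| ≤ C) : Integrable (fun y => k y * f y) muI :=
  hf.bdd_mul (c := C) hk (ae_muI_mem.mono fun y hy => hb y hy)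

lemma measurable_heatSemigroup (τ : ℝ) {f : ℝ → ℝ} (hf : AEStronglyMeasurable f muI) :
    Measurable (heatSemigroup τ f) := by
  have e : heatSemigroup τ f = fun x => ∫ y, dirichletKernel τ x y * (hf.mk f) y ∂muI := by
    funext x
    rw [heatSemigroup_eq]
    refine integral_congr_ae (hf.ae_eq_mk.mono fun y hy => ?_)
    simp only [hy]
  rw [e]
  refine StronglyMeasurable.measurable (StronglyMeasurable.integral_prod_right ?_)
  have h1 : Measurable fun q : ℝ × ℝ => dirichletKernel τ q.1 q.2 :=
    measurable_dirichletKernel.comp (f := fun q : ℝ × ℝ => (τ, q.1, q.2)) (by fun_prop)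
  exact (h1.mul (hf.stronglyMeasurable_mk.measurable.comp measurable_snd)).stronglyMeasurable

lemma measurable_heatSemigroup_uncurry {f : ℝ → ℝ} (hf : AEStronglyMeasurable f muI) :
    Measurable fun q : ℝ × ℝ => heatSemigroup q.1 f q.2 := by
  have e : (fun q : ℝ × ℝ => heatSemigroup q.1 f q.2) =
      fun q => ∫ y, dirichletKernel q.1 q.2 y * (hf.mk f) y ∂muI := by
    funext q
    rw [heatSemigroup_eq]
    refine integral_congr_ae (hf.ae_eq_mk.mono fun y hy => ?_)
    simp only [hy]
  rw [e]
  refine StronglyMeasurable.measurable (StronglyMeasurable.integral_prod_right ?_)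
  have h1 : Measurable fun q : (ℝ × ℝ) × ℝ => dirichletKernel q.1.1 q.1.2 q.2 :=
    measurable_dirichletKernel.comp (f := fun q : (ℝ × ℝ) × ℝ => (q.1.1, q.1.2, q.2))
      (by fun_prop)
  exact (h1.mul (hf.stronglyMeasurable_mk.measurable.comp measurable_snd)).stronglyMeasurable

lemma measurable_heatSemigroupDx_uncurry {f : ℝ → ℝ} (hf : AEStronglyMeasurable f muI) :
    Measurable fun q : ℝ × ℝ => heatSemigroupDx q.1 f q.2 := by
  have e : (fun q : ℝ × ℝ => heatSemigroupDx q.1 f q.2) =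
      fun q => ∫ y, kDx q.1 q.2 y * (hf.mk f) y ∂muI := by
    funext q
    refine integral_congr_ae (hf.ae_eq_mk.mono fun y hy => ?_)
    simp only [hy]
  rw [e]
  refine StronglyMeasurable.measurable (StronglyMeasurable.integral_prod_right ?_)
  have h1 : Measurable fun q : (ℝ × ℝ) × ℝ => kDx q.1.1 q.1.2 q.2 :=
    measurable_kDx.comp (f := fun q : (ℝ × ℝ) × ℝ => (q.1.1, q.1.2, q.2)) (by fun_prop)
  exact (h1.mul (hf.stronglyMeasurable_mk.measurable.comp measurable_snd)).stronglyMeasurable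

lemma hasDerivAt_heatSemigroup {τ : ℝ} (hτ : 0 < τ) {f : ℝ → ℝ} (hf : Integrable f muI)
    {x : ℝ} (hx : x ∈ Ioo 0 Real.pi) :
    HasDerivAt (heatSemigroup τ f) (heatSemigroupDx τ f x) x := by
  obtain ⟨C, hC, hb⟩ := exists_kernel_bound hτ
  have e : heatSemigroup τ f = fun x => ∫ y, dirichletKernel τ x y * f y ∂muI :=
    funext (heatSemigroup_eq τ f)
  rw [e]
  refine (hasDerivAt_integral_of_dominated_loc_of_deriv_le (isOpen_Ioo.mem_nhds hx)
    (Eventually.of_forall fun z =>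
      (measurable_dirichletKernel_right τ z).aestronglyMeasurable.mul hf.1)
    (integrable_bdd_mul hf (measurable_dirichletKernel_right τ x).aestronglyMeasurable
      fun y hy => (hb τ le_rfl x hx y hy).1)
    ((measurable_kDx_right τ x).aestronglyMeasurable.mul hf.1)
    (bound := fun y => C * ‖f y‖) ?_ (hf.norm.const_mul C) (ae_of_all _ fun y z _ =>
      (hasDerivAt_dirichletKernel_left hτ z y).mul_const _)).2
  filter_upwards [ae_muI_mem] with y hy z hz
  rw [norm_mul]
  exact mul_le_mul_of_nonneg_right (hb τ le_rfl z hz y hy).2.1 (norm_nonneg _)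

/-! ### Approximation of the identity -/

/-- The weight `|x-y|^4` gains `η²`, and the kernel at time `2η` costs at most `η⁻¹` for `η ≤ 1`.
The net factor `η` gives decay off the diagonal. -/
lemma neumannKernel_off_diagonal {d : ℝ} (hd : 0 < d) : ∃ C : ℝ, 0 ≤ C ∧ ∀ η, 0 < η → η ≤ 1 →
    ∀ x ∈ Ioo 0 Real.pi, ∀ y ∈ Ioo 0 Real.pi, d ≤ |x - y| → neumannKernel η x y ≤ C * η := by
  obtain ⟨C, hC, h⟩ := gk_bound 4 (by norm_num)
  obtain ⟨C', hC', h'⟩ := neumannKernel_le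
  refine ⟨(d ^ (4 : ℝ))⁻¹ * (C * (C' * 2)), by positivity, fun η hη hη1 x hx y hy hxy => ?_⟩
  obtain ⟨c, hc, h0, -, -⟩ := gk_bound_simple η hη
  have h1 := image_kernel_bound (by positivity) (by norm_num) (by positivity) h0
    (fun z => h η z hη) (a := 1) (b := 1) (by simp) (by simp) hx hy
  rw [one_mul, one_mul, ← neumannKernel, abs_of_nonneg (neumannKernel_nonneg _ _ _)] at h1
  have h2 : d ^ (4 : ℝ) ≤ |x - y| ^ (4 : ℝ) := by gcongr
  have h3 := h' (2 * η) (by positivity) x y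
  have hd4 : 0 < d ^ (4 : ℝ) := by positivity
  have h4 : η ^ ((4 : ℝ) / 2) = η * η := by
    rw [show (4 : ℝ) / 2 = 2 by norm_num, Real.rpow_two, sq]
  have hn := neumannKernel_nonneg η x y
  rw [h4] at h1
  have h5 : η * (1 + (2 * η)⁻¹) ≤ 2 := by
    rw [mul_add, mul_one, mul_inv, mul_left_comm, mul_inv_cancel₀ hη.ne']
    linarith
  have h6 : d ^ (4 : ℝ) * neumannKernel η x y ≤ C * (C' * 2) * η := by
    calc d ^ (4 : ℝ) * neumannKernel η x y ≤ |x - y| ^ (4 : ℝ) * neumannKernel η x y := by gcongr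
      _ ≤ C * (η * η) * neumannKernel (2 * η) x y := h1
      _ ≤ C * (η * η) * (C' * (1 + (2 * η)⁻¹)) := by gcongr
      _ = C * (C' * (η * (1 + (2 * η)⁻¹))) * η := by ring
      _ ≤ _ := by gcongr
  rw [mul_assoc, mul_assoc, ← div_eq_inv_mul, le_div_iff₀ hd4]
  linarith

/-- If `x` has distance at least `d` from the endpoints, then all reflected images stay at distance
`d`, even when `y` approaches the boundary. The fourth power acts as in
`neumannKernel_off_diagonal`. -/
lemma reflected_kernel_le {d : ℝ} (hd : 0 < d) : ∃ C : ℝ, 0 ≤ C ∧ ∀ η, 0 < η → η ≤ 1 →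
    ∀ x ∈ Ioo d (Real.pi - d), ∀ y ∈ Ioo 0 Real.pi, per (gk η) (x + y) ≤ C * η := by
  obtain ⟨C, hC, h⟩ := gk_bound 4 (by norm_num)
  obtain ⟨C', hC', h'⟩ := neumannKernel_le
  refine ⟨(d ^ (4 : ℝ))⁻¹ * (C * (C' * 2)), by positivity, fun η hη hη1 x hx y hy => ?_⟩
  obtain ⟨c, hc, h0, -, -⟩ := gk_bound_simple η hη
  have hpi := Real.pi_pos
  have h1 := abs_per_le (by positivity) (by norm_num) hd.le (by positivity) h0
    (fun z => h η z hη) (z := x + y) (fun n => by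
      rcases lt_or_ge n 0 with hn | hn
      · have h1 : (n : ℝ) ≤ -1 := by exact_mod_cast Int.le_sub_one_of_lt hn
        have h2 : 2 * Real.pi * n ≤ 2 * Real.pi * (-1) := by gcongr
        have := neg_le_abs (x + y + 2 * Real.pi * n)
        linarith [hx.2, hy.2]
      · have h1 : (0 : ℝ) ≤ n := by exact_mod_cast hn
        have h2 : 0 ≤ 2 * Real.pi * n := by positivity
        have := le_abs_self (x + y + 2 * Real.pi * n)
        linarith [hx.1, hy.1])
  rw [abs_of_nonneg (per_gk_nonneg _ _)] at h1
  have h3 : per (gk (2 * η)) (x + y) ≤ C' * (1 + (2 * η)⁻¹) := by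
    refine le_trans ?_ (h' (2 * η) (by positivity) x y)
    exact le_add_of_nonneg_left (per_gk_nonneg _ _)
  have hd4 : 0 < d ^ (4 : ℝ) := by positivity
  have h4 : η ^ ((4 : ℝ) / 2) = η * η := by
    rw [show (4 : ℝ) / 2 = 2 by norm_num, Real.rpow_two, sq]
  rw [h4] at h1
  have h5 : η * (1 + (2 * η)⁻¹) ≤ 2 := by
    rw [mul_add, mul_one, mul_inv, mul_left_comm, mul_inv_cancel₀ hη.ne']
    linarith
  have h6 : d ^ (4 : ℝ) * per (gk η) (x + y) ≤ C * (C' * 2) * η := by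
    calc _ ≤ C * (η * η) * per (gk (2 * η)) (x + y) := h1
      _ ≤ C * (η * η) * (C' * (1 + (2 * η)⁻¹)) := by gcongr
      _ = C * (C' * (η * (1 + (2 * η)⁻¹))) * η := by ring
      _ ≤ _ := by gcongr
  rw [mul_assoc, mul_assoc, ← div_eq_inv_mul, le_div_iff₀ hd4]
  linarith

/-- `e^{ηΔ} f (x) → f x` at points of continuity. -/
lemma tendsto_heatSemigroup {f : ℝ → ℝ} (hf : Integrable f muI) {x : ℝ}
    (hx : x ∈ Ioo 0 Real.pi) (hc : ContinuousAt f x) :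
    Tendsto (fun η => heatSemigroup η f x) (𝓝[>] 0) (𝓝 (f x)) := by
  have hev : ∀ᶠ η : ℝ in 𝓝[>] 0, 0 < η ∧ η ≤ 1 := by
    filter_upwards [Ioc_mem_nhdsGT (zero_lt_one' ℝ)] with η h using h
  have hid : Tendsto (fun η : ℝ => η) (𝓝[>] 0) (𝓝 0) := tendsto_nhdsWithin_of_tendsto_nhds tendsto_id
  -- The Dirichlet kernel is the Neumann kernel minus twice its reflected part. The first is a
  -- positive peak of mass one; the second disappears in the limit at an interior point.
  have h1 : Tendsto (fun η => ∫ y, neumannKernel η x y * f y ∂muI) (𝓝[>] 0) (𝓝 (f x)) := by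
    refine tendsto_setIntegral_peak_smul_of_integrableOn_of_tendsto (s := Ioo 0 Real.pi)
      (t := Ioo 0 Real.pi) (x₀ := x) (φ := fun η y => neumannKernel η x y) measurableSet_Ioo
      measurableSet_Ioo Subset.rfl self_mem_nhdsWithin (by simp)
      (Eventually.of_forall fun η y _ => neumannKernel_nonneg _ _ _) ?_ ?_ ?_ hf
      (hc.tendsto.mono_left nhdsWithin_le_nhds)
    · intro u hu hxu
      obtain ⟨d, hd, hdu⟩ := Metric.isOpen_iff.1 hu x hxu
      obtain ⟨C, hC, h⟩ := neumannKernel_off_diagonal hd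
      rw [Metric.tendstoUniformlyOn_iff]
      intro ε hε
      have h0 : Tendsto (fun η : ℝ => C * η) (𝓝[>] 0) (𝓝 0) := by
        simpa using hid.const_mul C
      filter_upwards [hev, h0.eventually_lt_const hε] with η hη hηε y hy
      have hdy : d ≤ |x - y| := by
        by_contra hlt
        exact hy.2 (hdu (by rw [Metric.mem_ball, dist_comm, Real.dist_eq]; linarith))
      have := h η hη.1 hη.2 x hx y hy.1 hdy
      simp only [Pi.zero_apply, dist_zero_left, Real.norm_eq_abs]
      rw [abs_of_nonneg (neumannKernel_nonneg _ _ _)]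
      linarith
    · refine tendsto_const_nhds.congr' ?_
      filter_upwards [hev] with η hη
      have := integral_neumannKernel hη.1 x
      rw [intervalIntegral_eq_muI] at this
      exact this.symm
    · filter_upwards [hev] with η hη
      exact (continuous_neumannKernel hη.1 x).aestronglyMeasurable
  set d := min x (Real.pi - x) / 2
  have hd : 0 < d := by
    have : 0 < min x (Real.pi - x) := lt_min hx.1 (by linarith [hx.2])
    positivity
  have hxd : x ∈ Ioo d (Real.pi - d) := by
    have h1 : min x (Real.pi - x) ≤ x := min_le_left _ _
    have h2 : min x (Real.pi - x) ≤ Real.pi - x := min_le_right _ _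
    have h3 : min x (Real.pi - x) = 2 * d := by simp only [d]; ring
    exact ⟨by linarith [hx.1], by linarith⟩
  obtain ⟨C, hC, h⟩ := reflected_kernel_le hd
  have h2 : Tendsto (fun η => ∫ y, per (gk η) (x + y) * f y ∂muI) (𝓝[>] 0) (𝓝 0) := by
    have h0 : Tendsto (fun η : ℝ => C * η * ∫ y, ‖f y‖ ∂muI) (𝓝[>] 0) (𝓝 0) := by
      simpa using (hid.const_mul C).mul_const (∫ y, ‖f y‖ ∂muI)
    refine squeeze_zero_norm' ?_ h0
    filter_upwards [hev] with η hη
    rw [← integral_const_mul]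
    refine norm_integral_le_of_norm_le (hf.norm.const_mul _) ?_
    filter_upwards [ae_muI_mem] with y hy
    rw [norm_mul]
    refine mul_le_mul_of_nonneg_right ?_ (norm_nonneg _)
    rw [Real.norm_of_nonneg (per_gk_nonneg _ _)]
    exact h η hη.1 hη.2 x hxd y hy
  have h3 := h1.sub (h2.const_mul 2)
  rw [mul_zero, sub_zero] at h3
  refine h3.congr' ?_
  filter_upwards [hev] with η hη
  obtain ⟨C', hC', hn⟩ := neumannKernel_le
  have i1 : Integrable (fun y => neumannKernel η x y * f y) muI :=
    integrable_bdd_mul hf (continuous_neumannKernel hη.1 x).aestronglyMeasurable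
      (C := C' * (1 + η⁻¹)) fun y _ => by
        rw [abs_of_nonneg (neumannKernel_nonneg _ _ _)]; exact hn η hη.1 x y
  have i2 : Integrable (fun y => per (gk η) (x + y) * f y) muI :=
    integrable_bdd_mul hf
      (by have := continuous_per_gk hη.1; fun_prop : Continuous fun y => per (gk η) (x + y)).aestronglyMeasurable
      (C := C * η) fun y hy => by
        rw [abs_of_nonneg (per_gk_nonneg _ _)]; exact h η hη.1 hη.2 x hxd y hy
  rw [heatSemigroup_eq, ← integral_const_mul, ← integral_sub i1 (i2.const_mul 2)]
  refine integral_congr_ae (ae_of_all _ fun y => ?_)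
  simp only [dirichletKernel_eq hη.1, neumannKernel]
  ring

/-! ### Sine coefficients -/

/-- The coefficients in the sine basis. -/
def sineCoeff (k : ℕ) (f : ℝ → ℝ) : ℝ := ∫ y, f y * sineMode k y ∂muI

lemma integrable_mul_sineMode {f : ℝ → ℝ} (hf : Integrable f muI) (k : ℕ) :
    Integrable (fun y => f y * sineMode k y) muI := by
  simp only [mul_comm (f _)]
  exact integrable_bdd_mul hf (measurable_sineMode k).aestronglyMeasurable
    fun y _ => abs_sineMode_le k y

lemma abs_sineCoeff_le {f : ℝ → ℝ} (hf : Integrable f muI) (k : ℕ) :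
    |sineCoeff k f| ≤ Real.sqrt (2 / Real.pi) * ∫ y, ‖f y‖ ∂muI := by
  rw [sineCoeff, ← integral_const_mul, ← Real.norm_eq_abs]
  refine norm_integral_le_of_norm_le (hf.norm.const_mul _) (ae_of_all _ fun y => ?_)
  rw [norm_mul, mul_comm]
  exact mul_le_mul_of_nonneg_right (abs_sineMode_le k y) (norm_nonneg _)

/-- Integration of a sine series in one variable against an integrable function. -/
lemma hasSum_integral_mul {a : ℕ → ℝ → ℝ} {b : ℕ → ℝ} {K f : ℝ → ℝ} (hf : Integrable f muI)
    (ha : ∀ j, AEStronglyMeasurable (a j) muI) (hb : ∀ j y, |a j y| ≤ b j) (hs : Summable b)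
    (hK : ∀ y, HasSum (fun j => a j y) (K y)) :
    HasSum (fun j => ∫ y, a j y * f y ∂muI) (∫ y, K y * f y ∂muI) := by
  refine hasSum_integral_of_dominated_convergence (fun j y => b j * ‖f y‖)
    (fun j => (ha j).mul hf.1) (fun j => ae_of_all _ fun y => ?_)
    (ae_of_all _ fun y => hs.mul_right _) ?_ (ae_of_all _ fun y => (hK y).mul_right _)
  · rw [norm_mul]
    exact mul_le_mul_of_nonneg_right (hb j y) (norm_nonneg _)
  · simp only [tsum_mul_right]
    exact hf.norm.const_mul _

lemma heatSemigroup_hasSum {τ : ℝ} (hτ : 0 < τ) {f : ℝ → ℝ} (hf : Integrable f muI) (x : ℝ) :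
    HasSum (fun j => decay j τ * sineMode (j + 1) x * sineCoeff (j + 1) f)
      (heatSemigroup τ f x) := by
  rw [heatSemigroup_eq]
  set c := Real.sqrt (2 / Real.pi)
  have h := hasSum_integral_mul hf (K := dirichletKernel τ x)
    (a := fun j y => decay j τ * sineMode (j + 1) x * sineMode (j + 1) y)
    (b := fun j => decay j τ * c * c)
    (fun j => ((measurable_sineMode (j + 1)).const_mul _).aestronglyMeasurable)
    (fun j y => abs_mode_mul_le (decay_pos _ _).le (abs_sineMode_le _ _) (abs_sineMode_le _ _))
    (((summable_decay_zero hτ).mul_right _).mul_right _)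
    (fun y => by rw [dirichletKernel_eq hτ]; exact dirichletKernel_hasSum hτ x y)
  refine hasSum_of_eq h (fun j => ?_) rfl
  rw [sineCoeff, ← integral_const_mul]
  congr 1; funext y; ring

lemma integral_cos_int_mul {m : ℤ} (hm : m ≠ 0) : ∫ y, Real.cos (m * y) ∂muI = 0 := by
  have h0 : (m : ℝ) ≠ 0 := by exact_mod_cast hm
  rw [← intervalIntegral_eq_muI, intervalIntegral.integral_comp_mul_left (fun y => Real.cos y) h0]
  simp [integral_cos, Real.sin_int_mul_pi]

lemma sineCoeff_sineMode (j k : ℕ) :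
    sineCoeff (j + 1) (sineMode (k + 1)) = if j = k then 1 else 0 := by
  have hpi := Real.pi_pos
  have hsq : Real.sqrt (2 / Real.pi) * Real.sqrt (2 / Real.pi) = 2 / Real.pi :=
    Real.mul_self_sqrt (by positivity)
  have e : ∀ y, sineMode (k + 1) y * sineMode (j + 1) y =
      Real.pi⁻¹ * (Real.cos (((k : ℤ) - (j : ℤ) : ℤ) * y) -
        Real.cos (((k : ℤ) + (j : ℤ) + 2 : ℤ) * y)) := fun y => by
    push_cast
    rw [show ((k : ℝ) - j) * y = ((k + 1 : ℕ) : ℝ) * y - ((j + 1 : ℕ) : ℝ) * y by push_cast; ring,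
      show ((k : ℝ) + j + 2) * y = ((k + 1 : ℕ) : ℝ) * y + ((j + 1 : ℕ) : ℝ) * y by
        push_cast; ring, Real.cos_sub, Real.cos_add, sineMode, sineMode]
    calc _ = (Real.sqrt (2 / Real.pi) * Real.sqrt (2 / Real.pi)) *
        (Real.sin (((k + 1 : ℕ) : ℝ) * y) * Real.sin (((j + 1 : ℕ) : ℝ) * y)) := by ring
      _ = _ := by rw [hsq]; ring
  have hi : ∀ m : ℤ, Integrable (fun y : ℝ => Real.cos (m * y)) muI := fun m =>
    Integrable.of_bound (by fun_prop : Continuous _).aestronglyMeasurable 1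
      (ae_of_all _ fun y => Real.abs_cos_le_one _)
  rw [sineCoeff]
  simp only [e]
  rw [integral_const_mul, integral_sub (hi _) (hi _),
    integral_cos_int_mul (m := (k : ℤ) + (j : ℤ) + 2) (by positivity), sub_zero]
  split_ifs with h
  · subst h
    simp only [sub_self, Int.cast_zero, zero_mul, Real.cos_zero, integral_const, smul_eq_mul,
      mul_one]
    rw [Measure.real, muI_univ, ENNReal.toReal_ofReal hpi.le, inv_mul_cancel₀ hpi.ne']
  · rw [integral_cos_int_mul (by omega), mul_zero]

lemma integrable_sineMode (k : ℕ) : Integrable (sineMode k) muI :=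
  Integrable.of_bound (measurable_sineMode k).aestronglyMeasurable _
    (ae_of_all _ fun y => abs_sineMode_le k y)

lemma heatSemigroup_sineMode {τ : ℝ} (hτ : 0 < τ) (k : ℕ) (x : ℝ) :
    heatSemigroup τ (sineMode (k + 1)) x = decay k τ * sineMode (k + 1) x := by
  have h := heatSemigroup_hasSum hτ (integrable_sineMode (k + 1)) x
  simp only [sineCoeff_sineMode, mul_ite, mul_one, mul_zero] at h
  have h2 := hasSum_ite_eq k (decay k τ * sineMode (k + 1) x)
  refine h.unique (hasSum_of_eq h2 (fun j => ?_) rfl)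
  split_ifs with hjk
  · rw [hjk]
  · rfl

lemma integrable_dirichletKernel {τ : ℝ} (hτ : 0 < τ) {x : ℝ} (hx : x ∈ Ioo 0 Real.pi) :
    Integrable (dirichletKernel τ x) muI := by
  obtain ⟨C, hC, hb⟩ := exists_kernel_bound hτ
  exact Integrable.of_bound (measurable_dirichletKernel_right τ x).aestronglyMeasurable C
    (ae_muI_mem.mono fun y hy => (hb τ le_rfl x hx y hy).1)

/-- The semigroup applied to a sine series. -/
lemma heatSemigroup_of_hasSum {η : ℝ} (hη : 0 < η) {g : ℝ → ℝ} {a b : ℕ → ℝ}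
    (hb : ∀ j, |a j| ≤ b j) (hs : Summable b)
    (hg : ∀ z, HasSum (fun j => a j * sineMode (j + 1) z) (g z)) {x : ℝ}
    (hx : x ∈ Ioo 0 Real.pi) :
    HasSum (fun j => a j * (decay j η * sineMode (j + 1) x)) (heatSemigroup η g x) := by
  set c := Real.sqrt (2 / Real.pi)
  have h := hasSum_integral_mul (integrable_dirichletKernel hη hx) (K := g)
    (a := fun j y => a j * sineMode (j + 1) y)
    (b := fun j => b j * c)
    (fun j => ((measurable_sineMode (j + 1)).const_mul _).aestronglyMeasurable)
    (fun j y => by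
      rw [abs_mul]
      exact mul_le_mul (hb j) (abs_sineMode_le _ _) (abs_nonneg _)
        ((abs_nonneg _).trans (hb j)))
    (hs.mul_right _) hg
  rw [heatSemigroup_eq]
  refine hasSum_of_eq h (fun j => ?_) ?_
  · rw [← heatSemigroup_sineMode hη, heatSemigroup_eq, ← integral_const_mul]
    congr 1; funext y; ring
  · congr 1; funext y; ring

/-- The semigroup property for the kernel. -/
lemma heatSemigroup_dirichletKernel {η τ : ℝ} (hη : 0 < η) (hτ : 0 < τ) {x : ℝ}
    (hx : x ∈ Ioo 0 Real.pi) (y : ℝ) :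
    ∫ z, dirichletKernel η x z * dirichletKernel τ z y ∂muI = dirichletKernel (τ + η) x y := by
  set c := Real.sqrt (2 / Real.pi)
  have h := heatSemigroup_of_hasSum hη (g := fun z => dirichletKernel τ z y)
    (a := fun j => decay j τ * sineMode (j + 1) y) (b := fun j => decay j τ * c)
    (fun j => by
      rw [abs_mul, abs_of_nonneg (decay_pos _ _).le]
      exact mul_le_mul_of_nonneg_left (abs_sineMode_le _ _) (decay_pos _ _).le)
    ((summable_decay_zero hτ).mul_right _)
    (fun z => by
      rw [dirichletKernel_eq hτ]
      exact hasSum_of_eq (dirichletKernel_hasSum hτ z y) (fun j => by ring) rfl) hx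
  rw [heatSemigroup_eq] at h
  have h2 := dirichletKernel_hasSum (add_pos hτ hη) x y
  rw [← dirichletKernel_eq (add_pos hτ hη)] at h2
  refine h.unique (hasSum_of_eq h2 (fun j => ?_) rfl)
  rw [decay_add]; ring

lemma heatSemigroup_kDy {η τ : ℝ} (hη : 0 < η) (hτ : 0 < τ) {x : ℝ}
    (hx : x ∈ Ioo 0 Real.pi) (y : ℝ) :
    ∫ z, dirichletKernel η x z * kDy τ z y ∂muI = kDy (τ + η) x y := by
  set c := Real.sqrt (2 / Real.pi)
  have hs : Summable fun j : ℕ => decay j τ * (c * ((j + 1 : ℕ) : ℝ)) := by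
    refine ((summable_decay 1 hτ).mul_left c).congr fun j => ?_
    rw [pow_one]; ring
  have h := heatSemigroup_of_hasSum hη (g := fun z => kDy τ z y)
    (a := fun j => decay j τ * cosMode (j + 1) y)
    (b := fun j : ℕ => decay j τ * (c * ((j + 1 : ℕ) : ℝ)))
    (fun j => by
      rw [abs_mul, abs_of_nonneg (decay_pos _ _).le]
      exact mul_le_mul_of_nonneg_left (abs_cosMode_le _ _) (decay_pos _ _).le)
    hs (fun z => hasSum_of_eq (kDy_hasSum hτ z y) (fun j => by ring) rfl) hx
  rw [heatSemigroup_eq] at h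
  refine h.unique (hasSum_of_eq (kDy_hasSum (add_pos hτ hη) x y) (fun j => ?_) rfl)
  rw [decay_add]; ring

/-- The semigroup property. -/
lemma heatSemigroup_heatSemigroup {η τ : ℝ} (hη : 0 < η) (hτ : 0 < τ) {f : ℝ → ℝ}
    (hf : Integrable f muI) {x : ℝ} (hx : x ∈ Ioo 0 Real.pi) :
    heatSemigroup η (heatSemigroup τ f) x = heatSemigroup (τ + η) f x := by
  set c := Real.sqrt (2 / Real.pi)
  have h := heatSemigroup_of_hasSum hη (g := heatSemigroup τ f)
    (a := fun j => decay j τ * sineCoeff (j + 1) f)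
    (b := fun j => decay j τ * (c * ∫ y, ‖f y‖ ∂muI))
    (fun j => by
      rw [abs_mul, abs_of_nonneg (decay_pos _ _).le]
      exact mul_le_mul_of_nonneg_left (abs_sineCoeff_le hf _) (decay_pos _ _).le)
    ((summable_decay_zero hτ).mul_right _)
    (fun z => hasSum_of_eq (heatSemigroup_hasSum hτ hf z) (fun j => by ring) rfl) hx
  refine h.unique (hasSum_of_eq (heatSemigroup_hasSum (add_pos hτ hη) hf x) (fun j => ?_) rfl)
  rw [decay_add]; ring

/-! ### Norm bounds for the semigroup -/

lemma eLpNorm_heatSemigroup_le : ∃ C : ℝ, 0 ≤ C ∧ ∀ (p : ℝ≥0∞), 1 ≤ p → p ≠ ⊤ → ∀ τ, 0 < τ →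
    ∀ f : ℝ → ℝ, AEStronglyMeasurable f muI →
      eLpNorm (heatSemigroup τ f) p muI ≤ ENNReal.ofReal C * eLpNorm f p muI ∧
      eLpNorm (heatSemigroupDx τ f) p muI ≤
        ENNReal.ofReal (C * τ ^ (-1 / 2 : ℝ)) * eLpNorm f p muI := by
  obtain ⟨C0, hC0, h0⟩ := dirichletKernel_weight_bound 0 le_rfl
  obtain ⟨C1, hC1, h1⟩ := kDx_weight_bound 0 le_rfl
  refine ⟨C0 + C1, by positivity, fun p hp hp' τ hτ f hf => ⟨?_, ?_⟩⟩
  · rw [funext (heatSemigroup_eq τ f)]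
    refine eLpNorm_kernel_le hp hp' (τ := 2 * τ) (by positivity) (by positivity) hf
      fun x hx y hy => ?_
    have := h0 τ hτ x hx y hy
    simp only [Real.rpow_zero, one_mul, zero_div, mul_one] at this
    refine this.trans (mul_le_mul_of_nonneg_right (by linarith) (neumannKernel_nonneg _ _ _))
  · refine eLpNorm_kernel_le hp hp' (τ := 2 * τ) (by positivity) (by positivity) hf
      fun x hx y hy => ?_
    have := h1 τ hτ x hx y hy
    simp only [Real.rpow_zero, one_mul, zero_sub] at this
    refine this.trans (mul_le_mul_of_nonneg_right ?_ (neumannKernel_nonneg _ _ _))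
    have : 0 < τ ^ (-1 / 2 : ℝ) := by positivity
    exact mul_le_mul_of_nonneg_right (by linarith) this.le

/-- A kernel bounded by `c` is dominated by `cπ` times the kernel `π⁻¹`, which averages over the
interval. -/
lemma eLpNorm_const_kernel_le {p : ℝ≥0∞} (hp : 1 ≤ p) (hp' : p ≠ ⊤) {c : ℝ}
    (hc : 0 ≤ c) {k : ℝ → ℝ → ℝ} {f : ℝ → ℝ} (hf : AEStronglyMeasurable f muI)
    (hk : ∀ x ∈ Ioo 0 Real.pi, ∀ y ∈ Ioo 0 Real.pi, |k x y| ≤ c) :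
    eLpNorm (fun x => ∫ y, k x y * f y ∂muI) p muI ≤
      ENNReal.ofReal (c * Real.pi) * eLpNorm f p muI := by
  have hpi := Real.pi_pos
  set u : ℝ → ℝ≥0∞ := fun _ => ∫⁻ y, ENNReal.ofReal Real.pi⁻¹ * ‖f y‖ₑ ∂muI
  have hone : ∫⁻ _, ENNReal.ofReal Real.pi⁻¹ ∂muI ≤ 1 := by
    rw [lintegral_const, muI_univ, ← ENNReal.ofReal_mul (by positivity),
      inv_mul_cancel₀ hpi.ne', ENNReal.ofReal_one]
  have hu : eLpNorm u p muI ≤ eLpNorm f p muI :=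
    (eLpNorm_averaging_le hp hp' (k := fun _ _ => ENNReal.ofReal Real.pi⁻¹)
      measurable_const hf.enorm (fun _ => hone) (fun _ => hone)).trans_eq (eLpNorm_enorm _)
  have h1 : ∀ᵐ x ∂muI, ‖∫ y, k x y * f y ∂muI‖ₑ ≤
      ENNReal.ofReal (c * Real.pi) * ‖u x‖ₑ := by
    filter_upwards [ae_muI_mem] with x hx
    refine (enorm_integral_le_lintegral_enorm _).trans ?_
    rw [enorm_eq_self]
    simp only [u]
    rw [← lintegral_const_mul' _ _ ENNReal.ofReal_ne_top]
    refine lintegral_mono_ae ?_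
    filter_upwards [ae_muI_mem] with y hy
    rw [enorm_mul, ← mul_assoc, ← ENNReal.ofReal_mul (by positivity), mul_assoc,
      mul_inv_cancel₀ hpi.ne', mul_one]
    refine mul_le_mul_left ?_ _
    rw [Real.enorm_eq_ofReal_abs]
    exact ENNReal.ofReal_le_ofReal (hk x hx y hy)
  have h2 := eLpNorm_le_nnreal_smul_eLpNorm_of_ae_le_mul' (c := (c * Real.pi).toNNReal) (p := p)
    (f := fun x => ∫ y, k x y * f y ∂muI) (g := u) (μ := muI) (by simpa [ENNReal.ofReal] using h1)
  refine h2.trans ?_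
  rw [ENNReal.smul_def, smul_eq_mul]
  exact mul_le_mul_right hu _

lemma eLpNorm_heatSemigroup_large_time : ∃ C : ℝ, 0 ≤ C ∧ ∀ (p : ℝ≥0∞), 1 ≤ p → p ≠ ⊤ →
    ∀ τ, 0 < τ → ∀ f : ℝ → ℝ, AEStronglyMeasurable f muI →
      eLpNorm (heatSemigroup τ f) p muI ≤ ENNReal.ofReal (C * (τ ^ 2)⁻¹) * eLpNorm f p muI ∧
      eLpNorm (heatSemigroupDx τ f) p muI ≤ ENNReal.ofReal (C * (τ ^ 2)⁻¹) * eLpNorm f p muI := by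
  obtain ⟨C, hC, h⟩ := kernel_large_time
  have hpi := Real.pi_pos
  refine ⟨C * Real.pi, by positivity, fun p hp hp' τ hτ f hf => ?_⟩
  rw [show C * Real.pi * (τ ^ 2)⁻¹ = C * (τ ^ 2)⁻¹ * Real.pi by ring]
  refine ⟨?_, ?_⟩
  · rw [funext (heatSemigroup_eq τ f)]
    exact eLpNorm_const_kernel_le hp hp' (by positivity) hf fun x _ y _ => (h τ hτ x y).1
  · exact eLpNorm_const_kernel_le hp hp' (by positivity) hf fun x _ y _ => (h τ hτ x y).2

/-! ### The operator `f ↦ e^{τΔ}(f V')` in divergence form -/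

/-- `f` is continuously differentiable on `(0,π)` with integrable derivative `f'`. -/
structure HasIntegrableDeriv (f f' : ℝ → ℝ) : Prop where
  hasDerivAt : ∀ x ∈ Ioo 0 Real.pi, HasDerivAt f (f' x) x
  integrable : Integrable f' muI

/-- `V` is bounded by `M` and `γ`-Hölder with constant `M` on `(0,π)`. -/
structure HolderBound (γ M : ℝ) (V : ℝ → ℝ) : Prop where
  nonneg : 0 ≤ M
  bound : ∀ x ∈ Ioo 0 Real.pi, |V x| ≤ M
  holder : ∀ x ∈ Ioo 0 Real.pi, ∀ y ∈ Ioo 0 Real.pi, |V x - V y| ≤ M * |x - y| ^ γ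
  measurable : Measurable V

lemma intervalIntegrable_of_muI {g : ℝ → ℝ} (hg : Integrable g muI) {a b : ℝ}
    (ha : a ∈ Icc 0 Real.pi) (hb : b ∈ Icc 0 Real.pi) : IntervalIntegrable g volume a b := by
  have : IntervalIntegrable g volume 0 Real.pi :=
    (intervalIntegrable_iff_integrableOn_Ioo_of_le Real.pi_pos.le).2 hg
  refine this.mono_set ?_
  rw [uIcc_of_le Real.pi_pos.le]
  exact uIcc_subset_Icc ha hb

lemma uIcc_subset_Ioo_pi {a b : ℝ} (ha : a ∈ Ioo 0 Real.pi) (hb : b ∈ Ioo 0 Real.pi) :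
    uIcc a b ⊆ Ioo 0 Real.pi := ordConnected_Ioo.uIcc_subset ha hb

/-- The fundamental theorem of calculus from the midpoint. Boundedness of `f` is what lets the
boundary terms vanish when the kernel is zero at the endpoints. -/
lemma HasIntegrableDeriv.exists_bound {f f' : ℝ → ℝ} (h : HasIntegrableDeriv f f') :
    ∃ F : ℝ, ∀ x ∈ Ioo 0 Real.pi, |f x| ≤ F := by
  have hpi := Real.pi_pos
  have h0 : Real.pi / 2 ∈ Ioo 0 Real.pi := ⟨by positivity, by linarith⟩
  refine ⟨|f (Real.pi / 2)| + ∫ y, ‖f' y‖ ∂muI, fun x hx => ?_⟩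
  have hi := intervalIntegrable_of_muI h.integrable (Ioo_subset_Icc_self h0)
    (Ioo_subset_Icc_self hx)
  have e := intervalIntegral.integral_eq_sub_of_hasDerivAt
    (fun y hy => h.hasDerivAt y (uIcc_subset_Ioo_pi h0 hx hy)) hi
  have h1 : |∫ y in (Real.pi / 2)..x, f' y| ≤ ∫ y, ‖f' y‖ ∂muI := by
    rw [← Real.norm_eq_abs]
    refine intervalIntegral.norm_integral_le_integral_norm_uIoc.trans ?_
    exact setIntegral_mono_set h.integrable.norm (ae_of_all _ fun _ => norm_nonneg _)
      (LE.le.eventuallyLE (uIoc_subset_uIcc.trans (uIcc_subset_Ioo_pi h0 hx)))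
  rw [e] at h1
  have := abs_sub_abs_le_abs_sub (f x) (f (Real.pi / 2))
  linarith

lemma aestronglyMeasurable_of_hasDerivAt {f f' : ℝ → ℝ}
    (h : ∀ x ∈ Ioo 0 Real.pi, HasDerivAt f (f' x) x) : AEStronglyMeasurable f muI :=
  ContinuousOn.aestronglyMeasurable
    (fun x hx => (h x hx).continuousAt.continuousWithinAt) measurableSet_Ioo

lemma HasIntegrableDeriv.integrable_self {f f' : ℝ → ℝ} (h : HasIntegrableDeriv f f') :
    Integrable f muI := by
  obtain ⟨F, hF⟩ := h.exists_bound
  exact Integrable.of_bound (aestronglyMeasurable_of_hasDerivAt h.hasDerivAt) F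
    (ae_muI_mem.mono fun y hy => hF y hy)

/-- Integration by parts without boundary terms. -/
lemma integral_deriv_mul_eq_zero {f f' K K' : ℝ → ℝ} (h : HasIntegrableDeriv f f')
    (hK : ∀ x ∈ Ioo 0 Real.pi, HasDerivAt K (K' x) x) (hK' : AEStronglyMeasurable K' muI)
    {C : ℝ} (hb : ∀ x ∈ Ioo 0 Real.pi, |K x| ≤ C) (hb' : ∀ x ∈ Ioo 0 Real.pi, |K' x| ≤ C)
    (h0 : Tendsto K (𝓝[>] 0) (𝓝 0)) (h1 : Tendsto K (𝓝[<] Real.pi) (𝓝 0)) :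
    ∫ y, (K' y * f y + K y * f' y) ∂muI = 0 := by
  obtain ⟨F, hF⟩ := h.exists_bound
  have hi : Integrable (fun y => K' y * f y + K y * f' y) muI :=
    (integrable_bdd_mul h.integrable_self hK' hb').add
      (integrable_bdd_mul h.integrable (aestronglyMeasurable_of_hasDerivAt hK) hb)
  have e1 : ∀ᶠ x in 𝓝[>] (0 : ℝ), |f x| ≤ F := by
    filter_upwards [Ioo_mem_nhdsGT Real.pi_pos] with x hx using hF x hx
  have e2 : ∀ᶠ x in 𝓝[<] Real.pi, |f x| ≤ F := by
    filter_upwards [Ioo_mem_nhdsLT Real.pi_pos] with x hx using hF x hx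
  have := intervalIntegral.integral_eq_sub_of_hasDerivAt_of_tendsto Real.pi_pos
    (f := fun y => f y * K y) (f' := fun y => K' y * f y + K y * f' y)
    (fun x hx => ((h.hasDerivAt x hx).mul (hK x hx)).congr_deriv (by ring))
    ((intervalIntegrable_iff_integrableOn_Ioo_of_le Real.pi_pos.le).2 hi)
    (bdd_le_mul_tendsto_zero' F e1 h0) (bdd_le_mul_tendsto_zero' F e2 h1)
  rw [← intervalIntegral_eq_muI, this, sub_zero]

lemma aestronglyMeasurable_kernel_integral {k : ℝ → ℝ → ℝ} (hk : Measurable (Function.uncurry k))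
    {f : ℝ → ℝ} (hf : AEStronglyMeasurable f muI) {μ : Measure ℝ} [SFinite μ] :
    AEStronglyMeasurable (fun x => ∫ y, k x y * f y ∂muI) μ :=
  AEStronglyMeasurable.integral_prod_right' (f := fun q : ℝ × ℝ => k q.1 q.2 * f q.2)
    (hk.aestronglyMeasurable.mul hf.comp_snd)

/-- Norm bound for an operator in divergence form with a Hölder coefficient. -/
lemma eLpNorm_divForm_le {p : ℝ≥0∞} (hp : 1 ≤ p) (hp' : p ≠ ⊤) {τ c c' γ M : ℝ} (hτ : 0 < τ)
    (hc : 0 ≤ c) (hc' : 0 ≤ c') {K K' : ℝ → ℝ → ℝ} {V f f' : ℝ → ℝ}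
    (hV : HolderBound γ M V) (h : HasIntegrableDeriv f f')
    (hK : ∀ x ∈ Ioo 0 Real.pi, ∀ y, HasDerivAt (K x) (K' x y) y)
    (hKm : Measurable (Function.uncurry K)) (hKm' : Measurable (Function.uncurry K'))
    (hbd : ∃ C : ℝ, ∀ x ∈ Ioo 0 Real.pi, ∀ y ∈ Ioo 0 Real.pi, |K x y| ≤ C ∧ |K' x y| ≤ C)
    (h0 : ∀ x, K x 0 = 0) (h1 : ∀ x, K x Real.pi = 0)
    (hkc : ∀ x ∈ Ioo 0 Real.pi, ∀ y ∈ Ioo 0 Real.pi,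
      |x - y| ^ γ * |K x y| ≤ c * neumannKernel τ x y)
    (hkc' : ∀ x ∈ Ioo 0 Real.pi, ∀ y ∈ Ioo 0 Real.pi,
      |x - y| ^ γ * |K' x y| ≤ c' * neumannKernel τ x y) :
    eLpNorm (fun x => ∫ y, (K' x y * f y + K x y * f' y) * V y ∂muI) p muI ≤
      ENNReal.ofReal (c' * M) * eLpNorm f p muI + ENNReal.ofReal (c * M) * eLpNorm f' p muI := by
  obtain ⟨C, hC⟩ := hbd
  have hK' : ∀ x, Measurable (K' x) := fun x => hKm'.comp measurable_prodMk_left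
  have hM := hV.nonneg
  -- Hölder continuity of `V` supplies exactly the weight for which the kernels are bounded.
  have hb : ∀ (k : ℝ → ℝ → ℝ) (c : ℝ), (∀ x ∈ Ioo 0 Real.pi, ∀ y ∈ Ioo 0 Real.pi,
      |x - y| ^ γ * |k x y| ≤ c * neumannKernel τ x y) → ∀ x ∈ Ioo 0 Real.pi, ∀ y ∈ Ioo 0 Real.pi,
      |k x y * (V y - V x)| ≤ c * M * neumannKernel τ x y := fun k c hk x hx y hy => by
    rw [abs_mul]
    have h2 := hV.holder y hy x hx
    rw [abs_sub_comm y x] at h2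
    have h3 := hk x hx y hy
    calc |k x y| * |V y - V x| ≤ |k x y| * (M * |x - y| ^ γ) := by gcongr
      _ = M * (|x - y| ^ γ * |k x y|) := by ring
      _ ≤ M * (c * neumannKernel τ x y) := by gcongr
      _ = _ := by ring
  have hVb : ∀ x ∈ Ioo 0 Real.pi, ∀ y ∈ Ioo 0 Real.pi, |V y - V x| ≤ M + M := fun x hx y hy =>
    (abs_sub _ _).trans (add_le_add (hV.bound y hy) (hV.bound x hx))
  -- The central cancellation: `K' f + K f'` is the derivative of `K f`, whose integral vanishes, so
  -- the constant `V x` can be subtracted from `V y` at no cost.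
  have key : ∀ x ∈ Ioo 0 Real.pi, ∫ y, (K' x y * f y + K x y * f' y) * V y ∂muI =
      (∫ y, K' x y * (V y - V x) * f y ∂muI) + ∫ y, K x y * (V y - V x) * f' y ∂muI := by
    intro x hx
    have hKc : Continuous (K x) := continuous_iff_continuousAt.2 fun y => (hK x hx y).continuousAt
    have hz := integral_deriv_mul_eq_zero h (fun y _ => hK x hx y) (hK' x).aestronglyMeasurable
      (fun y hy => (hC x hx y hy).1) (fun y hy => (hC x hx y hy).2)
      (by simpa only [h0 x] using (hKc.tendsto 0).mono_left nhdsWithin_le_nhds)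
      (by simpa only [h1 x] using (hKc.tendsto Real.pi).mono_left nhdsWithin_le_nhds)
    have hz2 : ∫ y, V x * (K' x y * f y + K x y * f' y) ∂muI = 0 := by
      rw [integral_const_mul, hz, mul_zero]
    have i1 := integrable_bdd_mul h.integrable_self (hK' x).aestronglyMeasurable
      (fun y hy => (hC x hx y hy).2)
    have i2 := integrable_bdd_mul h.integrable hKc.aestronglyMeasurable
      (fun y hy => (hC x hx y hy).1)
    have i3 : Integrable (fun y => V y * (K' x y * f y + K x y * f' y)) muI :=
      integrable_bdd_mul (i1.add i2) hV.measurable.aestronglyMeasurable hV.bound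
    have j1 : Integrable (fun y => K' x y * (V y - V x) * f y) muI := by
      have := integrable_bdd_mul i1 (k := fun y => V y - V x)
        (hV.measurable.sub_const _).aestronglyMeasurable (hVb x hx)
      exact this.congr (ae_of_all _ fun y => by ring)
    have j2 : Integrable (fun y => K x y * (V y - V x) * f' y) muI := by
      have := integrable_bdd_mul i2 (k := fun y => V y - V x)
        (hV.measurable.sub_const _).aestronglyMeasurable (hVb x hx)
      exact this.congr (ae_of_all _ fun y => by ring)
    rw [← integral_add j1 j2, ← sub_zero (∫ y, (K' x y * f y + K x y * f' y) * V y ∂muI), ← hz2]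
    have i3' : Integrable (fun y => (K' x y * f y + K x y * f' y) * V y) muI :=
      i3.congr (ae_of_all _ fun y => by ring)
    have i4 : Integrable (fun y => V x * (K' x y * f y + K x y * f' y)) muI :=
      (i1.add i2).const_mul _
    rw [← integral_sub i3' i4]
    refine integral_congr_ae (ae_of_all _ fun y => ?_)
    simp only []
    ring
  have m1 := eLpNorm_kernel_le hp hp' hτ (by positivity : 0 ≤ c' * M)
    h.integrable_self.1 (hb K' c' hkc')
  have m2 := eLpNorm_kernel_le hp hp' hτ (by positivity : 0 ≤ c * M) h.integrable.1 (hb K c hkc)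
  refine le_trans ?_ (add_le_add m1 m2)
  refine (eLpNorm_mono_enorm_ae (g := fun x => ‖∫ y, K' x y * (V y - V x) * f y ∂muI‖ₑ +
    ‖∫ y, K x y * (V y - V x) * f' y ∂muI‖ₑ) ?_).trans ?_
  · filter_upwards [ae_muI_mem] with x hx
    rw [key x hx, enorm_eq_self]
    exact enorm_add_le _ _
  · have hVm := hV.measurable
    have t1 : Measurable (Function.uncurry fun x y => K' x y * (V y - V x)) :=
      hKm'.mul ((hVm.comp measurable_snd).sub (hVm.comp measurable_fst))
    have t2 : Measurable (Function.uncurry fun x y => K x y * (V y - V x)) :=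
      hKm.mul ((hVm.comp measurable_snd).sub (hVm.comp measurable_fst))
    refine (eLpNorm_add_le
      (aestronglyMeasurable_kernel_integral t1 h.integrable_self.1).enorm.aestronglyMeasurable
      (aestronglyMeasurable_kernel_integral t2 h.integrable.1).enorm.aestronglyMeasurable
      hp).trans_eq ?_
    rw [eLpNorm_enorm, eLpNorm_enorm]

/-- The operator `f ↦ e^{τΔ}(f V')`, with the derivative of `V` moved to the other factors. -/
def divSemigroup (τ : ℝ) (V f f' : ℝ → ℝ) (x : ℝ) : ℝ :=
  -∫ y, (kDy τ x y * f y + dirichletKernel τ x y * f' y) * V y ∂muI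

/-- The space derivative of `divSemigroup`. -/
def divSemigroupDx (τ : ℝ) (V f f' : ℝ → ℝ) (x : ℝ) : ℝ :=
  -∫ y, (kDxy τ x y * f y + kDx τ x y * f' y) * V y ∂muI

lemma measurable_dirichletKernel_fix (τ : ℝ) : Measurable (Function.uncurry (dirichletKernel τ)) :=
  measurable_dirichletKernel.comp (f := fun q : ℝ × ℝ => (τ, q.1, q.2)) (by fun_prop)

lemma measurable_kDx_fix (τ : ℝ) : Measurable (Function.uncurry (kDx τ)) :=
  measurable_kDx.comp (f := fun q : ℝ × ℝ => (τ, q.1, q.2)) (by fun_prop)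

lemma measurable_kDy_fix (τ : ℝ) : Measurable (Function.uncurry (kDy τ)) :=
  measurable_kDy.comp (f := fun q : ℝ × ℝ => (τ, q.1, q.2)) (by fun_prop)

lemma measurable_kDxy_fix (τ : ℝ) : Measurable (Function.uncurry (kDxy τ)) :=
  measurable_kDxy.comp (f := fun q : ℝ × ℝ => (τ, q.1, q.2)) (by fun_prop)

/-- One cancellation, three kernels: `P^D`, `∂_x P^D` and the increment of `P^D` in time all vanish
at `y = 0` and `y = π`. In each case the Hölder weight adds `γ/2` to the exponent that parabolic
scaling alone would give. The third estimate feeds the fractional norm. -/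
lemma eLpNorm_divSemigroup_le (γ : ℝ) (hγ : 0 ≤ γ) (hγ1 : γ ≤ 1) : ∃ C : ℝ, 0 ≤ C ∧
    ∀ (p : ℝ≥0∞), 1 ≤ p → p ≠ ⊤ → ∀ τ, 0 < τ → ∀ (M : ℝ) (V f f' : ℝ → ℝ),
      HolderBound γ M V → HasIntegrableDeriv f f' →
      eLpNorm (divSemigroup τ V f f') p muI ≤
        ENNReal.ofReal (C * τ ^ ((γ - 1) / 2) * M) * eLpNorm f p muI +
        ENNReal.ofReal (C * τ ^ (γ / 2) * M) * eLpNorm f' p muI ∧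
      eLpNorm (divSemigroupDx τ V f f') p muI ≤
        ENNReal.ofReal (C * τ ^ ((γ - 2) / 2) * M) * eLpNorm f p muI +
        ENNReal.ofReal (C * τ ^ ((γ - 1) / 2) * M) * eLpNorm f' p muI ∧
      ∀ r, 0 ≤ r → r ≤ τ →
        eLpNorm (fun x => divSemigroup (τ + r) V f f' x - divSemigroup τ V f f' x) p muI ≤
        ENNReal.ofReal (C * r * τ ^ ((γ - 3) / 2) * M) * eLpNorm f p muI +
        ENNReal.ofReal (C * r * τ ^ ((γ - 2) / 2) * M) * eLpNorm f' p muI := by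
  obtain ⟨C0, hC0, h0⟩ := dirichletKernel_weight_bound γ hγ
  obtain ⟨C1, hC1, h1⟩ := kDx_weight_bound γ hγ
  obtain ⟨C1', hC1', h1'⟩ := kDy_weight_bound γ hγ
  obtain ⟨C2, hC2, h2⟩ := kDxy_weight_bound γ hγ
  obtain ⟨C3, hC3, h3⟩ := dirichletKernel_time_diff γ hγ (by linarith)
  obtain ⟨C4, hC4, h4⟩ := kDy_time_diff γ hγ (by linarith)
  set C := C0 + C1 + C1' + C2 + C3 + C4
  have hC : 0 ≤ C := by positivity
  have l0 : C0 ≤ C := by simp only [C]; linarith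
  have l1 : C1 ≤ C := by simp only [C]; linarith
  have l1' : C1' ≤ C := by simp only [C]; linarith
  have l2 : C2 ≤ C := by simp only [C]; linarith
  have l3 : C3 ≤ C := by simp only [C]; linarith
  have l4 : C4 ≤ C := by simp only [C]; linarith
  refine ⟨C, hC, fun p hp hp' τ hτ M V f f' hV h => ⟨?_, ?_, fun r hr hrτ => ?_⟩⟩
  · obtain ⟨B, hB, hb⟩ := exists_kernel_bound hτ
    change eLpNorm (-fun x => ∫ y, (kDy τ x y * f y + dirichletKernel τ x y * f' y) * V y ∂muI)
      p muI ≤ _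
    rw [eLpNorm_neg]
    refine eLpNorm_divForm_le hp hp' (τ := 2 * τ) (by positivity) (by positivity) (by positivity)
      hV h (fun x _ y => hasDerivAt_dirichletKernel_right hτ x y)
      (measurable_dirichletKernel_fix τ) (measurable_kDy_fix τ)
      ⟨B, fun x hx y hy => ⟨(hb τ le_rfl x hx y hy).1, (hb τ le_rfl x hx y hy).2.2.1⟩⟩
      (dirichletKernel_zero τ) (dirichletKernel_pi τ) (fun x hx y hy => ?_) (fun x hx y hy => ?_)
    · refine (h0 τ hτ x hx y hy).trans ?_
      have := neumannKernel_nonneg (2 * τ) x y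
      gcongr
    · refine (h1' τ hτ x hx y hy).trans ?_
      have := neumannKernel_nonneg (2 * τ) x y
      gcongr
  · obtain ⟨B, hB, hb⟩ := exists_kernel_bound hτ
    change eLpNorm (-fun x => ∫ y, (kDxy τ x y * f y + kDx τ x y * f' y) * V y ∂muI)
      p muI ≤ _
    rw [eLpNorm_neg]
    refine eLpNorm_divForm_le hp hp' (τ := 2 * τ) (by positivity) (by positivity) (by positivity)
      hV h (fun x _ y => hasDerivAt_kDx_right hτ x y)
      (measurable_kDx_fix τ) (measurable_kDxy_fix τ)
      ⟨B, fun x hx y hy => ⟨(hb τ le_rfl x hx y hy).2.1, (hb τ le_rfl x hx y hy).2.2.2⟩⟩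
      (kDx_zero hτ) (kDx_pi hτ) (fun x hx y hy => ?_) (fun x hx y hy => ?_)
    · refine (h1 τ hτ x hx y hy).trans ?_
      have := neumannKernel_nonneg (2 * τ) x y
      gcongr
    · refine (h2 τ hτ x hx y hy).trans ?_
      have := neumannKernel_nonneg (2 * τ) x y
      gcongr
  · obtain ⟨B, hB, hb⟩ := exists_kernel_bound hτ
    have hτr : 0 < τ + r := by linarith
    have hbr := hb (τ + r) (by linarith)
    have hint : ∀ t, τ ≤ t → ∀ x ∈ Ioo 0 Real.pi,
        Integrable (fun y => (kDy t x y * f y + dirichletKernel t x y * f' y) * V y) muI := by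
      intro t ht x hx
      have i1 := integrable_bdd_mul h.integrable_self (measurable_kDy_right t x).aestronglyMeasurable
        (fun y hy => (hb t ht x hx y hy).2.2.1)
      have i2 := integrable_bdd_mul h.integrable
        (measurable_dirichletKernel_right t x).aestronglyMeasurable
        (fun y hy => (hb t ht x hx y hy).1)
      exact (integrable_bdd_mul (i1.add i2) hV.measurable.aestronglyMeasurable hV.bound).congr
        (ae_of_all _ fun y => mul_comm _ _)
    have e : ∀ᵐ x ∂muI, divSemigroup (τ + r) V f f' x - divSemigroup τ V f f' x =
        -∫ y, ((kDy (τ + r) x y - kDy τ x y) * f y +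
          (dirichletKernel (τ + r) x y - dirichletKernel τ x y) * f' y) * V y ∂muI := by
      filter_upwards [ae_muI_mem] with x hx
      rw [divSemigroup, divSemigroup, ← neg_sub', ← integral_sub (hint _ (by linarith) x hx)
        (hint τ le_rfl x hx)]
      congr 2
      funext y
      ring
    rw [eLpNorm_congr_ae e]
    change eLpNorm (-fun x => ∫ y, ((kDy (τ + r) x y - kDy τ x y) * f y +
          (dirichletKernel (τ + r) x y - dirichletKernel τ x y) * f' y) * V y ∂muI) p muI ≤ _
    rw [eLpNorm_neg]
    refine eLpNorm_divForm_le hp hp' (τ := 4 * τ) (by positivity) (by positivity) (by positivity)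
      hV h (K := fun x y => dirichletKernel (τ + r) x y - dirichletKernel τ x y)
      (K' := fun x y => kDy (τ + r) x y - kDy τ x y)
      (fun x _ y => (hasDerivAt_dirichletKernel_right hτr x y).sub
        (hasDerivAt_dirichletKernel_right hτ x y))
      ((measurable_dirichletKernel_fix (τ + r)).sub (measurable_dirichletKernel_fix τ))
      ((measurable_kDy_fix (τ + r)).sub (measurable_kDy_fix τ))
      ⟨B + B, fun x hx y hy => ⟨(abs_sub _ _).trans
          (add_le_add (hbr x hx y hy).1 (hb τ le_rfl x hx y hy).1),
        (abs_sub _ _).trans (add_le_add (hbr x hx y hy).2.2.1 (hb τ le_rfl x hx y hy).2.2.1)⟩⟩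
      (fun x => by simp [dirichletKernel_zero]) (fun x => by simp [dirichletKernel_pi])
      (fun x hx y hy => ?_) (fun x hx y hy => ?_)
    · refine (h3 τ hτ r hr hrτ x hx y hy).trans ?_
      have := neumannKernel_nonneg (4 * τ) x y
      gcongr
    · refine (h4 τ hτ r hr hrτ x hx y hy).trans ?_
      have := neumannKernel_nonneg (4 * τ) x y
      gcongr

lemma hasDerivAt_divSemigroup {τ γ M : ℝ} (hτ : 0 < τ) {V f f' : ℝ → ℝ}
    (hV : HolderBound γ M V) (h : HasIntegrableDeriv f f') {x : ℝ} (hx : x ∈ Ioo 0 Real.pi) :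
    HasDerivAt (divSemigroup τ V f f') (divSemigroupDx τ V f f' x) x := by
  obtain ⟨C, hC, hb⟩ := exists_kernel_bound hτ
  have hb' := fun x hx y hy => hb τ le_rfl x hx y hy
  have hVm := hV.measurable.aestronglyMeasurable (μ := muI)
  have hf := h.integrable_self
  have hf' := h.integrable
  refine (hasDerivAt_integral_of_dominated_loc_of_deriv_le (isOpen_Ioo.mem_nhds hx)
    (Eventually.of_forall fun z =>
      (((measurable_kDy_right τ z).aestronglyMeasurable.mul hf.1).add
        ((measurable_dirichletKernel_right τ z).aestronglyMeasurable.mul hf'.1)).mul hVm) ?_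
    ((((measurable_kDxy_right τ x).aestronglyMeasurable.mul hf.1).add
        ((measurable_kDx_right τ x).aestronglyMeasurable.mul hf'.1)).mul hVm)
    (bound := fun y => (C * ‖f y‖ + C * ‖f' y‖) * M) ?_
    (((hf.norm.const_mul C).add (hf'.norm.const_mul C)).mul_const M) (ae_of_all _ fun y z _ =>
      (((hasDerivAt_kDy_left hτ z y).mul_const _).add
        ((hasDerivAt_dirichletKernel_left hτ z y).mul_const _)).mul_const _)).2.neg
  · have i1 := integrable_bdd_mul hf (measurable_kDy_right τ x).aestronglyMeasurable
      (fun y hy => (hb' x hx y hy).2.2.1)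
    have i2 := integrable_bdd_mul hf'
      (measurable_dirichletKernel_right τ x).aestronglyMeasurable (fun y hy => (hb' x hx y hy).1)
    exact (integrable_bdd_mul (i1.add i2) hVm hV.bound).congr
      (ae_of_all _ fun y => mul_comm _ _)
  · filter_upwards [ae_muI_mem] with y hy z hz
    rw [norm_mul]
    have hM := hV.nonneg
    refine mul_le_mul ((norm_add_le _ _).trans (add_le_add ?_ ?_)) (hV.bound y hy) (norm_nonneg _)
      (by positivity)
    · rw [norm_mul]
      exact mul_le_mul_of_nonneg_right (hb' z hz y hy).2.2.2 (norm_nonneg _)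
    · rw [norm_mul]
      exact mul_le_mul_of_nonneg_right (hb' z hz y hy).2.1 (norm_nonneg _)

/-- Increments are bounded by the integral of the derivative. -/
lemma enorm_sub_le_lintegral {g g' : ℝ → ℝ} (hg : ∀ x ∈ Ioo 0 Real.pi, HasDerivAt g (g' x) x)
    (hg' : AEStronglyMeasurable g' muI) {x₁ x₂ : ℝ} (h1 : x₁ ∈ Ioo 0 Real.pi)
    (h2 : x₂ ∈ Ioo 0 Real.pi) (h12 : x₁ < x₂) :
    ‖g x₂ - g x₁‖ₑ ≤ ∫⁻ z in Ioo x₁ x₂, ‖g' z‖ₑ := by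
  have hsub : Ioo x₁ x₂ ⊆ Ioo 0 Real.pi := Ioo_subset_Ioo h1.1.le h2.2.le
  rcases eq_or_ne (∫⁻ z in Ioo x₁ x₂, ‖g' z‖ₑ) ⊤ with h | h
  · rw [h]; exact le_top
  have hi : IntegrableOn g' (Ioo x₁ x₂) :=
    ⟨hg'.mono_measure (Measure.restrict_mono_set _ hsub), lt_top_iff_ne_top.2 h⟩
  have e := intervalIntegral.integral_eq_sub_of_hasDerivAt
    (fun y hy => hg y (uIcc_subset_Ioo_pi h1 h2 hy))
    ((intervalIntegrable_iff_integrableOn_Ioo_of_le h12.le).2 hi)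
  rw [← e, intervalIntegral.integral_of_le h12.le, integral_Ioc_eq_integral_Ioo]
  exact enorm_integral_le_lintegral_enorm _

/-! ### Norms of a function from its regularizations -/

lemma exists_seq_pos_tendsto {r : ℝ} (hr : 0 < r) : ∃ e : ℕ → ℝ, (∀ n, 0 < e n ∧ e n ≤ r) ∧
    Tendsto e atTop (𝓝[>] 0) := by
  refine ⟨fun n => r * (1 / ((n : ℝ) + 1)), fun n => ⟨by positivity, ?_⟩, ?_⟩
  · refine mul_le_of_le_one_right hr.le ?_
    rw [div_le_one (by positivity)]
    have : (0 : ℝ) ≤ n := by positivity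
    linarith
  · refine tendsto_nhdsWithin_iff.2 ⟨?_, Eventually.of_forall fun m => by
      simp only [mem_Ioi]; positivity⟩
    simpa using (tendsto_one_div_add_atTop_nhds_zero_nat (𝕜 := ℝ)).const_mul r

lemma measurable_lintegral_enorm {c : ℝ → ℝ → ℝ} (hc : Measurable (Function.uncurry c))
    (ν : Measure ℝ) [SFinite ν] : Measurable fun x => ∫⁻ s, ‖c s x‖ₑ ∂ν :=
  Measurable.lintegral_prod_left' (f := fun q : ℝ × ℝ => ‖c q.1 q.2‖ₑ) hc.enorm

lemma eLpNorm_lintegral_enorm_le {p : ℝ≥0∞} (hp : 1 ≤ p) (hp' : p ≠ ⊤) {c : ℝ → ℝ → ℝ}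
    (hc : Measurable (Function.uncurry c)) {ν : Measure ℝ} [SFinite ν] {l : ℝ → ℝ≥0∞}
    (hl : ∀ᵐ s ∂ν, eLpNorm (c s) p muI ≤ l s) :
    eLpNorm (fun x => ∫⁻ s, ‖c s x‖ₑ ∂ν) p muI ≤ ∫⁻ s, l s ∂ν := by
  refine (eLpNorm_lintegral_le hp hp' (F := fun s x => ‖c s x‖ₑ) hc.enorm).trans ?_
  refine lintegral_mono_ae (hl.mono fun s hs => ?_)
  rwa [eLpNorm_enorm]

lemma eLpNorm_enorm_add_lintegral_le {p : ℝ≥0∞} (hp : 1 ≤ p) (hp' : p ≠ ⊤) {c : ℝ → ℝ → ℝ}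
    (hc : Measurable (Function.uncurry c)) {ν : Measure ℝ} [SFinite ν] {l : ℝ → ℝ≥0∞}
    (hl : ∀ᵐ s ∂ν, eLpNorm (c s) p muI ≤ l s) {h : ℝ → ℝ} (hh : Measurable h) {A : ℝ≥0∞}
    (hA : eLpNorm h p muI ≤ A) :
    eLpNorm (fun x => ‖h x‖ₑ + ∫⁻ s, ‖c s x‖ₑ ∂ν) p muI ≤ A + ∫⁻ s, l s ∂ν := by
  have m1 : AEStronglyMeasurable (fun x => ‖h x‖ₑ) muI := hh.enorm.aestronglyMeasurable
  have m2 : AEStronglyMeasurable (fun x => ∫⁻ s, ‖c s x‖ₑ ∂ν) muI :=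
    (measurable_lintegral_enorm hc ν).aestronglyMeasurable
  refine (eLpNorm_add_le m1 m2 hp).trans ?_
  rw [eLpNorm_enorm]
  exact add_le_add hA (eLpNorm_lintegral_enorm_le hp hp' hc hl)

/-- If `e^{ηΔ}f = h(η) + ∫ b(η,s) ds` for all small `η`, then the norms of `f` and `f'` are bounded
by those of the terms on the right. -/
lemma eLpNorm_le_of_regularization {p : ℝ≥0∞} (hp : 1 ≤ p) (hp' : p ≠ ⊤) {f f' : ℝ → ℝ}
    (hf : Integrable f muI) (hd : ∀ x ∈ Ioo 0 Real.pi, HasDerivAt f (f' x) x)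
    {ν : Measure ℝ} [SFinite ν] {h hx : ℝ → ℝ → ℝ} {b bx : ℝ → ℝ → ℝ → ℝ}
    {r₀ : ℝ} (hr₀ : 0 < r₀) {A₀ A₁ : ℝ≥0∞} {l₀ l₁ : ℝ → ℝ≥0∞}
    (heq : ∀ η ∈ Ioc 0 r₀, ∀ x ∈ Ioo 0 Real.pi, heatSemigroup η f x = h η x + ∫ s, b η s x ∂ν)
    (hhm : ∀ η, Measurable (h η)) (hhxm : ∀ η, Measurable (hx η))
    (hhd : ∀ η ∈ Ioc 0 r₀, ∀ x ∈ Ioo 0 Real.pi, HasDerivAt (h η) (hx η x) x)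
    (hA₀ : ∀ η ∈ Ioc 0 r₀, eLpNorm (h η) p muI ≤ A₀)
    (hA₁ : ∀ η ∈ Ioc 0 r₀, eLpNorm (hx η) p muI ≤ A₁)
    (hbm : ∀ η, Measurable (Function.uncurry (b η)))
    (hbxm : ∀ η, Measurable (Function.uncurry (bx η)))
    (hbi : ∀ η ∈ Ioc 0 r₀, ∀ x ∈ Ioo 0 Real.pi, Integrable (fun s => b η s x) ν)
    (hbd : ∀ η ∈ Ioc 0 r₀, ∀ᵐ s ∂ν, ∀ x ∈ Ioo 0 Real.pi, HasDerivAt (b η s) (bx η s x) x)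
    (hl₀ : ∀ η ∈ Ioc 0 r₀, ∀ᵐ s ∂ν, eLpNorm (b η s) p muI ≤ l₀ s)
    (hl₁ : ∀ η ∈ Ioc 0 r₀, ∀ᵐ s ∂ν, eLpNorm (bx η s) p muI ≤ l₁ s) :
    eLpNorm f p muI ≤ A₀ + ∫⁻ s, l₀ s ∂ν ∧ eLpNorm f' p muI ≤ A₁ + ∫⁻ s, l₁ s ∂ν := by
  obtain ⟨e, he, het⟩ := exists_seq_pos_tendsto hr₀
  have hlim : ∀ x ∈ Ioo 0 Real.pi, Tendsto (fun n => heatSemigroup (e n) f x) atTop (𝓝 (f x)) :=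
    fun x hxm => (tendsto_heatSemigroup hf hxm (hd x hxm).continuousAt).comp het
  constructor
  · refine eLpNorm_le_of_tendsto (fun n => (measurable_heatSemigroup (e n) hf.1).aestronglyMeasurable)
      (ae_muI_mem.mono hlim) fun n => ?_
    have hη : e n ∈ Ioc 0 r₀ := ⟨(he n).1, (he n).2⟩
    refine le_trans ?_
      (eLpNorm_enorm_add_lintegral_le hp hp' (hbm (e n)) (hl₀ _ hη) (hhm (e n)) (hA₀ _ hη))
    refine eLpNorm_mono_enorm_ae (ae_muI_mem.mono fun x hxm => ?_)
    rw [heq _ hη x hxm, enorm_eq_self]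
    exact (enorm_add_le _ _).trans (add_le_add_right (enorm_integral_le_lintegral_enorm _) _)
  -- Increments in `x` are estimated instead of differentiating under the `s`-integral, so no
  -- majorant of `bx` that is uniform in `x` is required.
  · refine eLpNorm_deriv_le_of_tendsto hp hp' hd (fun n => measurable_heatSemigroup (e n) hf.1) hlim
      (H := fun n z => ‖hx (e n) z‖ₑ + ∫⁻ s, ‖bx (e n) s z‖ₑ ∂ν)
      (fun n => ((hhxm _).enorm.add (measurable_lintegral_enorm (hbxm _) ν)).aemeasurable) ?_ ?_
    · intro n x₁ h1 x₂ h2 h12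
      have hη : e n ∈ Ioc 0 r₀ := ⟨(he n).1, (he n).2⟩
      rw [heq _ hη x₁ h1, heq _ hη x₂ h2, add_sub_add_comm,
        ← integral_sub (hbi _ hη x₂ h2) (hbi _ hη x₁ h1)]
      refine (enorm_add_le _ _).trans ?_
      rw [lintegral_add_left (hhxm _).enorm]
      refine add_le_add (enorm_sub_le_lintegral (hhd _ hη) (hhxm _).aestronglyMeasurable h1 h2 h12)
        ((enorm_integral_le_lintegral_enorm _).trans ?_)
      have hsw : AEMeasurable (Function.uncurry fun z s => ‖bx (e n) s z‖ₑ)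
          ((volume.restrict (Ioo x₁ x₂)).prod ν) :=
        ((hbxm (e n)).enorm.comp measurable_swap).aemeasurable
      rw [lintegral_lintegral_swap hsw]
      refine lintegral_mono_ae ((hbd _ hη).mono fun s hs => ?_)
      exact enorm_sub_le_lintegral hs
        ((hbxm (e n)).comp measurable_prodMk_left).aestronglyMeasurable h1 h2 h12
    · intro n
      have hη : e n ∈ Ioc 0 r₀ := ⟨(he n).1, (he n).2⟩
      exact eLpNorm_enorm_add_lintegral_le hp hp' (hbxm (e n)) (hl₁ _ hη) (hhxm (e n)) (hA₁ _ hη)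

/-- The constant `1 + π` bounds `π^(1-1/p)` for all `p` simultaneously. -/
lemma eLpNorm_one_le {p : ℝ≥0∞} (hp : 1 ≤ p) {f : ℝ → ℝ} (hf : AEStronglyMeasurable f muI) :
    eLpNorm f 1 muI ≤ ENNReal.ofReal (1 + Real.pi) * eLpNorm f p muI := by
  have hpi := Real.pi_pos
  refine (eLpNorm_le_eLpNorm_mul_rpow_measure_univ hp hf).trans ?_
  rw [mul_comm, muI_univ]
  refine mul_le_mul_left ?_ _
  rw [ENNReal.toReal_one, div_one, ENNReal.ofReal_rpow_of_pos hpi]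
  refine ENNReal.ofReal_le_ofReal ?_
  have h0 : 0 ≤ 1 / p.toReal := by positivity
  calc Real.pi ^ (1 - 1 / p.toReal) ≤ (1 + Real.pi) ^ (1 - 1 / p.toReal) := by
        refine Real.rpow_le_rpow hpi.le (by linarith) ?_
        rcases eq_or_ne p ⊤ with h | h
        · simp [h]
        · have := one_le_toReal hp h
          rw [sub_nonneg, div_le_one (by linarith)]
          exact this
    _ ≤ (1 + Real.pi) ^ (1 : ℝ) :=
        Real.rpow_le_rpow_of_exponent_le (by linarith) (by linarith)
    _ = _ := Real.rpow_one _

lemma integrable_of_eLpNorm_lt_top {p : ℝ≥0∞} (hp : 1 ≤ p) {f : ℝ → ℝ}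
    (hf : AEStronglyMeasurable f muI) (h : eLpNorm f p muI < ⊤) : Integrable f muI :=
  (MemLp.integrable hp ⟨hf, h⟩)

/-- Bound of `‖e^{rΔ}f - f‖` from the regularizations of `f`. -/
lemma eLpNorm_heatSemigroup_sub_le {p : ℝ≥0∞} (hp : 1 ≤ p) (hp' : p ≠ ⊤) {f f' : ℝ → ℝ}
    (hf : Integrable f muI) (hd : ∀ x ∈ Ioo 0 Real.pi, HasDerivAt f (f' x) x)
    {ν : Measure ℝ} [SFinite ν] {b : ℝ → ℝ → ℝ → ℝ}
    {r : ℝ} (hr : 0 < r) {l : ℝ → ℝ≥0∞}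
    (heq : ∀ η, 0 < η → ∀ x ∈ Ioo 0 Real.pi, heatSemigroup η f x = ∫ s, b η s x ∂ν)
    (hbm : ∀ η, Measurable (Function.uncurry (b η)))
    (hbi : ∀ η, 0 < η → ∀ x ∈ Ioo 0 Real.pi, Integrable (fun s => b η s x) ν)
    (hl : ∀ η ∈ Ioc 0 r, ∀ᵐ s ∂ν, eLpNorm (fun x => b (η + r) s x - b η s x) p muI ≤ l s) :
    eLpNorm (fun x => heatSemigroup r f x - f x) p muI ≤ ∫⁻ s, l s ∂ν := by
  obtain ⟨e, he, het⟩ := exists_seq_pos_tendsto hr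
  have hSi : Integrable (heatSemigroup r f) muI := by
    obtain ⟨C, hC, h⟩ := eLpNorm_heatSemigroup_le
    have := (h 1 le_rfl ENNReal.one_ne_top r hr f hf.1).1
    refine integrable_of_eLpNorm_lt_top le_rfl (measurable_heatSemigroup r hf.1).aestronglyMeasurable
      (this.trans_lt (ENNReal.mul_lt_top ENNReal.ofReal_lt_top ?_))
    exact (memLp_one_iff_integrable.2 hf).2
  -- By the semigroup law `e^{rΔ}f - f` is the limit of the increments of `η ↦ e^{ηΔ}f` over a step
  -- `r`. These are expressed by the integrands `b`, and Fatou's lemma gives the bound.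
  have hlim : ∀ x ∈ Ioo 0 Real.pi, Tendsto
      (fun n => heatSemigroup (r + e n) f x - heatSemigroup (e n) f x) atTop
      (𝓝 (heatSemigroup r f x - f x)) := fun x hx => by
    refine Tendsto.sub ?_
      ((tendsto_heatSemigroup hf hx (hd x hx).continuousAt).comp het)
    refine ((tendsto_heatSemigroup hSi hx
      (hasDerivAt_heatSemigroup hr hf hx).continuousAt).comp het).congr fun n => ?_
    exact heatSemigroup_heatSemigroup (he n).1 hr hf hx
  refine eLpNorm_le_of_tendsto (fun n => ((measurable_heatSemigroup _ hf.1).sub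
    (measurable_heatSemigroup _ hf.1)).aestronglyMeasurable) (ae_muI_mem.mono hlim) fun n => ?_
  have hη : e n ∈ Ioc 0 r := ⟨(he n).1, (he n).2⟩
  have hdm : Measurable (Function.uncurry fun s x => b (e n + r) s x - b (e n) s x) :=
    (hbm _).sub (hbm _)
  calc _ ≤ eLpNorm (fun x => ∫⁻ s, ‖b (e n + r) s x - b (e n) s x‖ₑ ∂ν) p muI := by
        refine eLpNorm_mono_enorm_ae (ae_muI_mem.mono fun x hx => ?_)
        simp only [Pi.sub_apply]
        rw [add_comm r, heq _ hη.1 x hx, heq _ (add_pos hη.1 hr) x hx,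
          ← integral_sub (hbi _ (add_pos hη.1 hr) x hx) (hbi _ hη.1 x hx), enorm_eq_self]
        exact enorm_integral_le_lintegral_enorm _
    _ ≤ _ := eLpNorm_lintegral_enorm_le hp hp' hdm (hl _ hη)

/-! ### The fractional Sobolev norm -/

lemma heatSemigroup_congr {f f₁ : ℝ → ℝ} (h : f =ᵐ[muI] f₁) (τ x : ℝ) :
    heatSemigroup τ f x = heatSemigroup τ f₁ x := by
  rw [heatSemigroup_eq, heatSemigroup_eq]
  exact integral_congr_ae (h.mono fun y hy => by simp only [hy])

lemma HasFracLap.congr {p : ℝ≥0∞} {s : ℝ} {f f₁ g : ℝ → ℝ} (h : f =ᵐ[muI] f₁)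
    (hf : HasFracLap p s f g) : HasFracLap p s f₁ g where
  memLp_left := (memLp_congr_ae h).1 hf.memLp_left
  memLp_right := hf.memLp_right
  tendsto := by
    refine hf.tendsto.congr fun δ => eLpNorm_congr_ae (h.mono fun x hx => ?_)
    simp only [fracLapTrunc, heatSemigroup_congr h, hx]

lemma sobolevNorm_congr {p : ℝ≥0∞} {s : ℝ} {f f₁ : ℝ → ℝ} (h : f =ᵐ[muI] f₁) :
    sobolevNorm p s f = sobolevNorm p s f₁ := by
  unfold sobolevNorm
  refine iInf_congr fun g => ?_
  refine iInf_congr_Prop ⟨fun hf => hf.congr h, fun hf => hf.congr h.symm⟩ fun _ => rfl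

/-- The norm of `H^σ_p` is controlled by the modulus `‖e^{rΔ}f - f‖`. -/
lemma sobolevNorm_le {p : ℝ≥0∞} (hp : 1 ≤ p) (hp' : p ≠ ⊤) {σ : ℝ} {f : ℝ → ℝ}
    (hfm : Measurable f) (hf : MemLp f p muI) {l : ℝ → ℝ≥0∞}
    (hl : ∀ r, 0 < r → eLpNorm (fun x => heatSemigroup r f x - f x) p muI ≤ l r)
    (hfin : ∫⁻ r in Ioi 0, ENNReal.ofReal (r ^ (-(1 + σ / 2))) * l r ≠ ⊤) :
    sobolevNorm p σ f ≤ ENNReal.ofReal |(Real.Gamma (-σ / 2))⁻¹| *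
      ∫⁻ r in Ioi 0, ENNReal.ofReal (r ^ (-(1 + σ / 2))) * l r := by
  set G := (Real.Gamma (-σ / 2))⁻¹
  set F : ℝ → ℝ → ℝ := fun r x => (heatSemigroup r f x - f x) / r ^ (1 + σ / 2)
  have hfa : AEStronglyMeasurable f muI := hfm.aestronglyMeasurable
  have hFm : Measurable (Function.uncurry F) :=
    ((measurable_heatSemigroup_uncurry hfa).sub (hfm.comp measurable_snd)).div
      (measurable_fst.pow_const _)
  set φ : ℝ → ℝ≥0∞ := fun r => ENNReal.ofReal (r ^ (-(1 + σ / 2))) * l r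
  have hFn : ∀ r, 0 < r → eLpNorm (F r) p muI ≤ φ r := fun r hr => by
    have e : F r = (r ^ (-(1 + σ / 2))) • fun x => heatSemigroup r f x - f x := by
      funext x
      simp only [F, Pi.smul_apply, smul_eq_mul, Real.rpow_neg hr.le]
      rw [div_eq_inv_mul]
    rw [e, eLpNorm_const_smul, Real.enorm_of_nonneg (by positivity)]
    exact mul_le_mul_right (hl r hr) _
  have hset : ∀ S : Set ℝ, MeasurableSet S → S ⊆ Ioi 0 →
      eLpNorm (fun x => ∫⁻ r in S, ‖F r x‖ₑ) p muI ≤ ∫⁻ r in S, φ r := fun S hS hS0 => by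
    refine (eLpNorm_lintegral_le hp hp' (F := fun r x => ‖F r x‖ₑ) hFm.enorm).trans ?_
    refine setLIntegral_mono' hS fun r hr => ?_
    rw [eLpNorm_enorm]
    exact hFn r (hS0 hr)
  have hmeas : Measurable fun x => ∫⁻ r in Ioi 0, ‖F r x‖ₑ :=
    Measurable.lintegral_prod_left' (f := fun q : ℝ × ℝ => ‖F q.1 q.2‖ₑ) hFm.enorm
  -- Minkowski's inequality shows that the integral down to `r = 0` converges absolutely for almost
  -- every `x`, so it defines the candidate `g` pointwise.
  have hint : ∀ᵐ x ∂muI, IntegrableOn (fun r => F r x) (Ioi 0) := by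
    have h1 : eLpNorm (fun x => ∫⁻ r in Ioi 0, ‖F r x‖ₑ) p muI < ⊤ :=
      (hset _ measurableSet_Ioi Subset.rfl).trans_lt (lt_top_iff_ne_top.2 hfin)
    rw [eLpNorm_ennreal_eq hp hp'] at h1
    have hq := one_le_toReal hp hp'
    have h2 : ∫⁻ x, (∫⁻ r in Ioi 0, ‖F r x‖ₑ) ^ p.toReal ∂muI ≠ ⊤ := by
      intro h
      rw [h, ENNReal.top_rpow_of_pos (by positivity)] at h1
      exact lt_irrefl _ h1
    filter_upwards [ae_lt_top (hmeas.pow_const _) h2] with x hx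
    refine ⟨(hFm.comp measurable_prodMk_right).aestronglyMeasurable, ?_⟩
    rw [HasFiniteIntegral, lt_top_iff_ne_top]
    intro h
    rw [h, ENNReal.top_rpow_of_pos (by linarith)] at hx
    exact lt_irrefl _ hx
  set g : ℝ → ℝ := fun x => G * ∫ r in Ioi 0, F r x
  have hgm : Measurable g := by
    refine Measurable.const_mul (StronglyMeasurable.measurable ?_) G
    exact StronglyMeasurable.integral_prod_left (f := F) hFm.stronglyMeasurable
  have hmulG : ∀ (v : ℝ → ℝ) (u : ℝ → ℝ≥0∞) (c : ℝ≥0∞), (∀ᵐ x ∂muI, ‖v x‖ₑ ≤ ENNReal.ofReal |G| * u x) →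
      eLpNorm u p muI ≤ c → eLpNorm v p muI ≤ ENNReal.ofReal |G| * c := fun v u c hv hu => by
    have h2 := eLpNorm_le_nnreal_smul_eLpNorm_of_ae_le_mul' (c := |G|.toNNReal) (p := p)
      (f := v) (g := u) (μ := muI) (by simpa [ENNReal.ofReal] using hv)
    refine h2.trans ?_
    rw [ENNReal.smul_def, smul_eq_mul]
    exact mul_le_mul_right hu _
  have hgn : eLpNorm g p muI ≤ ENNReal.ofReal |G| * ∫⁻ r in Ioi 0, φ r := by
    refine hmulG g _ _ (ae_of_all _ fun x => ?_) (hset _ measurableSet_Ioi Subset.rfl)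
    simp only [g]
    rw [enorm_mul, Real.enorm_eq_ofReal_abs G]
    exact mul_le_mul_right (enorm_integral_le_lintegral_enorm _) _
  have hlap : HasFracLap p σ f g := by
    refine ⟨hf, ⟨hgm.aestronglyMeasurable, hgn.trans_lt
      (ENNReal.mul_lt_top ENNReal.ofReal_lt_top (lt_top_iff_ne_top.2 hfin))⟩, ?_⟩
    -- The truncation error is the part of the integral over `(0,δ]`, which tends to zero by
    -- absolute continuity.
    have hzero : Tendsto (fun δ : ℝ => ENNReal.ofReal |G| * ∫⁻ r in Ioc 0 δ, φ r)
        (𝓝[>] 0) (𝓝 0) := by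
      have h0 : Tendsto (fun δ : ℝ => ∫⁻ r in Ioc 0 δ, φ r ∂(volume.restrict (Ioi 0)))
          (𝓝[>] 0) (𝓝 0) := by
        refine tendsto_setLIntegral_zero hfin ?_
        have h1 : Tendsto (fun δ : ℝ => ENNReal.ofReal δ) (𝓝[>] 0) (𝓝 0) := by
          have := (ENNReal.continuous_ofReal.tendsto (0 : ℝ)).mono_left
            (nhdsWithin_le_nhds (s := Ioi 0))
          simpa using this
        refine tendsto_of_tendsto_of_tendsto_of_le_of_le tendsto_const_nhds h1
          (fun _ => zero_le) fun δ => ?_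
        refine (Measure.restrict_le_self _).trans_eq ?_
        rw [Real.volume_Ioc, sub_zero]
      have h1 : ∀ δ : ℝ, ∫⁻ r in Ioc 0 δ, φ r ∂(volume.restrict (Ioi 0)) =
          ∫⁻ r in Ioc 0 δ, φ r := fun δ => by
        rw [Measure.restrict_restrict measurableSet_Ioc, inter_eq_left.2 Ioc_subset_Ioi_self]
      simp only [h1] at h0
      simpa using ENNReal.Tendsto.const_mul h0 (Or.inr (ENNReal.ofReal_ne_top (r := |G|)))
    refine tendsto_of_tendsto_of_tendsto_of_le_of_le' tendsto_const_nhds hzero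
      (Eventually.of_forall fun _ => zero_le) ?_
    filter_upwards [self_mem_nhdsWithin] with δ hδ
    have hδ0 : (0 : ℝ) < δ := hδ
    refine hmulG _ _ _ (hint.mono fun x hx => ?_) (hset (Ioc 0 δ) measurableSet_Ioc
      Ioc_subset_Ioi_self)
    have hsplit : ∫ r in Ioi 0, F r x = (∫ r in Ioc 0 δ, F r x) + ∫ r in Ioi δ, F r x := by
      rw [← setIntegral_union (Ioc_disjoint_Ioi le_rfl) measurableSet_Ioi
        (hx.mono_set Ioc_subset_Ioi_self) (hx.mono_set (Ioi_subset_Ioi hδ0.le)),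
        Ioc_union_Ioi_eq_Ioi hδ0.le]
    have e : fracLapTrunc σ δ f x - g x = -(G * ∫ r in Ioc 0 δ, F r x) := by
      simp only [fracLapTrunc, g, hsplit]
      ring
    rw [e, enorm_neg, enorm_mul, Real.enorm_eq_ofReal_abs G]
    exact mul_le_mul_right (enorm_integral_le_lintegral_enorm _) _
  unfold sobolevNorm
  exact (iInf₂_le g hlap).trans hgn

/-! ### Bounds for Duhamel terms in divergence form -/

lemma ofReal_mul_le_mul_ofReal {C C' M x y : ℝ} (hC' : 0 ≤ C') (hM : 0 ≤ M)
    (h : C * x ≤ C' * y) (n : ℝ≥0∞) :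
    ENNReal.ofReal (C * x * M) * n ≤ ENNReal.ofReal (C' * M) * (n * ENNReal.ofReal y) := by
  calc ENNReal.ofReal (C * x * M) * n ≤ ENNReal.ofReal (C' * M * y) * n := by
        refine mul_le_mul_left (ENNReal.ofReal_le_ofReal ?_) n
        nlinarith
    _ = _ := by
        rw [ENNReal.ofReal_mul (by positivity)]
        ring

/-- The growth in `r` of the time increments of length `r` of a kernel at time `τ`. -/
def modulus (b c r τ : ℝ) : ℝ := if r ≤ τ then r * τ ^ (c - 1) else r ^ b * τ ^ (c - b)

/-- Uniformity in `η`: for exponents `a ≤ 0` one has `(τ+η)^a ≤ τ^a`, and the one positive exponent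
in the first bound is handled by `τ ≤ T`, `η ≤ 1`. Increments in time use the mean value bound for
`r ≤ τ` and the triangle inequality for `r > τ`. In the latter case `η ≤ r` gives `τ + η + r ≤ 3r`.
-/
lemma divSemigroup_regularized_bounds (γ T : ℝ) (hγ : 0 ≤ γ) (hγ1 : γ ≤ 1) : ∃ C : ℝ, 0 ≤ C ∧
    ∀ (p : ℝ≥0∞), 1 ≤ p → p ≠ ⊤ → ∀ τ, 0 < τ → τ ≤ T → ∀ η, 0 < η →
      ∀ (M : ℝ) (V f f' : ℝ → ℝ), HolderBound γ M V → HasIntegrableDeriv f f' →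
      (η ≤ 1 → eLpNorm (divSemigroup (τ + η) V f f') p muI ≤ ENNReal.ofReal (C * M) *
        (eLpNorm f p muI * powKer ((1 + γ) / 2) τ + eLpNorm f' p muI * powKer 1 τ)) ∧
      eLpNorm (divSemigroupDx (τ + η) V f f') p muI ≤ ENNReal.ofReal (C * M) *
        (eLpNorm f p muI * powKer (γ / 2) τ + eLpNorm f' p muI * powKer ((1 + γ) / 2) τ) ∧
      ∀ r, η ≤ r → eLpNorm (fun x => divSemigroup (τ + η + r) V f f' x -
          divSemigroup (τ + η) V f f' x) p muI ≤ ENNReal.ofReal (C * M) *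
        (eLpNorm f p muI * ENNReal.ofReal (modulus 0 ((γ - 1) / 2) r τ) +
          eLpNorm f' p muI * ENNReal.ofReal (modulus (γ / 2) (γ / 2) r τ)) := by
  obtain ⟨C, hC, h⟩ := eLpNorm_divSemigroup_le γ hγ hγ1
  have hT1 : (0 : ℝ) ≤ |T| + 1 := by positivity
  -- The `6` accounts for two terms, each with `(3r)^(γ/2) ≤ 3 r^(γ/2)`; the power of `|T| + 1`
  -- bounds `(τ + η)^(γ/2)`.
  set C' := 6 * C * (1 + (|T| + 1) ^ (γ / 2))
  have hpos : 0 ≤ (|T| + 1) ^ (γ / 2) := by positivity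
  have hC' : 0 ≤ C' := by positivity
  have hCC : 6 * C ≤ C' := le_mul_of_one_le_right (by positivity) (by linarith)
  have hCT : C * (|T| + 1) ^ (γ / 2) ≤ C' := by
    simp only [C']
    nlinarith [mul_nonneg hC hpos]
  refine ⟨C', hC', fun p hp hp' τ hτ hτT η hη M V f f' hV hf => ?_⟩
  have hM := hV.nonneg
  have hτη : 0 < τ + η := by positivity
  have hneg : ∀ a : ℝ, a ≤ 0 → (τ + η) ^ a ≤ τ ^ a := fun a ha =>
    Real.rpow_le_rpow_of_nonpos hτ (by linarith) ha
  have hterm : ∀ a : ℝ, a ≤ 0 → C * (τ + η) ^ a ≤ C' * τ ^ a := fun a ha =>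
    mul_le_mul (by linarith) (hneg a ha) (by positivity) hC'
  have e1 : (1 + γ) / 2 - 1 = (γ - 1) / 2 := by ring
  have e2 : γ / 2 - 1 = (γ - 2) / 2 := by ring
  refine ⟨fun hη1 => ?_, ?_, fun r hr => ?_⟩
  · refine (h p hp hp' (τ + η) hτη M V f f' hV hf).1.trans ?_
    rw [mul_add, powKer_of_pos _ hτ, powKer_of_pos _ hτ, e1]
    refine add_le_add (ofReal_mul_le_mul_ofReal hC' hM (hterm _ (by linarith)) _)
      (ofReal_mul_le_mul_ofReal hC' hM ?_ _)
    rw [sub_self, Real.rpow_zero, mul_one]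
    refine le_trans ?_ hCT
    have := le_abs_self T
    exact mul_le_mul_of_nonneg_left
      (Real.rpow_le_rpow hτη.le (by linarith) (by positivity)) hC
  · refine (h p hp hp' (τ + η) hτη M V f f' hV hf).2.1.trans ?_
    rw [mul_add, powKer_of_pos _ hτ, powKer_of_pos _ hτ, e1, e2]
    exact add_le_add (ofReal_mul_le_mul_ofReal hC' hM (hterm _ (by linarith)) _)
      (ofReal_mul_le_mul_ofReal hC' hM (hterm _ (by linarith)) _)
  · have hr0 : 0 < r := by linarith
    rw [mul_add]
    by_cases hrτ : r ≤ τ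
    · refine ((h p hp hp' (τ + η) hτη M V f f' hV hf).2.2 r hr0.le (by linarith)).trans ?_
      have hm : ∀ a c : ℝ, a ≤ 0 → a = c - 1 → ∀ b, C * r * (τ + η) ^ a ≤
          C' * modulus b c r τ := fun a c ha hac b => by
        rw [modulus, if_pos hrτ, ← hac]
        have := mul_le_mul_of_nonneg_left (hterm a ha) hr0.le
        linarith
      rw [mul_assoc C r, mul_assoc C r]
      exact add_le_add
        (ofReal_mul_le_mul_ofReal hC' hM
          (by rw [← mul_assoc]; exact hm _ _ (by linarith) (by ring) _) _)
        (ofReal_mul_le_mul_ofReal hC' hM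
          (by rw [← mul_assoc]; exact hm _ _ (by linarith) (by ring) _) _)
    · have hτr := (not_le.1 hrτ).le
      have b1 := (h p hp hp' (τ + η + r) (by positivity) M V f f' hV hf).1
      have b2 := (h p hp hp' (τ + η) hτη M V f f' hV hf).1
      have hmeas : ∀ ρ : ℝ, AEStronglyMeasurable (divSemigroup ρ V f f') muI := fun ρ => by
        have k1 := aestronglyMeasurable_kernel_integral (μ := muI) (k := fun x y => kDy ρ x y * V y)
          ((measurable_kDy_fix ρ).mul (hV.measurable.comp measurable_snd)) hf.integrable_self.1
        refine AEStronglyMeasurable.neg ?_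
        exact AEStronglyMeasurable.integral_prod_right'
          (f := fun q : ℝ × ℝ => (kDy ρ q.1 q.2 * f q.2 + dirichletKernel ρ q.1 q.2 * f' q.2) * V q.2)
          ((((measurable_kDy_fix ρ).aestronglyMeasurable.mul hf.integrable_self.1.comp_snd).add
            ((measurable_dirichletKernel_fix ρ).aestronglyMeasurable.mul
              hf.integrable.1.comp_snd)).mul
            (hV.measurable.comp measurable_snd).aestronglyMeasurable)
      refine (eLpNorm_sub_le (hmeas _) (hmeas _) hp).trans ((add_le_add b1 b2).trans ?_)
      rw [add_add_add_comm, ← add_mul, ← add_mul,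
        ← ENNReal.ofReal_add (by positivity) (by positivity),
        ← ENNReal.ofReal_add (by positivity) (by positivity), ← add_mul, ← add_mul, ← mul_add,
        ← mul_add]
      refine add_le_add (ofReal_mul_le_mul_ofReal hC' hM ?_ _)
        (ofReal_mul_le_mul_ofReal hC' hM ?_ _)
      · rw [modulus, if_neg hrτ, Real.rpow_zero, one_mul, sub_zero]
        have h1 : (τ + η + r) ^ ((γ - 1) / 2) ≤ τ ^ ((γ - 1) / 2) :=
          Real.rpow_le_rpow_of_nonpos hτ (by linarith) (by linarith)
        have h2 := hneg ((γ - 1) / 2) (by linarith)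
        have h3 : 0 ≤ τ ^ ((γ - 1) / 2) := by positivity
        calc _ ≤ C * (τ ^ ((γ - 1) / 2) + τ ^ ((γ - 1) / 2)) := by gcongr
          _ = 2 * C * τ ^ ((γ - 1) / 2) := by ring
          _ ≤ _ := by
            gcongr
            linarith
      · rw [modulus, if_neg hrτ, sub_self, Real.rpow_zero, mul_one]
        have h3 : (3 * r) ^ (γ / 2) ≤ 3 * r ^ (γ / 2) := by
          rw [Real.mul_rpow (by norm_num) hr0.le]
          have : (3 : ℝ) ^ (γ / 2) ≤ 3 ^ (1 : ℝ) :=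
            Real.rpow_le_rpow_of_exponent_le (by norm_num) (by linarith)
          rw [Real.rpow_one] at this
          gcongr
        have h1 : (τ + η + r) ^ (γ / 2) ≤ (3 * r) ^ (γ / 2) :=
          Real.rpow_le_rpow (by positivity) (by linarith) (by positivity)
        have h2 : (τ + η) ^ (γ / 2) ≤ (3 * r) ^ (γ / 2) :=
          Real.rpow_le_rpow (by positivity) (by linarith) (by positivity)
        have h4 : 0 ≤ r ^ (γ / 2) := by positivity
        calc _ ≤ C * (3 * r ^ (γ / 2) + 3 * r ^ (γ / 2)) := by
              refine mul_le_mul_of_nonneg_left ?_ hC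
              linarith
          _ = 6 * C * r ^ (γ / 2) := by ring
          _ ≤ _ := by gcongr

lemma measurable_modulus (b c : ℝ) : Measurable fun q : ℝ × ℝ => modulus b c q.1 q.2 :=
  Measurable.ite (measurableSet_le measurable_fst measurable_snd)
    (measurable_fst.mul (measurable_snd.pow_const _))
    ((measurable_fst.pow_const _).mul (measurable_snd.pow_const _))

/-- On `r ≤ τ` the integrand is `τ^(c-1) r^(-σ/2)`, integrable at zero since `σ < 2`. On `r > τ` it
is `τ^(c-b) r^(b-σ/2-1)`, integrable at infinity since `b < σ/2`. Both pieces scale like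
`τ^(c-σ/2)`. -/
lemma lintegral_modulus_le {b c σ : ℝ} (hσ : σ < 2) (hb : b < σ / 2) : ∃ C : ℝ, 0 ≤ C ∧
    ∀ τ, 0 < τ → ∫⁻ r in Ioi 0, ENNReal.ofReal (r ^ (-(1 + σ / 2))) *
      ENNReal.ofReal (modulus b c r τ) ≤ ENNReal.ofReal C * powKer (c - σ / 2 + 1) τ := by
  have h1 : 0 < 1 - σ / 2 := by linarith
  have h2 : 0 < σ / 2 - b := by linarith
  refine ⟨(1 - σ / 2)⁻¹ + (σ / 2 - b)⁻¹, by positivity, fun τ hτ => ?_⟩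
  rw [powKer_of_pos _ hτ, show c - σ / 2 + 1 - 1 = c - σ / 2 by ring, ← Ioc_union_Ioi_eq_Ioi hτ.le,
    lintegral_union measurableSet_Ioi (Ioc_disjoint_Ioi le_rfl),
    ENNReal.ofReal_add (by positivity) (by positivity), add_mul]
  refine add_le_add ?_ ?_
  · have e : ∀ r ∈ Ioc 0 τ, ENNReal.ofReal (r ^ (-(1 + σ / 2))) *
        ENNReal.ofReal (modulus b c r τ) =
        ENNReal.ofReal (τ ^ (c - 1)) * powKer (1 - σ / 2) r := fun r hr => by
      have hr0 : 0 < r := hr.1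
      rw [modulus, if_pos hr.2, powKer_of_pos _ hr0, ← ENNReal.ofReal_mul (by positivity),
        ← ENNReal.ofReal_mul (by positivity), ← mul_assoc]
      congr 1
      nth_rewrite 2 [← Real.rpow_one r]
      rw [← Real.rpow_add hr0, mul_comm]
      congr 2
      ring
    rw [setLIntegral_congr_fun measurableSet_Ioc e,
      lintegral_const_mul _ (measurable_powKer _), ← setLIntegral_congr Ioo_ae_eq_Ioc,
      lintegral_powKer h1 hτ.le, ← ENNReal.ofReal_mul (by positivity),
      ← ENNReal.ofReal_mul (by positivity)]
    refine ENNReal.ofReal_le_ofReal (le_of_eq ?_)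
    rw [div_eq_mul_inv, ← mul_assoc, ← Real.rpow_add hτ, mul_comm]
    congr 2
    ring
  · have e : ∀ r ∈ Ioi τ, ENNReal.ofReal (r ^ (-(1 + σ / 2))) *
        ENNReal.ofReal (modulus b c r τ) =
        ENNReal.ofReal (τ ^ (c - b)) * ENNReal.ofReal (r ^ (b - σ / 2 - 1)) := fun r hr => by
      have hrτ : τ < r := hr
      have hr0 : 0 < r := hτ.trans hrτ
      rw [modulus, if_neg (not_le.2 hrτ), ← ENNReal.ofReal_mul (by positivity),
        ← ENNReal.ofReal_mul (by positivity), ← mul_assoc, ← Real.rpow_add hr0, mul_comm]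
      congr 3
      ring
    rw [setLIntegral_congr_fun measurableSet_Ioi e, lintegral_const_mul _ (by fun_prop),
      ← ofReal_integral_eq_lintegral_ofReal
        (integrableOn_Ioi_rpow_of_lt (by linarith) hτ)
        (ae_restrict_of_forall_mem measurableSet_Ioi fun r hr =>
          Real.rpow_nonneg (hτ.trans hr).le _),
      integral_Ioi_rpow_of_lt (by linarith) hτ, ← ENNReal.ofReal_mul (by positivity),
      ← ENNReal.ofReal_mul (by positivity)]
    refine ENNReal.ofReal_le_ofReal (le_of_eq ?_)
    rw [show b - σ / 2 - 1 + 1 = -(σ / 2 - b) by ring, neg_div_neg_eq, div_eq_mul_inv, ← mul_assoc,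
      ← Real.rpow_add hτ, mul_comm]
    congr 2
    ring

/-! ### Source terms and regularized Duhamel integrals. -/

/-- The data of a source term `U V'` on `(0,T)`. -/
structure IsSource (p : ℝ≥0∞) (γ M T : ℝ) (V : ℝ → ℝ) (U U' : ℝ → ℝ → ℝ) : Prop where
  holder : HolderBound γ M V
  meas : Measurable (Function.uncurry U)
  meas' : Measurable (Function.uncurry U')
  deriv : ∀ᵐ s ∂volume.restrict (Ioo 0 T), HasIntegrableDeriv (U s) (U' s)
  finite : ∫⁻ s in Ioo 0 T, (eLpNorm (U s) p muI + eLpNorm (U' s) p muI) ≠ ⊤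

/-- The integrand of the Duhamel term at time `t`, regularized by `e^{ηΔ}`. -/
def divSource (t : ℝ) (V : ℝ → ℝ) (U U' : ℝ → ℝ → ℝ) (η s x : ℝ) : ℝ :=
  divSemigroup (t - s + η) V (U s) (U' s) x

/-- The space derivative of `divSource`. -/
def divSourceDx (t : ℝ) (V : ℝ → ℝ) (U U' : ℝ → ℝ → ℝ) (η s x : ℝ) : ℝ :=
  divSemigroupDx (t - s + η) V (U s) (U' s) x

lemma measurable_eLpNorm_section {p : ℝ≥0∞} (hp : 1 ≤ p) (hp' : p ≠ ⊤) {U : ℝ → ℝ → ℝ}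
    (hU : Measurable (Function.uncurry U)) : Measurable fun s => eLpNorm (U s) p muI := by
  have e : (fun s => eLpNorm (U s) p muI) =
      fun s => (∫⁻ x, ‖U s x‖ₑ ^ p.toReal ∂muI) ^ (1 / p.toReal) := by
    funext s
    rw [← eLpNorm_enorm, eLpNorm_ennreal_eq hp hp']
  rw [e]
  refine Measurable.pow_const ?_ _
  exact Measurable.lintegral_prod_right' (f := fun q : ℝ × ℝ => ‖U q.1 q.2‖ₑ ^ p.toReal)
    (hU.enorm.pow_const _)

lemma measurable_source_integral {k k' : ℝ → ℝ → ℝ → ℝ}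
    (hk : Measurable fun q : ℝ × ℝ × ℝ => k q.1 q.2.1 q.2.2)
    (hk' : Measurable fun q : ℝ × ℝ × ℝ => k' q.1 q.2.1 q.2.2) {V : ℝ → ℝ} (hV : Measurable V)
    {U U' : ℝ → ℝ → ℝ} (hU : Measurable (Function.uncurry U))
    (hU' : Measurable (Function.uncurry U')) (t η : ℝ) :
    Measurable (Function.uncurry fun s x =>
      -∫ y, (k (t - s + η) x y * U s y + k' (t - s + η) x y * U' s y) * V y ∂muI) := by
  have m1 : Measurable fun z : (ℝ × ℝ) × ℝ => (t - z.1.1 + η, z.1.2, z.2) := by fun_prop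
  have m2 : Measurable fun z : (ℝ × ℝ) × ℝ => (z.1.1, z.2) := by fun_prop
  have : Measurable fun z : (ℝ × ℝ) × ℝ => (k (t - z.1.1 + η) z.1.2 z.2 * U z.1.1 z.2 +
      k' (t - z.1.1 + η) z.1.2 z.2 * U' z.1.1 z.2) * V z.2 :=
    (((hk.comp m1).mul (hU.comp m2)).add ((hk'.comp m1).mul (hU'.comp m2))).mul
      (hV.comp measurable_snd)
  exact (StronglyMeasurable.integral_prod_right'
    (f := fun z : (ℝ × ℝ) × ℝ => (k (t - z.1.1 + η) z.1.2 z.2 * U z.1.1 z.2 +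
      k' (t - z.1.1 + η) z.1.2 z.2 * U' z.1.1 z.2) * V z.2) this.stronglyMeasurable).measurable.neg

namespace IsSource

variable {p : ℝ≥0∞} {γ M T : ℝ} {V : ℝ → ℝ} {U U' : ℝ → ℝ → ℝ}

lemma measurable_divSource (h : IsSource p γ M T V U U') (t η : ℝ) :
    Measurable (Function.uncurry (divSource t V U U' η)) :=
  measurable_source_integral measurable_kDy measurable_dirichletKernel h.holder.measurable
    h.meas h.meas' t η

lemma measurable_divSourceDx (h : IsSource p γ M T V U U') (t η : ℝ) :
    Measurable (Function.uncurry (divSourceDx t V U U' η)) :=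
  measurable_source_integral measurable_kDxy measurable_kDx h.holder.measurable
    h.meas h.meas' t η

lemma deriv_of_le (h : IsSource p γ M T V U U') {t : ℝ} (ht : t ≤ T) :
    ∀ᵐ s ∂volume.restrict (Ioo 0 t), HasIntegrableDeriv (U s) (U' s) :=
  ae_restrict_of_ae_restrict_of_subset (Ioo_subset_Ioo_right ht) h.deriv

/-- For `s ≤ t` the kernels are taken at times at least `η`, where they are bounded. The regularized
integrand is thus integrable in `s` although the norms of the source are only in `L_1` in time. -/
lemma enorm_divSource_le (h : IsSource p γ M T V U U') (hp : 1 ≤ p) {η : ℝ} (hη : 0 < η) :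
    ∃ C : ℝ, 0 ≤ C ∧ ∀ t x s, x ∈ Ioo 0 Real.pi → s ≤ t →
      ∫⁻ y, ‖(kDy (t - s + η) x y * U s y + dirichletKernel (t - s + η) x y * U' s y) * V y‖ₑ ∂muI ≤
        ENNReal.ofReal C * (eLpNorm (U s) p muI + eLpNorm (U' s) p muI) := by
  obtain ⟨B, hB, hb⟩ := exists_kernel_bound hη
  have hM := h.holder.nonneg
  have hpi := Real.pi_pos
  refine ⟨B * M * (1 + Real.pi), by positivity, fun t x s hx hs => ?_⟩
  have hUs : Measurable (U s) := h.meas.comp measurable_prodMk_left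
  have hUs' : Measurable (U' s) := h.meas'.comp measurable_prodMk_left
  calc _ ≤ ∫⁻ y, ENNReal.ofReal (B * M) * (‖U s y‖ₑ + ‖U' s y‖ₑ) ∂muI := by
        refine lintegral_mono_ae (ae_muI_mem.mono fun y hy => ?_)
        have hk := hb (t - s + η) (by linarith) x hx y hy
        rw [← enorm_norm, Real.enorm_of_nonneg (norm_nonneg _), ← ofReal_norm, ← ofReal_norm,
          ← ENNReal.ofReal_add (norm_nonneg _) (norm_nonneg _),
          ← ENNReal.ofReal_mul (by positivity)]
        refine ENNReal.ofReal_le_ofReal ?_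
        rw [norm_mul]
        calc _ ≤ (B * ‖U s y‖ + B * ‖U' s y‖) * M := by
              refine mul_le_mul ((norm_add_le _ _).trans (add_le_add ?_ ?_))
                (h.holder.bound y hy) (norm_nonneg _) (by positivity)
              · rw [norm_mul]
                exact mul_le_mul_of_nonneg_right hk.2.2.1 (norm_nonneg _)
              · rw [norm_mul]
                exact mul_le_mul_of_nonneg_right hk.1 (norm_nonneg _)
          _ = _ := by ring
    _ = ENNReal.ofReal (B * M) * (eLpNorm (U s) 1 muI + eLpNorm (U' s) 1 muI) := by
        rw [lintegral_const_mul' _ _ ENNReal.ofReal_ne_top, lintegral_add_left hUs.enorm,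
          eLpNorm_one_eq_lintegral_enorm, eLpNorm_one_eq_lintegral_enorm]
    _ ≤ ENNReal.ofReal (B * M) * (ENNReal.ofReal (1 + Real.pi) * eLpNorm (U s) p muI +
          ENNReal.ofReal (1 + Real.pi) * eLpNorm (U' s) p muI) := by
        gcongr
        · exact eLpNorm_one_le hp hUs.aestronglyMeasurable
        · exact eLpNorm_one_le hp hUs'.aestronglyMeasurable
    _ = _ := by
        rw [ENNReal.ofReal_mul (p := B * M) (by positivity)]
        ring

lemma lintegral_ne_top (h : IsSource p γ M T V U U') {t : ℝ} (ht : t ≤ T) :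
    ∫⁻ s in Ioo 0 t, (eLpNorm (U s) p muI + eLpNorm (U' s) p muI) ≠ ⊤ :=
  ne_top_of_le_ne_top h.finite (lintegral_mono_set (Ioo_subset_Ioo_right ht))

lemma integrable_divSource (h : IsSource p γ M T V U U') (hp : 1 ≤ p) {t η x : ℝ} (ht : t ≤ T)
    (hη : 0 < η) (hx : x ∈ Ioo 0 Real.pi) :
    Integrable (fun s => divSource t V U U' η s x) (volume.restrict (Ioo 0 t)) := by
  obtain ⟨C, hC, hb⟩ := h.enorm_divSource_le hp hη
  refine ⟨((h.measurable_divSource t η).comp measurable_prodMk_right).aestronglyMeasurable, ?_⟩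
  refine lt_of_le_of_lt (b := ENNReal.ofReal C *
    ∫⁻ s in Ioo 0 t, (eLpNorm (U s) p muI + eLpNorm (U' s) p muI)) ?_
    (ENNReal.mul_lt_top ENNReal.ofReal_lt_top (lt_top_iff_ne_top.2 (h.lintegral_ne_top ht)))
  rw [← lintegral_const_mul' _ _ ENNReal.ofReal_ne_top]
  refine setLIntegral_mono' measurableSet_Ioo fun s hs => ?_
  simp only [divSource, divSemigroup, enorm_neg]
  exact (enorm_integral_le_lintegral_enorm _).trans (hb t x s hx hs.2.le)

end IsSource

/-- The convolution of the norms of `U` and `U'` with power kernels. -/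
def srcConv (p : ℝ≥0∞) (θ θ' : ℝ) (U U' : ℝ → ℝ → ℝ) (t : ℝ) : ℝ≥0∞ :=
  ((fun s => eLpNorm (U s) p muI) ⋆ₗ[volume] powKer θ) t +
    ((fun s => eLpNorm (U' s) p muI) ⋆ₗ[volume] powKer θ') t

lemma setLIntegral_le_srcConv {p : ℝ≥0∞} (hp : 1 ≤ p) (hp' : p ≠ ⊤) {U U' : ℝ → ℝ → ℝ}
    (hU : Measurable (Function.uncurry U)) (θ θ' t c : ℝ) :
    ∫⁻ s in Ioo 0 t, ENNReal.ofReal c * (eLpNorm (U s) p muI * powKer θ (t - s) +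
      eLpNorm (U' s) p muI * powKer θ' (t - s)) ≤ ENNReal.ofReal c * srcConv p θ θ' U U' t := by
  have hm : Measurable fun s => eLpNorm (U s) p muI * powKer θ (t - s) :=
    (measurable_eLpNorm_section hp hp' hU).mul ((measurable_powKer θ).comp (by fun_prop))
  rw [lintegral_const_mul' _ _ ENNReal.ofReal_ne_top, lintegral_add_left hm]
  refine mul_le_mul_right (add_le_add ?_ ?_) _
  · refine (setLIntegral_le_lintegral _ _).trans_eq ?_
    simp only [lconvolution_def, sub_eq_neg_add]
  · refine (setLIntegral_le_lintegral _ _).trans_eq ?_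
    simp only [lconvolution_def, sub_eq_neg_add]

/-- Bounds for a function given by two Duhamel terms, from its regularizations. -/
lemma exists_duhamel_bound (γ T : ℝ) (hγ : 0 ≤ γ) (hγ1 : γ ≤ 1) : ∃ C : ℝ, 0 ≤ C ∧
    ∀ (p : ℝ≥0∞), 1 ≤ p → p ≠ ⊤ → ∀ (M₁ M₂ : ℝ) (V₁ V₂ : ℝ → ℝ) (U₁ U₁' U₂ U₂' : ℝ → ℝ → ℝ),
      IsSource p γ M₁ T V₁ U₁ U₁' → IsSource p γ M₂ T V₂ U₂ U₂' →
      ∀ t ∈ Ioo 0 T, ∀ (f f' : ℝ → ℝ) (h hx : ℝ → ℝ → ℝ) (A₀ A₁ : ℝ≥0∞), Integrable f muI →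
      (∀ x ∈ Ioo 0 Real.pi, HasDerivAt f (f' x) x) →
      (∀ η, Measurable (h η)) → (∀ η, Measurable (hx η)) →
      (∀ η, 0 < η → ∀ x ∈ Ioo 0 Real.pi, HasDerivAt (h η) (hx η x) x) →
      (∀ η, 0 < η → eLpNorm (h η) p muI ≤ A₀) → (∀ η, 0 < η → eLpNorm (hx η) p muI ≤ A₁) →
      (∀ η, 0 < η → ∀ x ∈ Ioo 0 Real.pi, heatSemigroup η f x = h η x +
        ∫ s in Ioo 0 t, (divSource t V₁ U₁ U₁' η s x + divSource t V₂ U₂ U₂' η s x)) →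
      eLpNorm f p muI ≤ A₀ + (ENNReal.ofReal (C * M₁) * srcConv p ((1 + γ) / 2) 1 U₁ U₁' t +
        ENNReal.ofReal (C * M₂) * srcConv p ((1 + γ) / 2) 1 U₂ U₂' t) ∧
      eLpNorm f' p muI ≤ A₁ +
        (ENNReal.ofReal (C * M₁) * srcConv p (γ / 2) ((1 + γ) / 2) U₁ U₁' t +
        ENNReal.ofReal (C * M₂) * srcConv p (γ / 2) ((1 + γ) / 2) U₂ U₂' t) := by
  obtain ⟨C, hC, hb⟩ := divSemigroup_regularized_bounds γ T hγ hγ1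
  refine ⟨C, hC, fun p hp hp' M₁ M₂ V₁ V₂ U₁ U₁' U₂ U₂' s1 s2 t ht f f' h hx A₀ A₁ hf hd hhm hhxm
    hhd hA₀ hA₁ heq => ?_⟩
  have hcont : ∀ θ θ' : ℝ, ∫⁻ s in Ioo 0 t,
      (ENNReal.ofReal (C * M₁) * (eLpNorm (U₁ s) p muI * powKer θ (t - s) +
        eLpNorm (U₁' s) p muI * powKer θ' (t - s)) +
      ENNReal.ofReal (C * M₂) * (eLpNorm (U₂ s) p muI * powKer θ (t - s) +
        eLpNorm (U₂' s) p muI * powKer θ' (t - s))) ≤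
      ENNReal.ofReal (C * M₁) * srcConv p θ θ' U₁ U₁' t +
        ENNReal.ofReal (C * M₂) * srcConv p θ θ' U₂ U₂' t := fun θ θ' => by
    have hm : Measurable fun s => ENNReal.ofReal (C * M₁) *
        (eLpNorm (U₁ s) p muI * powKer θ (t - s) + eLpNorm (U₁' s) p muI * powKer θ' (t - s)) := by
      have m1 := measurable_eLpNorm_section hp hp' s1.meas
      have m2 := measurable_eLpNorm_section hp hp' s1.meas'
      have m3 : ∀ θ, Measurable fun s => powKer θ (t - s) := fun θ =>
        (measurable_powKer θ).comp (by fun_prop)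
      exact ((m1.mul (m3 θ)).add (m2.mul (m3 θ'))).const_mul _
    rw [lintegral_add_left hm]
    exact add_le_add (setLIntegral_le_srcConv hp hp' s1.meas _ _ _ _)
      (setLIntegral_le_srcConv hp hp' s2.meas _ _ _ _)
  have hmem : ∀ᵐ s ∂volume.restrict (Ioo 0 t), s ∈ Ioo 0 t := ae_restrict_mem measurableSet_Ioo
  have hsec : ∀ {b : ℝ → ℝ → ℝ}, Measurable (Function.uncurry b) → ∀ s,
      AEStronglyMeasurable (b s) muI := fun hbm s =>
    (hbm.comp measurable_prodMk_left).aestronglyMeasurable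
  -- The range `0 < η ≤ 1`, encoded by `one_pos`, is the one in which the first bound of `hb` is
  -- uniform.
  have key := eLpNorm_le_of_regularization hp hp' hf hd (ν := volume.restrict (Ioo 0 t))
    (b := fun η s x => divSource t V₁ U₁ U₁' η s x + divSource t V₂ U₂ U₂' η s x)
    (bx := fun η s x => divSourceDx t V₁ U₁ U₁' η s x + divSourceDx t V₂ U₂ U₂' η s x)
    one_pos (fun η hη => heq η hη.1) hhm hhxm (fun η hη => hhd η hη.1) (fun η hη => hA₀ η hη.1)
    (fun η hη => hA₁ η hη.1)
    (fun η => (s1.measurable_divSource t η).add (s2.measurable_divSource t η))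
    (fun η => (s1.measurable_divSourceDx t η).add (s2.measurable_divSourceDx t η))
    (fun η hη x hxm => (s1.integrable_divSource hp ht.2.le hη.1 hxm).add
      (s2.integrable_divSource hp ht.2.le hη.1 hxm)) ?_
    (l₀ := fun s => ENNReal.ofReal (C * M₁) * (eLpNorm (U₁ s) p muI * powKer ((1 + γ) / 2) (t - s) +
        eLpNorm (U₁' s) p muI * powKer 1 (t - s)) +
      ENNReal.ofReal (C * M₂) * (eLpNorm (U₂ s) p muI * powKer ((1 + γ) / 2) (t - s) +
        eLpNorm (U₂' s) p muI * powKer 1 (t - s)))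
    (l₁ := fun s => ENNReal.ofReal (C * M₁) * (eLpNorm (U₁ s) p muI * powKer (γ / 2) (t - s) +
        eLpNorm (U₁' s) p muI * powKer ((1 + γ) / 2) (t - s)) +
      ENNReal.ofReal (C * M₂) * (eLpNorm (U₂ s) p muI * powKer (γ / 2) (t - s) +
        eLpNorm (U₂' s) p muI * powKer ((1 + γ) / 2) (t - s))) ?_ ?_
  · exact ⟨key.1.trans (add_le_add_right (hcont _ _) _),
      key.2.trans (add_le_add_right (hcont _ _) _)⟩
  · intro η hη
    filter_upwards [hmem, s1.deriv_of_le ht.2.le, s2.deriv_of_le ht.2.le] with s hs d1 d2 x hxm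
    have hτ : 0 < t - s + η := by linarith [hs.2, hη.1]
    exact (hasDerivAt_divSemigroup hτ s1.holder d1 hxm).add
      (hasDerivAt_divSemigroup hτ s2.holder d2 hxm)
  · intro η hη
    filter_upwards [hmem, s1.deriv_of_le ht.2.le, s2.deriv_of_le ht.2.le] with s hs d1 d2
    have hτ : 0 < t - s := by linarith [hs.2]
    have hτT : t - s ≤ T := by linarith [hs.1, ht.2]
    exact (eLpNorm_add_le (hsec (s1.measurable_divSource t η) s)
      (hsec (s2.measurable_divSource t η) s) hp).trans (add_le_add
      ((hb p hp hp' _ hτ hτT η hη.1 M₁ V₁ _ _ s1.holder d1).1 hη.2)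
      ((hb p hp hp' _ hτ hτT η hη.1 M₂ V₂ _ _ s2.holder d2).1 hη.2))
  · intro η hη
    filter_upwards [hmem, s1.deriv_of_le ht.2.le, s2.deriv_of_le ht.2.le] with s hs d1 d2
    have hτ : 0 < t - s := by linarith [hs.2]
    have hτT : t - s ≤ T := by linarith [hs.1, ht.2]
    exact (eLpNorm_add_le (hsec (s1.measurable_divSourceDx t η) s)
      (hsec (s2.measurable_divSourceDx t η) s) hp).trans (add_le_add
      (hb p hp hp' _ hτ hτT η hη.1 M₁ V₁ _ _ s1.holder d1).2.1
      (hb p hp hp' _ hτ hτT η hη.1 M₂ V₂ _ _ s2.holder d2).2.1)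

set_option maxHeartbeats 400000 in
/-- Bound in the fractional Sobolev norm for a function given by two Duhamel terms. -/
lemma exists_duhamel_sobolev_bound {β γ : ℝ} (T : ℝ) (hβ : 0 < β) (hβγ : β < γ) (hγ : γ < 1) :
    ∃ C : ℝ, 0 ≤ C ∧
    ∀ (p : ℝ≥0∞), 1 ≤ p → p ≠ ⊤ → ∀ (M₁ M₂ : ℝ) (V₁ V₂ : ℝ → ℝ) (U₁ U₁' U₂ U₂' : ℝ → ℝ → ℝ),
      IsSource p γ M₁ T V₁ U₁ U₁' → IsSource p γ M₂ T V₂ U₂ U₂' →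
      ∀ t ∈ Ioo 0 T, ∀ (f f' : ℝ → ℝ), Measurable f → MemLp f p muI →
      (∀ x ∈ Ioo 0 Real.pi, HasDerivAt f (f' x) x) →
      (∀ η, 0 < η → ∀ x ∈ Ioo 0 Real.pi, heatSemigroup η f x =
        ∫ s in Ioo 0 t, (divSource t V₁ U₁ U₁' η s x + divSource t V₂ U₂ U₂' η s x)) →
      srcConv p ((γ - β) / 2) ((1 + γ - β) / 2) U₁ U₁' t ≠ ⊤ →
      srcConv p ((γ - β) / 2) ((1 + γ - β) / 2) U₂ U₂' t ≠ ⊤ →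
      sobolevNorm p (1 + β) f ≤
        ENNReal.ofReal (C * M₁) * srcConv p ((γ - β) / 2) ((1 + γ - β) / 2) U₁ U₁' t +
        ENNReal.ofReal (C * M₂) * srcConv p ((γ - β) / 2) ((1 + γ - β) / 2) U₂ U₂' t := by
  obtain ⟨C, hC, hb⟩ := divSemigroup_regularized_bounds γ T (by linarith) hγ.le
  -- With `σ = 1 + β` the condition `σ < 2` at zero holds since `β < 1`, and the condition `b < σ/2`
  -- at infinity holds for both `b = 0` and `b = γ/2`.
  obtain ⟨D, hD, hd0⟩ := lintegral_modulus_le (b := 0) (c := (γ - 1) / 2) (σ := 1 + β)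
    (by linarith) (by linarith)
  obtain ⟨D', hD', hd1⟩ := lintegral_modulus_le (b := γ / 2) (c := γ / 2) (σ := 1 + β)
    (by linarith) (by linarith)
  set G := |(Real.Gamma (-(1 + β) / 2))⁻¹|
  have hG : 0 ≤ G := abs_nonneg _
  refine ⟨G * (C * (D + D')), by positivity, fun p hp hp' M₁ M₂ V₁ V₂ U₁ U₁' U₂ U₂' s1 s2 t ht f f'
    hfm hf hd heq fin1 fin2 => ?_⟩
  have hM₁ := s1.holder.nonneg
  have hM₂ := s2.holder.nonneg
  set μ₀ : ℝ → ℝ → ℝ≥0∞ := fun r τ => ENNReal.ofReal (modulus 0 ((γ - 1) / 2) r τ)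
  set μ₁ : ℝ → ℝ → ℝ≥0∞ := fun r τ => ENNReal.ofReal (modulus (γ / 2) (γ / 2) r τ)
  set k : ℝ → ℝ≥0∞ := fun r => ENNReal.ofReal (r ^ (-(1 + (1 + β) / 2)))
  set lam : ℝ → (ℝ → ℝ → ℝ) → (ℝ → ℝ → ℝ) → ℝ → ℝ → ℝ≥0∞ := fun M U U' r s =>
    ENNReal.ofReal (C * M) * (eLpNorm (U s) p muI * μ₀ r (t - s) +
      eLpNorm (U' s) p muI * μ₁ r (t - s))
  have hlm : ∀ (M : ℝ) (U U' : ℝ → ℝ → ℝ), Measurable (Function.uncurry U) →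
      Measurable (Function.uncurry U') → Measurable (Function.uncurry (lam M U U')) :=
    fun M U U' hU hU' => by
    have m1 := measurable_eLpNorm_section hp hp' hU
    have m2 := measurable_eLpNorm_section hp hp' hU'
    have m3 : ∀ b c : ℝ, Measurable fun q : ℝ × ℝ => ENNReal.ofReal (modulus b c q.1 (t - q.2)) :=
      fun b c => ((measurable_modulus b c).comp (f := fun q : ℝ × ℝ => (q.1, t - q.2))
        (by fun_prop)).ennreal_ofReal
    exact (((m1.comp measurable_snd).mul (m3 0 ((γ - 1) / 2))).add
      ((m2.comp measurable_snd).mul (m3 (γ / 2) (γ / 2)))).const_mul _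
  have hkm : Measurable k := by fun_prop
  have hint : ∀ (M : ℝ) (U U' : ℝ → ℝ → ℝ), 0 ≤ M → Measurable (Function.uncurry U) →
      Measurable (Function.uncurry U') →
      ∫⁻ r in Ioi 0, k r * ∫⁻ s in Ioo 0 t, lam M U U' r s ≤
        ENNReal.ofReal (C * (D + D') * M) * srcConv p ((γ - β) / 2) ((1 + γ - β) / 2) U U' t := by
    intro M U U' hM hU hU'
    have hsw : AEMeasurable (Function.uncurry fun r s => k r * lam M U U' r s)
        ((volume.restrict (Ioi 0)).prod (volume.restrict (Ioo 0 t))) :=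
      ((hkm.comp measurable_fst).mul (hlm M U U' hU hU')).aemeasurable
    simp_rw [← lintegral_const_mul' (k _) _ ENNReal.ofReal_ne_top]
    -- The `r`-integral is carried out first: for fixed `s` it converts the modulus into a power of
    -- `t - s`.
    rw [lintegral_lintegral_swap hsw]
    refine le_trans ?_ (setLIntegral_le_srcConv hp hp' hU _ _ _ _)
    refine setLIntegral_mono' measurableSet_Ioo fun s hs => ?_
    have hτ : 0 < t - s := by linarith [hs.2]
    have mμ : ∀ b c : ℝ, Measurable fun r => ENNReal.ofReal (modulus b c r (t - s)) :=
      fun b c => ((measurable_modulus b c).comp (f := fun r => (r, t - s))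
        (by fun_prop)).ennreal_ofReal
    have e : ∀ r, k r * lam M U U' r s = ENNReal.ofReal (C * M) *
        (eLpNorm (U s) p muI * (k r * μ₀ r (t - s)) +
          eLpNorm (U' s) p muI * (k r * μ₁ r (t - s))) := fun r => by
      simp only [lam]
      ring
    have n0 : Measurable fun r => k r * μ₀ r (t - s) := hkm.mul (mμ _ _)
    have n1 : Measurable fun r => k r * μ₁ r (t - s) := hkm.mul (mμ _ _)
    simp_rw [e]
    rw [lintegral_const_mul' _ _ ENNReal.ofReal_ne_top, lintegral_add_left (n0.const_mul _),
      lintegral_const_mul _ n0, lintegral_const_mul _ n1]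
    have h0 := hd0 (t - s) hτ
    have h1 := hd1 (t - s) hτ
    -- Here the relation between `β` and `γ` is decisive: the exponent `(γ - β)/2` must be positive
    -- for the remaining kernel to be integrable in `s`.
    rw [show (γ - 1) / 2 - (1 + β) / 2 + 1 = (γ - β) / 2 by ring] at h0
    rw [show γ / 2 - (1 + β) / 2 + 1 = (1 + γ - β) / 2 by ring] at h1
    calc _ ≤ ENNReal.ofReal (C * M) * (eLpNorm (U s) p muI *
            (ENNReal.ofReal (D + D') * powKer ((γ - β) / 2) (t - s)) + eLpNorm (U' s) p muI *
            (ENNReal.ofReal (D + D') * powKer ((1 + γ - β) / 2) (t - s))) := by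
          gcongr
          · exact h0.trans (mul_le_mul_left (ENNReal.ofReal_le_ofReal (by linarith)) _)
          · exact h1.trans (mul_le_mul_left (ENNReal.ofReal_le_ofReal (by linarith)) _)
      _ = _ := by
          rw [show C * (D + D') * M = C * M * (D + D') by ring,
            ENNReal.ofReal_mul (p := C * M) (by positivity)]
          ring
  have hl : ∀ r, 0 < r → eLpNorm (fun x => heatSemigroup r f x - f x) p muI ≤
      ∫⁻ s in Ioo 0 t, (lam M₁ U₁ U₁' r s + lam M₂ U₂ U₂' r s) := by
    intro r hr
    refine eLpNorm_heatSemigroup_sub_le hp hp' (hf.integrable hp) hd hr heq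
      (fun η => (s1.measurable_divSource t η).add (s2.measurable_divSource t η))
      (fun η hη x hxm => (s1.integrable_divSource hp ht.2.le hη hxm).add
        (s2.integrable_divSource hp ht.2.le hη hxm)) fun η hη => ?_
    filter_upwards [ae_restrict_mem measurableSet_Ioo, s1.deriv_of_le ht.2.le,
      s2.deriv_of_le ht.2.le] with s hs d1 d2
    have hτ : 0 < t - s := by linarith [hs.2]
    have hτT : t - s ≤ T := by linarith [hs.1, ht.2]
    have b1 := (hb p hp hp' _ hτ hτT η hη.1 M₁ V₁ _ _ s1.holder d1).2.2 r hη.2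
    have b2 := (hb p hp hp' _ hτ hτT η hη.1 M₂ V₂ _ _ s2.holder d2).2.2 r hη.2
    have hsec : ∀ {b : ℝ → ℝ → ℝ}, Measurable (Function.uncurry b) → ∀ s,
        AEStronglyMeasurable (b s) muI := fun hbm s =>
      (hbm.comp measurable_prodMk_left).aestronglyMeasurable
    have e : (fun x => divSource t V₁ U₁ U₁' (η + r) s x + divSource t V₂ U₂ U₂' (η + r) s x -
        (divSource t V₁ U₁ U₁' η s x + divSource t V₂ U₂ U₂' η s x)) =
        (fun x => divSemigroup (t - s + η + r) V₁ (U₁ s) (U₁' s) x -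
          divSemigroup (t - s + η) V₁ (U₁ s) (U₁' s) x) +
        fun x => divSemigroup (t - s + η + r) V₂ (U₂ s) (U₂' s) x -
          divSemigroup (t - s + η) V₂ (U₂ s) (U₂' s) x := by
      funext x
      simp only [divSource, Pi.add_apply, add_assoc]
      ring
    rw [e]
    have m1 := (hsec (s1.measurable_divSource t (η + r)) s).sub
      (hsec (s1.measurable_divSource t η) s)
    have m2 := (hsec (s2.measurable_divSource t (η + r)) s).sub
      (hsec (s2.measurable_divSource t η) s)
    have e1 : ∀ (V : ℝ → ℝ) (U U' : ℝ → ℝ → ℝ), (fun x => divSemigroup (t - s + η + r) V (U s) (U' s) x -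
          divSemigroup (t - s + η) V (U s) (U' s) x) =
        divSource t V U U' (η + r) s - divSource t V U U' η s := fun V U U' => by
      funext x
      simp only [divSource, Pi.sub_apply, add_assoc]
    refine (eLpNorm_add_le ?_ ?_ hp).trans (add_le_add b1 b2)
    · rw [e1]; exact m1
    · rw [e1]; exact m2
  have hle : ∫⁻ r in Ioi 0, k r * ∫⁻ s in Ioo 0 t, (lam M₁ U₁ U₁' r s + lam M₂ U₂ U₂' r s) ≤
      ENNReal.ofReal (C * (D + D') * M₁) * srcConv p ((γ - β) / 2) ((1 + γ - β) / 2) U₁ U₁' t +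
      ENNReal.ofReal (C * (D + D') * M₂) * srcConv p ((γ - β) / 2) ((1 + γ - β) / 2) U₂ U₂' t := by
    have hm1 := hlm M₁ U₁ U₁' s1.meas s1.meas'
    have e : ∀ r, k r * ∫⁻ s in Ioo 0 t, (lam M₁ U₁ U₁' r s + lam M₂ U₂ U₂' r s) =
        (k r * ∫⁻ s in Ioo 0 t, lam M₁ U₁ U₁' r s) +
          k r * ∫⁻ s in Ioo 0 t, lam M₂ U₂ U₂' r s := fun r => by
      have hmr : Measurable (lam M₁ U₁ U₁' r) := hm1.of_uncurry_left
      rw [← mul_add, lintegral_add_left hmr]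
    simp_rw [e]
    have hm1' : Measurable fun r => k r * ∫⁻ s in Ioo 0 t, lam M₁ U₁ U₁' r s :=
      hkm.mul (Measurable.lintegral_prod_right' (f := Function.uncurry (lam M₁ U₁ U₁')) hm1)
    rw [lintegral_add_left hm1']
    exact add_le_add (hint M₁ U₁ U₁' hM₁ s1.meas s1.meas') (hint M₂ U₂ U₂' hM₂ s2.meas s2.meas')
  refine (sobolevNorm_le hp hp' hfm hf hl (ne_top_of_le_ne_top ?_ hle)).trans ?_
  · exact ENNReal.add_ne_top.2 ⟨ENNReal.mul_ne_top ENNReal.ofReal_ne_top fin1,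
      ENNReal.mul_ne_top ENNReal.ofReal_ne_top fin2⟩
  · refine (mul_le_mul_right hle _).trans_eq ?_
    have e : ∀ M, G * (C * (D + D') * M) = G * (C * (D + D')) * M := fun M => by ring
    rw [mul_add, ← mul_assoc, ← mul_assoc, ← ENNReal.ofReal_mul hG, ← ENNReal.ofReal_mul hG,
      e, e]

/-! ### Inversion of the fractional Laplacian -/

/-- The kernel is symmetric, so Fubini moves the semigroup onto the eigenfunction. -/
lemma sineCoeff_heatSemigroup {t : ℝ} (ht : 0 < t) {f : ℝ → ℝ} (hf : Integrable f muI) (j : ℕ) :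
    sineCoeff (j + 1) (heatSemigroup t f) = decay j t * sineCoeff (j + 1) f := by
  obtain ⟨C, hC, hk⟩ := kernel_large_time
  have hint : Integrable (Function.uncurry fun x y =>
      sineMode (j + 1) x * dirichletKernel t x y * f y) (muI.prod muI) := by
    refine Integrable.bdd_mul (c := Real.sqrt (2 / Real.pi) * (C * (t ^ 2)⁻¹)) (hf.comp_snd muI)
      (((measurable_sineMode _).comp measurable_fst).mul
        (measurable_dirichletKernel_fix t)).aestronglyMeasurable (ae_of_all _ fun z => ?_)
    rw [norm_mul]
    exact mul_le_mul (abs_sineMode_le _ _) (hk t ht _ _).1 (norm_nonneg _) (by positivity)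
  have e1 : sineCoeff (j + 1) (heatSemigroup t f) =
      ∫ x, ∫ y, sineMode (j + 1) x * dirichletKernel t x y * f y ∂muI ∂muI := by
    unfold sineCoeff
    refine integral_congr_ae (ae_of_all _ fun x => ?_)
    simp only [heatSemigroup_eq]
    rw [mul_comm, ← integral_const_mul]
    simp only [mul_assoc]
  rw [e1, integral_integral_swap hint, sineCoeff, ← integral_const_mul]
  refine integral_congr_ae (ae_of_all _ fun y => ?_)
  have e2 := heatSemigroup_sineMode ht j y
  rw [heatSemigroup_eq] at e2
  simp only []
  rw [integral_mul_const, mul_comm (f y), ← mul_assoc, ← e2]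
  congr 1
  refine integral_congr_ae (ae_of_all _ fun x => ?_)
  simp only []
  rw [dirichletKernel_comm, mul_comm]

lemma abs_heatSemigroup_le : ∃ C : ℝ, 0 ≤ C ∧ ∀ t, 0 < t → ∀ f : ℝ → ℝ, Integrable f muI → ∀ x,
    |heatSemigroup t f x| ≤ C * (t ^ 2)⁻¹ * ∫ y, ‖f y‖ ∂muI := by
  obtain ⟨C, hC, hk⟩ := kernel_large_time
  refine ⟨C, hC, fun t ht f hf x => ?_⟩
  rw [heatSemigroup_eq, ← integral_const_mul, ← Real.norm_eq_abs]
  refine norm_integral_le_of_norm_le (hf.norm.const_mul _) (ae_of_all _ fun y => ?_)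
  rw [norm_mul]
  exact mul_le_mul_of_nonneg_right (hk t ht x y).1 (norm_nonneg _)

lemma integrable_fracLap_integrand {s δ : ℝ} (hs : 0 < s) (hδ : 0 < δ) {f : ℝ → ℝ}
    (hf : Integrable f muI) :
    Integrable (Function.uncurry fun y t => (heatSemigroup t f y - f y) / t ^ (1 + s / 2))
      (muI.prod (volume.restrict (Ioi δ))) := by
  obtain ⟨C, hC, hk⟩ := abs_heatSemigroup_le
  set B := C * (δ ^ 2)⁻¹ * ∫ y, ‖f y‖ ∂muI
  have hdom : Integrable (fun z : ℝ × ℝ => (B + ‖f z.1‖) * z.2 ^ (-(1 + s / 2)))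
      (muI.prod (volume.restrict (Ioi δ))) :=
    Integrable.mul_prod (f := fun y => B + ‖f y‖) (g := fun t : ℝ => t ^ (-(1 + s / 2)))
      ((integrable_const B).add hf.norm) (integrableOn_Ioi_rpow_of_lt (by linarith) hδ)
  refine hdom.mono' ?_ ?_
  · refine AEStronglyMeasurable.mul
      (((measurable_heatSemigroup_uncurry hf.1).comp measurable_swap).aestronglyMeasurable.sub
        hf.1.comp_fst) ?_
    exact (measurable_snd.pow_const _).inv.aestronglyMeasurable
  · have hmem : ∀ᵐ z ∂(muI.prod (volume.restrict (Ioi δ))), z.2 ∈ Ioi δ :=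
      Measure.quasiMeasurePreserving_snd.ae (ae_restrict_mem measurableSet_Ioi)
    filter_upwards [hmem] with z hz
    have hz' : δ < z.2 := hz
    have hz0 : 0 < z.2 := hδ.trans hz'
    simp only [Function.uncurry]
    rw [norm_div, Real.norm_of_nonneg (Real.rpow_nonneg hz0.le _), Real.rpow_neg hz0.le,
      div_eq_mul_inv]
    refine mul_le_mul_of_nonneg_right ((norm_sub_le _ _).trans (add_le_add_left ?_ _))
      (by positivity)
    refine (hk z.2 hz0 f hf z.1).trans ?_
    have : 0 ≤ ∫ y, ‖f y‖ ∂muI := integral_nonneg fun _ => norm_nonneg _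
    simp only [B]
    gcongr

/-- The truncated operator is diagonal in the sine basis; away from `t = 0` the integrals may be
interchanged. -/
lemma sineCoeff_fracLapTrunc {s δ : ℝ} (hs : 0 < s) (hδ : 0 < δ) {f : ℝ → ℝ}
    (hf : Integrable f muI) (j : ℕ) :
    sineCoeff (j + 1) (fracLapTrunc s δ f) = (Real.Gamma (-s / 2))⁻¹ *
      (∫ t in Ioi δ, (decay j t - 1) / t ^ (1 + s / 2)) * sineCoeff (j + 1) f := by
  have hint := integrable_fracLap_integrand hs hδ hf
  have hint' : Integrable (Function.uncurry fun y t => sineMode (j + 1) y *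
      ((heatSemigroup t f y - f y) / t ^ (1 + s / 2))) (muI.prod (volume.restrict (Ioi δ))) := by
    refine Integrable.bdd_mul (c := Real.sqrt (2 / Real.pi)) hint
      ((measurable_sineMode _).comp measurable_fst).aestronglyMeasurable
      (ae_of_all _ fun z => abs_sineMode_le _ _)
  have e1 : sineCoeff (j + 1) (fracLapTrunc s δ f) = (Real.Gamma (-s / 2))⁻¹ * ∫ y,
      (∫ t in Ioi δ, sineMode (j + 1) y * ((heatSemigroup t f y - f y) / t ^ (1 + s / 2))) ∂muI := by
    rw [← integral_const_mul]
    unfold sineCoeff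
    refine integral_congr_ae (ae_of_all _ fun y => ?_)
    simp only [fracLapTrunc]
    rw [integral_const_mul]
    ring
  rw [e1, integral_integral_swap hint', mul_assoc, ← integral_mul_const]
  congr 1
  refine setIntegral_congr_fun measurableSet_Ioi fun t ht => ?_
  have ht0 : 0 < t := hδ.trans ht
  have i1 : Integrable (fun y => heatSemigroup t f y * sineMode (j + 1) y) muI := by
    obtain ⟨C, hC, hk⟩ := abs_heatSemigroup_le
    exact integrable_mul_sineMode (Integrable.of_bound
      (measurable_heatSemigroup t hf.1).aestronglyMeasurable _
      (ae_of_all _ fun x => hk t ht0 f hf x)) _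
  have i2 := integrable_mul_sineMode hf (j + 1)
  have e2 : ∀ y, sineMode (j + 1) y * ((heatSemigroup t f y - f y) / t ^ (1 + s / 2)) =
      (heatSemigroup t f y * sineMode (j + 1) y - f y * sineMode (j + 1) y) *
        (t ^ (1 + s / 2))⁻¹ := fun y => by ring
  simp only [e2]
  rw [integral_mul_const, integral_sub i1 i2]
  have e3 := sineCoeff_heatSemigroup ht0 hf j
  unfold sineCoeff at e3 ⊢
  rw [e3]
  ring

lemma integrableOn_two_powers {a b : ℝ} (ha : -1 < a) (hb : b < -1) :
    IntegrableOn (fun r : ℝ => if r ≤ 1 then r ^ a else r ^ b) (Ioi 0) := by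
  rw [← Ioc_union_Ioi_eq_Ioi (zero_le_one' ℝ)]
  refine IntegrableOn.union ?_ ?_
  · refine IntegrableOn.congr_fun (f := fun r : ℝ => r ^ a) ?_ (fun r hr => ?_) measurableSet_Ioc
    · exact (intervalIntegrable_iff_integrableOn_Ioc_of_le zero_le_one).1
        (intervalIntegral.intervalIntegrable_rpow' ha)
    · simp only [if_pos hr.2]
  · refine IntegrableOn.congr_fun (f := fun r : ℝ => r ^ b) ?_ (fun r hr => ?_) measurableSet_Ioi
    · exact integrableOn_Ioi_rpow_of_lt hb one_pos
    · simp only [if_neg (not_le.2 (mem_Ioi.1 hr))]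

lemma integrableOn_exp_sub_one {a s : ℝ} (ha : 0 < a) (hs : 0 < s) (hs1 : s < 1) :
    IntegrableOn (fun t : ℝ => (Real.exp (-a * t) - 1) / t ^ (1 + s)) (Ioi 0) := by
  refine Integrable.mono' ((integrableOn_two_powers (a := -s) (b := -(1 + s)) (by linarith)
    (by linarith)).const_mul (a + 1)) (Measurable.aestronglyMeasurable (by fun_prop))
    (ae_restrict_of_forall_mem measurableSet_Ioi fun t ht => ?_)
  have ht0 : (0 : ℝ) < t := ht
  have h1 : Real.exp (-a * t) ≤ 1 := Real.exp_le_one_iff.2 (by nlinarith)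
  rw [norm_div, Real.norm_of_nonneg (Real.rpow_nonneg ht0.le _), Real.norm_eq_abs,
    abs_of_nonpos (by linarith), neg_sub, div_eq_mul_inv, ← Real.rpow_neg ht0.le]
  have hp : (0 : ℝ) ≤ t ^ (-(1 + s)) := by positivity
  split_ifs with h
  · have h2 : 1 - Real.exp (-a * t) ≤ a * t := by
      have := Real.add_one_le_exp (-a * t)
      linarith
    have e : t * t ^ (-(1 + s)) = t ^ (-s) := by
      nth_rewrite 1 [← Real.rpow_one t]
      rw [← Real.rpow_add ht0]
      congr 1
      ring
    calc _ ≤ a * t * t ^ (-(1 + s)) := mul_le_mul_of_nonneg_right h2 hp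
      _ = a * t ^ (-s) := by rw [mul_assoc, e]
      _ ≤ _ := by
        have : (0 : ℝ) ≤ t ^ (-s) := by positivity
        nlinarith
  · have := Real.exp_pos (-a * t)
    exact mul_le_mul_of_nonneg_right (by linarith) hp

/-- The constant `∫_0^∞ (e^{-t} - 1) t^{-1-s} dt`. -/
def expConst (s : ℝ) : ℝ := ∫ t in Ioi (0 : ℝ), (Real.exp (-1 * t) - 1) / t ^ (1 + s)

/-- The integrand is negative throughout. Only the fact that the constant is nonzero is needed, in
order to invert the multiplier; its value is never computed. -/
lemma expConst_neg {s : ℝ} (hs : 0 < s) (hs1 : s < 1) : expConst s < 0 := by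
  have hi := integrableOn_exp_sub_one one_pos hs hs1
  have : 0 < ∫ t in Ioi (0 : ℝ), -((Real.exp (-1 * t) - 1) / t ^ (1 + s)) := by
    have hpos : ∀ t : ℝ, 0 < t → 0 < -((Real.exp (-1 * t) - 1) / t ^ (1 + s)) := fun t ht => by
      rw [← neg_div, neg_sub]
      have : Real.exp (-1 * t) < 1 := Real.exp_lt_one_iff.2 (by linarith)
      have : 0 < t ^ (1 + s) := by positivity
      positivity
    rw [setIntegral_pos_iff_support_of_nonneg_ae
      (ae_restrict_of_forall_mem measurableSet_Ioi fun t ht => (hpos t ht).le) hi.neg]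
    have hsub : Ioi (0 : ℝ) ⊆
        Function.support fun t : ℝ => -((Real.exp (-1 * t) - 1) / t ^ (1 + s)) :=
      fun t ht => Function.mem_support.2 (hpos t ht).ne'
    rw [inter_eq_right.2 hsub, Real.volume_Ioi]
    exact ENNReal.zero_lt_top
  rw [integral_neg] at this
  unfold expConst
  linarith

lemma integral_exp_sub_one {a s : ℝ} (ha : 0 < a) :
    ∫ t in Ioi (0 : ℝ), (Real.exp (-a * t) - 1) / t ^ (1 + s) = a ^ s * expConst s := by
  have h := integral_comp_mul_left_Ioi (fun t : ℝ => (Real.exp (-1 * t) - 1) / t ^ (1 + s)) 0 ha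
  rw [mul_zero, smul_eq_mul] at h
  have e : ∀ t ∈ Ioi (0 : ℝ), (Real.exp (-a * t) - 1) / t ^ (1 + s) =
      a ^ (1 + s) * ((Real.exp (-1 * (a * t)) - 1) / (a * t) ^ (1 + s)) := fun t ht => by
    have ht0 : (0 : ℝ) < t := ht
    rw [Real.mul_rpow ha.le ht0.le, show -1 * (a * t) = -a * t by ring]
    have h1 : a ^ (1 + s) ≠ 0 := by positivity
    have h2 : t ^ (1 + s) ≠ 0 := by positivity
    field_simp
  rw [setIntegral_congr_fun measurableSet_Ioi e, integral_const_mul, h, expConst, ← mul_assoc,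
    Real.rpow_add ha, Real.rpow_one]
  field_simp

lemma tendsto_sineCoeff_of_tendsto_eLpNorm {p : ℝ≥0∞} (hp : 1 ≤ p) {F : ℝ → ℝ → ℝ} {g : ℝ → ℝ}
    {l : Filter ℝ} (hF : ∀ᶠ δ in l, Integrable (F δ) muI) (hg : Integrable g muI)
    (h : Tendsto (fun δ => eLpNorm (fun x => F δ x - g x) p muI) l (𝓝 0)) (k : ℕ) :
    Tendsto (fun δ => sineCoeff k (F δ)) l (𝓝 (sineCoeff k g)) := by
  rw [tendsto_iff_edist_tendsto_0]
  have h0 : Tendsto (fun δ => ENNReal.ofReal (Real.sqrt (2 / Real.pi)) *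
      (ENNReal.ofReal (1 + Real.pi) * eLpNorm (fun x => F δ x - g x) p muI)) l (𝓝 0) := by
    have := ENNReal.Tendsto.const_mul (ENNReal.Tendsto.const_mul h
      (Or.inr (ENNReal.ofReal_ne_top (r := 1 + Real.pi))))
      (Or.inr (ENNReal.ofReal_ne_top (r := Real.sqrt (2 / Real.pi))))
    simpa using this
  refine tendsto_of_tendsto_of_tendsto_of_le_of_le' tendsto_const_nhds h0
    (Eventually.of_forall fun _ => zero_le) (hF.mono fun δ hδ => ?_)
  rw [edist_eq_enorm_sub]
  unfold sineCoeff
  rw [← integral_sub (integrable_mul_sineMode hδ k) (integrable_mul_sineMode hg k)]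
  refine (enorm_integral_le_lintegral_enorm _).trans ?_
  refine le_trans ?_ (mul_le_mul_right (eLpNorm_one_le hp (hδ.sub hg).1) _)
  rw [eLpNorm_one_eq_lintegral_enorm, ← lintegral_const_mul' _ _ ENNReal.ofReal_ne_top]
  refine lintegral_mono fun x => ?_
  rw [← sub_mul, enorm_mul, mul_comm]
  refine mul_le_mul_left ?_ _
  rw [Real.enorm_eq_ofReal_abs]
  exact ENNReal.ofReal_le_ofReal (abs_sineMode_le _ _)

/-- Sine coefficients are continuous on `L_p`, so the limit `δ → 0` can be taken in each
coefficient. By scaling, `(-Δ)^{σ/2}` multiplies the coefficient of mode `k` by `k^σ` up to a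
constant independent of `k`. -/
lemma HasFracLap.sineCoeff_eq {p : ℝ≥0∞} (hp : 1 ≤ p) {σ : ℝ} (hσ : 0 < σ) (hσ2 : σ < 2)
    {f g : ℝ → ℝ} (h : HasFracLap p σ f g) (j : ℕ) :
    sineCoeff (j + 1) g = (Real.Gamma (-σ / 2))⁻¹ *
      ((((j + 1 : ℕ) : ℝ) ^ 2) ^ (σ / 2) * expConst (σ / 2)) * sineCoeff (j + 1) f := by
  have hf : Integrable f muI := h.memLp_left.integrable hp
  have hg : Integrable g muI := h.memLp_right.integrable hp
  have ha : (0 : ℝ) < ((j + 1 : ℕ) : ℝ) ^ 2 := by positivity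
  have hF : ∀ᶠ δ : ℝ in 𝓝[>] 0, Integrable (fracLapTrunc σ δ f) muI := by
    filter_upwards [self_mem_nhdsWithin] with δ hδ
    exact ((integrable_fracLap_integrand hσ hδ hf).integral_prod_left).const_mul _
  have t1 := tendsto_sineCoeff_of_tendsto_eLpNorm hp hF hg h.tendsto (j + 1)
  have hi := integrableOn_exp_sub_one ha (by positivity : 0 < σ / 2) (by linarith)
  have t2 := (aecover_Ioi_of_Ioi (μ := volume) (A := (0 : ℝ)) (l := 𝓝[>] 0) (a := fun δ : ℝ => δ)
    (tendsto_id.mono_left nhdsWithin_le_nhds)).integral_tendsto_of_countably_generated hi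
  rw [integral_exp_sub_one ha] at t2
  have t3 := (t2.const_mul (Real.Gamma (-σ / 2))⁻¹).mul_const (sineCoeff (j + 1) f)
  refine tendsto_nhds_unique t1 (t3.congr' ?_)
  filter_upwards [self_mem_nhdsWithin] with δ hδ
  have hδ0 : (0 : ℝ) < δ := hδ
  rw [sineCoeff_fracLapTrunc hσ hδ0 hf, Measure.restrict_restrict measurableSet_Ioi,
    inter_eq_left.2 (Ioi_subset_Ioi hδ0.le)]
  rfl

lemma integral_rpow_mul_decay {s : ℝ} (hs : 0 < s) (j : ℕ) :
    IntegrableOn (fun r => r ^ (s - 1) * decay j r) (Ioi 0) ∧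
    ∫ r in Ioi (0 : ℝ), r ^ (s - 1) * decay j r =
      (1 / ((j + 1 : ℕ) : ℝ) ^ 2) ^ s * Real.Gamma s := by
  have ha : (0 : ℝ) < ((j + 1 : ℕ) : ℝ) ^ 2 := by positivity
  have h := Real.integral_rpow_mul_exp_neg_mul_Ioi hs ha
  have e : ∀ r : ℝ, r ^ (s - 1) * decay j r =
      r ^ (s - 1) * Real.exp (-(((j + 1 : ℕ) : ℝ) ^ 2 * r)) := fun r => by
    rw [decay, neg_mul]
  simp only [e]
  refine ⟨?_, h⟩
  -- As before, a nonzero value of the Bochner integral forces integrability.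
  by_contra hn
  have h0 := integral_undef hn
  rw [h] at h0
  have : 0 < (1 / ((j + 1 : ℕ) : ℝ) ^ 2) ^ s * Real.Gamma s :=
    mul_pos (by positivity) (Real.Gamma_pos_of_pos hs)
  exact this.ne' h0

/-- `f` is recovered from `g = (-Δ)^{σ/2} f` by the integral of the heat semigroup. -/
lemma exists_heatSemigroup_eq_integral {σ : ℝ} (hσ : 0 < σ) (hσ2 : σ < 2) : ∃ c : ℝ,
    ∀ (p : ℝ≥0∞), 1 ≤ p → ∀ f g : ℝ → ℝ, HasFracLap p σ f g → ∀ η, 0 < η → ∀ x,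
      heatSemigroup η f x =
        ∫ r in Ioi (0 : ℝ), c * r ^ (σ / 2 - 1) * heatSemigroup (r + η) g x := by
  have hs : 0 < σ / 2 := by positivity
  set κ := (Real.Gamma (-σ / 2))⁻¹ * expConst (σ / 2)
  -- The argument lies strictly between `-1` and `0`, hence is not a pole of the Gamma function.
  have hΓ : Real.Gamma (-σ / 2) ≠ 0 := Real.Gamma_ne_zero fun m hm => by
    rcases Nat.eq_zero_or_pos m with h | h
    · subst h
      norm_num at hm
      linarith
    · have : (1 : ℝ) ≤ m := by exact_mod_cast h
      linarith
  have hκ : κ ≠ 0 := mul_ne_zero (inv_ne_zero hΓ) (expConst_neg hs (by linarith)).ne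
  have hΓ' := Real.Gamma_pos_of_pos hs
  -- Since `∫ r^(σ/2-1) e^{-k²r} dr = Γ(σ/2) k^(-σ)`, this constant inverts the multiplier `κ k^σ`
  -- simultaneously for all modes.
  refine ⟨(κ * Real.Gamma (σ / 2))⁻¹, fun p hp f g h η hη x => ?_⟩
  have hf : Integrable f muI := h.memLp_left.integrable hp
  have hg : Integrable g muI := h.memLp_right.integrable hp
  set c := (κ * Real.Gamma (σ / 2))⁻¹
  set F : ℕ → ℝ → ℝ := fun j r => c * r ^ (σ / 2 - 1) *
    (decay j (r + η) * sineMode (j + 1) x * sineCoeff (j + 1) g)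
  have hFe : ∀ j, F j = fun r => (c * (decay j η * sineMode (j + 1) x * sineCoeff (j + 1) g)) *
      (r ^ (σ / 2 - 1) * decay j r) := fun j => by
    funext r
    simp only [F, decay_add]
    ring
  have hFi : ∀ j, IntegrableOn (F j) (Ioi 0) := fun j => by
    rw [hFe]
    exact (integral_rpow_mul_decay hs j).1.const_mul _
  have hnorm : ∀ j, ∫ r in Ioi (0 : ℝ), ‖F j r‖ =
      |c * (decay j η * sineMode (j + 1) x * sineCoeff (j + 1) g)| *
        ((1 / ((j + 1 : ℕ) : ℝ) ^ 2) ^ (σ / 2) * Real.Gamma (σ / 2)) := fun j => by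
    rw [← (integral_rpow_mul_decay hs j).2, ← integral_const_mul]
    refine setIntegral_congr_fun measurableSet_Ioi fun r hr => ?_
    have hr0 : (0 : ℝ) < r := hr
    have hd := decay_pos j r
    simp only [hFe]
    rw [norm_mul, Real.norm_eq_abs, Real.norm_of_nonneg (by positivity)]
  -- The factor `e^{-k²η}` from the regularization makes the double series absolutely convergent;
  -- the coefficients of `g` are merely bounded.
  have hsum : Summable fun j => ∫ r in Ioi (0 : ℝ), ‖F j r‖ := by
    have hG := abs_sineCoeff_le hg
    set G := Real.sqrt (2 / Real.pi) * ∫ y, ‖g y‖ ∂muI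
    refine Summable.of_nonneg_of_le (fun j => integral_nonneg fun _ => norm_nonneg _) (fun j => ?_)
      ((summable_decay_zero hη).mul_left
        (|c| * (Real.sqrt (2 / Real.pi) * G) * Real.Gamma (σ / 2)))
    rw [hnorm, abs_mul]
    have h1 := abs_mode_mul_le (decay_pos j η).le (abs_sineMode_le (j + 1) x) (hG (j + 1))
    have h2 : (1 / ((j + 1 : ℕ) : ℝ) ^ 2) ^ (σ / 2) ≤ 1 := by
      refine Real.rpow_le_one (by positivity) ?_ hs.le
      rw [div_le_one (by positivity)]
      have : (1 : ℝ) ≤ ((j + 1 : ℕ) : ℝ) := by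
        push_cast
        have : (0 : ℝ) ≤ j := by positivity
        linarith
      nlinarith
    have h3 : (0 : ℝ) ≤ (1 / ((j + 1 : ℕ) : ℝ) ^ 2) ^ (σ / 2) := by positivity
    calc _ ≤ |c| * (decay j η * Real.sqrt (2 / Real.pi) * G) * (1 * Real.Gamma (σ / 2)) := by
          have h4 := (abs_nonneg _).trans h1
          gcongr
      _ = _ := by ring
  have hS := hasSum_integral_of_summable_integral_norm hFi hsum
  have e1 : ∫ r in Ioi (0 : ℝ), ∑' j, F j r =
      ∫ r in Ioi (0 : ℝ), c * r ^ (σ / 2 - 1) * heatSemigroup (r + η) g x := by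
    refine setIntegral_congr_fun measurableSet_Ioi fun r hr => ?_
    have hr0 : (0 : ℝ) < r := hr
    exact ((heatSemigroup_hasSum (add_pos hr0 hη) hg x).mul_left (c * r ^ (σ / 2 - 1))).tsum_eq
  rw [e1] at hS
  refine (heatSemigroup_hasSum hη hf x).unique (hasSum_of_eq hS (fun j => ?_) rfl)
  rw [hFe]
  simp only []
  rw [integral_const_mul, (integral_rpow_mul_decay hs j).2, h.sineCoeff_eq hp hσ hσ2,
    Real.div_rpow zero_le_one (by positivity), Real.one_rpow]
  have h4 : ((((j + 1 : ℕ) : ℝ) ^ 2) ^ (σ / 2)) ≠ 0 := by positivity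
  have e5 : (Real.Gamma (-σ / 2))⁻¹ * ((((j + 1 : ℕ) : ℝ) ^ 2) ^ (σ / 2) * expConst (σ / 2)) =
      κ * (((j + 1 : ℕ) : ℝ) ^ 2) ^ (σ / 2) := by simp only [κ]; ring
  rw [e5]
  simp only [c]
  field_simp

/-- The embedding of `H^σ_p`, `1 < σ < 2`, in `W^1_p`. -/
lemma exists_eLpNorm_le_sobolevNorm {σ : ℝ} (hσ : 1 < σ) (hσ2 : σ < 2) : ∃ C : ℝ, 0 ≤ C ∧
    ∀ (p : ℝ≥0∞), 1 ≤ p → p ≠ ⊤ → ∀ f f' : ℝ → ℝ,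
      (∀ x ∈ Ioo 0 Real.pi, HasDerivAt f (f' x) x) →
      eLpNorm f p muI ≤ ENNReal.ofReal C * sobolevNorm p σ f ∧
      eLpNorm f' p muI ≤ ENNReal.ofReal C * sobolevNorm p σ f := by
  obtain ⟨c, hc⟩ := exists_heatSemigroup_eq_integral (by linarith : 0 < σ) hσ2
  obtain ⟨C₁, hC₁, h1⟩ := eLpNorm_heatSemigroup_le
  obtain ⟨C₂, hC₂, h2⟩ := eLpNorm_heatSemigroup_large_time
  obtain ⟨C₃, hC₃, h3⟩ := abs_heatSemigroup_le
  -- An integrable majorant. Near zero a derivative costs `r^(-1/2)`, and `r^(σ/2-3/2)` is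
  -- integrable because `σ > 1`; for `r > 1` the decay `r⁻²` of the semigroup is used.
  set w : ℝ → ℝ := fun r => if r ≤ 1 then r ^ (σ / 2 - 3 / 2) else r ^ (σ / 2 - 3)
  have hw : IntegrableOn w (Ioi 0) := integrableOn_two_powers (by linarith) (by linarith)
  have hw0 : ∀ r, 0 < r → 0 ≤ w r := fun r hr => by
    simp only [w]
    split_ifs <;> positivity
  have hw1 : ∀ r, 0 < r → r ≤ 1 → r ^ (σ / 2 - 1) ≤ w r ∧
      r ^ (σ / 2 - 1) * r ^ (-1 / 2 : ℝ) ≤ w r := fun r hr hr1 => by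
    simp only [w, if_pos hr1]
    refine ⟨Real.rpow_le_rpow_of_exponent_ge hr hr1 (by linarith), le_of_eq ?_⟩
    rw [← Real.rpow_add hr]
    congr 1
    ring
  have hw2 : ∀ r, 1 < r → r ^ (σ / 2 - 1) * (r ^ 2)⁻¹ ≤ w r := fun r hr => by
    have hr0 : 0 < r := by linarith
    simp only [w, if_neg (not_le.2 hr)]
    rw [← Real.rpow_natCast, ← Real.rpow_neg hr0.le, ← Real.rpow_add hr0]
    refine le_of_eq ?_
    congr 1
    push_cast
    ring
  set D := |c| * (C₁ + C₂)
  set Iw := ∫ r in Ioi 0, w r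
  -- The added `1` keeps the constant positive, so that it can be divided out when the infimum over
  -- `g` is taken.
  refine ⟨D * Iw + 1, ?_, fun p hp hp' f f' hd => ?_⟩
  · have : 0 ≤ Iw := setIntegral_nonneg measurableSet_Ioi fun r hr => hw0 r hr
    positivity
  have hIw : 0 ≤ Iw := setIntegral_nonneg measurableSet_Ioi fun r hr => hw0 r hr
  have hD : 0 ≤ D := by positivity
  have key : ∀ g, HasFracLap p σ f g →
      eLpNorm f p muI ≤ ENNReal.ofReal (D * Iw + 1) * eLpNorm g p muI ∧
      eLpNorm f' p muI ≤ ENNReal.ofReal (D * Iw + 1) * eLpNorm g p muI := by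
    intro g hg
    have hf : Integrable f muI := hg.memLp_left.integrable hp
    have hgi : Integrable g muI := hg.memLp_right.integrable hp
    have hlint : ∫⁻ r in Ioi (0 : ℝ), ENNReal.ofReal (D * w r) * eLpNorm g p muI ≤
        ENNReal.ofReal (D * Iw + 1) * eLpNorm g p muI := by
      rw [lintegral_mul_const'' _ (hw.const_mul D).1.aemeasurable.ennreal_ofReal,
        ← ofReal_integral_eq_lintegral_ofReal (hw.const_mul D)
          (ae_restrict_of_forall_mem measurableSet_Ioi fun r hr => mul_nonneg hD (hw0 r hr)),
        integral_const_mul]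
      exact mul_le_mul_left (ENNReal.ofReal_le_ofReal (by linarith)) _
    have hcoef : ∀ (η r A B: ℝ) (v : ℝ → ℝ), 0 < r → 0 < η → 0 ≤ A → 0 ≤ B →
        eLpNorm v p muI ≤ ENNReal.ofReal A * eLpNorm g p muI →
        |c| * r ^ (σ / 2 - 1) * A ≤ B →
        eLpNorm (fun x => c * r ^ (σ / 2 - 1) * v x) p muI ≤
          ENNReal.ofReal B * eLpNorm g p muI := fun η r A B v hr hη hA hB hv hAB => by
      have hp0 : (0 : ℝ) ≤ r ^ (σ / 2 - 1) := by positivity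
      change eLpNorm ((c * r ^ (σ / 2 - 1)) • v) p muI ≤ _
      rw [eLpNorm_const_smul, Real.enorm_eq_ofReal_abs, abs_mul, abs_of_nonneg hp0]
      refine (mul_le_mul_right hv _).trans ?_
      rw [← mul_assoc, ← ENNReal.ofReal_mul (by positivity)]
      exact mul_le_mul_left (ENNReal.ofReal_le_ofReal hAB) _
    have hbm : ∀ η, Measurable (Function.uncurry fun r x =>
        c * r ^ (σ / 2 - 1) * heatSemigroup (r + η) g x) := fun η =>
      ((measurable_fst.pow_const _).const_mul c).mul
        ((measurable_heatSemigroup_uncurry hgi.1).comp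
          (f := fun q : ℝ × ℝ => (q.1 + η, q.2)) (by fun_prop))
    have hbxm : ∀ η, Measurable (Function.uncurry fun r x =>
        c * r ^ (σ / 2 - 1) * heatSemigroupDx (r + η) g x) := fun η =>
      ((measurable_fst.pow_const _).const_mul c).mul
        ((measurable_heatSemigroupDx_uncurry hgi.1).comp
          (f := fun q : ℝ × ℝ => (q.1 + η, q.2)) (by fun_prop))
    have main := eLpNorm_le_of_regularization hp hp' hf hd (ν := volume.restrict (Ioi 0))
      (h := fun _ _ => 0) (hx := fun _ _ => 0) (A₀ := 0) (A₁ := 0)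
      (b := fun η r x => c * r ^ (σ / 2 - 1) * heatSemigroup (r + η) g x)
      (bx := fun η r x => c * r ^ (σ / 2 - 1) * heatSemigroupDx (r + η) g x)
      (l₀ := fun r => ENNReal.ofReal (D * w r) * eLpNorm g p muI)
      (l₁ := fun r => ENNReal.ofReal (D * w r) * eLpNorm g p muI)
      one_pos (fun η hη x _ => by rw [zero_add]; exact hc p hp f g hg η hη.1 x)
      (fun _ => measurable_const) (fun _ => measurable_const)
      (fun _ _ x _ => hasDerivAt_const x 0) (fun _ _ => by simp) (fun _ _ => by simp)
      hbm hbxm ?_ ?_ ?_ ?_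
    · simp only [zero_add] at main
      exact ⟨main.1.trans hlint, main.2.trans hlint⟩
    · intro η hη x hx
      set G := ∫ y, ‖g y‖ ∂muI
      have hG : 0 ≤ G := integral_nonneg fun _ => norm_nonneg _
      refine Integrable.mono' (hw.const_mul (|c| * (C₃ * ((η ^ 2)⁻¹ + 1) * G)))
        ((hbm η).comp measurable_prodMk_right).aestronglyMeasurable
        (ae_restrict_of_forall_mem measurableSet_Ioi fun r hr => ?_)
      have hr0 : (0 : ℝ) < r := hr
      have hη0 := hη.1
      have hp0 : (0 : ℝ) ≤ r ^ (σ / 2 - 1) := by positivity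
      have hS := h3 (r + η) (by positivity) g hgi x
      have hwr := hw0 r hr0
      have hη2 : 0 ≤ (η ^ 2)⁻¹ := by positivity
      rw [norm_mul, norm_mul, Real.norm_eq_abs, Real.norm_of_nonneg hp0, Real.norm_eq_abs]
      have hkey : r ^ (σ / 2 - 1) * ((r + η) ^ 2)⁻¹ ≤ ((η ^ 2)⁻¹ + 1) * w r := by
        rcases le_or_gt r 1 with h | h
        · have b1 : ((r + η) ^ 2)⁻¹ ≤ (η ^ 2)⁻¹ := by
            gcongr
            linarith
          calc _ ≤ w r * (η ^ 2)⁻¹ := mul_le_mul (hw1 r hr0 h).1 b1 (by positivity) hwr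
            _ ≤ _ := by nlinarith
        · have b1 : ((r + η) ^ 2)⁻¹ ≤ (r ^ 2)⁻¹ := by
            gcongr
            linarith
          calc _ ≤ r ^ (σ / 2 - 1) * (r ^ 2)⁻¹ := mul_le_mul_of_nonneg_left b1 hp0
            _ ≤ w r := hw2 r h
            _ ≤ _ := by nlinarith
      calc _ ≤ |c| * r ^ (σ / 2 - 1) * (C₃ * ((r + η) ^ 2)⁻¹ * G) := by gcongr
        _ = |c| * (C₃ * (r ^ (σ / 2 - 1) * ((r + η) ^ 2)⁻¹) * G) := by ring
        _ ≤ |c| * (C₃ * (((η ^ 2)⁻¹ + 1) * w r) * G) := by gcongr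
        _ = _ := by ring
    · intro η hη
      filter_upwards [ae_restrict_mem measurableSet_Ioi] with r hr x hx
      have hr0 : (0 : ℝ) < r := hr
      exact (hasDerivAt_heatSemigroup (add_pos hr0 hη.1) hgi hx).const_mul _
    · intro η hη
      filter_upwards [ae_restrict_mem measurableSet_Ioi] with r hr
      have hr0 : (0 : ℝ) < r := hr
      have hrη := add_pos hr0 hη.1
      have hp0 : (0 : ℝ) ≤ r ^ (σ / 2 - 1) := by positivity
      have hwr := hw0 r hr0
      rcases le_or_gt r 1 with h | h
      · refine hcoef η r C₁ _ _ hr0 hη.1 hC₁ (mul_nonneg hD hwr)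
          (h1 p hp hp' (r + η) hrη g hgi.1).1 ?_
        calc _ = |c| * C₁ * r ^ (σ / 2 - 1) := by ring
          _ ≤ |c| * (C₁ + C₂) * w r := by
            gcongr
            · linarith
            · exact (hw1 r hr0 h).1
      · refine hcoef η r (C₂ * ((r + η) ^ 2)⁻¹) _ _ hr0 hη.1 (by positivity) (mul_nonneg hD hwr)
          (h2 p hp hp' (r + η) hrη g hgi.1).1 ?_
        have b1 : ((r + η) ^ 2)⁻¹ ≤ (r ^ 2)⁻¹ := by
          have := hη.1
          gcongr
          linarith
        calc _ = |c| * C₂ * (r ^ (σ / 2 - 1) * ((r + η) ^ 2)⁻¹) := by ring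
          _ ≤ |c| * (C₁ + C₂) * w r := by
            gcongr
            · linarith
            · exact (mul_le_mul_of_nonneg_left b1 hp0).trans (hw2 r h)
    · intro η hη
      filter_upwards [ae_restrict_mem measurableSet_Ioi] with r hr
      have hr0 : (0 : ℝ) < r := hr
      have hrη := add_pos hr0 hη.1
      have hp0 : (0 : ℝ) ≤ r ^ (σ / 2 - 1) := by positivity
      have hwr := hw0 r hr0
      rcases le_or_gt r 1 with h | h
      · refine hcoef η r (C₁ * (r + η) ^ (-1 / 2 : ℝ)) _ _ hr0 hη.1 (by positivity)
          (mul_nonneg hD hwr) (h1 p hp hp' (r + η) hrη g hgi.1).2 ?_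
        have b1 : (r + η) ^ (-1 / 2 : ℝ) ≤ r ^ (-1 / 2 : ℝ) :=
          Real.rpow_le_rpow_of_nonpos hr0 (by linarith [hη.1]) (by norm_num)
        calc _ = |c| * C₁ * (r ^ (σ / 2 - 1) * (r + η) ^ (-1 / 2 : ℝ)) := by ring
          _ ≤ |c| * (C₁ + C₂) * w r := by
            gcongr
            · linarith
            · exact (mul_le_mul_of_nonneg_left b1 hp0).trans (hw1 r hr0 h).2
      · refine hcoef η r (C₂ * ((r + η) ^ 2)⁻¹) _ _ hr0 hη.1 (by positivity) (mul_nonneg hD hwr)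
          (h2 p hp hp' (r + η) hrη g hgi.1).2 ?_
        have b1 : ((r + η) ^ 2)⁻¹ ≤ (r ^ 2)⁻¹ := by
          have := hη.1
          gcongr
          linarith
        calc _ = |c| * C₂ * (r ^ (σ / 2 - 1) * ((r + η) ^ 2)⁻¹) := by ring
          _ ≤ |c| * (C₁ + C₂) * w r := by
            gcongr
            · linarith
            · exact (mul_le_mul_of_nonneg_left b1 hp0).trans (hw2 r h)
  have hC0 : ENNReal.ofReal (D * Iw + 1) ≠ 0 := by
    rw [Ne, ENNReal.ofReal_eq_zero, not_le]
    positivity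
  unfold sobolevNorm
  constructor
  · rw [← ENNReal.div_le_iff' hC0 ENNReal.ofReal_ne_top]
    refine le_iInf₂ fun g hg => ?_
    rw [ENNReal.div_le_iff' hC0 ENNReal.ofReal_ne_top]
    exact (key g hg).1
  · rw [← ENNReal.div_le_iff' hC0 ENNReal.ofReal_ne_top]
    refine le_iInf₂ fun g hg => ?_
    rw [ENNReal.div_le_iff' hC0 ENNReal.ofReal_ne_top]
    exact (key g hg).2

/-! ### Regularized form of the mild equation -/

lemma ae_muI_prod_mem : ∀ᵐ z ∂(muI.prod muI), z.1 ∈ Ioo 0 Real.pi ∧ z.2 ∈ Ioo 0 Real.pi :=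
  (Measure.quasiMeasurePreserving_fst.ae ae_muI_mem).and
    (Measure.quasiMeasurePreserving_snd.ae ae_muI_mem)

/-- The outer semigroup acts on the first variable of the kernels only. After Fubini the claim is
the semigroup law for `P^D` and for `∂_y P^D`. -/
lemma heatSemigroup_divSemigroup {η τ γ M : ℝ} (hη : 0 < η) (hτ : 0 < τ) {V f f' : ℝ → ℝ}
    (hV : HolderBound γ M V) (h : HasIntegrableDeriv f f') {x : ℝ} (hx : x ∈ Ioo 0 Real.pi) :
    heatSemigroup η (divSemigroup τ V f f') x = divSemigroup (τ + η) V f f' x := by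
  obtain ⟨C, hC, hb⟩ := exists_kernel_bound (lt_min hη hτ)
  have hbη := hb η (min_le_left _ _) x hx
  have hbτ := hb τ (min_le_right _ _)
  have hVm := hV.measurable.aestronglyMeasurable (μ := muI)
  have hM := hV.nonneg
  have hPx : Measurable (dirichletKernel η x) := measurable_dirichletKernel_right η x
  have hint : Integrable (Function.uncurry fun z y => dirichletKernel η x z *
      ((kDy τ z y * f y + dirichletKernel τ z y * f' y) * V y)) (muI.prod muI) := by
    have hdom : Integrable (fun q : ℝ × ℝ => C * ((C * ‖f q.2‖ + C * ‖f' q.2‖) * M))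
        (muI.prod muI) :=
      ((((h.integrable_self.norm.const_mul C).add
        (h.integrable.norm.const_mul C)).mul_const M).const_mul C).comp_snd muI
    refine hdom.mono' ((hPx.comp measurable_fst).aestronglyMeasurable.mul
      ((((measurable_kDy_fix τ).aestronglyMeasurable.mul h.integrable_self.1.comp_snd).add
        ((measurable_dirichletKernel_fix τ).aestronglyMeasurable.mul
          h.integrable.1.comp_snd)).mul hVm.comp_snd)) ?_
    filter_upwards [ae_muI_prod_mem] with q hq
    simp only [Function.uncurry]
    have hk := hbτ q.1 hq.1 q.2 hq.2
    rw [norm_mul, norm_mul]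
    refine mul_le_mul (hbη q.1 hq.1).1 (mul_le_mul ((norm_add_le _ _).trans (add_le_add ?_ ?_))
      (hV.bound _ hq.2) (norm_nonneg _) (by positivity)) (by positivity) hC
    · rw [norm_mul]
      exact mul_le_mul_of_nonneg_right hk.2.2.1 (norm_nonneg _)
    · rw [norm_mul]
      exact mul_le_mul_of_nonneg_right hk.1 (norm_nonneg _)
  have e1 : heatSemigroup η (divSemigroup τ V f f') x =
      -∫ z, ∫ y, dirichletKernel η x z *
        ((kDy τ z y * f y + dirichletKernel τ z y * f' y) * V y) ∂muI ∂muI := by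
    rw [heatSemigroup_eq, ← integral_neg]
    refine integral_congr_ae (ae_of_all _ fun z => ?_)
    simp only [divSemigroup]
    rw [integral_const_mul, mul_neg]
  rw [e1, integral_integral_swap hint, divSemigroup]
  congr 1
  refine integral_congr_ae (ae_muI_mem.mono fun y hy => ?_)
  have i1 : Integrable (fun z => dirichletKernel η x z * kDy τ z y) muI :=
    Integrable.of_bound (hPx.mul ((measurable_kDy_fix τ).comp
      measurable_prodMk_right)).aestronglyMeasurable (C * C) (ae_muI_mem.mono fun z hz => by
        rw [norm_mul]
        exact mul_le_mul (hbη z hz).1 (hbτ z hz y hy).2.2.1 (norm_nonneg _) hC)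
  have i2 : Integrable (fun z => dirichletKernel η x z * dirichletKernel τ z y) muI :=
    Integrable.of_bound (hPx.mul ((measurable_dirichletKernel_fix τ).comp
      measurable_prodMk_right)).aestronglyMeasurable (C * C) (ae_muI_mem.mono fun z hz => by
        rw [norm_mul]
        exact mul_le_mul (hbη z hz).1 (hbτ z hz y hy).1 (norm_nonneg _) hC)
  have e2 : ∀ z, dirichletKernel η x z * ((kDy τ z y * f y + dirichletKernel τ z y * f' y) * V y) =
      (dirichletKernel η x z * kDy τ z y * f y + dirichletKernel η x z * dirichletKernel τ z y * f' y) *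
        V y := fun z => by ring
  simp only [e2]
  rw [integral_mul_const, integral_add (i1.mul_const _) (i2.mul_const _), integral_mul_const,
    integral_mul_const, heatSemigroup_kDy hη hτ hx, heatSemigroup_dirichletKernel hη hτ hx]

/-! ### Extension by zero and joint measurability. -/

/-- Restriction of a function to `(0,T) × (0,π)`, extended by zero. -/
def cutoff (T : ℝ) (v : ℝ → ℝ → ℝ) (s x : ℝ) : ℝ :=
  (Ioo 0 T ×ˢ Ioo 0 Real.pi).indicator (fun z : ℝ × ℝ => v z.1 z.2) (s, x)

/-- The space derivative on `(0,T) × (0,π)`, extended by zero. -/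
def cutoffDx (T : ℝ) (v : ℝ → ℝ → ℝ) (s x : ℝ) : ℝ := cutoff T (fun s => deriv (v s)) s x

lemma cutoff_of_mem {T : ℝ} {v : ℝ → ℝ → ℝ} {s x : ℝ} (hs : s ∈ Ioo 0 T) (hx : x ∈ Ioo 0 Real.pi) :
    cutoff T v s x = v s x := indicator_of_mem (mk_mem_prod hs hx) _

lemma cutoff_of_notMem_prod {T : ℝ} {v : ℝ → ℝ → ℝ} {z : ℝ × ℝ}
    (hz : z ∉ Ioo 0 T ×ˢ Ioo 0 Real.pi) : cutoff T v z.1 z.2 = 0 := indicator_of_notMem hz _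

lemma cutoff_of_notMem {T : ℝ} {v : ℝ → ℝ → ℝ} {s : ℝ} (hs : s ∉ Ioo 0 T) :
    cutoff T v s = 0 := funext fun _ => indicator_of_notMem (fun h => hs h.1) _

lemma cutoff_ae_eq {T : ℝ} {v : ℝ → ℝ → ℝ} {s : ℝ} (hs : s ∈ Ioo 0 T) :
    cutoff T v s =ᵐ[muI] v s := ae_muI_mem.mono fun _ hx => cutoff_of_mem hs hx

lemma cutoff_hasDerivAt {T : ℝ} {v : ℝ → ℝ → ℝ} {s : ℝ} (hs : s ∈ Ioo 0 T)
    (hd : ContDiffOn ℝ 1 (v s) (Ioo 0 Real.pi)) :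
    ∀ x ∈ Ioo 0 Real.pi, HasDerivAt (cutoff T v s) (cutoffDx T v s x) x := fun x hx => by
  have hnhds : Ioo 0 Real.pi ∈ 𝓝 x := isOpen_Ioo.mem_nhds hx
  have h1 : HasDerivAt (v s) (deriv (v s) x) x :=
    ((hd.differentiableOn one_ne_zero).differentiableAt hnhds).hasDerivAt
  rw [cutoffDx, cutoff_of_mem hs hx]
  refine h1.congr_of_eventuallyEq ?_
  filter_upwards [hnhds] with y hy using cutoff_of_mem hs hy

/-- Continuity in one variable and measurability in the other give joint measurability, so separate
continuity suffices. -/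
lemma measurable_cutoff {T : ℝ} {v : ℝ → ℝ → ℝ}
    (h1 : ∀ x ∈ Ioo 0 Real.pi, ContinuousOn (fun t => v t x) (Ioo 0 T))
    (h2 : ∀ t ∈ Ioo 0 T, ContinuousOn (v t) (Ioo 0 Real.pi)) :
    Measurable (Function.uncurry (cutoff T v)) := by
  set g : Ioo 0 Real.pi → Ioo 0 T → ℝ := fun x t => v t x
  have hg : Measurable (Function.uncurry g) :=
    measurable_uncurry_of_continuous_of_measurable
      (fun t => continuousOn_iff_continuous_domRestrict.1 (h2 t t.2))
      (fun x => (continuousOn_iff_continuous_domRestrict.1 (h1 x x.2)).measurable)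
  have hS : MeasurableSet (Ioo 0 T ×ˢ Ioo 0 Real.pi) := measurableSet_Ioo.prod measurableSet_Ioo
  refine measurable_of_restrict_of_restrict_compl hS ?_ ?_
  · have e : (Ioo 0 T ×ˢ Ioo 0 Real.pi).domRestrict (Function.uncurry (cutoff T v)) =
        Function.uncurry g ∘ fun z : (Ioo 0 T ×ˢ Ioo 0 Real.pi : Set (ℝ × ℝ)) =>
          ((⟨z.1.2, z.2.2⟩ : Ioo 0 Real.pi), (⟨z.1.1, z.2.1⟩ : Ioo 0 T)) := by
      funext z
      exact cutoff_of_mem z.2.1 z.2.2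
    rw [e]
    refine hg.comp (Measurable.prodMk ?_ ?_)
    · exact Measurable.subtype_mk (measurable_snd.comp measurable_subtype_coe)
    · exact Measurable.subtype_mk (measurable_fst.comp measurable_subtype_coe)
  · have e : (Ioo 0 T ×ˢ Ioo 0 Real.pi)ᶜ.domRestrict (Function.uncurry (cutoff T v)) = fun _ => 0 := by
      funext z
      exact cutoff_of_notMem_prod z.2
    rw [e]
    exact measurable_const

/-- The derivative is a pointwise limit of jointly measurable difference quotients. Those near the
right endpoint may sample the zero extension, but only finitely many do at a given point. -/
lemma measurable_cutoffDx {T : ℝ} {v : ℝ → ℝ → ℝ}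
    (h1 : ∀ x ∈ Ioo 0 Real.pi, ContinuousOn (fun t => v t x) (Ioo 0 T))
    (h2 : ∀ t ∈ Ioo 0 T, ContDiffOn ℝ 1 (v t) (Ioo 0 Real.pi)) :
    Measurable (Function.uncurry (cutoffDx T v)) := by
  have hm := measurable_cutoff h1 fun t ht => (h2 t ht).continuousOn
  have hS : MeasurableSet (Ioo 0 T ×ˢ Ioo 0 Real.pi) := measurableSet_Ioo.prod measurableSet_Ioo
  set D : ℕ → ℝ × ℝ → ℝ := fun n => (Ioo 0 T ×ˢ Ioo 0 Real.pi).indicator fun z =>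
    (1 / ((n : ℝ) + 1))⁻¹ • (cutoff T v z.1 (z.2 + 1 / ((n : ℝ) + 1)) - cutoff T v z.1 z.2)
  have hD : ∀ n, Measurable (D n) := fun n => by
    have hm2 : Measurable fun z : ℝ × ℝ => cutoff T v z.1 (z.2 + 1 / ((n : ℝ) + 1)) :=
      hm.comp (f := fun z : ℝ × ℝ => (z.1, z.2 + 1 / ((n : ℝ) + 1))) (by fun_prop)
    exact ((hm2.sub hm).const_smul (1 / ((n : ℝ) + 1))⁻¹).indicator hS
  refine measurable_of_tendsto_metrizable hD (tendsto_pi_nhds.2 fun z => ?_)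
  by_cases hz : z ∈ Ioo 0 T ×ˢ Ioo 0 Real.pi
  · have h := (cutoff_hasDerivAt hz.1 (h2 _ hz.1) z.2 hz.2).tendsto_slope_zero_right
    have hn : Tendsto (fun n : ℕ => 1 / ((n : ℝ) + 1)) atTop (𝓝[>] 0) :=
      tendsto_nhdsWithin_iff.2 ⟨tendsto_one_div_add_atTop_nhds_zero_nat,
        Eventually.of_forall fun n => by simp only [mem_Ioi]; positivity⟩
    refine (h.comp hn).congr fun n => ?_
    simp only [D, indicator_of_mem hz, Function.comp]
  · have e : ∀ n, D n z = 0 := fun n => indicator_of_notMem hz _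
    have e' : Function.uncurry (cutoffDx T v) z = 0 :=
      cutoff_of_notMem_prod (v := fun s => deriv (v s)) hz
    simp only [e, e']
    exact tendsto_const_nhds

/-- A convolution of two `L_1` functions is finite almost everywhere. The power kernel may be
truncated to `(0,T)`, because for `t < T` and `s > 0` it is never evaluated beyond `T`. -/
lemma ae_lconvolution_ne_top {N : ℝ → ℝ≥0∞} {T θ : ℝ} (hθ : 0 < θ) (hN : Measurable N)
    (hN0 : ∀ s ≤ 0, N s = 0) (hfin : ∫⁻ s, N s ≠ ⊤) :
    ∀ᵐ t, t < T → (N ⋆ₗ[volume] powKer θ) t ≠ ⊤ := by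
  rcases le_or_gt T 0 with hT | hT
  · refine ae_of_all _ fun t ht => ?_
    have : (N ⋆ₗ[volume] powKer θ) t = 0 := by
      rw [lconvolution_def]
      refine (lintegral_congr fun s => ?_).trans lintegral_zero
      rcases le_or_gt s 0 with h | h
      · rw [hN0 s h, zero_mul]
      · rw [powKer_of_nonpos θ (by linarith), mul_zero]
    rw [this]
    exact ENNReal.zero_ne_top
  set k : ℝ → ℝ≥0∞ := (Ioo 0 T).indicator (powKer θ)
  have hk : Measurable k := (measurable_powKer θ).indicator measurableSet_Ioo
  have h1 : ∫⁻ t, (N ⋆ₗ[volume] k) t ≠ ⊤ := by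
    rw [lintegral_lconvolution_eq hN hk, lintegral_indicator measurableSet_Ioo,
      lintegral_powKer hθ hT.le]
    exact ENNReal.mul_ne_top hfin ENNReal.ofReal_ne_top
  have h2 : Measurable (N ⋆ₗ[volume] k) := measurable_lconvolution _ hN hk
  filter_upwards [ae_lt_top h2 h1] with t ht htT
  refine ne_top_of_le_ne_top ht.ne (lintegral_mono fun s => ?_)
  rcases le_or_gt s 0 with h | h
  · simp only [hN0 s h, zero_mul, le_refl]
  · refine mul_le_mul_right ?_ _
    rcases le_or_gt t s with h' | h'
    · rw [powKer_of_nonpos θ (by linarith)]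
      exact zero_le
    · have hmem : -s + t ∈ Ioo 0 T := ⟨by linarith, by linarith⟩
      simp only [k]
      rw [indicator_of_mem hmem]

lemma IsSource.integrable_divSemigroup {p : ℝ≥0∞} (hp : 1 ≤ p) (hp' : p ≠ ⊤) {γ M T : ℝ}
    (hγ : 0 ≤ γ) (hγ1 : γ ≤ 1) {V : ℝ → ℝ} {U U' : ℝ → ℝ → ℝ} (h : IsSource p γ M T V U U')
    {t : ℝ} (ht : t ∈ Ioo 0 T) (hfin : srcConv p ((1 + γ) / 2) 1 U U' t ≠ ⊤) :
    Integrable (Function.uncurry fun r z => divSemigroup (t - r) V (U r) (U' r) z)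
      ((volume.restrict (Ioo 0 t)).prod muI) := by
  obtain ⟨C, hC, hb⟩ := eLpNorm_divSemigroup_le γ hγ hγ1
  have hm : Measurable (Function.uncurry fun r z => divSemigroup (t - r) V (U r) (U' r) z) := by
    have e : (fun r z => divSemigroup (t - r) V (U r) (U' r) z) = divSource t V U U' 0 := by
      funext r z
      rw [divSource, add_zero]
    rw [e]
    exact h.measurable_divSource t 0
  refine ⟨hm.aestronglyMeasurable, ?_⟩
  have hM := h.holder.nonneg
  have hT : 0 ≤ T := ht.1.le.trans ht.2.le
  have hTγ : 0 ≤ T ^ (γ / 2) := by positivity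
  set C' := C * (1 + T ^ (γ / 2))
  have hC' : 0 ≤ C' := by positivity
  rw [HasFiniteIntegral, lintegral_prod _ hm.enorm.aemeasurable]
  refine lt_of_le_of_lt (b := ENNReal.ofReal (1 + Real.pi) *
    (ENNReal.ofReal (C' * M) * srcConv p ((1 + γ) / 2) 1 U U' t)) ?_
    (ENNReal.mul_lt_top ENNReal.ofReal_lt_top
      (ENNReal.mul_lt_top ENNReal.ofReal_lt_top (lt_top_iff_ne_top.2 hfin)))
  refine le_trans ?_ (mul_le_mul_right (setLIntegral_le_srcConv hp hp' h.meas _ _ _ _) _)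
  rw [← lintegral_const_mul' _ _ ENNReal.ofReal_ne_top]
  refine lintegral_mono_ae ?_
  filter_upwards [ae_restrict_mem measurableSet_Ioo, h.deriv_of_le ht.2.le] with r hr hd
  have hτ : 0 < t - r := by linarith [hr.2]
  have h1 := eLpNorm_one_le hp (hm.of_uncurry_left (x := r)).aestronglyMeasurable
  rw [eLpNorm_one_eq_lintegral_enorm] at h1
  refine h1.trans (mul_le_mul_right ((hb p hp hp' _ hτ M V _ _ h.holder hd).1.trans ?_) _)
  rw [mul_add, powKer_of_pos _ hτ, powKer_of_pos _ hτ,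
    show (1 + γ) / 2 - 1 = (γ - 1) / 2 by ring]
  refine add_le_add (ofReal_mul_le_mul_ofReal hC' hM ?_ _) (ofReal_mul_le_mul_ofReal hC' hM ?_ _)
  · refine mul_le_mul_of_nonneg_right ?_ (by positivity)
    exact le_mul_of_one_le_right hC (by linarith)
  · rw [sub_self, Real.rpow_zero, mul_one]
    refine mul_le_mul_of_nonneg_left ?_ hC
    have : (t - r) ^ (γ / 2) ≤ T ^ (γ / 2) :=
      Real.rpow_le_rpow hτ.le (by linarith [hr.1, ht.2]) (by positivity)
    linarith

/-- Absolute convergence of the two double integrals permits merging them; only the merged integrand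
has the cancellation in divergence form. -/
lemma IsMildSolution.eq_divSemigroup {T s : ℝ} {p : ℝ≥0∞} {W u₀ : ℝ → ℝ} {u : ℝ → ℝ → ℝ}
    (hu : IsMildSolution T p s W u₀ u) {t z : ℝ} (ht : t ∈ Ioo 0 T) (hz : z ∈ Ioo 0 Real.pi) :
    u t z = heatSemigroup t u₀ z + ∫ r in Ioo 0 t, divSemigroup (t - r)
      ((Ioo 0 Real.pi).indicator W) (cutoff T u r) (cutoffDx T u r) z := by
  have hprod : (volume.restrict (Ioo 0 t ×ˢ Ioo 0 Real.pi) : Measure (ℝ × ℝ)) =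
      (volume.restrict (Ioo 0 t)).prod muI := by
    rw [muI, Measure.prod_restrict, Measure.volume_eq_prod]
  have hA := hu.integrable_left t ht z hz
  have hB := hu.integrable_right t ht z hz
  rw [IntegrableOn, hprod] at hA hB
  rw [hu.equation t ht z hz, sub_sub, sub_eq_add_neg]
  congr 1
  simp only [intervalIntegral_eq_muI]
  rw [intervalIntegral.integral_of_le ht.1.le, intervalIntegral.integral_of_le ht.1.le,
    integral_Ioc_eq_integral_Ioo, integral_Ioc_eq_integral_Ioo,
    ← integral_add hA.integral_prod_left hB.integral_prod_left, ← integral_neg]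
  refine integral_congr_ae ?_
  filter_upwards [ae_restrict_mem measurableSet_Ioo, hA.prod_right_ae, hB.prod_right_ae]
    with r hr hAr hBr
  rw [← integral_add hAr hBr, divSemigroup]
  congr 1
  refine integral_congr_ae (ae_muI_mem.mono fun y hy => ?_)
  have hrT : r ∈ Ioo 0 T := ⟨hr.1, hr.2.trans ht.2⟩
  simp only [cutoffDx]
  rw [cutoff_of_mem hrT hy, cutoff_of_mem hrT hy, indicator_of_mem hy,
    dirichletKernelDy_eq (by linarith [hr.2])]
  ring

/-- The mild equation, regularized by the heat semigroup. -/
lemma IsMildSolution.regularized {T s : ℝ} {p : ℝ≥0∞} (hp : 1 ≤ p) (hp' : p ≠ ⊤) {W u₀ : ℝ → ℝ}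
    {u : ℝ → ℝ → ℝ} (hu : IsMildSolution T p s W u₀ u) (hu₀ : Integrable u₀ muI) {γ M : ℝ}
    (hγ : 0 ≤ γ) (hγ1 : γ ≤ 1)
    (hS : IsSource p γ M T ((Ioo 0 Real.pi).indicator W) (cutoff T u) (cutoffDx T u)) {t : ℝ}
    (ht : t ∈ Ioo 0 T) (hfin : srcConv p ((1 + γ) / 2) 1 (cutoff T u) (cutoffDx T u) t ≠ ⊤)
    {η x : ℝ} (hη : 0 < η) (hx : x ∈ Ioo 0 Real.pi) :
    heatSemigroup η (cutoff T u t) x = heatSemigroup (t + η) u₀ x + ∫ r in Ioo 0 t,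
      divSource t ((Ioo 0 Real.pi).indicator W) (cutoff T u) (cutoffDx T u) η r x := by
  obtain ⟨C, hC, hb⟩ := exists_kernel_bound hη
  obtain ⟨C₂, hC₂, hb₂⟩ := abs_heatSemigroup_le
  have hI := hS.integrable_divSemigroup hp hp' hγ hγ1 ht hfin
  have hPm := (measurable_dirichletKernel_right η x).aestronglyMeasurable (μ := muI)
  have hPb := fun y hy => (hb η le_rfl x hx y hy).1
  set H : ℝ → ℝ → ℝ := fun r z => divSemigroup (t - r) ((Ioo 0 Real.pi).indicator W)
    (cutoff T u r) (cutoffDx T u r) z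
  have i1 : Integrable (heatSemigroup t u₀) muI := Integrable.of_bound
    (measurable_heatSemigroup t hu₀.1).aestronglyMeasurable _
    (ae_of_all _ fun z => hb₂ t ht.1 u₀ hu₀ z)
  have hI2 : Integrable (Function.uncurry fun z r => dirichletKernel η x z * H r z)
      (muI.prod (volume.restrict (Ioo 0 t))) := by
    have hmem : ∀ᵐ q ∂(muI.prod (volume.restrict (Ioo 0 t))), q.1 ∈ Ioo 0 Real.pi :=
      Measure.quasiMeasurePreserving_fst.ae ae_muI_mem
    exact Integrable.bdd_mul (c := C) hI.swap hPm.comp_fst (hmem.mono fun q hq => hPb q.1 hq)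
  have e1 : heatSemigroup η (cutoff T u t) x = ∫ z, (dirichletKernel η x z * heatSemigroup t u₀ z +
      ∫ r in Ioo 0 t, dirichletKernel η x z * H r z) ∂muI := by
    rw [heatSemigroup_eq]
    refine integral_congr_ae (ae_muI_mem.mono fun z hz => ?_)
    simp only []
    rw [cutoff_of_mem ht hz, hu.eq_divSemigroup ht hz, mul_add, integral_const_mul]
  have hI3 : Integrable (fun z => ∫ r in Ioo 0 t, dirichletKernel η x z * H r z) muI :=
    hI2.integral_prod_left
  rw [e1, integral_add (integrable_bdd_mul i1 hPm hPb) hI3,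
    ← heatSemigroup_eq, heatSemigroup_heatSemigroup hη ht.1 hu₀ hx, integral_integral_swap hI2]
  congr 1
  refine integral_congr_ae ?_
  filter_upwards [ae_restrict_mem measurableSet_Ioo, hS.deriv_of_le ht.2.le] with r hr hd
  have := heatSemigroup_divSemigroup hη (by linarith [hr.2] : 0 < t - r) hS.holder hd hx
  rw [heatSemigroup_eq] at this
  exact this

/-! ### Sine coefficients of a classical solution -/

namespace IsClassicalSolution

variable {T : ℝ} {p : ℝ≥0∞} {V u₀ : ℝ → ℝ} {u : ℝ → ℝ → ℝ}

lemma continuousOn_section (hu : IsClassicalSolution T p V u₀ u) {t : ℝ} (ht : t ∈ Ioo 0 T) :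
    ContinuousOn (u t) (Icc 0 Real.pi) :=
  hu.cont.comp (f := fun y : ℝ => (t, y)) (by fun_prop) fun y hy => ⟨ht, hy⟩

lemma exists_bound (hu : IsClassicalSolution T p V u₀ u) {t₁ t₂ : ℝ} (h1 : 0 < t₁) (h2 : t₂ < T) :
    ∃ K : ℝ, 0 ≤ K ∧ ∀ t ∈ Icc t₁ t₂, ∀ y ∈ Icc 0 Real.pi, |u t y| ≤ K := by
  obtain ⟨K, hK⟩ := (isCompact_Icc (a := t₁) (b := t₂)).prod (isCompact_Icc (a := 0) (b := Real.pi))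
    |>.exists_bound_of_continuousOn (hu.cont.mono
      (prod_mono (fun t ht => ⟨h1.trans_le ht.1, ht.2.trans_lt h2⟩) Subset.rfl))
  exact ⟨|K|, abs_nonneg _, fun t ht y hy => (hK (t, y) ⟨ht, hy⟩).trans (le_abs_self K)⟩

lemma hasDerivAt_time (hu : IsClassicalSolution T p V u₀ u) {t y : ℝ} (ht : t ∈ Ioo 0 T)
    (hy : y ∈ Ioo 0 Real.pi) : HasDerivAt (fun t => u t y)
      (deriv (deriv (u t)) y + u t y * deriv V y) t := by
  rw [← hu.equation t ht y hy]
  exact ((hu.diff_time y hy).differentiableAt (isOpen_Ioo.mem_nhds ht)).hasDerivAt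

lemma hasDerivAt_space (hu : IsClassicalSolution T p V u₀ u) {t y : ℝ} (ht : t ∈ Ioo 0 T)
    (hy : y ∈ Ioo 0 Real.pi) : HasDerivAt (u t) (deriv (u t) y) y :=
  (((hu.diff_space t ht).differentiableOn two_ne_zero).differentiableAt
    (isOpen_Ioo.mem_nhds hy)).hasDerivAt

lemma hasDerivAt_space_deriv (hu : IsClassicalSolution T p V u₀ u) {t y : ℝ} (ht : t ∈ Ioo 0 T)
    (hy : y ∈ Ioo 0 Real.pi) : HasDerivAt (deriv (u t)) (deriv (deriv (u t)) y) y := by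
  have h : ContDiffOn ℝ 1 (deriv (u t)) (Ioo 0 Real.pi) :=
    ((contDiffOn_succ_iff_deriv_of_isOpen (n := 1) isOpen_Ioo).1
      (by simpa [one_add_one_eq_two] using hu.diff_space t ht)).2.2
  exact ((h.differentiableOn one_ne_zero).differentiableAt (isOpen_Ioo.mem_nhds hy)).hasDerivAt

/-- The moment of `u(t)` against a Dirichlet eigenfunction of a subinterval. -/
lemma hasDerivAt_moment (hu : IsClassicalSolution T p V u₀ u)
    (hV : ContinuousOn (deriv V) (Ioo 0 Real.pi)) {a b κ : ℝ} (ha : 0 < a) (hab : a < b)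
    (hb : b < Real.pi) (hκ : Real.sin (κ * (b - a)) = 0) {t : ℝ} (ht : t ∈ Ioo 0 T) :
    HasDerivAt (fun t => ∫ y in a..b, u t y * Real.sin (κ * (y - a)))
      (-κ ^ 2 * (∫ y in a..b, u t y * Real.sin (κ * (y - a))) +
        (-(u t b * (κ * Real.cos (κ * (b - a))) - u t a * κ) +
        ∫ y in a..b, u t y * deriv V y * Real.sin (κ * (y - a)))) t := by
  have hsub : Icc a b ⊆ Ioo 0 Real.pi := fun y hy => ⟨ha.trans_le hy.1, hy.2.trans_lt hb⟩
  have huI : uIcc a b = Icc a b := uIcc_of_le hab.le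
  have hoc : uIoc a b ⊆ Ioo 0 Real.pi := uIoc_subset_uIcc.trans (huI ▸ hsub)
  have hψ : Continuous fun y => Real.sin (κ * (y - a)) := by fun_prop
  have hcu : ∀ s ∈ Ioo 0 T, ContinuousOn (fun y => u s y * Real.sin (κ * (y - a))) (uIcc a b) :=
    fun s hs => (((hu.continuousOn_section hs).mono (huI ▸ hsub.trans Ioo_subset_Icc_self)).mul
      hψ.continuousOn)
  have hct : ContinuousOn (fun y => deriv (fun t => u t y) t) (Ioo 0 Real.pi) :=
    hu.cont_dt.comp (f := fun y : ℝ => (t, y)) (by fun_prop) fun y hy => ⟨ht, hy⟩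
  have hcx : ContinuousOn (fun y => deriv (deriv (u t)) y) (Ioo 0 Real.pi) :=
    hu.cont_dxx.comp (f := fun y : ℝ => (t, y)) (by fun_prop) fun y hy => ⟨ht, hy⟩
  obtain ⟨t₁, h1⟩ := exists_between ht.1
  obtain ⟨t₂, h2⟩ := exists_between ht.2
  have hnhds : Icc t₁ t₂ ∈ 𝓝 t := Icc_mem_nhds h1.2 h2.1
  have hIT : Icc t₁ t₂ ⊆ Ioo 0 T := fun s hs => ⟨h1.1.trans_le hs.1, hs.2.trans_lt h2.2⟩
  obtain ⟨C, hC⟩ := (isCompact_Icc (a := t₁) (b := t₂)).prod (isCompact_Icc (a := a) (b := b))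
    |>.exists_bound_of_continuousOn (hu.cont_dt.mono (prod_mono hIT hsub))
  have key := (intervalIntegral.hasDerivAt_integral_of_dominated_loc_of_deriv_le
    (F := fun t y => u t y * Real.sin (κ * (y - a)))
    (F' := fun t y => deriv (fun t => u t y) t * Real.sin (κ * (y - a)))
    (bound := fun _ => C) (μ := volume) (a := a) (b := b) hnhds
    (Filter.eventually_of_mem (isOpen_Ioo.mem_nhds ht) fun s hs =>
      ((hcu s hs).mono uIoc_subset_uIcc).aestronglyMeasurable measurableSet_uIoc)
    (hcu t ht).intervalIntegrable
    (((hct.mono hoc).mul hψ.continuousOn).aestronglyMeasurable measurableSet_uIoc)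
    (ae_of_all _ fun y hy s hs => by
      rw [norm_mul]
      have h3 := hC (s, y) ⟨hs, huI ▸ uIoc_subset_uIcc hy⟩
      exact (mul_le_of_le_one_right (norm_nonneg _) (Real.abs_sin_le_one _)).trans h3)
    intervalIntegrable_const
    (ae_of_all _ fun y hy s hs => by
      have := (hu.hasDerivAt_time (hIT hs) (hoc hy)).mul_const (Real.sin (κ * (y - a)))
      rwa [← hu.equation s (hIT hs) y (hoc hy)] at this)).2
  refine key.congr_deriv ?_
  have hcV : ContinuousOn (fun y => u t y * deriv V y * Real.sin (κ * (y - a))) (uIcc a b) :=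
    (((hu.continuousOn_section ht).mono (huI ▸ hsub.trans Ioo_subset_Icc_self)).mul
      (hV.mono (huI ▸ hsub))).mul hψ.continuousOn
  have hcxx : ContinuousOn (fun y => deriv (deriv (u t)) y * Real.sin (κ * (y - a)) +
      κ ^ 2 * (u t y * Real.sin (κ * (y - a)))) (uIcc a b) :=
    ((hcx.mono (huI ▸ hsub)).mul hψ.continuousOn).add ((hcu t ht).const_mul _)
  have hsinD : ∀ y, HasDerivAt (fun y => Real.sin (κ * (y - a))) (κ * Real.cos (κ * (y - a))) y :=
    fun y => by
      have h := (Real.hasDerivAt_sin (κ * (y - a))).comp y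
        (((hasDerivAt_id y).sub_const a).const_mul κ)
      exact h.congr_deriv (by ring)
  have hcosD : ∀ y, HasDerivAt (fun y => κ * Real.cos (κ * (y - a)))
      (-(κ ^ 2 * Real.sin (κ * (y - a)))) y := fun y => by
      have h := ((Real.hasDerivAt_cos (κ * (y - a))).comp y
        (((hasDerivAt_id y).sub_const a).const_mul κ)).const_mul κ
      exact h.congr_deriv (by ring)
  -- Both integrations by parts at once, through the primitive `u_x ψ - u ψ'` with `ψ = sin (κ(y -
  -- a))`. As `ψ` vanishes at `a` and `b`, the values of `u_x` there drop out.
  have hftc := intervalIntegral.integral_eq_sub_of_hasDerivAt (a := a) (b := b)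
    (f := fun y => deriv (u t) y * Real.sin (κ * (y - a)) - u t y * (κ * Real.cos (κ * (y - a))))
    (fun y hy => (((hu.hasDerivAt_space_deriv ht (hsub (huI ▸ hy))).mul (hsinD y)).sub
      ((hu.hasDerivAt_space ht (hsub (huI ▸ hy))).mul (hcosD y))).congr_deriv
        (show _ = deriv (deriv (u t)) y * Real.sin (κ * (y - a)) +
          κ ^ 2 * (u t y * Real.sin (κ * (y - a))) by ring)) hcxx.intervalIntegrable
  have e1 : ∫ y in a..b, deriv (fun t => u t y) t * Real.sin (κ * (y - a)) =
      ∫ y in a..b, ((deriv (deriv (u t)) y * Real.sin (κ * (y - a)) +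
        κ ^ 2 * (u t y * Real.sin (κ * (y - a)))) + (u t y * deriv V y * Real.sin (κ * (y - a)) -
        κ ^ 2 * (u t y * Real.sin (κ * (y - a))))) := by
    refine intervalIntegral.integral_congr fun y hy => ?_
    rw [hu.equation t ht y (hsub (huI ▸ hy))]
    ring
  have i1 : IntervalIntegrable (fun y => κ ^ 2 * (u t y * Real.sin (κ * (y - a)))) volume a b :=
    ((hcu t ht).const_mul _).intervalIntegrable
  rw [e1, intervalIntegral.integral_add hcxx.intervalIntegrable (hcV.intervalIntegrable.sub i1),
    hftc, intervalIntegral.integral_sub hcV.intervalIntegrable i1, intervalIntegral.integral_const_mul, hκ, sub_self,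
    mul_zero, mul_zero, Real.sin_zero, Real.cos_zero]
  ring

/-- The integrating factor `e^{κ²t}` removes the zero-order term. Measurability of the right side
holds because it is a derivative in time, and the bound depends on the interval only through its
length, which prepares dominated convergence as `(a,b)` fills `(0,π)`. -/
lemma moment_integrated (hu : IsClassicalSolution T p V u₀ u)
    (hV : ContinuousOn (deriv V) (Ioo 0 Real.pi)) {B : ℝ}
    (hB : ∀ y ∈ Ioo 0 Real.pi, |deriv V y| ≤ B) {a b κ : ℝ} (ha : 0 < a) (hab : a < b)
    (hb : b < Real.pi) (hκ : Real.sin (κ * (b - a)) = 0) {t₁ t₂ K : ℝ} (h1 : 0 < t₁)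
    (h12 : t₁ ≤ t₂) (h2 : t₂ < T) (hK : ∀ t ∈ Icc t₁ t₂, ∀ y ∈ Icc 0 Real.pi, |u t y| ≤ K) :
    Real.exp (κ ^ 2 * t₂) * (∫ y in a..b, u t₂ y * Real.sin (κ * (y - a))) -
      Real.exp (κ ^ 2 * t₁) * (∫ y in a..b, u t₁ y * Real.sin (κ * (y - a))) =
    ∫ s in t₁..t₂, Real.exp (κ ^ 2 * s) * (-(u s b * (κ * Real.cos (κ * (b - a))) - u s a * κ) +
      ∫ y in a..b, u s y * deriv V y * Real.sin (κ * (y - a))) ∧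
    AEStronglyMeasurable (fun s => Real.exp (κ ^ 2 * s) *
      (-(u s b * (κ * Real.cos (κ * (b - a))) - u s a * κ) +
      ∫ y in a..b, u s y * deriv V y * Real.sin (κ * (y - a)))) (volume.restrict (uIoc t₁ t₂)) ∧
    ∀ s ∈ uIoc t₁ t₂, ‖Real.exp (κ ^ 2 * s) * (-(u s b * (κ * Real.cos (κ * (b - a))) - u s a * κ) +
      ∫ y in a..b, u s y * deriv V y * Real.sin (κ * (y - a)))‖ ≤
        Real.exp (κ ^ 2 * t₂) * (K * |κ| + K * |κ| + K * B * (b - a)) := by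
  have hpi := Real.pi_pos
  have huI : uIcc t₁ t₂ = Icc t₁ t₂ := uIcc_of_le h12
  have hIT : Icc t₁ t₂ ⊆ Ioo 0 T := fun s hs => ⟨h1.trans_le hs.1, hs.2.trans_lt h2⟩
  set G : ℝ → ℝ := fun s => -(u s b * (κ * Real.cos (κ * (b - a))) - u s a * κ) +
      ∫ y in a..b, u s y * deriv V y * Real.sin (κ * (y - a))
  set Φ : ℝ → ℝ := fun t => ∫ y in a..b, u t y * Real.sin (κ * (y - a))
  have hd : ∀ s ∈ Icc t₁ t₂, HasDerivAt (fun s => Real.exp (κ ^ 2 * s) * Φ s)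
      (Real.exp (κ ^ 2 * s) * G s) s := fun s hs => by
    have h3 := hu.hasDerivAt_moment hV ha hab hb hκ (hIT hs)
    have h4 : HasDerivAt (fun s => Real.exp (κ ^ 2 * s)) (Real.exp (κ ^ 2 * s) * κ ^ 2) s := by
      simpa using ((hasDerivAt_id s).const_mul (κ ^ 2)).exp
    refine (h4.mul h3).congr_deriv ?_
    simp only [G]
    ring
  have hm : AEStronglyMeasurable (fun s => Real.exp (κ ^ 2 * s) * G s)
      (volume.restrict (uIoc t₁ t₂)) := by
    refine (measurable_deriv (fun s => Real.exp (κ ^ 2 * s) * Φ s)).aestronglyMeasurable.congr ?_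
    filter_upwards [ae_restrict_mem measurableSet_uIoc] with s hs
    exact (hd s (huI ▸ uIoc_subset_uIcc hs)).deriv
  have hbd : ∀ s ∈ uIoc t₁ t₂, ‖Real.exp (κ ^ 2 * s) * G s‖ ≤
      Real.exp (κ ^ 2 * t₂) * (K * |κ| + K * |κ| + K * B * (b - a)) := fun s hs => by
    have hs' : s ∈ Icc t₁ t₂ := huI ▸ uIoc_subset_uIcc hs
    have hK0 : 0 ≤ K := (abs_nonneg _).trans (hK s hs' 0 ⟨le_rfl, hpi.le⟩)
    rw [norm_mul, Real.norm_of_nonneg (Real.exp_pos _).le]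
    refine mul_le_mul (Real.exp_le_exp.2 (mul_le_mul_of_nonneg_left hs'.2 (sq_nonneg _)))
      ((norm_add_le _ _).trans (add_le_add ?_ ?_)) (norm_nonneg _) (Real.exp_pos _).le
    · rw [norm_neg]
      refine (norm_sub_le _ _).trans (add_le_add ?_ ?_)
      · rw [norm_mul, norm_mul]
        refine mul_le_mul (hK s hs' b ⟨by linarith, hb.le⟩) ?_ (by positivity) hK0
        exact mul_le_of_le_one_right (norm_nonneg _) (Real.abs_cos_le_one _)
      · rw [norm_mul]
        exact mul_le_mul_of_nonneg_right (hK s hs' a ⟨ha.le, by linarith⟩) (norm_nonneg _)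
    · have := intervalIntegral.norm_integral_le_of_norm_le_const (a := a) (b := b) (C := K * B)
        (f := fun y => u s y * deriv V y * Real.sin (κ * (y - a))) fun y hy => by
          rw [uIoc_of_le hab.le] at hy
          have hy' : y ∈ Ioo 0 Real.pi := ⟨ha.trans hy.1, hy.2.trans_lt hb⟩
          rw [norm_mul, norm_mul]
          refine (mul_le_of_le_one_right (by positivity) (Real.abs_sin_le_one _)).trans ?_
          exact mul_le_mul (hK s hs' y (Ioo_subset_Icc_self hy')) (hB y hy') (norm_nonneg _) hK0
      rwa [abs_of_pos (by linarith)] at this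
  refine ⟨?_, hm, hbd⟩
  refine (intervalIntegral.integral_eq_sub_of_hasDerivAt
    (f := fun s => Real.exp (κ ^ 2 * s) * Φ s) (fun s hs => hd s (huI ▸ hs)) ?_).symm
  rw [intervalIntegrable_iff]
  have : IsFiniteMeasure (volume.restrict (uIoc t₁ t₂)) := by
    rw [uIoc_of_le h12]
    infer_instance
  exact Integrable.of_bound hm _ ((ae_restrict_mem measurableSet_uIoc).mono hbd)

end IsClassicalSolution

lemma tendsto_moment {v : ℝ → ℝ} {K : ℝ} (hv : AEStronglyMeasurable v muI)
    (hK : ∀ y ∈ Ioo 0 Real.pi, |v y| ≤ K) {e κ : ℕ → ℝ} {k : ℝ} (he : ∀ n, 0 < e n)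
    (he2 : ∀ n, e n ≤ Real.pi / 4) (he0 : Tendsto e atTop (𝓝 0)) (hκ : Tendsto κ atTop (𝓝 k)) :
    Tendsto (fun n => ∫ y in (e n)..(Real.pi - e n), v y * Real.sin (κ n * (y - e n))) atTop
      (𝓝 (∫ y, v y * Real.sin (k * y) ∂muI)) := by
  have hpi := Real.pi_pos
  have e1 : ∀ n, ∫ y in (e n)..(Real.pi - e n), v y * Real.sin (κ n * (y - e n)) =
      ∫ y, (Ioc (e n) (Real.pi - e n)).indicator (fun y => v y * Real.sin (κ n * (y - e n))) y
        ∂muI := fun n => by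
    have := he n
    have := he2 n
    rw [intervalIntegral.integral_of_le (by linarith), integral_indicator measurableSet_Ioc, muI,
      Measure.restrict_restrict measurableSet_Ioc, inter_eq_left.2]
    exact fun y hy => ⟨by linarith [hy.1], by linarith [hy.2]⟩
  simp only [e1]
  refine tendsto_integral_of_dominated_convergence (fun _ => K) (fun n => ?_) (integrable_const _)
    (fun n => ae_muI_mem.mono fun y hy => ?_) (ae_muI_mem.mono fun y hy => ?_)
  · exact (hv.mul (by fun_prop)).indicator measurableSet_Ioc
  · refine (norm_indicator_le_norm_self _ _).trans ?_
    rw [norm_mul]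
    exact (mul_le_of_le_one_right (norm_nonneg _) (Real.abs_sin_le_one _)).trans (hK y hy)
  · have h1 : Tendsto (fun n => v y * Real.sin (κ n * (y - e n))) atTop
        (𝓝 (v y * Real.sin (k * y))) := by
      have : Tendsto (fun n => κ n * (y - e n)) atTop (𝓝 (k * (y - 0))) :=
        hκ.mul (tendsto_const_nhds.sub he0)
      rw [sub_zero] at this
      exact ((Real.continuous_sin.tendsto _).comp this).const_mul _
    refine h1.congr' ?_
    have h2 : ∀ᶠ n in atTop, e n < min y (Real.pi - y) :=
      he0.eventually_lt_const (lt_min hy.1 (by linarith [hy.2]))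
    filter_upwards [h2] with n hn
    have h3 := hn.trans_le (min_le_left _ _)
    have h4 := hn.trans_le (min_le_right _ _)
    have hmem : y ∈ Ioc (e n) (Real.pi - e n) := ⟨h3, by linarith⟩
    rw [indicator_of_mem hmem]

namespace IsClassicalSolution

variable {T : ℝ} {p : ℝ≥0∞} {V u₀ : ℝ → ℝ} {u : ℝ → ℝ → ℝ}

/-- The interval `(0,π)` is exhausted by `(e n, π - e n)`. The boundary terms contain `u` but not
`u_x`, and they vanish in the limit because `u` is continuous up to the lateral boundary with value
zero. -/
lemma sine_moment_eq (hu : IsClassicalSolution T p V u₀ u)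
    (hV : ContinuousOn (deriv V) (Ioo 0 Real.pi)) {B : ℝ}
    (hB : ∀ y ∈ Ioo 0 Real.pi, |deriv V y| ≤ B) (k : ℕ) {t₁ t₂ : ℝ} (h1 : 0 < t₁)
    (h12 : t₁ ≤ t₂) (h2 : t₂ < T) :
    Real.exp ((k : ℝ) ^ 2 * t₂) * (∫ y, u t₂ y * Real.sin (k * y) ∂muI) -
      Real.exp ((k : ℝ) ^ 2 * t₁) * (∫ y, u t₁ y * Real.sin (k * y) ∂muI) =
    ∫ s in t₁..t₂, Real.exp ((k : ℝ) ^ 2 * s) *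
      ∫ y, u s y * deriv V y * Real.sin (k * y) ∂muI := by
  have hpi := Real.pi_pos
  obtain ⟨K, hK0, hK⟩ := hu.exists_bound h1 h2
  obtain ⟨e, he, he0'⟩ := exists_seq_pos_tendsto (by positivity : 0 < Real.pi / 4)
  have he0 : Tendsto e atTop (𝓝 0) := he0'.mono_right nhdsWithin_le_nhds
  have huI : uIcc t₁ t₂ = Icc t₁ t₂ := uIcc_of_le h12
  have hIT : Icc t₁ t₂ ⊆ Ioo 0 T := fun s hs => ⟨h1.trans_le hs.1, hs.2.trans_lt h2⟩
  -- The frequency is adjusted so that the sine vanishes at both ends of the smaller interval; it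
  -- converges to `k`.
  set κ : ℕ → ℝ := fun n => k * Real.pi / (Real.pi - e n - e n)
  have hden : ∀ n, Real.pi / 2 ≤ Real.pi - e n - e n := fun n => by linarith [(he n).2]
  have hκb : ∀ n, |κ n| ≤ 2 * k := fun n => by
    have h3 := hden n
    have h4 : 0 < Real.pi - e n - e n := by linarith
    rw [abs_of_nonneg (by positivity), div_le_iff₀ h4]
    have : (0 : ℝ) ≤ k := by positivity
    nlinarith
  have hκ0 : ∀ n, Real.sin (κ n * (Real.pi - e n - e n)) = 0 := fun n => by
    have h4 : Real.pi - e n - e n ≠ 0 := by linarith [hden n]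
    rw [div_mul_cancel₀ _ h4, Real.sin_nat_mul_pi]
  have hκ : Tendsto κ atTop (𝓝 k) := by
    have h5 : Tendsto (fun n => Real.pi - e n - e n) atTop (𝓝 (Real.pi - 0 - 0)) :=
      (tendsto_const_nhds.sub he0).sub he0
    rw [sub_zero, sub_zero] at h5
    have h6 := (tendsto_const_nhds (x := k * Real.pi)).div h5 hpi.ne'
    rwa [mul_div_cancel_right₀ _ hpi.ne'] at h6
  have hB0 : 0 ≤ B := (abs_nonneg _).trans (hB (Real.pi / 2) ⟨by positivity, by linarith⟩)
  have hint := fun n => hu.moment_integrated hV hB (he n).1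
    (by linarith [(he n).2] : e n < Real.pi - e n) (by linarith [(he n).1]) (hκ0 n) h1 h12 h2 hK
  have hmeas : ∀ t ∈ Icc t₁ t₂, AEStronglyMeasurable (u t) muI := fun t ht =>
    ((hu.continuousOn_section (hIT ht)).mono Ioo_subset_Icc_self).aestronglyMeasurable
      measurableSet_Ioo
  have hVm : AEStronglyMeasurable (deriv V) muI := hV.aestronglyMeasurable measurableSet_Ioo
  have hexp : ∀ s : ℝ, Tendsto (fun n => Real.exp (κ n ^ 2 * s)) atTop
      (𝓝 (Real.exp ((k : ℝ) ^ 2 * s))) := fun s =>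
    (Real.continuous_exp.tendsto _).comp ((hκ.pow 2).mul_const s)
  have hmom : ∀ t ∈ Icc t₁ t₂, Tendsto (fun n => Real.exp (κ n ^ 2 * t) *
      ∫ y in (e n)..(Real.pi - e n), u t y * Real.sin (κ n * (y - e n))) atTop
      (𝓝 (Real.exp ((k : ℝ) ^ 2 * t) * ∫ y, u t y * Real.sin (k * y) ∂muI)) := fun t ht =>
    (hexp t).mul (tendsto_moment (hmeas t ht) (fun y hy => hK t ht y (Ioo_subset_Icc_self hy))
      (fun n => (he n).1) (fun n => (he n).2) he0 hκ)
  refine tendsto_nhds_unique ((hmom t₂ ⟨h12, le_rfl⟩).sub (hmom t₁ ⟨le_rfl, h12⟩)) ?_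
  simp only [fun n => (hint n).1]
  refine intervalIntegral.tendsto_integral_filter_of_dominated_convergence
    (fun _ => Real.exp ((2 * k) ^ 2 * t₂) * (K * (2 * k) + K * (2 * k) + K * B * Real.pi))
    (Eventually.of_forall fun n => (hint n).2.1)
    (Eventually.of_forall fun n => ae_of_all _ fun s hs => ((hint n).2.2 s hs).trans ?_)
    intervalIntegrable_const (ae_of_all _ fun s hs => ?_)
  · have h7 : κ n ^ 2 ≤ (2 * k) ^ 2 := sq_le_sq' (by linarith [(abs_le.1 (hκb n)).1])
      ((le_abs_self _).trans (hκb n))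
    have h8 := hκb n
    have h9 : Real.pi - e n - e n ≤ Real.pi := by linarith [(he n).1]
    have h10 : 0 ≤ Real.pi - e n - e n := by linarith [hden n]
    have h11 : 0 ≤ t₂ := h1.le.trans h12
    gcongr
  · have hs' : s ∈ Icc t₁ t₂ := huI ▸ uIoc_subset_uIcc hs
    have hsT := hIT hs'
    have b0 : Tendsto (fun n => u s (e n)) atTop (𝓝 0) := by
      have hc := hu.continuousOn_section hsT 0 ⟨le_rfl, hpi.le⟩
      rw [ContinuousWithinAt, (hu.boundary s hsT).1] at hc
      refine hc.comp (tendsto_nhdsWithin_iff.2 ⟨he0, Eventually.of_forall fun n => ?_⟩)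
      exact ⟨(he n).1.le, by linarith [(he n).2]⟩
    have b1 : Tendsto (fun n => u s (Real.pi - e n)) atTop (𝓝 0) := by
      have hc := hu.continuousOn_section hsT Real.pi ⟨hpi.le, le_rfl⟩
      rw [ContinuousWithinAt, (hu.boundary s hsT).2] at hc
      have h12 : Tendsto (fun n => Real.pi - e n) atTop (𝓝 Real.pi) := by
        simpa using (tendsto_const_nhds (x := Real.pi)).sub he0
      refine hc.comp (tendsto_nhdsWithin_iff.2 ⟨h12, Eventually.of_forall fun n => ?_⟩)
      exact ⟨by linarith [(he n).2], by linarith [(he n).1]⟩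
    have c1 : Tendsto (fun n => u s (Real.pi - e n) *
        (κ n * Real.cos (κ n * (Real.pi - e n - e n)))) atTop (𝓝 0) := by
      refine squeeze_zero_norm (fun n => ?_) (by simpa using b1.norm.mul_const (2 * k : ℝ))
      rw [norm_mul, norm_mul]
      refine mul_le_mul_of_nonneg_left ?_ (norm_nonneg _)
      exact (mul_le_of_le_one_right (norm_nonneg _) (Real.abs_cos_le_one _)).trans (hκb n)
    have c0 : Tendsto (fun n => u s (e n) * κ n) atTop (𝓝 0) := by simpa using b0.mul hκ
    have hlim := (hexp s).mul (((c1.sub c0).neg).add (tendsto_moment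
      ((hmeas s hs').mul hVm) (K := K * B) (fun y hy => by
        simp only [Pi.mul_apply]
        rw [abs_mul]
        exact mul_le_mul (hK s hs' y (Ioo_subset_Icc_self hy)) (hB y hy) (abs_nonneg _) hK0)
      (fun n => (he n).1) (fun n => (he n).2) he0 hκ))
    simpa only [sub_zero, neg_zero, zero_add, Pi.mul_apply] using hlim

end IsClassicalSolution

/-! ### Regularized form of the classical equation -/

/-- `V` is differentiable on `(0,π)` with continuous derivative bounded by `B`. -/
structure C1Bound (B : ℝ) (V : ℝ → ℝ) : Prop where
  hasDerivAt : ∀ y ∈ Ioo 0 Real.pi, HasDerivAt V (deriv V y) y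
  continuousOn : ContinuousOn (deriv V) (Ioo 0 Real.pi)
  bound : ∀ y ∈ Ioo 0 Real.pi, |deriv V y| ≤ B

lemma C1Bound.nonneg {B : ℝ} {V : ℝ → ℝ} (h : C1Bound B V) : 0 ≤ B :=
  (abs_nonneg _).trans (h.bound (Real.pi / 2) ⟨by positivity, by linarith [Real.pi_pos]⟩)

lemma exists_c1Bound {V : ℝ → ℝ} (hV : ContDiffOn ℝ ∞ V (Icc 0 Real.pi)) : ∃ B, C1Bound B V := by
  have hc : ContinuousOn (derivWithin V (Icc 0 Real.pi)) (Icc 0 Real.pi) :=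
    hV.continuousOn_derivWithin (uniqueDiffOn_Icc Real.pi_pos) (by simp)
  obtain ⟨B, hB⟩ := isCompact_Icc.exists_bound_of_continuousOn hc
  have hn : ∀ y ∈ Ioo 0 Real.pi, Icc 0 Real.pi ∈ 𝓝 y := fun y hy => Icc_mem_nhds hy.1 hy.2
  have he : ∀ y ∈ Ioo 0 Real.pi, derivWithin V (Icc 0 Real.pi) y = deriv V y := fun y hy =>
    derivWithin_of_mem_nhds (hn y hy)
  refine ⟨B, fun y hy => ?_, (hc.mono Ioo_subset_Icc_self).congr fun y hy => (he y hy).symm,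
    fun y hy => ?_⟩
  · exact ((hV.differentiableOn (by simp)).differentiableAt (hn y hy)).hasDerivAt
  · rw [← he y hy]
    exact hB y (Ioo_subset_Icc_self hy)

lemma HasIntegrableDeriv.integrable_divForm {f f' V : ℝ → ℝ} (h : HasIntegrableDeriv f f')
    {M γ : ℝ} (hH : HolderBound γ M V) {τ x : ℝ} (hτ : 0 < τ) (hx : x ∈ Ioo 0 Real.pi) :
    Integrable (fun y => (kDy τ x y * f y + dirichletKernel τ x y * f' y) * V y) muI := by
  obtain ⟨C, hC, hb⟩ := exists_kernel_bound hτ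
  have hb' := fun y hy => hb τ le_rfl x hx y hy
  have := integrable_bdd_mul ((integrable_bdd_mul h.integrable_self
    (measurable_kDy_right τ x).aestronglyMeasurable (fun y hy => (hb' y hy).2.2.1)).add
    (integrable_bdd_mul h.integrable (measurable_dirichletKernel_right τ x).aestronglyMeasurable
    (fun y hy => (hb' y hy).1))) hH.measurable.aestronglyMeasurable hH.bound
  exact this.congr (ae_of_all _ fun y => mul_comm _ _)

/-- Integration by parts with the product `P^D V`, which vanishes at the endpoints since `V` is
bounded. It shows that the divergence form agrees with the actual product `f V'` when `V` is
differentiable. -/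
lemma HasIntegrableDeriv.heatSemigroup_mul_deriv {f f' V : ℝ → ℝ} (h : HasIntegrableDeriv f f')
    {B M γ : ℝ} (hV : C1Bound B V) (hH : HolderBound γ M ((Ioo 0 Real.pi).indicator V)) {τ x : ℝ}
    (hτ : 0 < τ) (hx : x ∈ Ioo 0 Real.pi) :
    heatSemigroup τ (fun y => f y * deriv V y) x =
      divSemigroup τ ((Ioo 0 Real.pi).indicator V) f f' x := by
  obtain ⟨C, hC, hb⟩ := exists_kernel_bound hτ
  have hb' := fun y hy => hb τ le_rfl x hx y hy
  have hpi := Real.pi_pos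
  have hM := hH.nonneg
  have hVM : ∀ y ∈ Ioo 0 Real.pi, |V y| ≤ M := fun y hy => by
    have := hH.bound y hy
    rwa [indicator_of_mem hy] at this
  have hVm : AEStronglyMeasurable V muI := aestronglyMeasurable_of_hasDerivAt hV.hasDerivAt
  have hV'm : AEStronglyMeasurable (deriv V) muI := (measurable_deriv V).aestronglyMeasurable
  have hPc : Continuous (dirichletKernel τ x) := continuous_iff_continuousAt.2 fun y =>
    (hasDerivAt_dirichletKernel_right hτ x y).continuousAt
  have hPm := hPc.aestronglyMeasurable (μ := muI)
  have hkm := (measurable_kDy_right τ x).aestronglyMeasurable (μ := muI)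
  have hz := integral_deriv_mul_eq_zero h (K := fun y => dirichletKernel τ x y * V y)
    (K' := fun y => kDy τ x y * V y + dirichletKernel τ x y * deriv V y) (C := C * M + C * B)
    (fun y hy => (hasDerivAt_dirichletKernel_right hτ x y).mul (hV.hasDerivAt y hy))
    ((hkm.mul hVm).add (hPm.mul hV'm)) (fun y hy => ?_) (fun y hy => ?_) ?_ ?_
  · have i1 : Integrable (fun y => dirichletKernel τ x y * (f y * deriv V y)) muI := by
      have := integrable_bdd_mul (integrable_bdd_mul h.integrable_self hV'm hV.bound) hPm
        (fun y hy => (hb' y hy).1)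
      exact this.congr (ae_of_all _ fun y => by ring)
    have i2 := h.integrable_divForm hH hτ hx
    rw [heatSemigroup_eq, divSemigroup, eq_neg_iff_add_eq_zero, ← integral_add i1 i2]
    refine Eq.trans (integral_congr_ae (ae_muI_mem.mono fun y hy => ?_)) hz
    simp only [indicator_of_mem hy]
    ring
  · rw [abs_mul]
    refine (mul_le_mul (hb' y hy).1 (hVM y hy) (abs_nonneg _) hC).trans ?_
    exact le_add_of_nonneg_right (mul_nonneg hC hV.nonneg)
  · refine (abs_add_le _ _).trans (add_le_add ?_ ?_)
    · rw [abs_mul]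
      exact mul_le_mul (hb' y hy).2.2.1 (hVM y hy) (abs_nonneg _) hC
    · rw [abs_mul]
      exact mul_le_mul (hb' y hy).1 (hV.bound y hy) (abs_nonneg _) hC
  · have h0 : Tendsto (dirichletKernel τ x) (𝓝[>] 0) (𝓝 0) := by
      simpa only [dirichletKernel_zero] using (hPc.tendsto 0).mono_left nhdsWithin_le_nhds
    exact (bdd_le_mul_tendsto_zero' M (by
      filter_upwards [Ioo_mem_nhdsGT hpi] with y hy using hVM y hy) h0).congr fun y => mul_comm _ _
  · have h0 : Tendsto (dirichletKernel τ x) (𝓝[<] Real.pi) (𝓝 0) := by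
      simpa only [dirichletKernel_pi] using (hPc.tendsto Real.pi).mono_left nhdsWithin_le_nhds
    exact (bdd_le_mul_tendsto_zero' M (by
      filter_upwards [Ioo_mem_nhdsLT hpi] with y hy using hVM y hy) h0).congr fun y => mul_comm _ _

lemma sineCoeff_eq_moment (k : ℕ) (f : ℝ → ℝ) :
    sineCoeff k f = Real.sqrt (2 / Real.pi) * ∫ y, f y * Real.sin (k * y) ∂muI := by
  rw [sineCoeff, ← integral_const_mul]
  refine integral_congr_ae (ae_of_all _ fun y => ?_)
  simp only [sineMode]
  ring

namespace IsClassicalSolution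

variable {T : ℝ} {p : ℝ≥0∞} {V u₀ : ℝ → ℝ} {u : ℝ → ℝ → ℝ}

lemma aestronglyMeasurable_section (hu : IsClassicalSolution T p V u₀ u) {t : ℝ}
    (ht : t ∈ Ioo 0 T) : AEStronglyMeasurable (u t) muI :=
  ((hu.continuousOn_section ht).mono Ioo_subset_Icc_self).aestronglyMeasurable measurableSet_Ioo

/-- Near `t = 0` the convergence to `u₀` in `L_p` gives the bound, and on the remaining times
continuity on a compact rectangle does. Nothing is assumed as `t` approaches `T`, hence the
restriction to `T' < T`. -/
lemma exists_eLpNorm_bound (hu : IsClassicalSolution T p V u₀ u) (hp : 1 ≤ p)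
    (hu₀ : MemLp u₀ p muI) {T' : ℝ} (hT' : T' < T) :
    ∃ K : ℝ≥0∞, K ≠ ⊤ ∧ ∀ t, 0 < t → t ≤ T' → eLpNorm (u t) p muI ≤ K := by
  have h1 : ∀ᶠ t in 𝓝[>] (0 : ℝ), eLpNorm (fun x => u t x - u₀ x) p muI < 1 :=
    hu.initial.eventually_lt_const one_pos
  obtain ⟨τ, hτ, hτ1⟩ := mem_nhdsGT_iff_exists_Ioo_subset.1 h1
  have hτ0 : (0 : ℝ) < τ := hτ
  obtain ⟨K, hK0, hK⟩ := hu.exists_bound hτ0 hT'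
  refine ⟨(1 + eLpNorm u₀ p muI) + muI univ ^ p.toReal⁻¹ * ENNReal.ofReal K,
    ENNReal.add_ne_top.2 ⟨ENNReal.add_ne_top.2 ⟨ENNReal.one_ne_top, hu₀.2.ne⟩,
      ENNReal.mul_ne_top (ENNReal.rpow_ne_top_of_nonneg (by positivity) (measure_ne_top _ _))
        ENNReal.ofReal_ne_top⟩, fun t ht0 htT => ?_⟩
  have ht : t ∈ Ioo 0 T := ⟨ht0, htT.trans_lt hT'⟩
  rcases lt_or_ge t τ with h | h
  · refine le_trans ?_ le_self_add
    have h2 : eLpNorm (fun x => u t x - u₀ x) p muI < 1 := hτ1 ⟨ht0, h⟩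
    have e : u t = (fun x => u t x - u₀ x) + u₀ := by
      funext x
      simp
    rw [e]
    exact (eLpNorm_add_le ((hu.aestronglyMeasurable_section ht).sub hu₀.1) hu₀.1 hp).trans
      (add_le_add h2.le le_rfl)
  · refine le_trans ?_ le_add_self
    exact eLpNorm_le_of_ae_bound (ae_muI_mem.mono fun y hy =>
      hK t ⟨h, htT⟩ y (Ioo_subset_Icc_self hy))

lemma measurable_cutoff (hu : IsClassicalSolution T p V u₀ u) {T' : ℝ} (hT' : T' ≤ T) :
    Measurable (Function.uncurry (cutoff T' u)) := by
  refine _root_.measurable_cutoff (fun x hx t ht => ?_) fun t ht => ?_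
  · exact (hu.hasDerivAt_time ⟨ht.1, ht.2.trans_le hT'⟩ hx).continuousAt.continuousWithinAt
  · exact (hu.continuousOn_section ⟨ht.1, ht.2.trans_le hT'⟩).mono Ioo_subset_Icc_self

lemma measurable_cutoffDx (hu : IsClassicalSolution T p V u₀ u) {T' : ℝ} (hT' : T' ≤ T) :
    Measurable (Function.uncurry (cutoffDx T' u)) := by
  refine _root_.measurable_cutoffDx (fun x hx t ht => ?_) fun t ht => ?_
  · exact (hu.hasDerivAt_time ⟨ht.1, ht.2.trans_le hT'⟩ hx).continuousAt.continuousWithinAt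
  · exact (hu.diff_space t ⟨ht.1, ht.2.trans_le hT'⟩).of_le (by norm_num)

end IsClassicalSolution

/-- The reaction term of the classical equation. -/
def reaction (T : ℝ) (V : ℝ → ℝ) (u : ℝ → ℝ → ℝ) (s y : ℝ) : ℝ := cutoff T u s y * deriv V y

namespace IsClassicalSolution

variable {T : ℝ} {p : ℝ≥0∞} {V u₀ : ℝ → ℝ} {u : ℝ → ℝ → ℝ}

lemma measurable_reaction (hu : IsClassicalSolution T p V u₀ u) {T' : ℝ} (hT' : T' ≤ T) :
    Measurable (Function.uncurry (reaction T' V u)) :=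
  (hu.measurable_cutoff hT').mul ((measurable_deriv V).comp measurable_snd)

lemma exists_reaction_bound (hu : IsClassicalSolution T p V u₀ u) (hp : 1 ≤ p)
    (hu₀ : MemLp u₀ p muI) {B : ℝ} (hV : C1Bound B V) {T' : ℝ} (hT' : T' < T) :
    ∃ K : ℝ≥0∞, K ≠ ⊤ ∧ ∀ t ∈ Ioo 0 T', eLpNorm (reaction T' V u t) p muI ≤ K := by
  obtain ⟨K, hK, hb⟩ := hu.exists_eLpNorm_bound hp hu₀ hT'
  refine ⟨ENNReal.ofReal B * K, ENNReal.mul_ne_top ENNReal.ofReal_ne_top hK, fun t ht => ?_⟩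
  refine (eLpNorm_le_mul_eLpNorm_of_ae_le_mul (g := u t) (c := B)
    (ae_muI_mem.mono fun y hy => ?_) p).trans (mul_le_mul_right (hb t ht.1 ht.2.le) _)
  rw [reaction, cutoff_of_mem ht hy, norm_mul, mul_comm]
  exact mul_le_mul_of_nonneg_right (hV.bound y hy) (norm_nonneg _)

lemma exists_reaction_integral_bound (hu : IsClassicalSolution T p V u₀ u) (hp : 1 ≤ p)
    (hu₀ : MemLp u₀ p muI) {B : ℝ} (hV : C1Bound B V) {T' : ℝ} (hT' : T' < T) :
    ∃ G : ℝ, 0 ≤ G ∧ ∀ t ∈ Ioo 0 T', Integrable (reaction T' V u t) muI ∧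
      ∫ y, ‖reaction T' V u t y‖ ∂muI ≤ G := by
  obtain ⟨K, hK, hb⟩ := hu.exists_reaction_bound hp hu₀ hV hT'
  refine ⟨(ENNReal.ofReal (1 + Real.pi) * K).toReal, ENNReal.toReal_nonneg, fun t ht => ?_⟩
  have hm : AEStronglyMeasurable (reaction T' V u t) muI :=
    ((hu.measurable_reaction hT'.le).of_uncurry_left (x := t)).aestronglyMeasurable
  refine ⟨integrable_of_eLpNorm_lt_top hp hm ((hb t ht).trans_lt (lt_top_iff_ne_top.2 hK)), ?_⟩
  rw [integral_norm_eq_lintegral_enorm hm]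
  refine ENNReal.toReal_mono (ENNReal.mul_ne_top ENNReal.ofReal_ne_top hK) ?_
  rw [← eLpNorm_one_eq_lintegral_enorm]
  exact (eLpNorm_one_le hp hm).trans (mul_le_mul_right (hb t ht) _)

lemma measurable_sineCoeff_reaction (hu : IsClassicalSolution T p V u₀ u) {T' : ℝ} (hT' : T' ≤ T)
    (k : ℕ) : Measurable fun s => sineCoeff k (reaction T' V u s) := by
  refine StronglyMeasurable.measurable ?_
  exact StronglyMeasurable.integral_prod_right'
    (f := fun q : ℝ × ℝ => reaction T' V u q.1 q.2 * sineMode k q.2)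
    ((hu.measurable_reaction hT').mul
      ((measurable_sineMode k).comp measurable_snd)).stronglyMeasurable

/-- Duhamel's formula for a single mode. It results from `sine_moment_eq` as the initial time tends
to zero, the coefficient of `u` then tending to that of `u₀`. -/
lemma sineCoeff_eq (hu : IsClassicalSolution T p V u₀ u) (hp : 1 ≤ p) (hu₀ : MemLp u₀ p muI)
    {B : ℝ} (hV : C1Bound B V) {T' : ℝ} (hT' : T' < T) (j : ℕ) {t : ℝ} (ht : t ∈ Ioo 0 T') :
    sineCoeff (j + 1) (u t) = decay j t * sineCoeff (j + 1) u₀ +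
      ∫ s in Ioo 0 t, decay j (t - s) * sineCoeff (j + 1) (reaction T' V u s) := by
  obtain ⟨G, hG, hGb⟩ := hu.exists_reaction_integral_bound hp hu₀ hV hT'
  set k : ℕ := j + 1
  set r : ℝ → ℝ := fun s => Real.exp ((k : ℝ) ^ 2 * s) * sineCoeff k (reaction T' V u s)
  have hrm : Measurable r :=
    Measurable.mul (by fun_prop) (hu.measurable_sineCoeff_reaction hT'.le k)
  have hri : IntegrableOn r (Icc 0 t) := by
    rw [integrableOn_Icc_iff_integrableOn_Ioo]
    refine Integrable.of_bound hrm.aestronglyMeasurable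
      (Real.exp ((k : ℝ) ^ 2 * t) * (Real.sqrt (2 / Real.pi) * G))
      (ae_restrict_of_forall_mem measurableSet_Ioo fun s hs => ?_)
    have hs' : s ∈ Ioo 0 T' := ⟨hs.1, hs.2.trans ht.2⟩
    simp only [r]
    rw [norm_mul, Real.norm_of_nonneg (Real.exp_pos _).le]
    refine mul_le_mul (Real.exp_le_exp.2 (mul_le_mul_of_nonneg_left hs.2.le (sq_nonneg _))) ?_
      (norm_nonneg _) (Real.exp_pos _).le
    exact (abs_sineCoeff_le (hGb s hs').1 k).trans
      (mul_le_mul_of_nonneg_left (hGb s hs').2 (by positivity))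
  have hkey : ∀ t₁ ∈ Ioo 0 t, Real.exp ((k : ℝ) ^ 2 * t) * sineCoeff k (u t) -
      Real.exp ((k : ℝ) ^ 2 * t₁) * sineCoeff k (u t₁) = ∫ s in t₁..t, r s := fun t₁ h1 => by
    have h := hu.sine_moment_eq hV.continuousOn hV.bound k h1.1 h1.2.le (ht.2.trans hT')
    have h' := congrArg (fun v => Real.sqrt (2 / Real.pi) * v) h
    simp only [← intervalIntegral.integral_const_mul] at h'
    rw [sineCoeff_eq_moment, sineCoeff_eq_moment]
    refine Eq.trans (by ring) (h'.trans ?_)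
    refine intervalIntegral.integral_congr fun s hs => ?_
    rw [uIcc_of_le h1.2.le] at hs
    have hs' : s ∈ Ioo 0 T' := ⟨h1.1.trans_le hs.1, hs.2.trans_lt ht.2⟩
    simp only [r]
    rw [sineCoeff_eq_moment, mul_left_comm]
    congr 2
    refine integral_congr_ae (ae_muI_mem.mono fun y hy => ?_)
    simp only [reaction]
    rw [cutoff_of_mem hs' hy]
  have hlim1 : Tendsto (fun t₁ => Real.exp ((k : ℝ) ^ 2 * t) * sineCoeff k (u t) -
      Real.exp ((k : ℝ) ^ 2 * t₁) * sineCoeff k (u t₁)) (𝓝[>] 0)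
      (𝓝 (Real.exp ((k : ℝ) ^ 2 * t) * sineCoeff k (u t) - 1 * sineCoeff k u₀)) := by
    refine tendsto_const_nhds.sub (Tendsto.mul ?_ ?_)
    · have : Tendsto (fun t₁ : ℝ => Real.exp ((k : ℝ) ^ 2 * t₁)) (𝓝 0)
          (𝓝 (Real.exp ((k : ℝ) ^ 2 * 0))) := Continuous.tendsto (by fun_prop) 0
      rw [mul_zero, Real.exp_zero] at this
      exact this.mono_left nhdsWithin_le_nhds
    · refine tendsto_sineCoeff_of_tendsto_eLpNorm hp ?_ (hu₀.integrable hp) hu.initial k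
      obtain ⟨K, hK, hb⟩ := hu.exists_eLpNorm_bound hp hu₀ hT'
      filter_upwards [Ioo_mem_nhdsGT (ht.1.trans ht.2)] with s hs
      exact integrable_of_eLpNorm_lt_top hp
        (hu.aestronglyMeasurable_section ⟨hs.1, hs.2.trans hT'⟩)
        ((hb s hs.1 hs.2.le).trans_lt (lt_top_iff_ne_top.2 hK))
  have hlim2 : Tendsto (fun t₁ => ∫ s in t₁..t, r s) (𝓝[>] 0) (𝓝 (∫ s in (0 : ℝ)..t, r s)) := by
    have hc := intervalIntegral.continuousOn_primitive_interval_left (a := 0) (b := t) (f := r)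
      (μ := volume) (by rwa [uIcc_of_le ht.1.le]) 0 left_mem_uIcc
    refine hc.mono_left ?_
    rw [uIcc_of_le ht.1.le]
    exact (nhdsWithin_le_iff.2 (mem_of_superset (Ioo_mem_nhdsGT ht.1) Ioo_subset_Icc_self))
  have heq := tendsto_nhds_unique (hlim1.congr' (by
    filter_upwards [Ioo_mem_nhdsGT ht.1] with t₁ h1 using hkey t₁ h1)) hlim2
  rw [intervalIntegral.integral_of_le ht.1.le, integral_Ioc_eq_integral_Ioo] at heq
  have hE : Real.exp ((k : ℝ) ^ 2 * t) * decay j t = 1 := by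
    rw [decay, ← Real.exp_add]
    simp [k]
  have e2 : ∫ s in Ioo 0 t, decay j (t - s) * sineCoeff k (reaction T' V u s) =
      decay j t * ∫ s in Ioo 0 t, r s := by
    rw [← integral_const_mul]
    refine integral_congr_ae (ae_of_all _ fun s => ?_)
    simp only [r, decay]
    rw [← mul_assoc, ← Real.exp_add]
    congr 2
    ring
  rw [e2, ← heq]
  linear_combination (-sineCoeff k (u t)) * hE

/-- Summation of Duhamel's formula over all modes. Because of `η > 0` the series converges
absolutely, uniformly in `s`, and can be exchanged with the time integral. -/
lemma regularized_reaction (hu : IsClassicalSolution T p V u₀ u) (hp : 1 ≤ p)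
    (hu₀ : MemLp u₀ p muI) {B : ℝ} (hV : C1Bound B V) {T' : ℝ} (hT' : T' < T) {t : ℝ}
    (ht : t ∈ Ioo 0 T') {η : ℝ} (hη : 0 < η) (x : ℝ) :
    heatSemigroup η (cutoff T' u t) x = heatSemigroup (t + η) u₀ x +
      ∫ s in Ioo 0 t, heatSemigroup (t - s + η) (reaction T' V u s) x := by
  obtain ⟨G, hG, hGb⟩ := hu.exists_reaction_integral_bound hp hu₀ hV hT'
  obtain ⟨K, hK, hKb⟩ := hu.exists_eLpNorm_bound hp hu₀ hT'
  have htT : t ∈ Ioo 0 T := ⟨ht.1, ht.2.trans hT'⟩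
  have hui : Integrable (u t) muI := integrable_of_eLpNorm_lt_top hp
    (hu.aestronglyMeasurable_section htT) ((hKb t ht.1 ht.2.le).trans_lt (lt_top_iff_ne_top.2 hK))
  have hu₀i := hu₀.integrable hp
  set F : ℕ → ℝ → ℝ := fun j s =>
    decay j (t - s + η) * sineMode (j + 1) x * sineCoeff (j + 1) (reaction T' V u s)
  have hmem : ∀ s ∈ Ioo 0 t, s ∈ Ioo 0 T' := fun s hs => ⟨hs.1, hs.2.trans ht.2⟩
  have hFm : ∀ j, Measurable (F j) := fun j =>
    Measurable.mul (Measurable.mul (by unfold decay; fun_prop) measurable_const)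
      (hu.measurable_sineCoeff_reaction hT'.le _)
  set c : ℝ := Real.sqrt (2 / Real.pi) * (Real.sqrt (2 / Real.pi) * G)
  have hc : 0 ≤ c := by positivity
  have hFb : ∀ j, ∀ s ∈ Ioo 0 t, ‖F j s‖ ≤ c * decay j η := fun j s hs => by
    have h1 := abs_mode_mul_le (decay_pos j (t - s + η)).le (abs_sineMode_le (j + 1) x)
      ((abs_sineCoeff_le (hGb s (hmem s hs)).1 (j + 1)).trans
        (mul_le_mul_of_nonneg_left (hGb s (hmem s hs)).2 (Real.sqrt_nonneg _)))
    have h2 : decay j (t - s + η) ≤ decay j η := by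
      rw [decay_add]
      exact mul_le_of_le_one_left (decay_pos j η).le (decay_le_one j (by linarith [hs.2]))
    refine h1.trans ?_
    calc _ = c * decay j (t - s + η) := by simp only [c]; ring
      _ ≤ _ := mul_le_mul_of_nonneg_left h2 hc
  have hFi : ∀ j, IntegrableOn (F j) (Ioo 0 t) := fun j =>
    Integrable.of_bound (hFm j).aestronglyMeasurable _
      (ae_restrict_of_forall_mem measurableSet_Ioo (hFb j))
  have hsum : Summable fun j => ∫ s in Ioo 0 t, ‖F j s‖ := by
    refine Summable.of_nonneg_of_le (fun j => integral_nonneg fun _ => norm_nonneg _) (fun j => ?_)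
      ((summable_decay_zero hη).mul_left (t * c))
    calc _ ≤ ∫ s in Ioo 0 t, c * decay j η :=
          setIntegral_mono_on (hFi j).norm (integrable_const _) measurableSet_Ioo (hFb j)
      _ = _ := by
          rw [setIntegral_const, measureReal_def, Real.volume_Ioo, sub_zero,
            ENNReal.toReal_ofReal ht.1.le, smul_eq_mul, ← mul_assoc]
  have hS := hasSum_integral_of_summable_integral_norm hFi hsum
  have e1 : ∫ s in Ioo 0 t, ∑' j, F j s =
      ∫ s in Ioo 0 t, heatSemigroup (t - s + η) (reaction T' V u s) x := by
    refine setIntegral_congr_fun measurableSet_Ioo fun s hs => ?_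
    exact (heatSemigroup_hasSum (by linarith [hs.2]) (hGb s (hmem s hs)).1 x).tsum_eq
  rw [e1] at hS
  rw [heatSemigroup_congr (cutoff_ae_eq ht)]
  refine (heatSemigroup_hasSum hη hui x).unique (hasSum_of_eq
    ((heatSemigroup_hasSum (add_pos ht.1 hη) hu₀i x).add hS) (fun j => ?_) rfl)
  rw [hu.sineCoeff_eq hp hu₀ hV hT' j ht, mul_add, ← integral_const_mul, decay_add]
  congr 1
  · ring
  · refine integral_congr_ae (ae_of_all _ fun s => ?_)
    simp only [F, decay_add]
    ring

end IsClassicalSolution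

/-! ### The classical solution as a source -/

lemma exists_initial_bound : ∃ C : ℝ, 0 ≤ C ∧ ∀ (p : ℝ≥0∞), 1 ≤ p → p ≠ ⊤ → ∀ f : ℝ → ℝ,
    AEStronglyMeasurable f muI → ∀ t, 0 < t → ∀ η, 0 ≤ η →
      eLpNorm (heatSemigroup (t + η) f) p muI ≤ ENNReal.ofReal C * eLpNorm f p muI ∧
      eLpNorm (heatSemigroupDx (t + η) f) p muI ≤
        ENNReal.ofReal C * (eLpNorm f p muI * powKer (1 / 2) t) := by
  obtain ⟨C, hC, h⟩ := eLpNorm_heatSemigroup_le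
  refine ⟨C, hC, fun p hp hp' f hf t ht η hη => ?_⟩
  obtain ⟨h0, h1⟩ := h p hp hp' (t + η) (by linarith) f hf
  refine ⟨h0, h1.trans ?_⟩
  rw [powKer_of_pos _ ht, mul_comm (eLpNorm f p muI), ← mul_assoc, ← ENNReal.ofReal_mul hC]
  refine mul_le_mul_left (ENNReal.ofReal_le_ofReal (mul_le_mul_of_nonneg_left ?_ hC)) _
  rw [show (1 / 2 - 1 : ℝ) = -1 / 2 by norm_num]
  exact Real.rpow_le_rpow_of_nonpos ht (by linarith) (by norm_num)

lemma setLIntegral_powKer_sub {θ t : ℝ} (hθ : 0 < θ) (ht : 0 ≤ t) :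
    ∫⁻ s in Ioo 0 t, powKer θ (t - s) = ENNReal.ofReal (t ^ θ / θ) := by
  rw [← lintegral_powKer hθ ht, ← lintegral_indicator measurableSet_Ioo,
    ← lintegral_indicator measurableSet_Ioo,
    ← lintegral_sub_left_eq_self ((Ioo 0 t).indicator (powKer θ)) t]
  refine lintegral_congr fun s => ?_
  have : s ∈ Ioo 0 t ↔ t - s ∈ Ioo 0 t := by
    simp only [mem_Ioo]
    constructor <;> rintro ⟨h1, h2⟩ <;> constructor <;> linarith
  by_cases hs : s ∈ Ioo 0 t
  · rw [indicator_of_mem hs, indicator_of_mem (this.1 hs)]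
  · rw [indicator_of_notMem hs, indicator_of_notMem (fun h => hs (this.2 h))]

lemma measurable_heatSemigroup_source {k : ℝ → ℝ → ℝ → ℝ}
    (hk : Measurable fun q : ℝ × ℝ × ℝ => k q.1 q.2.1 q.2.2) {R : ℝ → ℝ → ℝ}
    (hR : Measurable (Function.uncurry R)) (t η : ℝ) :
    Measurable (Function.uncurry fun s x => ∫ y, k (t - s + η) x y * R s y ∂muI) := by
  have m1 : Measurable fun z : (ℝ × ℝ) × ℝ => (t - z.1.1 + η, z.1.2, z.2) := by fun_prop
  have m2 : Measurable fun z : (ℝ × ℝ) × ℝ => (z.1.1, z.2) := by fun_prop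
  exact (StronglyMeasurable.integral_prod_right'
    (f := fun z : (ℝ × ℝ) × ℝ => k (t - z.1.1 + η) z.1.2 z.2 * R z.1.1 z.2)
    ((hk.comp m1).mul (hR.comp m2)).stronglyMeasurable).measurable

lemma cutoffDx_of_notMem {T : ℝ} {v : ℝ → ℝ → ℝ} {s : ℝ} (hs : s ∉ Ioo 0 T) :
    cutoffDx T v s = 0 := cutoff_of_notMem (v := fun s => deriv (v s)) hs

namespace IsClassicalSolution

variable {T : ℝ} {p : ℝ≥0∞} {V u₀ : ℝ → ℝ} {u : ℝ → ℝ → ℝ}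

lemma integrable_cutoff (hu : IsClassicalSolution T p V u₀ u) (hp : 1 ≤ p) (hu₀ : MemLp u₀ p muI)
    {T' : ℝ} (hT' : T' < T) {t : ℝ} (ht : t ∈ Ioo 0 T') : MemLp (cutoff T' u t) p muI := by
  obtain ⟨K, hK, hKb⟩ := hu.exists_eLpNorm_bound hp hu₀ hT'
  exact (memLp_congr_ae (cutoff_ae_eq ht)).2
    ⟨hu.aestronglyMeasurable_section ⟨ht.1, ht.2.trans hT'⟩,
      (hKb t ht.1 ht.2.le).trans_lt (lt_top_iff_ne_top.2 hK)⟩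

lemma hasDerivAt_cutoff (hu : IsClassicalSolution T p V u₀ u) {T' : ℝ} (hT' : T' ≤ T) {t : ℝ}
    (ht : t ∈ Ioo 0 T') :
    ∀ x ∈ Ioo 0 Real.pi, HasDerivAt (cutoff T' u t) (cutoffDx T' u t x) x :=
  cutoff_hasDerivAt ht ((hu.diff_space t ⟨ht.1, ht.2.trans_le hT'⟩).of_le (by norm_num))

/-- For smooth `V` the reaction term is bounded in `L_p` up to `T'`, so the smoothing rate
`τ^(-1/2)` of the semigroup and one use of Duhamel's formula suffice. The constants depend on `V'`
and `T'`; the bound serves only to show that the norms are finite and integrable in time. -/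
lemma exists_deriv_bound (hu : IsClassicalSolution T p V u₀ u) (hp : 1 ≤ p) (hp' : p ≠ ⊤)
    (hu₀ : MemLp u₀ p muI) {B : ℝ} (hV : C1Bound B V) {T' : ℝ} (hT' : T' < T) :
    ∃ K₀ K₁ : ℝ≥0∞, K₀ ≠ ⊤ ∧ K₁ ≠ ⊤ ∧ ∀ t ∈ Ioo 0 T',
      eLpNorm (cutoffDx T' u t) p muI ≤ K₀ * powKer (1 / 2) t + K₁ := by
  obtain ⟨G, hG, hGb⟩ := hu.exists_reaction_integral_bound hp hu₀ hV hT'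
  obtain ⟨K, hK, hKb⟩ := hu.exists_reaction_bound hp hu₀ hV hT'
  obtain ⟨C, hC, hCb⟩ := exists_initial_bound
  obtain ⟨C', hC', hCb'⟩ := abs_heatSemigroup_le
  have hu₀i := hu₀.integrable hp
  have hR := hu.measurable_reaction hT'.le
  have hRm : ∀ s, AEStronglyMeasurable (reaction T' V u s) muI := fun s =>
    (hR.of_uncurry_left (x := s)).aestronglyMeasurable
  refine ⟨ENNReal.ofReal C * eLpNorm u₀ p muI,
    ENNReal.ofReal C * K * ENNReal.ofReal (T' ^ (1 / 2 : ℝ) / (1 / 2)),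
    ENNReal.mul_ne_top ENNReal.ofReal_ne_top hu₀.2.ne,
    ENNReal.mul_ne_top (ENNReal.mul_ne_top ENNReal.ofReal_ne_top hK) ENNReal.ofReal_ne_top,
    fun t ht => ?_⟩
  have hmem : ∀ s ∈ Ioo 0 t, s ∈ Ioo 0 T' := fun s hs => ⟨hs.1, hs.2.trans ht.2⟩
  have hfi := (hu.integrable_cutoff hp hu₀ hT' ht).integrable hp
  have hpos : ∀ η : ℝ, η ∈ Ioc (0 : ℝ) 1 → 0 < t + η := fun η hη => add_pos ht.1 hη.1
  have key := (eLpNorm_le_of_regularization hp hp' hfi (hu.hasDerivAt_cutoff hT'.le ht)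
    (ν := volume.restrict (Ioo 0 t)) (h := fun η => heatSemigroup (t + η) u₀)
    (hx := fun η => heatSemigroupDx (t + η) u₀)
    (b := fun η s x => heatSemigroup (t - s + η) (reaction T' V u s) x)
    (bx := fun η s x => heatSemigroupDx (t - s + η) (reaction T' V u s) x)
    (A₀ := ENNReal.ofReal C * eLpNorm u₀ p muI)
    (A₁ := ENNReal.ofReal C * (eLpNorm u₀ p muI * powKer (1 / 2) t))
    (l₀ := fun _ => ENNReal.ofReal C * K)
    (l₁ := fun s => ENNReal.ofReal C * K * powKer (1 / 2) (t - s)) one_pos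
    (fun η hη x _ => hu.regularized_reaction hp hu₀ hV hT' ht hη.1 x)
    (fun η => measurable_heatSemigroup _ hu₀.1)
    (fun η => (measurable_heatSemigroupDx_uncurry hu₀.1).comp (f := fun x => (t + η, x))
      (by fun_prop))
    (fun η hη x hx => hasDerivAt_heatSemigroup (hpos η hη) hu₀i hx)
    (fun η hη => (hCb p hp hp' u₀ hu₀.1 t ht.1 η hη.1.le).1)
    (fun η hη => (hCb p hp hp' u₀ hu₀.1 t ht.1 η hη.1.le).2)
    (fun η => ?_) (fun η => measurable_heatSemigroup_source measurable_kDx hR t η)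
    (fun η hη x hx => ?_) (fun η hη => ?_) (fun η hη => ?_) (fun η hη => ?_)).2
  · refine key.trans (add_le_add (by rw [mul_assoc]) ?_)
    rw [lintegral_const_mul' _ _ (ENNReal.mul_ne_top ENNReal.ofReal_ne_top hK),
      setLIntegral_powKer_sub (by norm_num) ht.1.le]
    refine mul_le_mul_right (ENNReal.ofReal_le_ofReal ?_) _
    exact div_le_div_of_nonneg_right (Real.rpow_le_rpow ht.1.le ht.2.le (by norm_num))
      (by norm_num)
  · simp only [heatSemigroup_eq]
    exact measurable_heatSemigroup_source measurable_dirichletKernel hR t η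
  · refine Integrable.of_bound (C := C' * (η ^ 2)⁻¹ * G) ?_
      (ae_restrict_of_forall_mem measurableSet_Ioo fun s hs => ?_)
    · simp only [heatSemigroup_eq]
      exact ((measurable_heatSemigroup_source measurable_dirichletKernel hR t η).comp
        (f := fun s => (s, x)) (by fun_prop)).aestronglyMeasurable
    · have hη0 := hη.1
      have h2 : η ≤ t - s + η := by linarith [hs.2]
      refine (hCb' _ (hη0.trans_le h2) _ (hGb s (hmem s hs)).1 x).trans ?_
      have h3 : ((t - s + η) ^ 2)⁻¹ ≤ (η ^ 2)⁻¹ := by gcongr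
      exact mul_le_mul (mul_le_mul_of_nonneg_left h3 hC') (hGb s (hmem s hs)).2
        (integral_nonneg fun _ => norm_nonneg _) (by positivity)
  · exact ae_restrict_of_forall_mem measurableSet_Ioo fun s hs x hx =>
      hasDerivAt_heatSemigroup (by linarith [hs.2, hη.1]) (hGb s (hmem s hs)).1 hx
  · refine ae_restrict_of_forall_mem measurableSet_Ioo fun s hs => ?_
    exact (hCb p hp hp' _ (hRm s) (t - s) (by linarith [hs.2]) η hη.1.le).1.trans
      (mul_le_mul_right (hKb s (hmem s hs)) _)
  · refine ae_restrict_of_forall_mem measurableSet_Ioo fun s hs => ?_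
    refine (hCb p hp hp' _ (hRm s) (t - s) (by linarith [hs.2]) η hη.1.le).2.trans ?_
    rw [mul_assoc]
    exact mul_le_mul_right (mul_le_mul_left (hKb s (hmem s hs)) _) _

/-- The solution is cut off at `T'` but regarded as a source on all of `(0,T)`. In this way the
estimates, and with them their constants, refer to `T` alone. -/
lemma isSource (hu : IsClassicalSolution T p V u₀ u) (hp : 1 ≤ p) (hp' : p ≠ ⊤)
    (hu₀ : MemLp u₀ p muI) {B : ℝ} (hV : C1Bound B V) {γ M : ℝ}
    (hH : HolderBound γ M ((Ioo 0 Real.pi).indicator V)) {T' : ℝ} (hT' : T' < T) (hT0 : 0 ≤ T') :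
    IsSource p γ M T ((Ioo 0 Real.pi).indicator V) (cutoff T' u) (cutoffDx T' u) where
  holder := hH
  meas := hu.measurable_cutoff hT'.le
  meas' := hu.measurable_cutoffDx hT'.le
  deriv := by
    obtain ⟨K₀, K₁, hK₀, hK₁, hKb⟩ := hu.exists_deriv_bound hp hp' hu₀ hV hT'
    refine ae_of_all _ fun s => ?_
    by_cases hs : s ∈ Ioo 0 T'
    · refine ⟨hu.hasDerivAt_cutoff hT'.le hs, integrable_of_eLpNorm_lt_top hp
        ((hu.measurable_cutoffDx hT'.le).of_uncurry_left (x := s)).aestronglyMeasurable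
        ((hKb s hs).trans_lt ?_)⟩
      refine lt_top_iff_ne_top.2 (ENNReal.add_ne_top.2 ⟨ENNReal.mul_ne_top hK₀ ?_, hK₁⟩)
      rw [powKer_of_pos _ hs.1]
      exact ENNReal.ofReal_ne_top
    · have e1 : cutoff T' u s = 0 := cutoff_of_notMem hs
      have e2 : cutoffDx T' u s = 0 := cutoffDx_of_notMem hs
      rw [e1, e2]
      exact ⟨fun x _ => hasDerivAt_const x 0, integrable_zero _ _ _⟩
  finite := by
    obtain ⟨K₀, K₁, hK₀, hK₁, hKb⟩ := hu.exists_deriv_bound hp hp' hu₀ hV hT'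
    obtain ⟨K, hK, hKb'⟩ := hu.exists_eLpNorm_bound hp hu₀ hT'
    have hb : ∀ s, eLpNorm (cutoff T' u s) p muI + eLpNorm (cutoffDx T' u s) p muI ≤
        (Ioo 0 T').indicator (fun s => K + (K₀ * powKer (1 / 2) s + K₁)) s := fun s => by
      by_cases hs : s ∈ Ioo 0 T'
      · rw [indicator_of_mem hs, eLpNorm_congr_ae (cutoff_ae_eq hs)]
        exact add_le_add (hKb' s hs.1 hs.2.le) (hKb s hs)
      · have e1 : cutoff T' u s = 0 := cutoff_of_notMem hs
        have e2 : cutoffDx T' u s = 0 := cutoffDx_of_notMem hs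
        rw [e1, e2, eLpNorm_zero, add_zero]
        exact zero_le
    refine ((setLIntegral_le_lintegral _ _).trans (lintegral_mono hb)).trans_lt ?_ |>.ne
    rw [lintegral_indicator measurableSet_Ioo, lintegral_add_left measurable_const,
      lintegral_add_right _ measurable_const, lintegral_const_mul' _ _ hK₀,
      lintegral_powKer (by norm_num) hT0, setLIntegral_const, setLIntegral_const, Real.volume_Ioo]
    exact ENNReal.add_lt_top.2 ⟨ENNReal.mul_lt_top hK.lt_top ENNReal.ofReal_lt_top,
      ENNReal.add_lt_top.2 ⟨ENNReal.mul_lt_top hK₀.lt_top ENNReal.ofReal_lt_top,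
        ENNReal.mul_lt_top hK₁.lt_top ENNReal.ofReal_lt_top⟩⟩

lemma regularized (hu : IsClassicalSolution T p V u₀ u) (hp : 1 ≤ p) (hp' : p ≠ ⊤)
    (hu₀ : MemLp u₀ p muI) {B : ℝ} (hV : C1Bound B V) {γ M : ℝ}
    (hH : HolderBound γ M ((Ioo 0 Real.pi).indicator V)) {T' : ℝ} (hT' : T' < T) {t : ℝ}
    (ht : t ∈ Ioo 0 T') {η x : ℝ} (hη : 0 < η) (hx : x ∈ Ioo 0 Real.pi) :
    heatSemigroup η (cutoff T' u t) x = heatSemigroup (t + η) u₀ x + ∫ s in Ioo 0 t,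
      divSource t ((Ioo 0 Real.pi).indicator V) (cutoff T' u) (cutoffDx T' u) η s x := by
  have hS := hu.isSource hp hp' hu₀ hV hH hT' (ht.1.trans ht.2).le
  rw [hu.regularized_reaction hp hu₀ hV hT' ht hη x]
  congr 1
  refine integral_congr_ae ?_
  filter_upwards [hS.deriv_of_le (ht.2.trans hT').le, ae_restrict_mem measurableSet_Ioo]
    with s hs hst
  exact hs.heatSemigroup_mul_deriv hV hH (by linarith [hst.2]) hx

end IsClassicalSolution

/-! ### Hölder bounds and convolution bounds -/

lemma HolderBound.of_bounds {γ M : ℝ} (hγ : 0 < γ) (hM : 0 ≤ M) {V : ℝ → ℝ}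
    (hb : ∀ x ∈ Ioo 0 Real.pi, |V x| ≤ M)
    (hh : ∀ x ∈ Ioo 0 Real.pi, ∀ y ∈ Ioo 0 Real.pi, |V x - V y| ≤ M * |x - y| ^ γ) :
    HolderBound γ M ((Ioo 0 Real.pi).indicator V) where
  nonneg := hM
  bound x hx := by
    rw [indicator_of_mem hx]
    exact hb x hx
  holder x hx y hy := by
    rw [indicator_of_mem hx, indicator_of_mem hy]
    exact hh x hx y hy
  measurable := by
    classical
    have hc : ContinuousOn V (Ioo 0 Real.pi) := fun x hx => by
      refine tendsto_iff_norm_sub_tendsto_zero.2 (squeeze_zero' (Eventually.of_forall fun _ => norm_nonneg _)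
        (g := fun y => M * |y - x| ^ γ) (eventually_mem_nhdsWithin.mono fun y hy => hh y hy x hx) ?_)
      have h : Continuous fun y : ℝ => M * |y - x| ^ γ :=
        continuous_const.mul ((by fun_prop : Continuous fun y : ℝ => |y - x|).rpow_const
          fun _ => Or.inr hγ.le)
      have h' := (h.tendsto x).mono_left (nhdsWithin_le_nhds (s := Ioo 0 Real.pi))
      simpa [Real.zero_rpow hγ.ne'] using h'
    rw [← piecewise_eq_indicator]
    exact hc.measurable_piecewise continuousOn_const measurableSet_Ioo

lemma HolderBound.of_holderNorm {γ : ℝ} (hγ : 0 < γ) {V : ℝ → ℝ} (hV : holderNorm γ V ≠ ⊤) :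
    HolderBound γ (holderNorm γ V).toReal ((Ioo 0 Real.pi).indicator V) := by
  refine .of_bounds hγ ENNReal.toReal_nonneg (fun x hx => ?_) fun x hx y hy => ?_
  · refine (ENNReal.ofReal_le_iff_le_toReal hV).1 (le_trans ?_ le_self_add)
    exact le_iSup₂ (f := fun x (_ : x ∈ Ioo 0 Real.pi) => ENNReal.ofReal |V x|) x hx
  · rcases eq_or_ne x y with rfl | hxy
    · rw [sub_self, abs_zero]
      positivity
    · have hpos : 0 < |x - y| ^ γ := Real.rpow_pos_of_pos (abs_pos.2 (sub_ne_zero.2 hxy)) _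
      refine (div_le_iff₀ hpos).1 ((ENNReal.ofReal_le_iff_le_toReal hV).1 (le_trans ?_ le_add_self))
      refine le_trans ?_ (le_iSup₂ (f := fun x (_ : x ∈ Ioo 0 Real.pi) =>
        ⨆ y ∈ Ioo 0 Real.pi, ⨆ _ : x ≠ y, ENNReal.ofReal (|V x - V y| / |x - y| ^ γ)) x hx)
      refine le_trans ?_ (le_iSup₂ (f := fun y (_ : y ∈ Ioo 0 Real.pi) =>
        ⨆ _ : x ≠ y, ENNReal.ofReal (|V x - V y| / |x - y| ^ γ)) y hy)
      exact le_iSup (fun _ : x ≠ y => ENNReal.ofReal (|V x - V y| / |x - y| ^ γ)) hxy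

lemma powKer_one {t : ℝ} (ht : 0 < t) : powKer 1 t = 1 := by
  rw [powKer_of_pos _ ht]
  simp

lemma lconvolution_powKer_one_le (f : ℝ → ℝ≥0∞) (t : ℝ) :
    (f ⋆ₗ[volume] powKer 1) t ≤ ∫⁻ s, f s := by
  rw [lconvolution_def]
  refine lintegral_mono fun s => mul_le_of_le_one_right' ?_
  rcases lt_or_ge 0 (-s + t) with h | h
  · rw [powKer_one h]
  · rw [powKer_of_nonpos _ h]
    exact zero_le

/-- The convolved kernels behave like `t^(α+θ-1)`, which is bounded on `(0,T)` precisely because `α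
+ θ ≥ 1`. -/
lemma exists_lconvolution_powKer_bound {α θ : ℝ} (T : ℝ) (hα : 0 < α) (hθ : 0 < θ)
    (h1 : 1 ≤ α + θ) : ∃ B : ℝ, 0 ≤ B ∧ ∀ (K : ℝ≥0∞) (f : ℝ → ℝ≥0∞),
      (∀ᵐ t, f t ≤ K * powKer α t) →
      ∀ t ≤ T, (f ⋆ₗ[volume] powKer θ) t ≤ ENNReal.ofReal B * K := by
  obtain ⟨B, hB, hb⟩ := powKer_lconvolution_le hα hθ
  refine ⟨B * |T| ^ (α + θ - 1), by positivity, fun K f hf t ht => ?_⟩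
  refine (lconvolution_mono_left hf t).trans ?_
  rw [const_mul_lconvolution (measurable_powKer _) (measurable_powKer _), mul_comm K,
    ENNReal.ofReal_mul hB]
  refine mul_le_mul_left ((hb t).trans (mul_le_mul_right ?_ _)) _
  rcases lt_or_ge 0 t with h | h
  · rw [powKer_of_pos _ h]
    exact ENNReal.ofReal_le_ofReal
      (Real.rpow_le_rpow h.le (ht.trans (le_abs_self T)) (by linarith))
  · rw [powKer_of_nonpos _ h]
    exact zero_le

/-- Gronwall's inequality for a constant inhomogeneity. -/
lemma gronwall_const {η C T : ℝ} (hη : 0 < η) (hC : 0 ≤ C) (hT : 0 < T) :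
    ∃ C' : ℝ, 0 ≤ C' ∧ ∀ (N : ℝ → ℝ≥0∞) (D : ℝ≥0∞), Measurable N →
      (∀ t ∉ Ioo 0 T, N t = 0) → ∫⁻ t, N t ≠ ⊤ →
      (∀ᵐ t, t ∈ Ioo 0 T → N t ≤ D + ENNReal.ofReal C * (N ⋆ₗ[volume] powKer η) t) →
      ∀ᵐ t, N t ≤ ENNReal.ofReal C' * D * powKer 1 t := by
  obtain ⟨C₁, hC₁, h1⟩ := gronwall_lintegral T hη hC
  obtain ⟨C₂, hC₂, h2⟩ := gronwall_lconvolution hη hC hT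
  obtain ⟨B, hB, hb⟩ := exists_lconvolution_powKer_bound (α := 1) T one_pos hη (by linarith)
  refine ⟨1 + C * (C₂ * (B + C₁ * T)), by positivity, fun N D hN hN0 hfin hle => ?_⟩
  set a : ℝ → ℝ≥0∞ := (Ioo 0 T).indicator fun _ => D
  have ha : Measurable a := measurable_const.indicator measurableSet_Ioo
  have ha0 : ∀ t ≤ 0, a t = 0 := fun t ht => indicator_of_notMem (fun h => ht.not_gt h.1) _
  have hle' : ∀ᵐ t, N t ≤ a t + ENNReal.ofReal C * (N ⋆ₗ[volume] powKer η) t := by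
    filter_upwards [hle] with t ht
    by_cases hmem : t ∈ Ioo 0 T
    · simp only [a]
      rw [indicator_of_mem hmem]
      exact ht hmem
    · rw [hN0 t hmem]
      exact zero_le
  have hak : ∀ t ≤ T, (a ⋆ₗ[volume] powKer η) t ≤ ENNReal.ofReal B * D := hb D a <|
    ae_of_all _ fun t => by
      by_cases hmem : t ∈ Ioo 0 T
      · simp only [a]
        rw [indicator_of_mem hmem, powKer_one hmem.1, mul_one]
      · simp only [a]
        rw [indicator_of_notMem hmem]
        exact zero_le
  -- The `L_1` inequality bounds the total mass of `N` by `D`, and this mass then enters the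
  -- pointwise inequality. Finiteness of `∫ N` is thus used only qualitatively.
  have hI := h1 N a hN ha hN0 ha0 hle' hfin
  have hai : ∫⁻ t, a t = D * ENNReal.ofReal T := by
    simp only [a]
    rw [lintegral_indicator measurableSet_Ioo, setLIntegral_const, Real.volume_Ioo, sub_zero]
  rw [hai] at hI
  have hconv := h2 N a _ hN ha (fun t ht => hN0 t fun h => ht.not_gt h.1) ha0 hle' hak
  filter_upwards [hle] with t ht
  by_cases hmem : t ∈ Ioo 0 T
  · rw [powKer_one hmem.1, mul_one]
    refine (ht hmem).trans ((add_le_add le_rfl (mul_le_mul_right ((hconv t hmem.2.le).trans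
      (mul_le_mul_right (add_le_add le_rfl hI) _)) _)).trans_eq ?_)
    rw [ENNReal.ofReal_add zero_le_one (by positivity), ENNReal.ofReal_one,
      ENNReal.ofReal_mul hC, ENNReal.ofReal_mul hC₂, ENNReal.ofReal_add hB (by positivity),
      ENNReal.ofReal_mul hC₁]
    ring
  · rw [hN0 t hmem]
    exact zero_le

/-- Supplies a vanishing second source, so that the lemma on two Duhamel terms also covers an
equation with one. -/
lemma IsSource.zero_coeff {p : ℝ≥0∞} {γ M T : ℝ} {V : ℝ → ℝ} {U U' : ℝ → ℝ → ℝ}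
    (h : IsSource p γ M T V U U') : IsSource p γ 0 T 0 U U' where
  holder := ⟨le_rfl, fun _ _ => by simp, fun _ _ _ _ => by simp, measurable_const⟩
  meas := h.meas
  meas' := h.meas'
  deriv := h.deriv
  finite := h.finite

lemma divSource_zero_coeff (t : ℝ) (U U' : ℝ → ℝ → ℝ) (η s x : ℝ) :
    divSource t 0 U U' η s x = 0 := by
  simp [divSource, divSemigroup]

lemma lintegral_cutoff_norm {p : ℝ≥0∞} {T : ℝ} {v : ℝ → ℝ → ℝ} :
    ∫⁻ s, (eLpNorm (cutoff T v s) p muI + eLpNorm (cutoffDx T v s) p muI) =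
      ∫⁻ s in Ioo 0 T, (eLpNorm (cutoff T v s) p muI + eLpNorm (cutoffDx T v s) p muI) := by
  rw [← lintegral_indicator measurableSet_Ioo]
  refine lintegral_congr fun s => ?_
  by_cases hs : s ∈ Ioo 0 T
  · rw [indicator_of_mem hs]
  · rw [indicator_of_notMem hs, cutoff_of_notMem hs, cutoffDx_of_notMem hs, eLpNorm_zero, add_zero]

/-! ### The mild solution as a source -/

namespace IsMildSolution

variable {T β : ℝ} {p : ℝ≥0∞} {W u₀ : ℝ → ℝ} {u : ℝ → ℝ → ℝ}

lemma measurable_cutoff (hu : IsMildSolution T p (1 + β) W u₀ u) {T' : ℝ} (hT' : T' ≤ T) :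
    Measurable (Function.uncurry (cutoff T' u)) :=
  _root_.measurable_cutoff
    (fun x hx => (hu.cont_time x hx).mono (Ioo_subset_Ioo_right hT'))
    fun t ht => (hu.diff_space t (Ioo_subset_Ioo_right hT' ht)).continuousOn

lemma measurable_cutoffDx (hu : IsMildSolution T p (1 + β) W u₀ u) {T' : ℝ} (hT' : T' ≤ T) :
    Measurable (Function.uncurry (cutoffDx T' u)) :=
  _root_.measurable_cutoffDx
    (fun x hx => (hu.cont_time x hx).mono (Ioo_subset_Ioo_right hT'))
    fun t ht => hu.diff_space t (Ioo_subset_Ioo_right hT' ht)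

lemma hasDerivAt_cutoff (hu : IsMildSolution T p (1 + β) W u₀ u) {T' : ℝ} (hT' : T' ≤ T) {t : ℝ}
    (ht : t ∈ Ioo 0 T') :
    ∀ x ∈ Ioo 0 Real.pi, HasDerivAt (cutoff T' u t) (cutoffDx T' u t x) x :=
  cutoff_hasDerivAt ht (hu.diff_space t (Ioo_subset_Ioo_right hT' ht))

/-- The embedding of `H^{1+β}_p` in `W^1_p` converts integrability in time of the Sobolev norm into
that of `‖u‖` and `‖u_x‖`. -/
lemma isSource (hu : IsMildSolution T p (1 + β) W u₀ u) (hp : 1 ≤ p) (hp' : p ≠ ⊤) (hβ : 0 < β)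
    (hβ1 : β < 1) {γ M : ℝ} {V : ℝ → ℝ} (hH : HolderBound γ M V) {T' : ℝ} (hT' : T' ≤ T) :
    IsSource p γ M T V (cutoff T' u) (cutoffDx T' u) := by
  obtain ⟨C, hC, hb⟩ := exists_eLpNorm_le_sobolevNorm (σ := 1 + β) (by linarith) (by linarith)
  have hbd : ∀ s, eLpNorm (cutoff T' u s) p muI ≤ ENNReal.ofReal C * sobolevNorm p (1 + β) (u s) ∧
      eLpNorm (cutoffDx T' u s) p muI ≤ ENNReal.ofReal C * sobolevNorm p (1 + β) (u s) := fun s => by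
    by_cases hs : s ∈ Ioo 0 T'
    · rw [← sobolevNorm_congr (cutoff_ae_eq hs)]
      exact hb p hp hp' _ _ (hu.hasDerivAt_cutoff hT' hs)
    · rw [cutoff_of_notMem hs, cutoffDx_of_notMem hs, eLpNorm_zero]
      exact ⟨zero_le, zero_le⟩
  refine ⟨hH, hu.measurable_cutoff hT', hu.measurable_cutoffDx hT', ?_, ?_⟩
  · filter_upwards [ae_lt_top' hu.aemeasurable_norm hu.integrable_norm.ne] with s hs
    by_cases hs' : s ∈ Ioo 0 T'
    · exact ⟨hu.hasDerivAt_cutoff hT' hs', integrable_of_eLpNorm_lt_top hp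
        ((hu.measurable_cutoffDx hT').of_uncurry_left (x := s)).aestronglyMeasurable
        ((hbd s).2.trans_lt (ENNReal.mul_lt_top ENNReal.ofReal_lt_top hs))⟩
    · rw [cutoff_of_notMem hs', cutoffDx_of_notMem hs']
      exact ⟨fun x _ => hasDerivAt_const x 0, integrable_zero _ _ _⟩
  · refine ((lintegral_mono fun s => add_le_add (hbd s).1 (hbd s).2).trans_lt ?_).ne
    have := hu.aemeasurable_norm.const_mul (ENNReal.ofReal C)
    rw [lintegral_add_left' this, lintegral_const_mul' _ _ ENNReal.ofReal_ne_top]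
    have h := ENNReal.mul_lt_top (a := ENNReal.ofReal C) ENNReal.ofReal_lt_top hu.integrable_norm
    exact ENNReal.add_lt_top.2 ⟨h, h⟩

/-- A bootstrap from integrability in time to rates. In the inequality for `‖u‖` the derivative
enters through the bounded kernel of exponent one, so its time integral counts as a constant and
Gronwall's inequality bounds `‖u‖`. This is then an inhomogeneity in the inequality for `‖u_x‖`,
next to the `t^(-1/2)` coming from `e^{tΔ}u₀` with `u₀` in `L_p`. -/
lemma exists_eLpNorm_bound (hu : IsMildSolution T p (1 + β) W u₀ u) (hp : 1 ≤ p) (hp' : p ≠ ⊤)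
    (hT : 0 < T) (hβ : 0 < β) (hβ1 : β < 1) (hu₀ : MemLp u₀ p muI) {γ M : ℝ} (hγ : 0 < γ)
    (hγ1 : γ ≤ 1) (hH : HolderBound γ M ((Ioo 0 Real.pi).indicator W)) :
    ∃ K : ℝ≥0∞, K ≠ ⊤ ∧ (∀ᵐ t, eLpNorm (cutoff T u t) p muI ≤ K * powKer 1 t) ∧
      ∀ᵐ t, eLpNorm (cutoffDx T u t) p muI ≤ K * powKer (1 / 2) t := by
  have hS := hu.isSource hp hp' hβ hβ1 hH le_rfl
  obtain ⟨C, hC, hd⟩ := exists_duhamel_bound γ T hγ.le hγ1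
  obtain ⟨C₀, hC₀, h0⟩ := exists_initial_bound
  set n₀ : ℝ → ℝ≥0∞ := fun s => eLpNorm (cutoff T u s) p muI
  set n₁ : ℝ → ℝ≥0∞ := fun s => eLpNorm (cutoffDx T u s) p muI
  have hn₀ : Measurable n₀ := measurable_eLpNorm_section hp hp' hS.meas
  have hn₁ : Measurable n₁ := measurable_eLpNorm_section hp hp' hS.meas'
  have hz₀ : ∀ t ∉ Ioo 0 T, n₀ t = 0 := fun t ht => by
    simp only [n₀]
    rw [cutoff_of_notMem ht, eLpNorm_zero]
  have hz₁ : ∀ t ∉ Ioo 0 T, n₁ t = 0 := fun t ht => by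
    simp only [n₁]
    rw [cutoffDx_of_notMem ht, eLpNorm_zero]
  have hsum : ∫⁻ s, (n₀ s + n₁ s) ≠ ⊤ := by
    rw [lintegral_cutoff_norm]
    exact hS.finite
  rw [lintegral_add_left hn₀] at hsum
  obtain ⟨hi₀, hi₁⟩ := ENNReal.add_ne_top.1 hsum
  have hneg : ∀ s ≤ 0, s ∉ Ioo 0 T := fun s hs h => hs.not_gt h.1
  set L : ℝ≥0∞ := ENNReal.ofReal C₀ * eLpNorm u₀ p muI
  have hL : L ≠ ⊤ := ENNReal.mul_ne_top ENNReal.ofReal_ne_top hu₀.2.ne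
  have hCM : 0 ≤ C * M := mul_nonneg hC hH.nonneg
  -- Only for almost every `t` is it known at this stage that the convolutions are finite and that
  -- `u(t)` lies in `L_p`, as the regularized equation requires.
  have key : ∀ᵐ t, t ∈ Ioo 0 T →
      n₀ t ≤ L + ENNReal.ofReal (C * M) *
        ((n₀ ⋆ₗ[volume] powKer ((1 + γ) / 2)) t + (n₁ ⋆ₗ[volume] powKer 1) t) ∧
      n₁ t ≤ L * powKer (1 / 2) t + ENNReal.ofReal (C * M) *
        ((n₀ ⋆ₗ[volume] powKer (γ / 2)) t + (n₁ ⋆ₗ[volume] powKer ((1 + γ) / 2)) t) := by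
    filter_upwards [ae_lconvolution_ne_top (T := T) (θ := (1 + γ) / 2) (by linarith) hn₀
      (fun s hs => hz₀ s (hneg s hs)) hi₀, ae_lconvolution_ne_top (T := T) (θ := 1) one_pos hn₁
      (fun s hs => hz₁ s (hneg s hs)) hi₁, (ae_restrict_iff' measurableSet_Ioo).1 (ae_lt_top
      hn₀ hi₀ |> ae_restrict_of_ae (s := Ioo 0 T))] with t h1 h2 h3 ht
    have hfin : srcConv p ((1 + γ) / 2) 1 (cutoff T u) (cutoffDx T u) t ≠ ⊤ :=
      ENNReal.add_ne_top.2 ⟨h1 ht.2, h2 ht.2⟩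
    have hfi : Integrable (cutoff T u t) muI := integrable_of_eLpNorm_lt_top hp
      (hS.meas.of_uncurry_left (x := t)).aestronglyMeasurable (h3 ht)
    have h := hd p hp hp' M 0 _ 0 _ _ _ _ hS hS.zero_coeff t ht (cutoff T u t) (cutoffDx T u t)
      (fun η => heatSemigroup (t + η) u₀) (fun η => heatSemigroupDx (t + η) u₀) L
      (L * powKer (1 / 2) t) hfi (hu.hasDerivAt_cutoff le_rfl ht)
      (fun η => measurable_heatSemigroup _ hu₀.1)
      (fun η => (measurable_heatSemigroupDx_uncurry hu₀.1).comp (f := fun x => (t + η, x))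
        (by fun_prop))
      (fun η hη x hx => hasDerivAt_heatSemigroup (add_pos ht.1 hη) (hu₀.integrable hp) hx)
      (fun η hη => (h0 p hp hp' u₀ hu₀.1 t ht.1 η hη.le).1)
      (fun η hη => by
        simp only [L]
        rw [mul_assoc]
        exact (h0 p hp hp' u₀ hu₀.1 t ht.1 η hη.le).2)
      (fun η hη x hx => by
        simp only [divSource_zero_coeff, add_zero]
        exact hu.regularized hp hp' (hu₀.integrable hp) hγ.le hγ1 hS ht hfin hη hx)
    simp only [mul_zero, ENNReal.ofReal_zero, zero_mul, add_zero] at h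
    exact h
  obtain ⟨C₁, hC₁, hg₁⟩ := gronwall_const (η := (1 + γ) / 2) (T := T) (by linarith) hCM hT
  have hb₀ := hg₁ n₀ (L + ENNReal.ofReal (C * M) * ∫⁻ s, n₁ s) hn₀ hz₀ hi₀ (by
    filter_upwards [key] with t ht hmem
    refine (ht hmem).1.trans ?_
    rw [mul_add, add_assoc]
    refine add_le_add le_rfl ?_
    rw [add_comm]
    exact add_le_add (mul_le_mul_right (lconvolution_powKer_one_le _ _) _) le_rfl)
  set K₀ : ℝ≥0∞ := ENNReal.ofReal C₁ * (L + ENNReal.ofReal (C * M) * ∫⁻ s, n₁ s)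
  have hK₀ : K₀ ≠ ⊤ := ENNReal.mul_ne_top ENNReal.ofReal_ne_top
    (ENNReal.add_ne_top.2 ⟨hL, ENNReal.mul_ne_top ENNReal.ofReal_ne_top hi₁⟩)
  obtain ⟨B₀, hB₀, hc₀⟩ := exists_lconvolution_powKer_bound (α := 1) (θ := γ / 2) T one_pos
    (by linarith) (by linarith)
  obtain ⟨B₁, hB₁, hc₁⟩ := exists_lconvolution_powKer_bound (α := 1 / 2) (θ := (1 + γ) / 2) T
    (by norm_num) (by linarith) (by linarith)
  obtain ⟨C₂, hC₂, hg₂⟩ := gronwall_lconvolution (η := (1 + γ) / 2) (by linarith) hCM hT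
  set L₁ : ℝ≥0∞ := ENNReal.ofReal (C * M) * (ENNReal.ofReal B₀ * K₀)
  have hL₁ : L₁ ≠ ⊤ := ENNReal.mul_ne_top ENNReal.ofReal_ne_top
    (ENNReal.mul_ne_top ENNReal.ofReal_ne_top hK₀)
  set A : ℝ≥0∞ := L + L₁ * ENNReal.ofReal (T ^ (1 / 2 : ℝ))
  have hA : A ≠ ⊤ := ENNReal.add_ne_top.2 ⟨hL, ENNReal.mul_ne_top hL₁ ENNReal.ofReal_ne_top⟩
  -- On a bounded interval constants are absorbed into multiples of `t^(-1/2)`.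
  have hone : ∀ t ∈ Ioo 0 T, ∀ D : ℝ≥0∞,
      D ≤ D * ENNReal.ofReal (T ^ (1 / 2 : ℝ)) * powKer (1 / 2) t := fun t ht D => by
    have h := powKer_le (θ := 1) (η := 1 / 2) (by norm_num) ht.2
    rw [powKer_one ht.1, show (1 - 1 / 2 : ℝ) = 1 / 2 by norm_num] at h
    rw [mul_assoc]
    exact le_mul_of_one_le_right' h
  have key₁ : ∀ᵐ t, n₁ t ≤ A * powKer (1 / 2) t +
      ENNReal.ofReal (C * M) * (n₁ ⋆ₗ[volume] powKer ((1 + γ) / 2)) t := by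
    filter_upwards [key] with t ht
    by_cases hmem : t ∈ Ioo 0 T
    · refine (ht hmem).2.trans ?_
      rw [mul_add, ← add_assoc]
      refine add_le_add ?_ le_rfl
      simp only [A]
      rw [add_mul]
      refine add_le_add le_rfl ((mul_le_mul_right (hc₀ K₀ n₀ hb₀ t hmem.2.le) _).trans
        (hone t hmem _))
    · rw [hz₁ t hmem]
      exact zero_le
  have hcv := hg₂ n₁ (fun t => A * powKer (1 / 2) t) (ENNReal.ofReal B₁ * A) hn₁
    ((measurable_powKer _).const_mul _) (fun t ht => hz₁ t (hneg t ht))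
    (fun t ht => by rw [powKer_of_nonpos _ ht, mul_zero]) key₁
    (hc₁ A _ (ae_of_all _ fun _ => le_rfl))
  set L₂ : ℝ≥0∞ := ENNReal.ofReal (C * M) *
    (ENNReal.ofReal C₂ * (ENNReal.ofReal B₁ * A + ∫⁻ s, n₁ s))
  have hL₂ : L₂ ≠ ⊤ := ENNReal.mul_ne_top ENNReal.ofReal_ne_top (ENNReal.mul_ne_top
    ENNReal.ofReal_ne_top (ENNReal.add_ne_top.2
      ⟨ENNReal.mul_ne_top ENNReal.ofReal_ne_top hA, hi₁⟩))
  refine ⟨K₀ + (A + L₂ * ENNReal.ofReal (T ^ (1 / 2 : ℝ))), ENNReal.add_ne_top.2 ⟨hK₀,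
    ENNReal.add_ne_top.2 ⟨hA, ENNReal.mul_ne_top hL₂ ENNReal.ofReal_ne_top⟩⟩, ?_, ?_⟩
  · filter_upwards [hb₀] with t ht using ht.trans (mul_le_mul_left le_self_add _)
  · filter_upwards [key₁] with t ht
    by_cases hmem : t ∈ Ioo 0 T
    · refine ht.trans (le_trans ?_ (mul_le_mul_left le_add_self _))
      rw [add_mul A]
      exact add_le_add le_rfl ((mul_le_mul_right (hcv t hmem.2.le) _).trans (hone t hmem _))
    · refine (hz₁ t hmem).trans_le ?_
      exact zero_le

/-- The bounds `‖u‖ ≤ K` and `‖u_x‖ ≤ K t^(-1/2)` are convolved with the kernels. The condition `1/2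
≤ θ'` compensates the singularity of `u_x` at `t = 0`, and any `θ > 0` will do for `u`. -/
lemma exists_srcConv_bound (hu : IsMildSolution T p (1 + β) W u₀ u) (hp : 1 ≤ p) (hp' : p ≠ ⊤)
    (hT : 0 < T) (hβ : 0 < β) (hβ1 : β < 1) (hu₀ : MemLp u₀ p muI) {γ M : ℝ} (hγ : 0 < γ)
    (hγ1 : γ ≤ 1) (hH : HolderBound γ M ((Ioo 0 Real.pi).indicator W)) {θ θ' : ℝ} (hθ : 0 < θ)
    (hθ' : 1 / 2 ≤ θ') :
    ∃ K : ℝ≥0∞, K ≠ ⊤ ∧ ∀ t ≤ T, srcConv p θ θ' (cutoff T u) (cutoffDx T u) t ≤ K := by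
  obtain ⟨K, hK, h0, h1⟩ := hu.exists_eLpNorm_bound hp hp' hT hβ hβ1 hu₀ hγ hγ1 hH
  obtain ⟨B₀, hB₀, hc₀⟩ := exists_lconvolution_powKer_bound (α := 1) T one_pos hθ (by linarith)
  obtain ⟨B₁, hB₁, hc₁⟩ := exists_lconvolution_powKer_bound (α := 1 / 2) (θ := θ') T
    (by norm_num) (by linarith) (by linarith)
  exact ⟨ENNReal.ofReal B₀ * K + ENNReal.ofReal B₁ * K, ENNReal.add_ne_top.2
    ⟨ENNReal.mul_ne_top ENNReal.ofReal_ne_top hK, ENNReal.mul_ne_top ENNReal.ofReal_ne_top hK⟩,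
    fun t ht => add_le_add (hc₀ K _ h0 t ht) (hc₁ K _ h1 t ht)⟩

end IsMildSolution

/-! ### Stability -/

lemma HolderBound.add {γ M₁ M₂ : ℝ} {f g : ℝ → ℝ} (hf : HolderBound γ M₁ f)
    (hg : HolderBound γ M₂ g) : HolderBound γ (M₁ + M₂) (f + g) where
  nonneg := add_nonneg hf.nonneg hg.nonneg
  bound x hx := (abs_add_le _ _).trans (add_le_add (hf.bound x hx) (hg.bound x hx))
  holder x hx y hy := by
    rw [Pi.add_apply, Pi.add_apply, add_sub_add_comm, add_mul]
    exact (abs_add_le _ _).trans (add_le_add (hf.holder x hx y hy) (hg.holder x hx y hy))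
  measurable := hf.measurable.add hg.measurable

lemma HolderBound.mono {γ M M' : ℝ} {f : ℝ → ℝ} (hf : HolderBound γ M f) (h : M ≤ M') :
    HolderBound γ M' f where
  nonneg := hf.nonneg.trans h
  bound x hx := (hf.bound x hx).trans h
  holder x hx y hy := (hf.holder x hx y hy).trans (mul_le_mul_of_nonneg_right h (by positivity))
  measurable := hf.measurable

lemma HasIntegrableDeriv.sub {f f' g g' : ℝ → ℝ} (hf : HasIntegrableDeriv f f')
    (hg : HasIntegrableDeriv g g') : HasIntegrableDeriv (f - g) (f' - g') :=
  ⟨fun x hx => (hf.hasDerivAt x hx).sub (hg.hasDerivAt x hx), hf.integrable.sub hg.integrable⟩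

/-- The splitting `f V' - g W' = (f - g) V' + g (V - W)'`. In the application the small coefficient
`V - W` acts on the fixed mild solution, whereas `V` acts on the unknown difference. -/
lemma divSemigroup_sub {τ x γ M M' : ℝ} (hτ : 0 < τ) (hx : x ∈ Ioo 0 Real.pi)
    {V W f f' g g' : ℝ → ℝ} (hV : HolderBound γ M V) (hVW : HolderBound γ M' (V - W))
    (hf : HasIntegrableDeriv f f') (hg : HasIntegrableDeriv g g') :
    divSemigroup τ V f f' x - divSemigroup τ W g g' x =
      divSemigroup τ V (f - g) (f' - g') x + divSemigroup τ (V - W) g g' x := by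
  have e1 : divSemigroup τ V (f - g) (f' - g') x =
      divSemigroup τ V f f' x - divSemigroup τ V g g' x := by
    rw [divSemigroup, divSemigroup, divSemigroup, sub_neg_eq_add, neg_add_eq_sub,
      ← neg_sub (∫ y, (kDy τ x y * f y + dirichletKernel τ x y * f' y) * V y ∂muI),
      ← integral_sub (hf.integrable_divForm hV hτ hx) (hg.integrable_divForm hV hτ hx)]
    congr 1
    refine integral_congr_ae (ae_of_all _ fun y => ?_)
    simp only [Pi.sub_apply]
    ring
  have e2 : divSemigroup τ W g g' x =
      divSemigroup τ V g g' x - divSemigroup τ (V - W) g g' x := by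
    rw [divSemigroup, divSemigroup, divSemigroup, sub_neg_eq_add, neg_add_eq_sub,
      ← neg_sub (∫ y, (kDy τ x y * g y + dirichletKernel τ x y * g' y) * V y ∂muI),
      ← integral_sub (hg.integrable_divForm hV hτ hx) (hg.integrable_divForm hVW hτ hx)]
    congr 1
    refine integral_congr_ae (ae_of_all _ fun y => ?_)
    simp only [Pi.sub_apply]
    ring
  rw [e1, e2]
  ring

lemma heatSemigroup_sub {η x : ℝ} (hη : 0 < η) (hx : x ∈ Ioo 0 Real.pi) {f g : ℝ → ℝ}
    (hf : Integrable f muI) (hg : Integrable g muI) :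
    heatSemigroup η (f - g) x = heatSemigroup η f x - heatSemigroup η g x := by
  obtain ⟨C, hC, hb⟩ := exists_kernel_bound hη
  have hi : ∀ {f : ℝ → ℝ}, Integrable f muI →
      Integrable (fun y => dirichletKernel η x y * f y) muI := fun hf =>
    integrable_bdd_mul hf (measurable_dirichletKernel_right η x).aestronglyMeasurable
      (fun y hy => (hb η le_rfl x hx y hy).1)
  rw [heatSemigroup_eq, heatSemigroup_eq, heatSemigroup_eq, ← integral_sub (hi hf) (hi hg)]
  simp only [Pi.sub_apply, mul_sub]

lemma IsSource.sub {p : ℝ≥0∞} (hp : 1 ≤ p) (hp' : p ≠ ⊤) {γ M M' T : ℝ} {V W : ℝ → ℝ}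
    {U U' Y Y' : ℝ → ℝ → ℝ} (h : IsSource p γ M T V U U') (h' : IsSource p γ M' T W Y Y') :
    IsSource p γ M T V (U - Y) (U' - Y') where
  holder := h.holder
  meas := h.meas.sub h'.meas
  meas' := h.meas'.sub h'.meas'
  deriv := by filter_upwards [h.deriv, h'.deriv] with s hs hs' using hs.sub hs'
  finite := by
    have hle : ∀ s, eLpNorm ((U - Y) s) p muI + eLpNorm ((U' - Y') s) p muI ≤
        (eLpNorm (U s) p muI + eLpNorm (U' s) p muI) +
          (eLpNorm (Y s) p muI + eLpNorm (Y' s) p muI) := fun s => by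
      rw [add_add_add_comm]
      exact add_le_add
        (eLpNorm_sub_le (h.meas.of_uncurry_left (x := s)).aestronglyMeasurable
          (h'.meas.of_uncurry_left (x := s)).aestronglyMeasurable hp)
        (eLpNorm_sub_le (h.meas'.of_uncurry_left (x := s)).aestronglyMeasurable
          (h'.meas'.of_uncurry_left (x := s)).aestronglyMeasurable hp)
    refine ((lintegral_mono hle).trans_lt ?_).ne
    have hm : Measurable fun s => eLpNorm (U s) p muI + eLpNorm (U' s) p muI :=
      (measurable_eLpNorm_section hp hp' h.meas).add (measurable_eLpNorm_section hp hp' h.meas')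
    rw [lintegral_add_left hm]
    exact ENNReal.add_lt_top.2 ⟨h.finite.lt_top, h'.finite.lt_top⟩

/-- Both kernels are reduced to the most singular exponent, which leaves one scalar convolution
inequality for the sum of the two norms. -/
lemma srcConv_le_lconvolution {p : ℝ≥0∞} (hp : 1 ≤ p) (hp' : p ≠ ⊤) {U U' : ℝ → ℝ → ℝ}
    (hU : Measurable (Function.uncurry U)) (hU' : Measurable (Function.uncurry U'))
    (h0 : ∀ s ≤ 0, U s = 0 ∧ U' s = 0) {θ θ' η T t : ℝ} (hT : 0 ≤ T) (hθ : η ≤ θ) (hθ' : η ≤ θ')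
    (ht : t ≤ T) :
    srcConv p θ θ' U U' t ≤ ENNReal.ofReal (T ^ (θ - η) + T ^ (θ' - η)) *
      ((fun s => eLpNorm (U s) p muI + eLpNorm (U' s) p muI) ⋆ₗ[volume] powKer η) t := by
  rw [ENNReal.ofReal_add (by positivity) (by positivity), add_mul]
  refine add_le_add ?_ ?_
  · refine (lconvolution_powKer_le (fun s hs => ?_) (measurable_eLpNorm_section hp hp' hU)
      hθ ht).trans (mul_le_mul_right (lconvolution_mono_left (ae_of_all _ fun s => le_self_add) t) _)
    simp only [(h0 s hs).1, eLpNorm_zero]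
  · refine (lconvolution_powKer_le (fun s hs => ?_) (measurable_eLpNorm_section hp hp' hU')
      hθ' ht).trans (mul_le_mul_right (lconvolution_mono_left (ae_of_all _ fun s => le_add_self) t) _)
    simp only [(h0 s hs).2, eLpNorm_zero]

lemma cutoff_eq_cutoff {T T' : ℝ} (h : T' ≤ T) {v : ℝ → ℝ → ℝ} {s : ℝ} (hs : s ∈ Ioo 0 T') :
    cutoff T' v s = cutoff T v s := by
  funext x
  have hs' := Ioo_subset_Ioo_right h hs
  by_cases hx : x ∈ Ioo 0 Real.pi
  · rw [cutoff_of_mem hs hx, cutoff_of_mem hs' hx]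
  · rw [cutoff_of_notMem_prod (z := (s, x)) fun hz => hx hz.2,
      cutoff_of_notMem_prod (z := (s, x)) fun hz => hx hz.2]

/-- The two regularized equations are subtracted. The initial data are the same and cancel, and the
source splits according to `divSemigroup_sub`. -/
lemma difference_regularized {T β γ M M' M₀ B : ℝ} {p : ℝ≥0∞} {W V u₀ : ℝ → ℝ} {u v : ℝ → ℝ → ℝ}
    (hu : IsMildSolution T p (1 + β) W u₀ u) (hv : IsClassicalSolution T p V u₀ v) (hp : 1 ≤ p)
    (hp' : p ≠ ⊤) (hβ : 0 < β) (hβ1 : β < 1) (hu₀ : MemLp u₀ p muI) (hγ : 0 < γ) (hγ1 : γ ≤ 1)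
    (hV : C1Bound B V) (hW : HolderBound γ M₀ ((Ioo 0 Real.pi).indicator W))
    (hH : HolderBound γ M ((Ioo 0 Real.pi).indicator V))
    (hD : HolderBound γ M' ((Ioo 0 Real.pi).indicator V - (Ioo 0 Real.pi).indicator W))
    {T' t : ℝ} (hT' : T' < T) (ht : t ∈ Ioo 0 T')
    (hfin : srcConv p ((1 + γ) / 2) 1 (cutoff T u) (cutoffDx T u) t ≠ ⊤)
    (hui : Integrable (cutoff T' u t) muI) {η x : ℝ} (hη : 0 < η) (hx : x ∈ Ioo 0 Real.pi) :
    heatSemigroup η ((cutoff T' v - cutoff T' u) t) x = ∫ s in Ioo 0 t,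
      (divSource t ((Ioo 0 Real.pi).indicator V) (cutoff T' v - cutoff T' u)
        (cutoffDx T' v - cutoffDx T' u) η s x +
      divSource t ((Ioo 0 Real.pi).indicator V - (Ioo 0 Real.pi).indicator W)
        (cutoff T u) (cutoffDx T u) η s x) := by
  have hSv := hv.isSource hp hp' hu₀ hV hH hT' (ht.1.trans ht.2).le
  have hSu := hu.isSource hp hp' hβ hβ1 hW le_rfl
  have htT : t ∈ Ioo 0 T := ⟨ht.1, ht.2.trans hT'⟩
  rw [Pi.sub_apply, heatSemigroup_sub hη hx ((hv.integrable_cutoff hp hu₀ hT' ht).integrable hp) hui,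
    hv.regularized hp hp' hu₀ hV hH hT' ht hη hx, cutoff_eq_cutoff hT'.le ht,
    hu.regularized hp hp' (hu₀.integrable hp) hγ.le hγ1 hSu htT hfin hη hx,
    add_sub_add_left_eq_sub,
    ← integral_sub (hSv.integrable_divSource hp htT.2.le hη hx)
      (hSu.integrable_divSource hp htT.2.le hη hx)]
  refine integral_congr_ae ?_
  filter_upwards [hSv.deriv_of_le htT.2.le, hSu.deriv_of_le htT.2.le,
    ae_restrict_mem measurableSet_Ioo] with s h1 h2 hs
  have hs' : s ∈ Ioo 0 T' := ⟨hs.1, hs.2.trans ht.2⟩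
  simp only [divSource, Pi.sub_apply]
  rw [cutoff_eq_cutoff (v := u) hT'.le hs',
    show cutoffDx T' u s = cutoffDx T u s from
      cutoff_eq_cutoff (v := fun s => deriv (u s)) hT'.le hs']
  exact divSemigroup_sub (by linarith [hs.2]) hx hH hD h1 h2

/-- The solution depends Lipschitz continuously on the coefficient, near that of a mild
solution. -/
lemma exists_linftySobolevNorm_le {T β γ : ℝ} {p : ℝ≥0∞} {W u₀ : ℝ → ℝ} {u : ℝ → ℝ → ℝ}
    (hβ : 0 < β) (hβγ : β < γ) (hγ1 : γ < 1) (hT : 0 < T) (hp : 1 ≤ p) (hp' : p ≠ ⊤)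
    (hW : holderNorm γ W ≠ ⊤) (hu₀ : MemLp u₀ p muI) (hu : IsMildSolution T p (1 + β) W u₀ u) :
    ∃ D : ℝ≥0∞, D ≠ ⊤ ∧ ∀ (V : ℝ → ℝ) (v : ℝ → ℝ → ℝ), ContDiffOn ℝ ∞ V (Icc 0 Real.pi) →
      IsClassicalSolution T p V u₀ v → holderNorm γ (fun x => V x - W x) ≤ 1 →
      linftySobolevNorm T p (1 + β) (fun t x => v t x - u t x) ≤
        D * holderNorm γ (fun x => V x - W x) := by
  have hγ : 0 < γ := hβ.trans hβγ
  have hβ1 : β < 1 := hβγ.trans hγ1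
  have hHW := HolderBound.of_holderNorm hγ hW
  -- A Hölder bound valid for every `V` with `‖V - W‖ ≤ 1`; it makes all constants independent of
  -- `V`.
  set M : ℝ := (holderNorm γ W).toReal + 1
  have hM : 0 ≤ M := by positivity
  obtain ⟨C, hC, hdu⟩ := exists_duhamel_bound γ T hγ.le hγ1.le
  obtain ⟨Cs, hCs, hso⟩ := exists_duhamel_sobolev_bound T hβ hβγ hγ1
  obtain ⟨K₁, hK₁, hb₁⟩ := hu.exists_srcConv_bound hp hp' hT hβ hβ1 hu₀ hγ hγ1.le hHW
    (θ := (1 + γ) / 2) (θ' := 1) (by linarith) (by norm_num)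
  obtain ⟨K₂, hK₂, hb₂⟩ := hu.exists_srcConv_bound hp hp' hT hβ hβ1 hu₀ hγ hγ1.le hHW
    (θ := γ / 2) (θ' := (1 + γ) / 2) (by linarith) (by linarith)
  obtain ⟨K₃, hK₃, hb₃⟩ := hu.exists_srcConv_bound hp hp' hT hβ hβ1 hu₀ hγ hγ1.le hHW
    (θ := (γ - β) / 2) (θ' := (1 + γ - β) / 2) (by linarith) (by linarith)
  -- The cost of replacing the four exponents that occur, two for the function and two for its
  -- derivative, by the smallest one, `γ/2`.
  set E : ℝ := (T ^ ((1 + γ) / 2 - γ / 2) + T ^ (1 - γ / 2)) +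
    (T ^ (γ / 2 - γ / 2) + T ^ ((1 + γ) / 2 - γ / 2))
  have hE : 0 ≤ E := by positivity
  obtain ⟨C', hC', hg⟩ := gronwall_const (η := γ / 2) (C := C * M * E) (T := T) (by linarith)
    (by positivity) hT
  obtain ⟨B₀, hB₀, hc₀⟩ := exists_lconvolution_powKer_bound (α := 1) (θ := (γ - β) / 2) T one_pos
    (by linarith) (by linarith)
  obtain ⟨B₁, hB₁, hc₁⟩ := exists_lconvolution_powKer_bound (α := 1) (θ := (1 + γ - β) / 2) T
    one_pos (by linarith) (by linarith)
  set D₀ : ℝ≥0∞ := ENNReal.ofReal C' * (ENNReal.ofReal C * (K₁ + K₂))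
  have hD₀ : D₀ ≠ ⊤ := ENNReal.mul_ne_top ENNReal.ofReal_ne_top
    (ENNReal.mul_ne_top ENNReal.ofReal_ne_top (ENNReal.add_ne_top.2 ⟨hK₁, hK₂⟩))
  refine ⟨ENNReal.ofReal (Cs * M) * ((ENNReal.ofReal B₀ + ENNReal.ofReal B₁) * D₀) +
    ENNReal.ofReal Cs * K₃, ENNReal.add_ne_top.2 ⟨ENNReal.mul_ne_top ENNReal.ofReal_ne_top
      (ENNReal.mul_ne_top (ENNReal.add_ne_top.2 ⟨ENNReal.ofReal_ne_top, ENNReal.ofReal_ne_top⟩)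
      hD₀), ENNReal.mul_ne_top ENNReal.ofReal_ne_top hK₃⟩, fun V v hVs hv hVW => ?_⟩
  have hd_top : holderNorm γ (fun x => V x - W x) ≠ ⊤ := ne_top_of_le_ne_top ENNReal.one_ne_top hVW
  have hHD := HolderBound.of_holderNorm hγ hd_top
  set d : ℝ := (holderNorm γ (fun x => V x - W x)).toReal
  have hd0 : 0 ≤ d := ENNReal.toReal_nonneg
  have hd1 : d ≤ 1 := ENNReal.toReal_le_of_le_ofReal zero_le_one (by rwa [ENNReal.ofReal_one])
  rw [← ENNReal.ofReal_toReal hd_top]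
  change _ ≤ _ * ENNReal.ofReal d
  obtain ⟨B, hV⟩ := exists_c1Bound hVs
  have hHV : HolderBound γ M ((Ioo 0 Real.pi).indicator V) := by
    have h := (hHW.add hHD).mono (add_le_add le_rfl hd1)
    rwa [← indicator_add', show (W + fun x => V x - W x) = V from
      funext fun x => add_sub_cancel _ _] at h
  rw [show (fun x => V x - W x) = V - W from rfl, indicator_sub'] at hHD
  obtain ⟨Ku, hKu, hu0, -⟩ := hu.exists_eLpNorm_bound hp hp' hT hβ hβ1 hu₀ hγ hγ1.le hHW
  have huL : ∀ᵐ s, s ∈ Ioo 0 T → eLpNorm (cutoff T u s) p muI < ⊤ := by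
    filter_upwards [hu0] with s hs hmem
    refine hs.trans_lt ?_
    rw [powKer_one hmem.1, mul_one]
    exact hKu.lt_top
  refine essSup_le_of_ae_le _ ((ae_restrict_iff' measurableSet_Ioo).2 ?_)
  filter_upwards [huL] with t htL ht
  -- The classical solution is controlled only up to times before `T`, so the cutoff `T'` is chosen
  -- after `t`. None of the constants fixed above depends on it.
  obtain ⟨T', htT', hT'⟩ := exists_between ht.2
  have htm : t ∈ Ioo 0 T' := ⟨ht.1, htT'⟩
  have hT0 : 0 ≤ T' := (ht.1.trans htT').le
  have hsub : Ioo 0 T' ⊆ Ioo 0 T := Ioo_subset_Ioo_right hT'.le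
  set U := cutoff T' v - cutoff T' u
  set U' := cutoffDx T' v - cutoffDx T' u
  have hSU : IsSource p γ M T ((Ioo 0 Real.pi).indicator V) U U' :=
    (hv.isSource hp hp' hu₀ hV hHV hT' hT0).sub hp hp' (hu.isSource hp hp' hβ hβ1 hHW hT'.le)
  have hSu : IsSource p γ d T _ (cutoff T u) (cutoffDx T u) :=
    hu.isSource hp hp' hβ hβ1 hHD le_rfl
  have hU0 : ∀ s ∉ Ioo 0 T', U s = 0 ∧ U' s = 0 := fun s hs => by
    simp only [U, U', Pi.sub_apply, cutoff_of_notMem hs, cutoffDx_of_notMem hs, sub_zero, and_self]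
  have hUd : ∀ s ∈ Ioo 0 T', ∀ x ∈ Ioo 0 Real.pi, HasDerivAt (U s) (U' s x) x := fun s hs x hx =>
    (hv.hasDerivAt_cutoff hT'.le hs x hx).sub (hu.hasDerivAt_cutoff hT'.le hs x hx)
  have hmem : ∀ s ∈ Ioo 0 T', eLpNorm (cutoff T u s) p muI < ⊤ → MemLp (cutoff T' u s) p muI :=
    fun s hs h => ⟨((hu.measurable_cutoff hT'.le).of_uncurry_left (x := s)).aestronglyMeasurable,
      by rwa [cutoff_eq_cutoff hT'.le hs]⟩
  have hreg : ∀ s ∈ Ioo 0 T', eLpNorm (cutoff T u s) p muI < ⊤ → ∀ η, 0 < η →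
      ∀ x ∈ Ioo 0 Real.pi, heatSemigroup η (U s) x = ∫ r in Ioo 0 s,
        (divSource s ((Ioo 0 Real.pi).indicator V) U U' η r x +
        divSource s ((Ioo 0 Real.pi).indicator V - (Ioo 0 Real.pi).indicator W)
          (cutoff T u) (cutoffDx T u) η r x) := fun s hs h η hη x hx =>
    difference_regularized hu hv hp hp' hβ hβ1 hu₀ hγ hγ1.le hV hHW hHV hHD hT' hs
      (ne_top_of_le_ne_top hK₁ (hb₁ s (hsub hs).2.le)) ((hmem s hs h).integrable hp) hη hx
  have hUL : ∀ s ∈ Ioo 0 T', eLpNorm (cutoff T u s) p muI < ⊤ → MemLp (U s) p muI :=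
    fun s hs h => (hv.integrable_cutoff hp hu₀ hT' hs).sub (hmem s hs h)
  set N : ℝ → ℝ≥0∞ := fun s => eLpNorm (U s) p muI + eLpNorm (U' s) p muI
  have hNm : Measurable N :=
    (measurable_eLpNorm_section hp hp' hSU.meas).add (measurable_eLpNorm_section hp hp' hSU.meas')
  have hN0 : ∀ s ∉ Ioo 0 T', N s = 0 := fun s hs => by
    simp only [N, (hU0 s hs).1, (hU0 s hs).2, eLpNorm_zero, add_zero]
  have hNfin : ∫⁻ s, N s ≠ ⊤ := by
    have e : ∫⁻ s, N s = ∫⁻ s in Ioo 0 T, N s := by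
      rw [← lintegral_indicator measurableSet_Ioo]
      refine lintegral_congr fun s => ?_
      by_cases hs : s ∈ Ioo 0 T
      · rw [indicator_of_mem hs]
      · rw [indicator_of_notMem hs, hN0 s fun h => hs (hsub h)]
    rw [e]
    exact hSU.finite
  have hneg : ∀ s ≤ 0, U s = 0 ∧ U' s = 0 := fun s hs => hU0 s fun h => hs.not_gt h.1
  -- The perturbation contributes a constant multiple of `d`, thanks to the bounds on the mild
  -- solution, and Gronwall's inequality passes this linear dependence to `N`.
  have hN := hg N (ENNReal.ofReal C * (K₁ + K₂) * ENNReal.ofReal d) hNm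
    (fun s hs => hN0 s fun h => hs (hsub h)) hNfin (by
    filter_upwards [huL] with s hsL hs
    by_cases hs' : s ∈ Ioo 0 T'
    · obtain ⟨h0, h1⟩ := hdu p hp hp' M d _ _ U U' _ _ hSU hSu s hs (U s) (U' s) (fun _ _ => 0)
        (fun _ _ => 0) 0 0 ((hUL s hs' (hsL hs)).integrable hp) (hUd s hs')
        (fun _ => measurable_const) (fun _ => measurable_const)
        (fun _ _ x _ => hasDerivAt_const x 0) (fun _ _ => by simp) (fun _ _ => by simp)
        (fun η hη x hx => by rw [zero_add]; exact hreg s hs' (hsL hs) η hη x hx)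
      rw [zero_add] at h0 h1
      refine (add_le_add h0 h1).trans ?_
      have e1 := srcConv_le_lconvolution hp hp' hSU.meas hSU.meas' hneg (θ := (1 + γ) / 2)
        (θ' := 1) (η := γ / 2) hT.le (by linarith) (by linarith) hs.2.le
      have e2 := srcConv_le_lconvolution hp hp' hSU.meas hSU.meas' hneg (θ := γ / 2)
        (θ' := (1 + γ) / 2) (η := γ / 2) hT.le le_rfl (by linarith) hs.2.le
      rw [ENNReal.ofReal_mul hC (q := d), add_add_add_comm, ← mul_add, ← mul_add, add_comm]
      refine add_le_add ?_ ?_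
      · refine (mul_le_mul_right (add_le_add (hb₁ s hs.2.le) (hb₂ s hs.2.le)) _).trans_eq ?_
        ring
      · refine (mul_le_mul_right (add_le_add e1 e2) _).trans_eq ?_
        rw [← add_mul, ← ENNReal.ofReal_add (by positivity) (by positivity), ← mul_assoc,
          ← ENNReal.ofReal_mul (by positivity)]
    · refine (hN0 s hs').trans_le ?_
      exact zero_le)
  -- For the difference both norms are bounded by a multiple of `d`, without singularity at `t = 0`,
  -- so any positive exponents are admissible in this convolution.
  have hsrc : srcConv p ((γ - β) / 2) ((1 + γ - β) / 2) U U' t ≤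
      (ENNReal.ofReal B₀ + ENNReal.ofReal B₁) * (D₀ * ENNReal.ofReal d) := by
    rw [add_mul]
    refine add_le_add (hc₀ _ _ ?_ t ht.2.le) (hc₁ _ _ ?_ t ht.2.le)
    · filter_upwards [hN] with s hs
      exact (le_self_add.trans hs).trans_eq (by simp only [D₀]; ring)
    · filter_upwards [hN] with s hs
      exact (le_add_self.trans hs).trans_eq (by simp only [D₀]; ring)
  have hfin := hso p hp hp' M d _ _ U U' _ _ hSU hSu t ht (U t) (U' t)
    (hSU.meas.of_uncurry_left (x := t)) (hUL t htm (htL ht)) (hUd t htm)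
    (hreg t htm (htL ht))
    (ne_top_of_le_ne_top (ENNReal.mul_ne_top (ENNReal.add_ne_top.2
      ⟨ENNReal.ofReal_ne_top, ENNReal.ofReal_ne_top⟩)
      (ENNReal.mul_ne_top hD₀ ENNReal.ofReal_ne_top)) hsrc)
    (ne_top_of_le_ne_top hK₃ (hb₃ t ht.2.le))
  have hae : U t =ᵐ[muI] fun x => v t x - u t x :=
    (cutoff_ae_eq htm).sub (cutoff_ae_eq htm)
  rw [sobolevNorm_congr hae] at hfin
  refine hfin.trans ((add_le_add (mul_le_mul_right hsrc _)
    (mul_le_mul_right (hb₃ t ht.2.le) _)).trans_eq ?_)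
  rw [ENNReal.ofReal_mul hCs (q := d)]
  ring

end

/-! ### Convergence of the regularized solutions. -/

theorem mainTheorem4 (β γ T : ℝ) (p : ℝ≥0∞)
    (hβ : 0 < β) (hβγ : β < γ) (hγ : γ < 1 / 2) (hT : 0 < T) (hp : 1 ≤ p) (hp' : p ≠ ⊤)
    (W : ℝ → ℝ) (hW : holderNorm γ W < ⊤)
    (Wε : ℝ → ℝ → ℝ) (hWε : ∀ ε > 0, ContDiffOn ℝ ∞ (Wε ε) (Icc 0 Real.pi))
    (hconv : Tendsto (fun ε => holderNorm γ (fun x => Wε ε x - W x)) (𝓝[>] 0) (𝓝 0))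
    (u₀ : ℝ → ℝ) (hu₀ : MemSobolev p β u₀)
    (u : ℝ → ℝ → ℝ) (hu : IsMildSolution T p (1 + β) W u₀ u)
    (uε : ℝ → ℝ → ℝ → ℝ) (huε : ∀ ε > 0, IsClassicalSolution T p (Wε ε) u₀ (uε ε)) :
    Tendsto (fun ε => linftySobolevNorm T p (1 + β) (fun t x => uε ε t x - u t x))
      (𝓝[>] 0) (𝓝 0) := by
  obtain ⟨g, hg⟩ := hu₀
  obtain ⟨D, hD, hle⟩ := exists_linftySobolevNorm_le hβ hβγ (by linarith) hT hp hp' hW.ne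
    hg.memLp_left hu
  have hlim := ENNReal.Tendsto.const_mul hconv (a := D) (Or.inr hD)
  rw [mul_zero] at hlim
  refine tendsto_of_tendsto_of_tendsto_of_le_of_le' tendsto_const_nhds hlim
    (Eventually.of_forall fun _ => zero_le) ?_
  -- The Lipschitz estimate is local, so it applies once `Wε` is within distance one of `W`.
  filter_upwards [hconv.eventually_le_const zero_lt_one, self_mem_nhdsWithin] with ε h1 hε
  exact hle (Wε ε) (uε ε) (hWε ε hε) (huε ε hε) h1
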